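/- **Lie algebras.** Let $e,f,h$ be the standard basis of $\mathfrak{sl}_2=\mathfrak{sl}_2(\mathbb C)$, $(x,y)=\operatorname{tr}(xy)$, and $\mathfrak b=\mathbb Ch+\mathbb Ce$. Let $\widetilde{\mathfrak{sl}}_2=\mathfrak{sl}_2\otimes\mathbb C[t,t^{-1}]\oplus\mathbb Cc\oplus\mathbb Cd$ with $x(n)=x\otimes t^n$, $[x(n),y(m)]=[x,y](n+m)+n\,\delta_{n+m,0}(x,y)c$, $c$ central, $[d,x(n)]=n\,x(n)$, and let $\widehat{\mathfrak{sl}}_2=\mathfrak{sl}_2\otimes\mathbb C[t,t^{-1}]\oplus\mathbb Cc$. A module is restricted if every vector is annihilated by $x(n)$ for all $n\gg0$, for each $x\in\mathfrak{sl}_2$. On restricted modules let $T(n)$, $n\in\mathbb Z$, be the operators given by $$\sum_{n\in\mathbb Z} T(n)z^{-n-2}=\tfrac12\big(:\!e(z)f(z)\!:+:\!f(z)e(z)\!:+\tfrac12:\!h(z)h(z)\!:\big),\qquad x(z)=\sum_{n\in\mathbb Z} x(n)z^{-n-1},$$ where in $:\!x(z)y(z)\!:$ the operator $x(m)$ stands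 to the left of the modes of $y$ if $m<0$ and to their right if $m\ge0$. Let $\widetilde{\mathcal T}_-$ be the Lie algebra with basis $d,\ T(n)\ (n\le0)$ and brackets $[d,T(n)]=nT(n)$, $[T(n),T(m)]=0$. **Modules.** For $\lambda,\mu\in\mathbb C$ and $\mathfrak g=\widetilde{\mathfrak{sl}}_2$ or $\widehat{\mathfrak{sl}}_2$ let $V_{\mathfrak g}(\lambda,\mu,-2)$ be the quotient of $U(\mathfrak g)$ by the left ideal generated by $e(0)-\lambda$, $f(1)-\mu$, $c+2$ and $e(i),h(i),f(i+1)$ for $i>0$, and let $w$ be the image of $1$. Let $V_{\widetilde{\mathfrak{sl}}_2}(\lambda,0,-2,\mathbf 0)$ be the quotient of $V_{\widetilde{\mathfrak{sl}}_2}(\lambda,0,-2)$ by the submodule generated by $dw$ and all $T(n)w$, $n\in\mathbb Z$. For $c(z)=\sum_{n\le0}c_nz^{-n-2}$ let $V_{\widehat{\mathfrak{sl}}_2}(\lambda,\mu,-2,c(z))$ be the quotient of $V_{\widehat{\mathfrak{sl}}_2}(\lambda,\mu,-2)$ by the submodule generated by the $(T(n)-c_n)w$, $n\le0$. **Twists.**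 Let $\mathfrak s$ be a nonempty set of negative integers, $r>0$ the generator of the subgroup of $\mathbb Z$ generated by $\mathfrak s$, and $\chi:\mathfrak s\cup\{0\}\to\mathbb C$ a map with $\chi(i)\ne0$ for $i\in\mathfrak s$. Let $\varphi:U(\widetilde{\mathcal T}_-)\to U(\mathfrak b)$ be the algebra homomorphism with $\varphi(d)=-\frac r2h$, $\varphi(T(i))=\chi(i)e^{-i/r}$ for $i\in\mathfrak s\cup\{0\}$ and $\varphi(T(i))=0$ for the other $i\leq 0$. For a $\mathfrak b$-module $M$ let $M^{\varphi}$ be the $\widetilde{\mathcal T}_-$-module $M$ on which $x$ acts as $\varphi(x)$. **Theorem.** Let $\lambda\in\mathbb C^*$. 1. For every simple $\widetilde{\mathcal T}_-$-module $X$ the space $V_{\widetilde{\mathfrak{sl}}_2}(\lambda,0,-2,\mathbf 0)\otimes X$ has exactly one structure of a restricted $\widetilde{\mathfrak{sl}}_2$-module for which $e(n),h(n),c,d,T(n)$ $(n\in\mathbb Z)$ act as on a tensor product of modules (that is, $y(v\otimes x)=yv\otimes x+v\otimes yx$), where $e(n),h(n),c$ for $n\in\mathbb Z$ and $T(n)$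 for $n>0$ act on $X$ by zero. With this structure it is a simple quotient of $V_{\widetilde{\mathfrak{sl}}_2}(\lambda,0,-2)$. Every simple quotient of $V_{\widetilde{\mathfrak{sl}}_2}(\lambda,0,-2)$ is isomorphic to $V_{\widetilde{\mathfrak{sl}}_2}(\lambda,0,-2,\mathbf 0)\otimes X$ for some simple $\widetilde{\mathcal T}_-$-module $X$, and $V_{\widetilde{\mathfrak{sl}}_2}(\lambda,0,-2,\mathbf 0)\otimes X\cong V_{\widetilde{\mathfrak{sl}}_2}(\lambda,0,-2,\mathbf 0)\otimes X'$ over $\widetilde{\mathfrak{sl}}_2$ if and only if $X\cong X'$ over $\widetilde{\mathcal T}_-$. So the isomorphism classes of simple $\widetilde{\mathcal T}_-$-modules correspond bijectively to those of the simple quotients of $V_{\widetilde{\mathfrak{sl}}_2}(\lambda,0,-2)$. 2. A $\widetilde{\mathcal T}_-$-module $X$ is simple if and only if it is $1$-dimensional or isomorphic to $M^{\varphi}$ for some $\varphi$ as above and some infinite-dimensional simple $\mathfrak b$-module $M$. 3. If $\mu\in\mathbb C^*$, then every simple quotient of $V_{\widetilde{\mathfrak{sl}}_2}(\lambda,\mu,-2)$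 is isomorphic to the induced module $\operatorname{Ind}_{\widehat{\mathfrak{sl}}_2}^{\widetilde{\mathfrak{sl}}_2}V_{\widehat{\mathfrak{sl}}_2}(\lambda,\mu,-2,c(z))$ for some $c(z)=\sum_{n\le0}c_nz^{-n-2}$. -/

import Mathlib

open scoped TensorProduct

attribute [local instance 100] LieRing.ofAssociativeRing

noncomputable section

namespace WhittakerSl2

/-! ### Modules attached to representations -/

/-- The `L`-module given by a representation `ρ : L → End V`: the space `V` with `⁅x, v⁆ = ρ x v`. -/
def RepSpace {L V : Type*} [LieRing L] [LieAlgebra ℂ L] [AddCommGroup V] [Module ℂ V]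
    (_ρ : L →ₗ⁅ℂ⁆ Module.End ℂ V) : Type _ := V

section RepSpace

variable {L V : Type*} [LieRing L] [LieAlgebra ℂ L] [AddCommGroup V] [Module ℂ V]
  (ρ : L →ₗ⁅ℂ⁆ Module.End ℂ V)

instance : AddCommGroup (RepSpace ρ) := inferInstanceAs (AddCommGroup V)

instance : Module ℂ (RepSpace ρ) := inferInstanceAs (Module ℂ V)

instance : LieRingModule L (RepSpace ρ) where
  bracket x v := (ρ x : V → V) v
  add_lie x y v := by
    change ρ (x + y) v = ρ x v + ρ y v
    rw [map_add]; rfl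
  lie_add x v w := map_add (ρ x) v w
  leibniz_lie x y := by
    have key : ∀ v : V, ρ x (ρ y v) = ρ ⁅x, y⁆ v + ρ y (ρ x v) := fun v => by
      rw [LieHom.map_lie, LieRing.of_associative_ring_bracket, LinearMap.sub_apply,
        Module.End.mul_apply, Module.End.mul_apply, sub_add_cancel]
    exact key

instance : LieModule ℂ L (RepSpace ρ) where
  smul_lie t x v := by
    change ρ (t • x) v = t • ρ x v
    rw [map_smul]; rfl
  lie_smul t x v := map_smul (ρ x) t v

end RepSpace

/-- The representation of `L` on a (left) module over the enveloping algebra `U(L)`. -/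
def envRep (L P : Type*) [LieRing L] [LieAlgebra ℂ L] [AddCommGroup P] [Module ℂ P]
    [Module (UniversalEnvelopingAlgebra ℂ L) P]
    [IsScalarTower ℂ (UniversalEnvelopingAlgebra ℂ L) P] : L →ₗ⁅ℂ⁆ Module.End ℂ P :=
  (Algebra.lsmul ℂ ℂ P : UniversalEnvelopingAlgebra ℂ L →ₐ[ℂ] Module.End ℂ P).toLieHom.comp
    (UniversalEnvelopingAlgebra.ι ℂ)

/-- `W` is (isomorphic to) a simple quotient of the `L`-module `V`. -/
def IsSimpleQuotient (L V W : Type*) [LieRing L] [LieAlgebra ℂ L]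
    [AddCommGroup V] [Module ℂ V] [LieRingModule L V]
    [AddCommGroup W] [Module ℂ W] [LieRingModule L W] : Prop :=
  LieModule.IsIrreducible ℂ L W ∧ ∃ π : V →ₗ⁅ℂ,L⁆ W, Function.Surjective π

section Induced

variable {K L : Type*} [LieRing K] [LieAlgebra ℂ K] [LieRing L] [LieAlgebra ℂ L]
  (j : K →ₗ⁅ℂ⁆ L) (M : Type*) [AddCommGroup M] [Module ℂ M] [LieRingModule K M]

/-- The relations `(a x) ⊗ m = a ⊗ (x m)`, for `a ∈ U(L)`, `x ∈ K`, `m ∈ M`. -/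
def inducedRelations :
    Submodule (UniversalEnvelopingAlgebra ℂ L) (UniversalEnvelopingAlgebra ℂ L ⊗[ℂ] M) :=
  Submodule.span _ {z | ∃ (a : UniversalEnvelopingAlgebra ℂ L) (x : K) (m : M),
    z = (a * UniversalEnvelopingAlgebra.ι ℂ (j x)) ⊗ₜ[ℂ] m - a ⊗ₜ[ℂ] ⁅x, m⁆}

/-- The induced module `Ind_K^L M = U(L) ⊗_{U(K)} M`, constructed as the quotient of
`U(L) ⊗_ℂ M` by the relations that make the tensor product balanced over `U(K)`. -/
abbrev Induced : Type _ :=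
  RepSpace (envRep L ((UniversalEnvelopingAlgebra ℂ L ⊗[ℂ] M) ⧸ inducedRelations j M))

end Induced

/-! ### The affine Lie algebras -/

/-- `sl₂(ℂ)`: the traceless complex `2 × 2` matrices. -/
abbrev Sl2 := LieAlgebra.SpecialLinear.sl (Fin 2) ℂ

/-- `e = E₁₂`. -/
def e0 : Sl2 := LieAlgebra.SpecialLinear.single (0 : Fin 2) 1 (by decide) 1
/-- `f = E₂₁`. -/
def f0 : Sl2 := LieAlgebra.SpecialLinear.single (1 : Fin 2) 0 (by decide) 1
/-- `h = E₁₁ - E₂₂`. -/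
def h0 : Sl2 := LieAlgebra.SpecialLinear.singleSubSingle (0 : Fin 2) 1 1

/-- The normalized invariant form `(x, y) = tr (x y)`; so `(e, f) = 1` and `(h, h) = 2`. -/
def form : LinearMap.BilinForm ℂ Sl2 :=
  LinearMap.mk₂ ℂ (fun x y => Matrix.trace (x.val * y.val))
    (fun x y z => by simp [add_mul]) (fun a x y => by simp)
    (fun x y z => by simp [mul_add]) (fun a x y => by simp)

/-- The loop space `sl₂ ⊗ ℂ[t, t⁻¹]`, as the space of finitely supported families indexed by `ℤ`:
`Finsupp.single n x` is `x ⊗ t^n`. -/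
abbrev LoopSl2 := ℤ →₀ Sl2

/-- A bilinear map on the loop space from its values on `(x ⊗ t^n, y ⊗ t^m)`. -/
def loopBilin {Q : Type*} [AddCommGroup Q] [Module ℂ Q] (B : ℤ → ℤ → Sl2 →ₗ[ℂ] Sl2 →ₗ[ℂ] Q) :
    LoopSl2 →ₗ[ℂ] LoopSl2 →ₗ[ℂ] Q :=
  Finsupp.lsum ℂ fun n => (Finsupp.lsum ℂ fun m => (B n m).flip).flip

theorem loopBilin_single {Q : Type*} [AddCommGroup Q] [Module ℂ Q]
    (B : ℤ → ℤ → Sl2 →ₗ[ℂ] Sl2 →ₗ[ℂ] Q) (n m : ℤ) (x y : Sl2) :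
    loopBilin B (Finsupp.single n x) (Finsupp.single m y) = B n m x y := by
  simp [loopBilin]

/-- The bracket of the loop algebra: `[x ⊗ t^n, y ⊗ t^m] = [x, y] ⊗ t^(n+m)`. -/
def loopBr : LoopSl2 →ₗ[ℂ] LoopSl2 →ₗ[ℂ] LoopSl2 :=
  loopBilin fun n m =>
    ((LieModule.toEnd ℂ Sl2 Sl2 : Sl2 →ₗ⁅ℂ⁆ Module.End ℂ Sl2) :
      Sl2 →ₗ[ℂ] Module.End ℂ Sl2).compr₂ (Finsupp.lsingle (n + m))

/-- The cocycle `ψ(x ⊗ t^n, y ⊗ t^m) = n δ_{n+m,0} (x, y)`. -/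
def loopCocycle : LoopSl2 →ₗ[ℂ] LoopSl2 →ₗ[ℂ] ℂ :=
  loopBilin fun n m => if n + m = 0 then (n : ℂ) • form else 0

/-- The derivation `t d/dt`: `x ⊗ t^n ↦ n (x ⊗ t^n)`. -/
def loopD : LoopSl2 →ₗ[ℂ] LoopSl2 :=
  Finsupp.lsum ℂ fun n => (n : ℂ) • Finsupp.lsingle n

theorem loopBr_single (n m : ℤ) (x y : Sl2) :
    loopBr (Finsupp.single n x) (Finsupp.single m y) = Finsupp.single (n + m) ⁅x, y⁆ := by
  rw [loopBr, loopBilin_single]; rfl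

theorem loopCocycle_single (n m : ℤ) (x y : Sl2) :
    loopCocycle (Finsupp.single n x) (Finsupp.single m y) =
      if n + m = 0 then (n : ℂ) * form x y else 0 := by
  rw [loopCocycle, loopBilin_single]
  split_ifs <;> rfl

theorem loopD_single (n : ℤ) (x : Sl2) :
    loopD (Finsupp.single n x) = (n : ℂ) • Finsupp.single n x := by
  simp [loopD]

theorem form_comm (x y : Sl2) : form x y = form y x := by
  change Matrix.trace (x.val * y.val) = Matrix.trace (y.val * x.val)
  exact Matrix.trace_mul_comm _ _

theorem form_lie (x y z : Sl2) : form ⁅x, y⁆ z = form x ⁅y, z⁆ := by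
  change Matrix.trace ((x.val * y.val - y.val * x.val) * z.val) =
    Matrix.trace (x.val * (y.val * z.val - z.val * y.val))
  rw [sub_mul, mul_sub, Matrix.trace_sub, Matrix.trace_sub, ← mul_assoc, ← mul_assoc,
    mul_assoc y.val, Matrix.trace_mul_comm y.val]

theorem loopBr_swap (x y : LoopSl2) : loopBr x y = - loopBr y x := by
  induction x using Finsupp.induction_linear with
  | zero => simp
  | add x x' hx hx' => simp only [map_add, LinearMap.add_apply, hx, hx']; abel
  | single n a =>
    induction y using Finsupp.induction_linear with
    | zero => simp
    | add y y' hy hy' => simp only [map_add, LinearMap.add_apply, hy, hy']; abel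
    | single m b =>
      rw [loopBr_single, loopBr_single, add_comm m n, ← Finsupp.single_neg, lie_skew]

theorem loopBr_self (x : LoopSl2) : loopBr x x = 0 := by
  have h : (2 : ℂ) • loopBr x x = 0 := by
    rw [two_smul]
    nth_rewrite 1 [loopBr_swap x x]
    exact neg_add_cancel _
  exact (smul_eq_zero.mp h).resolve_left two_ne_zero

theorem loopBr_jacobi (x y z : LoopSl2) :
    loopBr x (loopBr y z) = loopBr (loopBr x y) z + loopBr y (loopBr x z) := by
  induction x using Finsupp.induction_linear with
  | zero => simp
  | add x x' hx hx' => simp only [map_add, LinearMap.add_apply, hx, hx']; abel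
  | single n a =>
    induction y using Finsupp.induction_linear with
    | zero => simp
    | add y y' hy hy' => simp only [map_add, LinearMap.add_apply, hy, hy']; abel
    | single m b =>
      induction z using Finsupp.induction_linear with
      | zero => simp
      | add z z' hz hz' => simp only [map_add, hz, hz']; abel
      | single k c =>
        simp only [loopBr_single]
        rw [leibniz_lie, Finsupp.single_add, add_assoc n m k, add_left_comm m n k]

theorem loopD_loopBr (x y : LoopSl2) :
    loopD (loopBr x y) = loopBr (loopD x) y + loopBr x (loopD y) := by
  induction x using Finsupp.induction_linear with
  | zero => simp
  | add x x' hx hx' => simp only [map_add, LinearMap.add_apply, hx, hx']; abel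
  | single n a =>
    induction y using Finsupp.induction_linear with
    | zero => simp
    | add y y' hy hy' => simp only [map_add, hy, hy']; abel
    | single m b =>
      rw [loopD_single, loopD_single, loopBr_single, loopD_single, map_smul, map_smul,
        LinearMap.smul_apply, loopBr_single, ← add_smul, Int.cast_add]

theorem loopCocycle_swap (x y : LoopSl2) : loopCocycle x y = - loopCocycle y x := by
  induction x using Finsupp.induction_linear with
  | zero => simp
  | add x x' hx hx' => simp only [map_add, LinearMap.add_apply, hx, hx']; ring
  | single n a =>
    induction y using Finsupp.induction_linear with
    | zero => simp
    | add y y' hy hy' => simp only [map_add, LinearMap.add_apply, hy, hy']; ring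
    | single m b =>
      rw [loopCocycle_single, loopCocycle_single, form_comm b a, add_comm m n]
      split_ifs with h
      · have : (n : ℂ) = - m := by
          rw [eq_neg_iff_add_eq_zero]; exact_mod_cast h
        rw [this]; ring
      · simp

theorem loopCocycle_loopD (x y : LoopSl2) :
    loopCocycle (loopD x) y = - loopCocycle x (loopD y) := by
  induction x using Finsupp.induction_linear with
  | zero => simp
  | add x x' hx hx' => simp only [map_add, LinearMap.add_apply, hx, hx']; ring
  | single n a =>
    induction y using Finsupp.induction_linear with
    | zero => simp
    | add y y' hy hy' => simp only [map_add, hy, hy']; ring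
    | single m b =>
      rw [loopD_single, loopD_single, map_smul, map_smul, LinearMap.smul_apply,
        loopCocycle_single]
      split_ifs with h
      · have : (n : ℂ) = - m := by
          rw [eq_neg_iff_add_eq_zero]; exact_mod_cast h
        rw [this]; simp
      · simp

theorem loopCocycle_loopBr (x y z : LoopSl2) :
    loopCocycle x (loopBr y z) = loopCocycle (loopBr x y) z + loopCocycle y (loopBr x z) := by
  induction x using Finsupp.induction_linear with
  | zero => simp
  | add x x' hx hx' => simp only [map_add, LinearMap.add_apply, hx, hx']; ring
  | single n a =>
    induction y using Finsupp.induction_linear with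
    | zero => simp
    | add y y' hy hy' => simp only [map_add, LinearMap.add_apply, hy, hy']; ring
    | single m b =>
      induction z using Finsupp.induction_linear with
      | zero => simp
      | add z z' hz hz' => simp only [map_add, hz, hz']; ring
      | single k c =>
        simp only [loopBr_single, loopCocycle_single]
        have h1 : form b ⁅a, c⁆ = - form a ⁅b, c⁆ := by
          rw [← form_lie, ← lie_skew, map_neg, LinearMap.neg_apply, form_lie]
        rw [form_lie, h1, ← add_assoc, show m + (n + k) = n + m + k by ring]
        split_ifs
        · push_cast; ring
        · simp

/-- The affine Lie algebra `sl₂ ⊗ ℂ[t, t⁻¹] ⊕ ℂ c ⊕ ℂ d`; a triple `(x, a, α)` is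
`x + a c + α d`. -/
def AffTilde : Type := LoopSl2 × ℂ × ℂ

instance : AddCommGroup AffTilde := inferInstanceAs (AddCommGroup (LoopSl2 × ℂ × ℂ))

instance : Module ℂ AffTilde := inferInstanceAs (Module ℂ (LoopSl2 × ℂ × ℂ))

/-- `[x, y] = [x, y]_loop + ψ(x, y) c` for `x, y` in the loop algebra, `c` is central and
`[d, x] = t dx/dt`. -/
instance : LieRing AffTilde where
  bracket X Y := (loopBr X.1 Y.1 + X.2.2 • loopD Y.1 - Y.2.2 • loopD X.1, loopCocycle X.1 Y.1, 0)
  add_lie X Y Z := by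
    refine Prod.ext ?_ (Prod.ext ?_ ?_)
    · change loopBr (X.1 + Y.1) Z.1 + (X.2.2 + Y.2.2) • loopD Z.1 - Z.2.2 • loopD (X.1 + Y.1) =
        (loopBr X.1 Z.1 + X.2.2 • loopD Z.1 - Z.2.2 • loopD X.1) +
        (loopBr Y.1 Z.1 + Y.2.2 • loopD Z.1 - Z.2.2 • loopD Y.1)
      simp only [add_smul, map_add, LinearMap.add_apply, smul_add]; abel
    · change loopCocycle (X.1 + Y.1) Z.1 = loopCocycle X.1 Z.1 + loopCocycle Y.1 Z.1
      simp
    · change (0 : ℂ) = 0 + 0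
      simp
  lie_add X Y Z := by
    refine Prod.ext ?_ (Prod.ext ?_ ?_)
    · change loopBr X.1 (Y.1 + Z.1) + X.2.2 • loopD (Y.1 + Z.1) - (Y.2.2 + Z.2.2) • loopD X.1 =
        (loopBr X.1 Y.1 + X.2.2 • loopD Y.1 - Y.2.2 • loopD X.1) +
        (loopBr X.1 Z.1 + X.2.2 • loopD Z.1 - Z.2.2 • loopD X.1)
      simp only [add_smul, map_add, smul_add]; abel
    · change loopCocycle X.1 (Y.1 + Z.1) = loopCocycle X.1 Y.1 + loopCocycle X.1 Z.1
      simp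
    · change (0 : ℂ) = 0 + 0
      simp
  lie_self X := by
    refine Prod.ext ?_ (Prod.ext ?_ ?_)
    · change loopBr X.1 X.1 + X.2.2 • loopD X.1 - X.2.2 • loopD X.1 = 0
      simp [loopBr_self]
    · change loopCocycle X.1 X.1 = 0
      exact self_eq_neg.mp (loopCocycle_swap X.1 X.1)
    · rfl
  leibniz_lie X Y Z := by
    refine Prod.ext ?_ (Prod.ext ?_ ?_)
    · change loopBr X.1 (loopBr Y.1 Z.1 + Y.2.2 • loopD Z.1 - Z.2.2 • loopD Y.1) +
          X.2.2 • loopD (loopBr Y.1 Z.1 + Y.2.2 • loopD Z.1 - Z.2.2 • loopD Y.1) -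
          (0 : ℂ) • loopD X.1 =
        (loopBr (loopBr X.1 Y.1 + X.2.2 • loopD Y.1 - Y.2.2 • loopD X.1) Z.1 +
          (0 : ℂ) • loopD Z.1 -
          Z.2.2 • loopD (loopBr X.1 Y.1 + X.2.2 • loopD Y.1 - Y.2.2 • loopD X.1)) +
        (loopBr Y.1 (loopBr X.1 Z.1 + X.2.2 • loopD Z.1 - Z.2.2 • loopD X.1) +
          Y.2.2 • loopD (loopBr X.1 Z.1 + X.2.2 • loopD Z.1 - Z.2.2 • loopD X.1) -
          (0 : ℂ) • loopD Y.1)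
      simp only [map_add, map_sub, map_smul, LinearMap.add_apply, LinearMap.sub_apply,
        LinearMap.smul_apply, loopD_loopBr, smul_add, smul_sub, zero_smul]
      rw [loopBr_jacobi X.1 Y.1 Z.1, loopBr_swap Y.1 (loopD X.1)]
      simp only [smul_comm X.2.2 Y.2.2, smul_comm X.2.2 Z.2.2, smul_comm Y.2.2 Z.2.2, smul_neg]
      abel
    · change loopCocycle X.1 (loopBr Y.1 Z.1 + Y.2.2 • loopD Z.1 - Z.2.2 • loopD Y.1) =
        loopCocycle (loopBr X.1 Y.1 + X.2.2 • loopD Y.1 - Y.2.2 • loopD X.1) Z.1 +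
        loopCocycle Y.1 (loopBr X.1 Z.1 + X.2.2 • loopD Z.1 - Z.2.2 • loopD X.1)
      simp only [map_add, map_sub, map_smul, LinearMap.add_apply, LinearMap.sub_apply,
        LinearMap.smul_apply, smul_eq_mul]
      rw [loopCocycle_loopBr, loopCocycle_loopD Y.1 Z.1, loopCocycle_loopD X.1 Z.1,
        loopCocycle_swap Y.1 (loopD X.1), loopCocycle_loopD X.1 Y.1]
      ring
    · change (0 : ℂ) = 0 + 0
      simp

instance : LieAlgebra ℂ AffTilde where
  lie_smul t X Y := by
    refine Prod.ext ?_ (Prod.ext ?_ ?_)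
    · change loopBr X.1 (t • Y.1) + X.2.2 • loopD (t • Y.1) - (t * Y.2.2) • loopD X.1 =
        t • (loopBr X.1 Y.1 + X.2.2 • loopD Y.1 - Y.2.2 • loopD X.1)
      simp only [map_smul, smul_add, smul_sub, mul_smul, smul_comm X.2.2 t]
    · change loopCocycle X.1 (t • Y.1) = t • loopCocycle X.1 Y.1
      simp
    · change (0 : ℂ) = t * 0
      simp

/-- The affine Lie algebra without derivation, `sl₂ ⊗ ℂ[t, t⁻¹] ⊕ ℂ c`. -/
def AffHat : LieSubalgebra ℂ AffTilde where
  carrier := {X | X.2.2 = 0}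
  zero_mem' := rfl
  add_mem' {X Y} hX hY := by
    change X.2.2 + Y.2.2 = 0
    rw [show X.2.2 = 0 from hX, show Y.2.2 = 0 from hY, add_zero]
  smul_mem' t X hX := by
    change t * X.2.2 = 0
    rw [show X.2.2 = 0 from hX, mul_zero]
  lie_mem' _ _ := rfl

/-- `x(n) = x ⊗ t^n`. -/
def cur (x : Sl2) (n : ℤ) : AffHat := ⟨(Finsupp.single n x, 0, 0), rfl⟩

/-- The central element `c`. -/
def cen : AffHat := ⟨(0, 1, 0), rfl⟩

/-- The derivation `d`. -/
def der : AffTilde := (0, 0, 1)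

/-- A representation of the affine algebra is restricted if every vector is killed by `x(n)` for
all sufficiently large `n`, for each `x ∈ sl₂`. -/
def IsRestricted {V : Type*} [AddCommGroup V] [Module ℂ V] (ρ : AffHat →ₗ⁅ℂ⁆ Module.End ℂ V) :
    Prop :=
  ∀ (v : V) (x : Sl2), ∃ N : ℤ, ∀ n ≥ N, ρ (cur x n) v = 0

/-- The term of index `m` of the coefficient of `z^(-n-2)` in the normally ordered product
`:x(z) y(z):`, where `x(z) = ∑ x(m) z^(-m-1)`: the operator `x(m)` stands to the left if `m < 0`
and to the right if `m ≥ 0`. -/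
def normalTerm {V : Type*} [AddCommGroup V] [Module ℂ V] (ρ : AffHat →ₗ⁅ℂ⁆ Module.End ℂ V)
    (x y : Sl2) (n m : ℤ) : Module.End ℂ V :=
  if m < 0 then ρ (cur x m) * ρ (cur y (n - m)) else ρ (cur y (n - m)) * ρ (cur x m)

/-- The Sugawara operators `T(n)`, where
`∑ T(n) z^(-n-2) = ½ (:e(z) f(z): + :f(z) e(z): + ½ :h(z) h(z):)`.
On a restricted module only finitely many terms of the sum are nonzero on a given vector. -/
def sugawara {V : Type*} [AddCommGroup V] [Module ℂ V] (ρ : AffHat →ₗ⁅ℂ⁆ Module.End ℂ V)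
    (n : ℤ) (v : V) : V :=
  (1 / 2 : ℂ) • ∑ᶠ m : ℤ, (normalTerm ρ e0 f0 n m v + normalTerm ρ f0 e0 n m v +
    (1 / 2 : ℂ) • normalTerm ρ h0 h0 n m v)

/-! ### Universal Whittaker modules -/

section Whittaker

variable (L : Type*) [LieRing L] [LieAlgebra ℂ L] (j : AffHat →ₗ⁅ℂ⁆ L) (lam mu kappa : ℂ)

/-- The left ideal of `U(L)` generated by `e(0) - λ`, `f(1) - μ`, `c - κ` and `e(i)`, `h(i)`,
`f(i+1)` for `i > 0`; here `j` is the identity of `AffHat` or its inclusion into `AffTilde`. -/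
def whittakerIdeal :
    Submodule (UniversalEnvelopingAlgebra ℂ L) (UniversalEnvelopingAlgebra ℂ L) :=
  let u : AffHat → UniversalEnvelopingAlgebra ℂ L := fun x => UniversalEnvelopingAlgebra.ι ℂ (j x)
  let s : ℂ → UniversalEnvelopingAlgebra ℂ L := algebraMap ℂ _
  Submodule.span _
    ({u (cur e0 0) - s lam, u (cur f0 1) - s mu, u cen - s kappa} ∪
      {z | ∃ i : ℤ, 0 < i ∧ (z = u (cur e0 i) ∨ z = u (cur h0 i) ∨ z = u (cur f0 (i + 1)))})

end Whittaker

/-- The universal Whittaker module `V(λ, μ, κ)` over the affine algebra with derivation. -/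
abbrev VTilde (lam mu kappa : ℂ) : Type :=
  RepSpace (envRep AffTilde
    (UniversalEnvelopingAlgebra ℂ AffTilde ⧸ whittakerIdeal AffTilde AffHat.incl lam mu kappa))

/-- The generator of `VTilde`. -/
def wTilde (lam mu kappa : ℂ) : VTilde lam mu kappa :=
  Submodule.Quotient.mk (p := whittakerIdeal AffTilde AffHat.incl lam mu kappa) 1

/-- The universal Whittaker module `V(λ, μ, κ)` over the affine algebra without derivation. -/
abbrev VHat (lam mu kappa : ℂ) : Type :=
  RepSpace (envRep AffHat
    (UniversalEnvelopingAlgebra ℂ AffHat ⧸ whittakerIdeal AffHat LieHom.id lam mu kappa))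

/-- The generator of `VHat`. -/
def wHat (lam mu kappa : ℂ) : VHat lam mu kappa :=
  Submodule.Quotient.mk (p := whittakerIdeal AffHat LieHom.id lam mu kappa) 1

/-- `V(λ, μ, -2, c(z))`, the quotient of `V(λ, μ, -2)` by the submodule generated by
`(T(n) - c_n) w`, `n ≤ 0`, for `c(z) = ∑_{n ≤ 0} c_n z^(-n-2)` (only the `c n` with `n ≤ 0` are
used). -/
abbrev VHatC (lam mu : ℂ) (c : ℤ → ℂ) : Type :=
  VHat lam mu (-2) ⧸ LieSubmodule.lieSpan ℂ AffHat
    {v : VHat lam mu (-2) | ∃ n ≤ 0,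
      v = sugawara (LieModule.toEnd ℂ AffHat (VHat lam mu (-2))) n (wHat lam mu (-2)) -
        c n • wHat lam mu (-2)}

/-- `V(λ, 0, -2, 0)`, the quotient of the universal Whittaker module over the affine algebra with
derivation by the submodule generated by `d w` and all `T(n) w`. -/
abbrev VZero (lam : ℂ) : Type :=
  VTilde lam 0 (-2) ⧸ LieSubmodule.lieSpan ℂ AffTilde
    ({⁅der, wTilde lam 0 (-2)⁆} ∪ {v : VTilde lam 0 (-2) | ∃ n : ℤ,
      v = sugawara (LieModule.toEnd ℂ AffHat (VTilde lam 0 (-2))) n (wTilde lam 0 (-2))})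

/-! ### The Lie algebra spanned by `d` and the `T(n)`, `n ≤ 0` -/

/-- The abelian Lie algebra with basis `T(n)`, `n ≤ 0`. -/
abbrev TSpace := {n : ℤ // n ≤ 0} →₀ ℂ

/-- `T(n) ↦ n T(n)`. -/
def tD : TSpace →ₗ[ℂ] TSpace := Finsupp.lsum ℂ fun n => ((n : ℤ) : ℂ) • Finsupp.lsingle n

/-- The Lie algebra with basis `d`, `T(n)` (`n ≤ 0`) and brackets `[d, T(n)] = n T(n)`,
`[T(n), T(m)] = 0`; a pair `(x, α)` is `x + α d`. -/
def TNeg : Type := TSpace × ℂ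

instance : AddCommGroup TNeg := inferInstanceAs (AddCommGroup (TSpace × ℂ))

instance : Module ℂ TNeg := inferInstanceAs (Module ℂ (TSpace × ℂ))

instance : LieRing TNeg where
  bracket X Y := (X.2 • tD Y.1 - Y.2 • tD X.1, 0)
  add_lie X Y Z := by
    refine Prod.ext ?_ ?_
    · change (X.2 + Y.2) • tD Z.1 - Z.2 • tD (X.1 + Y.1) =
        (X.2 • tD Z.1 - Z.2 • tD X.1) + (Y.2 • tD Z.1 - Z.2 • tD Y.1)
      simp only [add_smul, map_add, smul_add]; abel
    · change (0 : ℂ) = 0 + 0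
      simp
  lie_add X Y Z := by
    refine Prod.ext ?_ ?_
    · change X.2 • tD (Y.1 + Z.1) - (Y.2 + Z.2) • tD X.1 =
        (X.2 • tD Y.1 - Y.2 • tD X.1) + (X.2 • tD Z.1 - Z.2 • tD X.1)
      simp only [add_smul, map_add, smul_add]; abel
    · change (0 : ℂ) = 0 + 0
      simp
  lie_self X := by
    refine Prod.ext ?_ rfl
    change X.2 • tD X.1 - X.2 • tD X.1 = 0
    simp
  leibniz_lie X Y Z := by
    refine Prod.ext ?_ ?_
    · change X.2 • tD (Y.2 • tD Z.1 - Z.2 • tD Y.1) - (0 : ℂ) • tD X.1 =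
        ((0 : ℂ) • tD Z.1 - Z.2 • tD (X.2 • tD Y.1 - Y.2 • tD X.1)) +
        (Y.2 • tD (X.2 • tD Z.1 - Z.2 • tD X.1) - (0 : ℂ) • tD Y.1)
      simp only [map_sub, map_smul, smul_sub, zero_smul]
      simp only [smul_comm X.2 Y.2, smul_comm X.2 Z.2, smul_comm Y.2 Z.2]
      abel
    · change (0 : ℂ) = 0 + 0
      simp

instance : LieAlgebra ℂ TNeg where
  lie_smul t X Y := by
    refine Prod.ext ?_ ?_
    · change X.2 • tD (t • Y.1) - (t * Y.2) • tD X.1 = t • (X.2 • tD Y.1 - Y.2 • tD X.1)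
      simp only [map_smul, smul_sub, mul_smul, smul_comm X.2 t]
    · change (0 : ℂ) = t * 0
      simp

/-- The element `d` of `TNeg`. -/
def tder : TNeg := (0, 1)

/-- The element `T(n)` of `TNeg` for `n ≤ 0`; and `T(n) = 0` for `n > 0`. -/
def tT (n : ℤ) : TNeg := if hn : n ≤ 0 then (Finsupp.single ⟨n, hn⟩ 1, 0) else 0

/-! ### The modules `V(λ, 0, -2, 0) ⊗ X` -/

/-- `ρ` is an action of the affine algebra (with derivation) on `V(λ, 0, -2, 0) ⊗ X` that is
restricted and extends the tensor product action of the Lie algebra spanned by the `e(n)`, `h(n)`,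
`c`, `d` and `T(n)` (`n ∈ ℤ`), where `T(n)` acts on `V(λ, 0, -2, 0)` and through `ρ` as Sugawara
operator, `X` is a module over `TNeg`, and the `e(n)`, `h(n)`, `c` and the `T(n)` with `n > 0` act
on `X` by zero. -/
structure IsTensorAction (lam : ℂ) {X : Type*} [AddCommGroup X] [Module ℂ X]
    [LieRingModule TNeg X] (ρ : AffTilde →ₗ⁅ℂ⁆ Module.End ℂ (VZero lam ⊗[ℂ] X)) : Prop where
  restricted : IsRestricted (ρ.comp AffHat.incl)
  act_e : ∀ (n : ℤ) (v : VZero lam) (x : X),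
    ρ (cur e0 n) (v ⊗ₜ[ℂ] x) = ⁅cur e0 n, v⁆ ⊗ₜ[ℂ] x
  act_h : ∀ (n : ℤ) (v : VZero lam) (x : X),
    ρ (cur h0 n) (v ⊗ₜ[ℂ] x) = ⁅cur h0 n, v⁆ ⊗ₜ[ℂ] x
  act_c : ∀ (v : VZero lam) (x : X), ρ cen (v ⊗ₜ[ℂ] x) = ⁅cen, v⁆ ⊗ₜ[ℂ] x
  act_d : ∀ (v : VZero lam) (x : X),
    ρ der (v ⊗ₜ[ℂ] x) = ⁅der, v⁆ ⊗ₜ[ℂ] x + v ⊗ₜ[ℂ] ⁅tder, x⁆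
  act_T : ∀ (n : ℤ) (v : VZero lam) (x : X),
    sugawara (ρ.comp AffHat.incl) n (v ⊗ₜ[ℂ] x) =
      sugawara (LieModule.toEnd ℂ AffHat (VZero lam)) n v ⊗ₜ[ℂ] x + v ⊗ₜ[ℂ] ⁅tT n, x⁆

/-! ### Twisted modules over the Borel subalgebra -/

theorem h0_lie_e0 : ⁅h0, e0⁆ = (2 : ℂ) • e0 := by
  apply Subtype.ext
  change h0.val * e0.val - e0.val * h0.val = (2 : ℂ) • e0.val
  have hh : h0.val = Matrix.single (0 : Fin 2) (0 : Fin 2) (1 : ℂ) - Matrix.single 1 1 1 := rfl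
  have he : e0.val = Matrix.single (0 : Fin 2) (1 : Fin 2) (1 : ℂ) := rfl
  rw [hh, he]
  ext a b
  fin_cases a <;> fin_cases b <;> (simp [Matrix.mul_apply, Matrix.single_apply]; try norm_num)

/-- The Borel subalgebra `𝔟 = ℂ h + ℂ e` of `sl₂`. -/
def Borel : LieSubalgebra ℂ Sl2 where
  toSubmodule := Submodule.span ℂ {h0, e0}
  lie_mem' {x y} hx hy := by
    change x ∈ Submodule.span ℂ {h0, e0} at hx
    change y ∈ Submodule.span ℂ {h0, e0} at hy
    change ⁅x, y⁆ ∈ Submodule.span ℂ {h0, e0}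
    obtain ⟨a, b, rfl⟩ := Submodule.mem_span_pair.mp hx
    obtain ⟨a', b', rfl⟩ := Submodule.mem_span_pair.mp hy
    refine Submodule.mem_span_pair.mpr ⟨0, 2 * (a * b' - b * a'), ?_⟩
    simp only [add_lie, lie_add, smul_lie, lie_smul, lie_self, ← lie_skew e0 h0, h0_lie_e0]
    module

/-- `h ∈ 𝔟`. -/
def bh : Borel := ⟨h0, Submodule.subset_span (by simp)⟩

/-- `e ∈ 𝔟`. -/
def be : Borel := ⟨e0, Submodule.subset_span (by simp)⟩

/-- The parameters of a twist: a nonempty set `s` of negative integers, the positive generator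
`r` of the subgroup of `ℤ` generated by `s`, and complex numbers `χ i`, `i ∈ s ∪ {0}`, that are
nonzero for `i ∈ s` (the values of `χ` outside `s ∪ {0}` are not used). -/
structure TwistDatum where
  s : Set ℤ
  nonempty : s.Nonempty
  neg : ∀ i ∈ s, i < 0
  r : ℕ
  r_pos : 0 < r
  closure_eq : AddSubgroup.closure s = AddSubgroup.zmultiples (r : ℤ)
  χ : ℤ → ℂ
  χ_ne : ∀ i ∈ s, χ i ≠ 0

open Classical in
/-- `φ(T(i)) = χ(i) e^(-i/r)` for `i ∈ s ∪ {0}`, and `φ(T(i)) = 0` for the other `i`. -/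
def TwistDatum.onT (D : TwistDatum) (i : ℤ) : UniversalEnvelopingAlgebra ℂ Borel :=
  if i ∈ D.s ∪ {0} then
    D.χ i • (UniversalEnvelopingAlgebra.ι ℂ be) ^ (-i / (D.r : ℤ)).toNat
  else 0

/-- `φ(d) = -(r/2) h`. -/
def TwistDatum.onD (D : TwistDatum) : UniversalEnvelopingAlgebra ℂ Borel :=
  (-(D.r : ℂ) / 2) • UniversalEnvelopingAlgebra.ι ℂ bh

theorem bh_pow_be (k : ℕ) :
    ⁅UniversalEnvelopingAlgebra.ι ℂ bh, (UniversalEnvelopingAlgebra.ι ℂ be) ^ k⁆ =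
      (2 * k : ℂ) • (UniversalEnvelopingAlgebra.ι ℂ be) ^ k := by
  have h1 : ⁅UniversalEnvelopingAlgebra.ι ℂ bh, UniversalEnvelopingAlgebra.ι ℂ be⁆ =
      (2 : ℂ) • UniversalEnvelopingAlgebra.ι ℂ be := by
    rw [← LieHom.map_lie, ← map_smul]
    congr 1
    exact Subtype.ext h0_lie_e0
  induction k with
  | zero => simp [LieRing.of_associative_ring_bracket]
  | succ k ih =>
    rw [LieRing.of_associative_ring_bracket] at h1 ih ⊢
    generalize UniversalEnvelopingAlgebra.ι ℂ bh = H at *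
    generalize UniversalEnvelopingAlgebra.ι ℂ be = E at *
    have : H * E ^ (k + 1) - E ^ (k + 1) * H =
        (H * E ^ k - E ^ k * H) * E + E ^ k * (H * E - E * H) := by
      rw [pow_succ]; noncomm_ring
    rw [this, h1, ih, smul_mul_assoc, mul_smul_comm, ← pow_succ, ← add_smul]
    congr 1
    push_cast; ring

theorem TwistDatum.onT_comm (D : TwistDatum) (i k : ℤ) : ⁅D.onT i, D.onT k⁆ = 0 := by
  unfold TwistDatum.onT
  rw [LieRing.of_associative_ring_bracket]
  split_ifs
  · rw [smul_mul_smul_comm, smul_mul_smul_comm, ← pow_add, ← pow_add, mul_comm, add_comm, sub_self]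
  all_goals simp

theorem TwistDatum.onD_onT (D : TwistDatum) (i : ℤ) : ⁅D.onD, D.onT i⁆ = (i : ℂ) • D.onT i := by
  unfold TwistDatum.onT TwistDatum.onD
  split_ifs with hi
  · rw [smul_lie, lie_smul, bh_pow_be]
    have hdvd : (D.r : ℤ) ∣ i := by
      rcases hi with hi | hi
      · have := AddSubgroup.subset_closure hi
        rw [D.closure_eq] at this
        exact Int.mem_zmultiples_iff.mp this
      · rw [show i = 0 from hi]; exact dvd_zero _
    have hle : i ≤ 0 := by
      rcases hi with hi | hi
      · exact (D.neg i hi).le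
      · rw [show i = 0 from hi]
    obtain ⟨q, hq⟩ := hdvd
    have hr : (0 : ℤ) < D.r := by exact_mod_cast D.r_pos
    have hdiv : -i / (D.r : ℤ) = -q := by
      rw [hq, ← mul_neg, Int.mul_ediv_cancel_left _ hr.ne']
    have hq0 : q ≤ 0 := by
      by_contra hc
      have : 0 < (D.r : ℤ) * q := mul_pos hr (by omega)
      omega
    have hnat : (((-i / (D.r : ℤ)).toNat : ℕ) : ℂ) = -(q : ℂ) := by
      rw [hdiv]
      have : (((-q).toNat : ℕ) : ℤ) = -q := Int.toNat_of_nonneg (by omega)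
      exact_mod_cast congrArg (Int.cast : ℤ → ℂ) this
    rw [smul_smul, smul_smul, smul_smul, hnat, hq]
    congr 1
    push_cast; ring
  · simp

/-- The linear extension of `T(n) ↦ φ(T(n))`, `n ≤ 0`. -/
def TwistDatum.onTSpace (D : TwistDatum) : TSpace →ₗ[ℂ] UniversalEnvelopingAlgebra ℂ Borel :=
  Finsupp.lsum ℂ fun n => LinearMap.toSpanSingleton ℂ _ (D.onT n)

theorem TwistDatum.onTSpace_single (D : TwistDatum) (n : {n : ℤ // n ≤ 0}) (a : ℂ) :
    D.onTSpace (Finsupp.single n a) = a • D.onT n := by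
  simp [TwistDatum.onTSpace]

theorem TwistDatum.onTSpace_comm (D : TwistDatum) (x y : TSpace) :
    ⁅D.onTSpace x, D.onTSpace y⁆ = 0 := by
  induction x using Finsupp.induction_linear with
  | zero => simp
  | add x x' hx hx' => rw [map_add, add_lie, hx, hx', add_zero]
  | single n a =>
    induction y using Finsupp.induction_linear with
    | zero => simp
    | add y y' hy hy' => rw [map_add, lie_add, hy, hy', add_zero]
    | single m b =>
      rw [D.onTSpace_single, D.onTSpace_single, smul_lie, lie_smul, D.onT_comm, smul_zero,
        smul_zero]

theorem TwistDatum.onD_onTSpace (D : TwistDatum) (x : TSpace) :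
    ⁅D.onD, D.onTSpace x⁆ = D.onTSpace (tD x) := by
  induction x using Finsupp.induction_linear with
  | zero => simp
  | add x x' hx hx' => rw [map_add, lie_add, hx, hx', map_add, map_add]
  | single n a =>
    have h : tD (Finsupp.single n a) = ((n : ℤ) : ℂ) • Finsupp.single n a := by simp [tD]
    rw [h, map_smul, D.onTSpace_single, lie_smul, D.onD_onT, smul_comm]

/-- The Lie algebra homomorphism `φ : TNeg → U(𝔟)`. -/
def TwistDatum.φ (D : TwistDatum) : TNeg →ₗ⁅ℂ⁆ UniversalEnvelopingAlgebra ℂ Borel where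
  toFun X := D.onTSpace X.1 + X.2 • D.onD
  map_add' X Y := by
    change D.onTSpace (X.1 + Y.1) + (X.2 + Y.2) • D.onD = _
    rw [map_add, add_smul]; abel
  map_smul' t X := by
    change D.onTSpace (t • X.1) + (t * X.2) • D.onD = t • (D.onTSpace X.1 + X.2 • D.onD)
    rw [map_smul, mul_smul, smul_add]
  map_lie' {X Y} := by
    change D.onTSpace (X.2 • tD Y.1 - Y.2 • tD X.1) + (0 : ℂ) • D.onD =
      ⁅D.onTSpace X.1 + X.2 • D.onD, D.onTSpace Y.1 + Y.2 • D.onD⁆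
    rw [map_sub, map_smul, map_smul, zero_smul, add_zero, add_lie, lie_add, lie_add,
      D.onTSpace_comm, smul_lie, smul_lie, lie_smul, lie_smul, lie_self, smul_zero, smul_zero,
      D.onD_onTSpace, ← lie_skew, D.onD_onTSpace, smul_neg]
    abel

/-- The twist `M^φ` of a `𝔟`-module `M`: the space `M`, on which `x ∈ TNeg` acts as `φ(x) ∈ U(𝔟)`. -/
abbrev Twist (D : TwistDatum) (M : Type*) [AddCommGroup M] [Module ℂ M] [LieRingModule Borel M]
    [LieModule ℂ Borel M] : Type _ :=
  RepSpace ((UniversalEnvelopingAlgebra.lift ℂ (LieModule.toEnd ℂ Borel M)).toLieHom.comp D.φ)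

end WhittakerSl2

end

open WhittakerSl2

universe u

/-! The proof combines a rigidity property of the currents e(n), h(n) alone with the fact that at
level -2 the operators T(n) commute with all x(n).

Rigidity. Let X be a space of Whittaker vectors: e(0) acts by λ, and e(i), h(i) act by zero for i >
0. Since λ ≠ 0, the series λ + Σ e(-i) z^i is invertible. Multiplying the annihilating modes of h
and e by its inverse gives operators that act like ∂/∂e(-n), n > 0, and ∂/∂h(-n), n ≥ 0, up to lower
order (`eDer`, `hDer`). An Euler operator argument (`filt_kernel`, `filt_meets`) then shows that the
module generated by X behaves like polynomials in these modes with coefficients in X: its Whittaker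
vectors are exactly X, and each nonzero submodule meets X (`mem_of_mem_borelSpan`,
`exists_mem_of_mem_borelSpan`). Applied to a graph inside a product, this shows that two modules
generated by the same X are isomorphic over the e(n), h(n) (`exists_equiv_of_borelSpan_eq_top`).

The role of T. On a Whittaker vector x one has T(n)x = λ f(n)x + Σ_{m<0} e(m) f(n-m)x + terms in h
only. Only larger modes of f occur in the sum, so the system is triangular and recovers every f(n)x
from the actions of e, h and T (`f_mem_of_whit`, `f_eq`). Hence a simple quotient is governed by its
space X of Whittaker vectors together with d and the T(n) acting on it. For μ = 0 the T(n) with n >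
0 vanish, and X is a simple `TNeg`-module (`IsCritical.exists_whittakerData`).

Existence. Given a simple X, a module whose Whittaker vectors form X is built from the Wakimoto free
field realization: e = a, h = -2:aa*: + b, f = -:aa*²: - 2∂a* + a*b, with commuting modes b(n)
acting on X. There T becomes the Miura expression ½∂b + ¼b², and the resulting Riccati equation for
b is solved mode by mode, starting from the scalar T(0) (`exists_model`). The case X = ℂ with
trivial action shows that V(λ, 0, -2, 0) is nonzero; rigidity then carries the model for X over to
V(λ, 0, -2, 0) ⊗ X (`exists_tensor_model`). There e and h act on the first factor, and the operators
f(n) come with the transported action, although no tensor formula for them is available.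

Simple `TNeg`-modules. By Schur's lemma each T(n) is zero or invertible. If some T(n) with n < 0 is
nonzero, the degrees of invertible homogeneous operators form a group that contains r, so there is
an invertible u of degree -r. Each T(n) is then a scalar times a power of u, and a multiple of d
together with u gives the action of the Borel subalgebra (`exists_twist`). Conversely, a numerical
semigroup contains all large integers, which gives the simplicity of the twists
(`isIrreducible_twist`).

The case μ ≠ 0. Now T(1) has the nonzero eigenvalue λμ on the generator, and T(n) T(1)^(-n) has
degree 0, hence is a scalar for n ≤ 0; this yields the c_n. The generator satisfies the relations of
V(λ, μ, -2, c(z)), and the map from the induced module is injective because the vectors d^k w are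
linearly independent (`polyMap_injective`). -/

namespace WhittakerSl2

noncomputable section

/-! ### Locally finite sums of operators -/

section LocSum

variable {V ι : Type*} [AddCommGroup V] [Module ℂ V]

/-- A family of operators is locally finite if only finitely many members are nonzero on each
vector. -/
def LocFin (F : ι → Module.End ℂ V) : Prop :=
  ∀ v, (Function.support fun i => F i v).Finite

open Classical in
/-- The sum of a locally finite family of operators. -/
def locSum (F : ι → Module.End ℂ V) : Module.End ℂ V :=
  if hF : LocFin F then
    { toFun := fun v => ∑ᶠ i, F i v
      map_add' := fun v w => by
        simp only [map_add]; exact finsum_add_distrib (hF v) (hF w)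
      map_smul' := fun t v => by
        simp only [map_smul, RingHom.id_apply]; exact (smul_finsum' t (hF v)).symm }
  else 0

theorem locSum_apply {F : ι → Module.End ℂ V} (hF : LocFin F) (v : V) :
    locSum F v = ∑ᶠ i, F i v := by
  rw [locSum, dif_pos hF]; rfl

theorem LocFin.mul_left {F : ι → Module.End ℂ V} (hF : LocFin F) (A : Module.End ℂ V) :
    LocFin fun i => A * F i := fun v =>
  (hF v).subset fun i hi => by
    simp only [Function.mem_support, Module.End.mul_apply] at hi ⊢
    exact fun h => hi (by rw [h, map_zero])

theorem LocFin.mul_right {F : ι → Module.End ℂ V} (hF : LocFin F) (A : Module.End ℂ V) :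
    LocFin fun i => F i * A := fun v => hF (A v)

theorem LocFin.add {F G : ι → Module.End ℂ V} (hF : LocFin F) (hG : LocFin G) :
    LocFin fun i => F i + G i := fun v =>
  ((hF v).union (hG v)).subset fun i hi => by
    simp only [Function.mem_support, LinearMap.add_apply, Set.mem_union] at hi ⊢
    by_contra! h
    exact hi (by rw [h.1, h.2, add_zero])

theorem LocFin.smul {F : ι → Module.End ℂ V} (hF : LocFin F) (c : ι → ℂ) :
    LocFin fun i => c i • F i := fun v =>
  (hF v).subset fun i hi => by
    simp only [Function.mem_support, LinearMap.smul_apply] at hi ⊢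
    exact fun h => hi (by rw [h, smul_zero])

theorem LocFin.neg {F : ι → Module.End ℂ V} (hF : LocFin F) : LocFin fun i => - F i := by
  simpa using hF.smul fun _ => -1

theorem LocFin.sub {F G : ι → Module.End ℂ V} (hF : LocFin F) (hG : LocFin G) :
    LocFin fun i => F i - G i := by
  simpa [sub_eq_add_neg] using hF.add hG.neg

theorem LocFin.comp_injective {κ : Type*} {F : ι → Module.End ℂ V} (hF : LocFin F) {g : κ → ι}
    (hg : Function.Injective g) : LocFin fun i => F (g i) := fun v =>
  (hF v).preimage hg.injOn

theorem locSum_mul_left {F : ι → Module.End ℂ V} (hF : LocFin F) (A : Module.End ℂ V) :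
    A * locSum F = locSum fun i => A * F i := by
  ext v
  rw [Module.End.mul_apply, locSum_apply hF, locSum_apply (hF.mul_left A)]
  exact (LinearMap.toAddMonoidHom A).map_finsum (hF v)

theorem locSum_mul_right {F : ι → Module.End ℂ V} (hF : LocFin F) (A : Module.End ℂ V) :
    locSum F * A = locSum fun i => F i * A := by
  ext v
  rw [Module.End.mul_apply, locSum_apply hF, locSum_apply (hF.mul_right A)]
  rfl

theorem locSum_add {F G : ι → Module.End ℂ V} (hF : LocFin F) (hG : LocFin G) :
    (locSum fun i => F i + G i) = locSum F + locSum G := by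
  ext v
  rw [LinearMap.add_apply, locSum_apply hF, locSum_apply hG, locSum_apply (hF.add hG)]
  exact finsum_add_distrib (hF v) (hG v)

theorem locSum_smul {F : ι → Module.End ℂ V} (hF : LocFin F) (c : ℂ) :
    (locSum fun i => c • F i) = c • locSum F := by
  ext v
  rw [LinearMap.smul_apply, locSum_apply hF, locSum_apply (hF.smul fun _ => c)]
  exact (smul_finsum' c (hF v)).symm

theorem locSum_neg {F : ι → Module.End ℂ V} (hF : LocFin F) :
    (locSum fun i => - F i) = - locSum F := by
  simpa using locSum_smul hF (-1)

theorem locSum_sub {F G : ι → Module.End ℂ V} (hF : LocFin F) (hG : LocFin G) :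
    (locSum fun i => F i - G i) = locSum F - locSum G := by
  have := locSum_add hF hG.neg
  rw [locSum_neg hG] at this
  simpa [sub_eq_add_neg] using this

/-- Reindexing by a bijection preserves and reflects local finiteness. So no finiteness hypothesis
is needed: in the other case both sides have the default value 0. -/
theorem locSum_comp_equiv {κ : Type*} (F : ι → Module.End ℂ V) (g : κ ≃ ι) :
    (locSum fun i => F (g i)) = locSum F := by
  by_cases hF : LocFin F
  · ext v
    rw [locSum_apply hF, locSum_apply (hF.comp_injective g.injective)]
    exact finsum_comp_equiv g (f := fun i => F i v)
  · have hG : ¬ LocFin fun i => F (g i) := fun h => hF (by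
      simpa using h.comp_injective g.symm.injective)
    simp only [locSum, dif_neg hF, dif_neg hG]

theorem locFin_single [DecidableEq ι] (i : ι) (A : Module.End ℂ V) :
    LocFin fun j => if j = i then A else 0 := fun v =>
  (Set.finite_singleton i).subset fun j hj => by
    by_contra h
    exact hj (by simp [show j ≠ i from h])

theorem locSum_single [DecidableEq ι] (i : ι) (A : Module.End ℂ V) :
    (locSum fun j => if j = i then A else 0) = A := by
  ext v
  rw [locSum_apply (locFin_single i A), finsum_eq_single _ i (fun j hj => by simp [hj])]
  simp

theorem LocFin.mem_of {F : ι → Module.End ℂ V} (hF : LocFin F) {N : Submodule ℂ V} {v : V}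
    (h : ∀ i, F i v ∈ N) : locSum F v ∈ N := by
  rw [locSum_apply hF]
  exact finsum_induction (fun x => x ∈ N) N.zero_mem (fun _ _ => N.add_mem) h

theorem LocFin.congr {F G : ι → Module.End ℂ V} (hF : LocFin F) (h : ∀ i, F i = G i) :
    LocFin G := by rwa [← (funext h : F = G)]

end LocSum

end

end WhittakerSl2

namespace WhittakerSl2

noncomputable section

/-! ### Filtrations by the number of creation operators -/

section Filtration

variable {V ι : Type*} [AddCommGroup V] [Module ℂ V]

/-- The span of the vectors obtained from `X` by fewer than `k` operators `S i`. -/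
def filt (S : ι → Module.End ℂ V) (X : Submodule ℂ V) : ℕ → Submodule ℂ V
  | 0 => ⊥
  | k + 1 => X ⊔ ⨆ i, (filt S X k).map (S i)

variable {S D : ι → Module.End ℂ V} {X N : Submodule ℂ V}

theorem le_filt_succ (k : ℕ) : X ≤ filt S X (k + 1) := le_sup_left

theorem apply_mem_filt {k : ℕ} {u : V} (i : ι) (hu : u ∈ filt S X k) :
    S i u ∈ filt S X (k + 1) :=
  le_sup_right (a := X) (le_iSup (fun i => (filt S X k).map (S i)) i (Submodule.mem_map_of_mem hu))

theorem filt_succ_le {k : ℕ} (hX : X ≤ N) (hS : ∀ i, ∀ u ∈ filt S X k, S i u ∈ N) :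
    filt S X (k + 1) ≤ N :=
  sup_le hX (iSup_le fun i => Submodule.map_le_iff_le_comap.mpr (hS i))

theorem filt_le (hX : X ≤ N) (hS : ∀ i, ∀ u ∈ N, S i u ∈ N) (k : ℕ) : filt S X k ≤ N := by
  induction k with
  | zero => exact bot_le
  | succ k ih => exact filt_succ_le hX fun i u hu => hS i u (ih hu)

theorem filt_le_succ (k : ℕ) : filt S X k ≤ filt S X (k + 1) := by
  induction k with
  | zero => exact bot_le
  | succ k ih => exact filt_succ_le (le_filt_succ _) fun i u hu => apply_mem_filt i (ih hu)

theorem filt_mono : Monotone (filt S X) := monotone_nat_of_le_succ filt_le_succ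

theorem filt_one : filt S X 1 = X :=
  le_antisymm (filt_succ_le le_rfl fun i u hu => by
    rw [show u = 0 from hu, map_zero]; exact X.zero_mem) (le_filt_succ 0)

theorem mem_iSup_filt {u : V} : u ∈ ⨆ k, filt S X k ↔ ∃ k, u ∈ filt S X k :=
  Submodule.mem_iSup_of_directed _ filt_mono.directed_le

variable [DecidableEq ι]

/-- The operator Σ S i ∘ D i plays the part of the Euler operator Σ x ∂/∂x. Moving it past S l
reproduces S l once, up to terms S i (…) whose argument has dropped a step of the filtration by
`hDS`. Induction then gives multiplication by k on step k + 1 modulo step k. Step k + 1 holds words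
in at most k operators, whence the eigenvalue k. The truncated k - 1 in `hDS` is harmless at k = 0,
where the step is zero. -/
theorem filt_euler (hDX : ∀ i, ∀ x ∈ X, D i x = 0) (hSS : ∀ i j, S i * S j = S j * S i)
    (hD : LocFin D)
    (hDS : ∀ k, ∀ u ∈ filt S X k, ∀ i l,
      D i (S l u) - S l (D i u) - (if i = l then u else 0) ∈ filt S X (k - 1))
    (k : ℕ) :
    ∀ u ∈ filt S X (k + 1), locSum (fun i => S i * D i) u - (k : ℂ) • u ∈ filt S X k := by
  have hSD : LocFin fun i => S i * D i := fun v =>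
    (hD v).subset fun i hi => by
      simp only [Function.mem_support, Module.End.mul_apply] at hi ⊢
      exact fun h => hi (by rw [h, map_zero])
  have hX0 : ∀ x ∈ X, locSum (fun i => S i * D i) x = 0 := fun x hx => by
    rw [locSum_apply hSD]
    simp [hDX _ x hx]
  induction k with
  | zero =>
    intro u hu
    rw [filt_one] at hu
    simp [hX0 u hu]
  | succ k ih =>
    let A : Module.End ℂ V := locSum (fun i => S i * D i) - ((k + 1 : ℕ) : ℂ) • 1
    suffices h : filt S X (k + 1 + 1) ≤ (filt S X (k + 1)).comap A from fun u hu => h hu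
    refine filt_succ_le (N := (filt S X (k + 1)).comap A) (fun x hx => ?_) fun l u hu => ?_
    · change locSum (fun i => S i * D i) x - ((k + 1 : ℕ) : ℂ) • x ∈ filt S X (k + 1)
      rw [hX0 x hx, zero_sub]
      exact Submodule.neg_mem _ (Submodule.smul_mem _ _ (le_filt_succ k hx))
    · change locSum (fun i => S i * D i) (S l u) - ((k + 1 : ℕ) : ℂ) • S l u ∈ filt S X (k + 1)
      have hR : LocFin fun i => S i * (D i * S l - S l * D i - if i = l then 1 else 0) := fun v =>
        (((hD (S l v)).union (hD v)).union (Set.finite_singleton l)).subset fun i hi => by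
          by_contra h
          simp only [Set.mem_union, Function.mem_support, Set.mem_singleton_iff, not_or,
            not_not] at h
          refine hi ?_
          simp [h.1.1, h.1.2, h.2]
      have key : locSum (fun i => S i * D i) (S l u) - ((k + 1 : ℕ) : ℂ) • S l u =
          locSum (fun i => S i * (D i * S l - S l * D i - if i = l then 1 else 0)) u +
          S l (locSum (fun i => S i * D i) u - (k : ℂ) • u) := by
        have e1 : locSum (fun i => S i * D i) * S l =
            locSum (fun i => S i * (D i * S l - S l * D i - if i = l then 1 else 0)) +
              (S l * locSum (fun i => S i * D i) + S l) := by
          rw [locSum_mul_right hSD]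
          have hl : (S l * locSum fun i => S i * D i) + S l =
              locSum fun i => S l * (S i * D i) + if i = l then S l else 0 := by
            rw [locSum_add (hSD.mul_left _) (locFin_single _ _), locSum_single,
              locSum_mul_left hSD]
          rw [hl, ← locSum_add hR ((hSD.mul_left _).add (locFin_single _ _))]
          congr 1
          funext i
          rw [← mul_assoc (S l), hSS l i]
          by_cases hil : i = l
          · subst hil; simp only [if_true]; noncomm_ring
          · simp only [hil, if_false]; noncomm_ring
        have e2 := LinearMap.congr_fun e1 u
        simp only [Module.End.mul_apply, LinearMap.add_apply] at e2
        rw [e2, map_sub, map_smul]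
        push_cast
        module
      rw [key]
      refine Submodule.add_mem _ (hR.mem_of fun i => ?_) (apply_mem_filt l (ih u hu))
      refine apply_mem_filt i ?_
      have := hDS (k + 1) u hu i l
      rw [Nat.add_sub_cancel] at this
      convert this using 2
      split_ifs <;> simp

/-- The Euler operator vanishes on a vector killed by all D i, but acts as k on step k + 1 modulo
step k. So for k ≠ 0 the vector already lies one step lower, and descent ends in X. -/
theorem filt_kernel (hDX : ∀ i, ∀ x ∈ X, D i x = 0) (hSS : ∀ i j, S i * S j = S j * S i)
    (hD : LocFin D)
    (hDS : ∀ k, ∀ u ∈ filt S X k, ∀ i l,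
      D i (S l u) - S l (D i u) - (if i = l then u else 0) ∈ filt S X (k - 1))
    {k : ℕ} {u : V} (hu : u ∈ filt S X k) (hDu : ∀ i, D i u = 0) : u ∈ X := by
  have hSD : LocFin fun i => S i * D i := fun v =>
    (hD v).subset fun i hi => by
      simp only [Function.mem_support, Module.End.mul_apply] at hi ⊢
      exact fun h => hi (by rw [h, map_zero])
  induction k with
  | zero => rw [show u = 0 from hu]; exact X.zero_mem
  | succ k ih =>
    rcases Nat.eq_zero_or_pos k with rfl | hk
    · rwa [filt_one] at hu
    · refine ih ?_
      have h := filt_euler hDX hSS hD hDS k u hu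
      have h0 : locSum (fun i => S i * D i) u = 0 := by
        rw [locSum_apply hSD]; simp [hDu]
      rw [h0, zero_sub, neg_mem_iff] at h
      exact (Submodule.smul_mem_iff _ (by exact_mod_cast hk.ne')).mp h

theorem filt_lower (hDX : ∀ i, ∀ x ∈ X, D i x = 0)
    (hDS : ∀ k, ∀ u ∈ filt S X k, ∀ i l,
      D i (S l u) - S l (D i u) - (if i = l then u else 0) ∈ filt S X (k - 1))
    (k : ℕ) (i : ι) : ∀ u ∈ filt S X (k + 1), D i u ∈ filt S X k := by
  induction k with
  | zero =>
    intro u hu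
    rw [filt_one] at hu
    rw [hDX i u hu]; exact Submodule.zero_mem _
  | succ k ih =>
    refine filt_succ_le (N := (filt S X (k + 1)).comap (D i)) (fun x hx => ?_) fun l u hu => ?_
    · rw [Submodule.mem_comap, hDX i x hx]; exact Submodule.zero_mem _
    · rw [Submodule.mem_comap]
      have h := filt_le_succ k (hDS (k + 1) u hu i l)
      have h2 : S l (D i u) ∈ filt S X (k + 1) := apply_mem_filt l (ih u hu)
      have h3 : (if i = l then u else 0) ∈ filt S X (k + 1) := by
        split_ifs
        · exact hu
        · exact Submodule.zero_mem _
      have := Submodule.add_mem _ (Submodule.add_mem _ h h3) h2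
      convert this using 1
      abel

/-- Apply operators D i as long as the result is nonzero. This stays in N and lowers the filtration,
and it stops at a vector killed by all D i, which lies in X by `filt_kernel`. -/
theorem filt_meets (hDX : ∀ i, ∀ x ∈ X, D i x = 0) (hSS : ∀ i j, S i * S j = S j * S i)
    (hD : LocFin D)
    (hDS : ∀ k, ∀ u ∈ filt S X k, ∀ i l,
      D i (S l u) - S l (D i u) - (if i = l then u else 0) ∈ filt S X (k - 1))
    (hN : ∀ i, ∀ u ∈ N, D i u ∈ N)
    {k : ℕ} {u : V} (hu : u ∈ filt S X k) (huN : u ∈ N) (hu0 : u ≠ 0) :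
    ∃ x ∈ X, x ∈ N ∧ x ≠ 0 := by
  induction k generalizing u with
  | zero => exact absurd hu hu0
  | succ k ih =>
    by_cases h : ∀ i, D i u = 0
    · exact ⟨u, filt_kernel hDX hSS hD hDS hu h, huN, hu0⟩
    · push Not at h
      obtain ⟨i, hi⟩ := h
      exact ih (filt_lower hDX hDS k i u hu) (hN i u huN) hi

end Filtration

end

end WhittakerSl2

namespace WhittakerSl2

noncomputable section

/-! ### Modules over the current algebra of the Borel subalgebra at the critical level -/

section BorelCurrents

variable {V : Type*} [AddCommGroup V] [Module ℂ V]

/-- The operators `e(n)`, `h(n)` of a restricted module at the critical level. -/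
structure BorelCurrents (e h : ℤ → Module.End ℂ V) : Prop where
  ee : ∀ m n, e m * e n = e n * e m
  he : ∀ m n, h m * e n = e n * h m + (2 : ℂ) • e (m + n)
  hh : ∀ m n, h m * h n = h n * h m + (if m + n = 0 then -4 * (m : ℂ) else 0) • 1
  loc_e : ∀ v, ∃ N : ℤ, ∀ n ≥ N, e n v = 0
  loc_h : ∀ v, ∃ N : ℤ, ∀ n ≥ N, h n v = 0

/-- The Whittaker vectors: `e(0)` acts by `lam`, and `e(i)`, `h(i)` with `i > 0` by zero. -/
def whittakerVectors (e h : ℤ → Module.End ℂ V) (lam : ℂ) : Submodule ℂ V where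
  carrier := {v | e 0 v = lam • v ∧ ∀ i > 0, e i v = 0 ∧ h i v = 0}
  zero_mem' := by simp
  add_mem' {v w} hv hw := ⟨by rw [map_add, hv.1, hw.1, smul_add], fun i hi => by
    simp [map_add, hv.2 i hi, hw.2 i hi]⟩
  smul_mem' t v hv := ⟨by rw [map_smul, hv.1, smul_comm], fun i hi => by
    simp [map_smul, hv.2 i hi]⟩

/-- A subspace is stable under all members of a family of operators. -/
def StableUnder (e : ℤ → Module.End ℂ V) (N : Submodule ℂ V) : Prop :=
  ∀ n, ∀ v ∈ N, e n v ∈ N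

/-- The smallest subspace that contains `X` and is stable under the `e(n)` and `h(n)`. -/
def borelSpan (e h : ℤ → Module.End ℂ V) (X : Submodule ℂ V) : Submodule ℂ V :=
  sInf {N | X ≤ N ∧ StableUnder e N ∧ StableUnder h N}

variable {e h : ℤ → Module.End ℂ V} {lam : ℂ} {X N : Submodule ℂ V}

theorem borelSpan_le (hX : X ≤ N) (he : StableUnder e N) (hh : StableUnder h N) :
    borelSpan e h X ≤ N := sInf_le ⟨hX, he, hh⟩

theorem le_borelSpan : X ≤ borelSpan e h X := le_sInf fun _ h => h.1

theorem borelSpan_stable_e : StableUnder e (borelSpan e h X) := fun n v hv => by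
  rw [borelSpan, Submodule.mem_sInf] at hv ⊢
  exact fun N hN => hN.2.1 n v (hv N hN)

theorem borelSpan_stable_h : StableUnder h (borelSpan e h X) := fun n v hv => by
  rw [borelSpan, Submodule.mem_sInf] at hv ⊢
  exact fun N hN => hN.2.2 n v (hv N hN)

/-- The coefficients of the inverse of the power series `lam + ∑_{i > 0} e(-i) z^i`. -/
def invCoeff (e : ℤ → Module.End ℂ V) (lam : ℂ) : ℕ → Module.End ℂ V
  | j => lam⁻¹ • ((if j = 0 then 1 else 0) -
      ∑ i : Fin j, e (-((j : ℤ) - i)) * invCoeff e lam i)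

/-- `e(q) - lam δ_{q,0}` for `q ≥ 0`, and zero for `q < 0`. -/
def ePos (e : ℤ → Module.End ℂ V) (lam : ℂ) (q : ℤ) : Module.End ℂ V :=
  if 0 ≤ q then e q - (if q = 0 then lam • 1 else 0) else 0

theorem invCoeff_mem (hN : StableUnder e N) (j : ℕ) : ∀ u ∈ N, invCoeff e lam j u ∈ N := by
  induction j using Nat.strong_induction_on with
  | _ j ih =>
    intro u hu
    rw [invCoeff]
    simp only [LinearMap.smul_apply, LinearMap.sub_apply, LinearMap.sum_apply,
      Module.End.mul_apply]
    refine N.smul_mem _ (N.sub_mem ?_ (N.sum_mem fun i _ => hN _ _ (ih i i.2 u hu)))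
    split_ifs
    · exact hu
    · exact N.zero_mem

theorem ePos_mem (hN : StableUnder e N) (q : ℤ) : ∀ u ∈ N, ePos e lam q u ∈ N := fun u hu => by
  unfold ePos
  split_ifs
  · exact N.sub_mem (hN _ _ hu) (N.smul_mem _ hu)
  · simpa using hN _ _ hu
  · exact N.zero_mem

/-- The recursion for `invCoeff`, read as a Cauchy product with the series whose constant
coefficient is lam and whose other coefficients are the e(-i). -/
theorem invCoeff_conv (hlam : lam ≠ 0) (n : ℕ) :
    ∑ j ∈ Finset.range (n + 1), (if j = n then lam • 1 else e (-((n : ℤ) - j))) *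
      invCoeff e lam j = if n = 0 then 1 else 0 := by
  rw [Finset.sum_range_succ, if_pos rfl, invCoeff, smul_mul_smul_comm, mul_inv_cancel₀ hlam,
    one_smul, one_mul, Finset.sum_fin_eq_sum_range, ← add_sub_assoc, add_comm, add_sub_assoc,
    ← Finset.sum_sub_distrib, Finset.sum_eq_zero, add_zero]
  intro j hj
  have hj' := Finset.mem_range.mp hj
  rw [if_neg hj'.ne, dif_pos hj', sub_self]

theorem locFin_invCoeff_mul {F : ℕ → Module.End ℂ V} (hF : LocFin F) :
    LocFin fun j => invCoeff e lam j * F j := fun v =>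
  (hF v).subset fun j hj => by
    simp only [Function.mem_support, Module.End.mul_apply] at hj ⊢
    exact fun h => hj (by rw [h, map_zero])

/-- The span of the vectors `e(-n₁) ⋯ e(-nₖ) x` with `nᵢ > 0` and `x ∈ X`. -/
def eSpan (e : ℤ → Module.End ℂ V) (X : Submodule ℂ V) : Submodule ℂ V :=
  ⨆ k, filt (fun n : ℕ => e (-((n : ℤ) + 1))) X k

/-- The operators that act on the span of the `e(-n₁) ⋯ e(-nₖ) x` like `∂/∂e(-i-1)`. -/
def eDer (e h : ℤ → Module.End ℂ V) (lam : ℂ) (i : ℕ) : Module.End ℂ V :=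
  (1 / 2 : ℂ) • locSum fun j : ℕ => invCoeff e lam j * h ((i : ℤ) + 1 + j)

namespace BorelCurrents

variable (B : BorelCurrents e h)
include B

theorem eh (m n : ℤ) : e m * h n = h n * e m - (2 : ℂ) • e (m + n) := by
  rw [B.he n m, add_comm n m]; abel

theorem invCoeff_comm (j : ℕ) (n : ℤ) : invCoeff e lam j * e n = e n * invCoeff e lam j := by
  induction j using Nat.strong_induction_on with
  | _ j ih =>
    rw [invCoeff, smul_mul_assoc, mul_smul_comm, sub_mul, mul_sub, Finset.sum_mul, Finset.mul_sum]
    congr 2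
    · split_ifs <;> simp
    · refine Finset.sum_congr rfl fun i _ => ?_
      rw [mul_assoc, ih i i.2, ← mul_assoc, B.ee, mul_assoc]

theorem locFin_e_add (p : ℤ) : LocFin fun j : ℕ => e (p + j) := fun v => by
  obtain ⟨N, hN⟩ := B.loc_e v
  refine (Set.finite_lt_nat (N - p).toNat).subset fun j hj => ?_
  by_contra hc
  exact hj (hN _ (by simp only [Set.mem_ofPred_eq] at hc; omega))

theorem locFin_h_add (p : ℤ) : LocFin fun j : ℕ => h (p + j) := fun v => by
  obtain ⟨N, hN⟩ := B.loc_h v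
  refine (Set.finite_lt_nat (N - p).toNat).subset fun j hj => ?_
  by_contra hc
  exact hj (hN _ (by simp only [Set.mem_ofPred_eq] at hc; omega))

theorem locFin_ePos_add (p : ℤ) : LocFin fun j : ℕ => ePos e lam (p + j) := fun v => by
  obtain ⟨N, hN⟩ := B.loc_e v
  refine (Set.finite_lt_nat (max (N - p) (1 - p)).toNat).subset fun j hj => ?_
  by_contra hc
  simp only [Set.mem_ofPred_eq] at hc
  refine hj ?_
  have h1 : p + j ≠ 0 := by omega
  unfold ePos
  simp only [h1, if_false, sub_zero]
  split_ifs
  · exact hN _ (by omega)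
  · rfl

/-- The product of `e(z)` with the inverse of its part of nonpositive modes. -/
theorem locSum_invCoeff_mul_e (hlam : lam ≠ 0) (p : ℤ) :
    locSum (fun j : ℕ => invCoeff e lam j * e (p + j)) =
      (if p = 0 then 1 else 0) + locSum fun j : ℕ => invCoeff e lam j * ePos e lam (p + j) := by
  have h1 := locFin_invCoeff_mul (e := e) (lam := lam) (B.locFin_e_add p)
  have h2 := locFin_invCoeff_mul (e := e) (lam := lam) (B.locFin_ePos_add (lam := lam) p)
  rw [← sub_eq_iff_eq_add, ← locSum_sub h1 h2]
  -- What `ePos` removes from e(z) are the modes q ≤ 0 with e(0) replaced by lam, that is, the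
  -- coefficients of the inverted series. Only j ≤ -p contributes, and the sum is the finite
  -- convolution of `invCoeff_conv`.
  have h3 : ∀ j : ℕ, invCoeff e lam j * e (p + j) - invCoeff e lam j * ePos e lam (p + j) =
      if p + j ≤ 0 then (if p + j = 0 then lam • 1 else e (p + j)) * invCoeff e lam j else 0 := by
    intro j
    rw [← mul_sub]
    unfold ePos
    rcases lt_trichotomy (p + j) 0 with hp | hp | hp
    · rw [if_neg (by omega), if_pos hp.le, if_neg hp.ne, sub_zero, B.invCoeff_comm]
    · simp [hp]
    · rw [if_pos hp.le, if_neg hp.ne', if_neg (by omega), sub_zero, sub_self, mul_zero]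
  have h4 := h1.sub h2
  simp only [h3] at h4 ⊢
  ext v
  rw [locSum_apply h4]
  rcases lt_or_ge 0 p with hp | hp
  · have : ∀ j : ℕ, ¬ (p + j ≤ 0) := fun j => by omega
    simp [this, hp.ne']
  · obtain ⟨n, rfl⟩ : ∃ n : ℕ, p = -n := ⟨(-p).toNat, by omega⟩
    rw [finsum_eq_finsetSum_of_support_subset (s := Finset.range (n + 1))]
    · have := LinearMap.congr_fun (invCoeff_conv (e := e) hlam n) v
      rw [LinearMap.sum_apply] at this
      have h5 : (if -(n : ℤ) = 0 then (1 : Module.End ℂ V) else 0) = if n = 0 then 1 else 0 := by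
        simp
      rw [h5, ← this]
      refine Finset.sum_congr rfl fun j hj => ?_
      have hj' := Finset.mem_range.mp hj
      rw [if_pos (by omega)]
      congr 2
      by_cases hjn : j = n
      · subst hjn; simp
      · rw [if_neg (by omega), if_neg hjn]
        congr 1; ring
    · intro j hj
      simp only [Function.mem_support] at hj
      by_contra hc
      simp only [Finset.coe_range, Set.mem_Iio] at hc
      exact hj (by rw [if_neg (by omega)]; rfl)

/-! #### The subspace generated by the `e(-n)` -/

theorem ePos_eSpan (hX : X ≤ whittakerVectors e h lam) (q : ℤ) :
    ∀ u ∈ eSpan e X, ePos e lam q u = 0 := by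
  suffices H : ∀ k, filt (fun n : ℕ => e (-((n : ℤ) + 1))) X k ≤ LinearMap.ker (ePos e lam q) by
    intro u hu
    obtain ⟨k, hk⟩ := mem_iSup_filt.mp hu
    exact H k hk
  refine filt_le (fun x hx => ?_) fun i u hu => ?_
  · have hx' := hX hx
    rw [LinearMap.mem_ker]
    unfold ePos
    split_ifs with h1 h2
    · subst h2; simp [hx'.1]
    · simpa using (hx'.2 q (by omega)).1
    · rfl
  · have hc : ePos e lam q * e (-((i : ℤ) + 1)) = e (-((i : ℤ) + 1)) * ePos e lam q := by
      unfold ePos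
      split_ifs
      · rw [sub_mul, mul_sub, B.ee]; simp
      · simp [B.ee]
      · simp
    rw [LinearMap.mem_ker] at hu ⊢
    have := LinearMap.congr_fun hc u
    simpa [hu] using this

/-- Negative modes lengthen the word. The others act by scalars, lam for e(0) and 0 for e(q) with q
> 0, since `ePos` kills the whole span. -/
theorem eSpan_stable_e (hX : X ≤ whittakerVectors e h lam) : StableUnder e (eSpan e X) := by
  intro q u hu
  rcases lt_or_ge q 0 with hq | hq
  · obtain ⟨k, hk⟩ := mem_iSup_filt.mp hu
    refine mem_iSup_filt.mpr ⟨k + 1, ?_⟩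
    have := apply_mem_filt (S := fun n : ℕ => e (-((n : ℤ) + 1))) (-q - 1).toNat hk
    rwa [show -(((-q - 1).toNat : ℤ) + 1) = q by omega] at this
  · have h1 := B.ePos_eSpan hX q u hu
    unfold ePos at h1
    rw [if_pos hq] at h1
    split_ifs at h1
    · rw [LinearMap.sub_apply, sub_eq_zero] at h1
      rw [h1]; exact Submodule.smul_mem _ _ hu
    · rw [sub_zero] at h1
      rw [h1]; exact Submodule.zero_mem _

theorem locFin_eDer_aux (i : ℕ) :
    LocFin fun j : ℕ => invCoeff e lam j * h ((i : ℤ) + 1 + j) :=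
  locFin_invCoeff_mul (B.locFin_h_add _)

/-- Half the commutator of h(i+1+j) with e(-l-1) is e(i-l+j). So the left side is a coefficient of
the inverse series times e(z), which is δ plus terms that end in `ePos`. -/
theorem eDer_comm (hlam : lam ≠ 0) (i l : ℕ) :
    eDer e h lam i * e (-((l : ℤ) + 1)) - e (-((l : ℤ) + 1)) * eDer e h lam i =
      (if i = l then 1 else 0) + locSum fun j : ℕ => invCoeff e lam j * ePos e lam (i - l + j) := by
  have h1 := B.locFin_eDer_aux (lam := lam) i
  have h5 : (if (i : ℤ) - l = 0 then (1 : Module.End ℂ V) else 0) = if i = l then 1 else 0 := by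
    simp [sub_eq_zero]
  have h2 := B.locSum_invCoeff_mul_e hlam ((i : ℤ) - l)
  rw [h5] at h2
  rw [← h2, eDer, smul_mul_assoc, mul_smul_comm, ← smul_sub, locSum_mul_right h1,
    locSum_mul_left h1, ← locSum_sub (h1.mul_right _) (h1.mul_left _),
    ← locSum_smul ((h1.mul_right _).sub (h1.mul_left _))]
  congr 1
  funext j
  rw [mul_assoc, B.he, ← mul_assoc (e _), ← B.invCoeff_comm, mul_assoc, ← mul_sub,
    add_sub_cancel_left, mul_smul_comm, smul_smul,
    show (i : ℤ) + 1 + j + -((l : ℤ) + 1) = i - l + j by ring]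
  norm_num

theorem locFin_eDer : LocFin (eDer e h lam) := fun v => by
  obtain ⟨N, hN⟩ := B.loc_h v
  refine (Set.finite_lt_nat N.toNat).subset fun i hi => ?_
  by_contra hc
  simp only [Set.mem_ofPred_eq, not_lt] at hc
  refine hi ?_
  change eDer e h lam i v = 0
  rw [eDer, LinearMap.smul_apply, locSum_apply (B.locFin_eDer_aux i)]
  have : ∀ j : ℕ, (invCoeff e lam j * h ((i : ℤ) + 1 + j)) v = 0 := fun j => by
    rw [Module.End.mul_apply, hN _ (by omega), map_zero]
  simp [this]

theorem eDer_mem (hN : StableUnder e N) (hN' : StableUnder h N) (i : ℕ) :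
    ∀ u ∈ N, eDer e h lam i u ∈ N := fun _ hu =>
  N.smul_mem _ ((B.locFin_eDer_aux i).mem_of fun _ => invCoeff_mem hN _ _ (hN' _ _ hu))

theorem eDer_whittaker (hX : X ≤ whittakerVectors e h lam) (i : ℕ) :
    ∀ x ∈ X, eDer e h lam i x = 0 := fun x hx => by
  rw [eDer, LinearMap.smul_apply, locSum_apply (B.locFin_eDer_aux i)]
  have : ∀ j : ℕ, (invCoeff e lam j * h ((i : ℤ) + 1 + j)) x = 0 := fun j => by
    rw [Module.End.mul_apply, ((hX hx).2 _ (by omega)).2, map_zero]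
  simp [this]

/-- On the span of the words in the e(-n) the terms ending in `ePos` vanish, so `eDer` satisfies the
derivation rule exactly there, not merely up to lower order. -/
theorem eDer_filt (hlam : lam ≠ 0) (hX : X ≤ whittakerVectors e h lam) (k : ℕ) :
    ∀ u ∈ filt (fun n : ℕ => e (-((n : ℤ) + 1))) X k, ∀ i l : ℕ,
      eDer e h lam i (e (-((l : ℤ) + 1)) u) - e (-((l : ℤ) + 1)) (eDer e h lam i u) -
        (if i = l then u else 0) ∈ filt (fun n : ℕ => e (-((n : ℤ) + 1))) X (k - 1) := by
  intro u hu i l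
  have h1 := LinearMap.congr_fun (B.eDer_comm hlam i l) u
  have h2 : locSum (fun j : ℕ => invCoeff e lam j * ePos e lam (i - l + j)) u = 0 := by
    rw [locSum_apply (locFin_invCoeff_mul (B.locFin_ePos_add _))]
    have : ∀ j : ℕ, (invCoeff e lam j * ePos e lam (i - l + j)) u = 0 := fun j => by
      rw [Module.End.mul_apply, B.ePos_eSpan hX _ u (mem_iSup_filt.mpr ⟨k, hu⟩), map_zero]
    simp [this]
  rw [LinearMap.add_apply, h2, add_zero] at h1
  simp only [LinearMap.sub_apply, Module.End.mul_apply] at h1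
  rw [h1]
  split_ifs <;> simp

/-- The operators `eDer` are combinations of terms `invCoeff` times h(i) with i > 0. So vanishing of
these h(i) gives vanishing of all derivatives. -/
theorem eSpan_kernel (hlam : lam ≠ 0) (hX : X ≤ whittakerVectors e h lam) {u : V}
    (hu : u ∈ eSpan e X) (hh : ∀ i > 0, h i u = 0) : u ∈ X := by
  obtain ⟨k, hk⟩ := mem_iSup_filt.mp hu
  refine filt_kernel (B.eDer_whittaker hX) (fun i j => B.ee _ _) B.locFin_eDer
    (B.eDer_filt hlam hX) hk fun i => ?_
  rw [eDer, LinearMap.smul_apply, locSum_apply (B.locFin_eDer_aux i)]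
  have : ∀ j : ℕ, (invCoeff e lam j * h ((i : ℤ) + 1 + j)) u = 0 := fun j => by
    rw [Module.End.mul_apply, hh _ (by omega), map_zero]
  simp [this]

theorem eSpan_meets (hlam : lam ≠ 0) (hX : X ≤ whittakerVectors e h lam)
    (hN : StableUnder e N) (hN' : StableUnder h N) {u : V}
    (hu : u ∈ eSpan e X) (huN : u ∈ N) (hu0 : u ≠ 0) : ∃ x ∈ X, x ∈ N ∧ x ≠ 0 := by
  obtain ⟨k, hk⟩ := mem_iSup_filt.mp hu
  exact filt_meets (B.eDer_whittaker hX) (fun i j => B.ee _ _) B.locFin_eDer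
    (B.eDer_filt hlam hX) (B.eDer_mem hN hN') hk huN hu0

theorem eSpan_stable_h (hX : X ≤ whittakerVectors e h lam) (q : ℤ) (hq : 0 < q) :
    ∀ u ∈ eSpan e X, h q u ∈ eSpan e X := by
  suffices H : ∀ k, filt (fun n : ℕ => e (-((n : ℤ) + 1))) X k ≤
      (eSpan e X) ⊓ (eSpan e X).comap (h q) by
    intro u hu
    obtain ⟨k, hk⟩ := mem_iSup_filt.mp hu
    exact (H k hk).2
  refine filt_le (fun x hx => ⟨mem_iSup_filt.mpr ⟨1, by rwa [filt_one]⟩, ?_⟩) fun i u hu => ?_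
  · rw [Submodule.comap_coe, Set.mem_preimage, ((hX hx).2 q hq).2]; exact Submodule.zero_mem _
  · refine ⟨B.eSpan_stable_e hX _ _ hu.1, ?_⟩
    have h1 := LinearMap.congr_fun (B.he q (-((i : ℤ) + 1))) u
    simp only [Module.End.mul_apply, LinearMap.add_apply, LinearMap.smul_apply] at h1
    change h q (e (-((i : ℤ) + 1)) u) ∈ eSpan e X
    rw [h1]
    exact Submodule.add_mem _ (B.eSpan_stable_e hX _ _ hu.2)
      (Submodule.smul_mem _ _ (B.eSpan_stable_e hX _ _ hu.1))

end BorelCurrents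

end BorelCurrents

end

end WhittakerSl2

namespace WhittakerSl2

noncomputable section

/-! ### Derivatives with respect to the h(-n), and the rigidity of modules generated by Whittaker
vectors -/

section BorelCurrents

variable {V : Type*} [AddCommGroup V] [Module ℂ V]
  {e h : ℤ → Module.End ℂ V} {lam : ℂ} {X N : Submodule ℂ V}

/-- The operators that act on the products `h(-n₁) ⋯ h(-nₖ) y` with `y` in the span of the
`e(-n₁) ⋯ e(-nₖ) x` like `∂/∂h(-n)` up to lower order. -/
def hDer (e : ℤ → Module.End ℂ V) (lam : ℂ) (n : ℕ) : Module.End ℂ V :=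
  (-1 / 2 : ℂ) • locSum fun j : ℕ => invCoeff e lam j * ePos e lam (n + j)

/-- The subspace spanned by the products of fewer than `k` operators `h(-n)`, applied to the span of
the `e(-n₁) ⋯ e(-nₖ) x`. -/
def hFilt (e h : ℤ → Module.End ℂ V) (X : Submodule ℂ V) (k : ℕ) : Submodule ℂ V :=
  filt (fun n : ℕ => h (-(n : ℤ))) (eSpan e X) k

namespace BorelCurrents

variable (B : BorelCurrents e h)
include B

/-- Moving e(q) to the right past a factor h(-l) costs a term in which this h has become a mode of
e, so the number of factors h never grows. -/
theorem hFilt_stable_e (hX : X ≤ whittakerVectors e h lam) (k : ℕ) :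
    StableUnder e (hFilt e h X k) := by
  suffices H : ∀ k, hFilt e h X k ≤ ⨅ q, (hFilt e h X k).comap (e q) from
    fun q u hu => Submodule.mem_iInf _ |>.mp (H k hu) q
  intro k
  induction k with
  | zero => exact bot_le
  | succ k ih =>
    refine filt_succ_le (fun y hy => ?_) fun l u hu => ?_
    · exact (Submodule.mem_iInf _).mpr fun q => le_filt_succ k (B.eSpan_stable_e hX q y hy)
    · refine (Submodule.mem_iInf _).mpr fun q => ?_
      have hu' := Submodule.mem_iInf _ |>.mp (ih hu) q
      have := LinearMap.congr_fun (B.eh q (-(l : ℤ))) u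
      simp only [Module.End.mul_apply, LinearMap.sub_apply, LinearMap.smul_apply] at this
      rw [Submodule.mem_comap, this]
      exact Submodule.sub_mem _ (apply_mem_filt (S := fun n : ℕ => h (-(n : ℤ))) l hu')
        (Submodule.smul_mem _ _
          (filt_le_succ k (Submodule.mem_iInf _ |>.mp (ih hu) _)))

theorem ePos_h (q : ℤ) (l : ℤ) :
    ePos e lam q * h l = h l * ePos e lam q - if 0 ≤ q then (2 : ℂ) • e (q + l) else 0 := by
  unfold ePos
  split_ifs
  · rw [sub_mul, mul_sub, B.eh]; simp; abel
  · rw [sub_zero, B.eh]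
  · simp

/-- `ePos` kills the bottom step. Its commutator with a factor h trades this factor for a mode of e,
so each application uses up one h. -/
theorem ePos_hFilt (hX : X ≤ whittakerVectors e h lam) (k : ℕ) (q : ℤ) :
    ∀ u ∈ hFilt e h X (k + 1), ePos e lam q u ∈ hFilt e h X k := by
  induction k with
  | zero =>
    intro u hu
    rw [hFilt, filt_one] at hu
    rw [B.ePos_eSpan hX q u hu]; exact Submodule.zero_mem _
  | succ k ih =>
    refine filt_succ_le (N := (hFilt e h X (k + 1)).comap (ePos e lam q))
      (fun y hy => ?_) fun l u hu => ?_
    · rw [Submodule.mem_comap, B.ePos_eSpan hX q y hy]; exact Submodule.zero_mem _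
    · have := LinearMap.congr_fun (B.ePos_h (lam := lam) q (-(l : ℤ))) u
      simp only [Module.End.mul_apply, LinearMap.sub_apply] at this
      rw [Submodule.mem_comap, this]
      refine Submodule.sub_mem _
        (apply_mem_filt (S := fun n : ℕ => h (-(n : ℤ))) l (ih u hu)) ?_
      split_ifs
      · exact Submodule.smul_mem _ _ (B.hFilt_stable_e hX (k + 1) _ u hu)
      · exact Submodule.zero_mem _

/-- The commutator of h(l) with a coefficient of the inverse series is again a polynomial in the
e(n): by the recursion it only involves modes of e and earlier commutators. -/
theorem invCoeff_h_mem (hN : StableUnder e N) (l : ℤ) (j : ℕ) :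
    ∀ u ∈ N, (invCoeff e lam j * h l - h l * invCoeff e lam j) u ∈ N := by
  induction j using Nat.strong_induction_on with
  | _ j ih =>
    intro u hu
    have h1 : invCoeff e lam j * h l - h l * invCoeff e lam j =
        lam⁻¹ • -∑ i : Fin j, (e (-((j : ℤ) - i)) *
          (invCoeff e lam i * h l - h l * invCoeff e lam i) -
          (2 : ℂ) • (e (-((j : ℤ) - i) + l) * invCoeff e lam i)) := by
      rw [invCoeff, smul_mul_assoc, mul_smul_comm, ← smul_sub, sub_mul, mul_sub, Finset.sum_mul,
        Finset.mul_sum]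
      have h2 : (if j = 0 then (1 : Module.End ℂ V) else 0) * h l =
        h l * if j = 0 then 1 else 0 := by split_ifs <;> simp
      rw [h2, sub_sub_sub_cancel_left, ← Finset.sum_sub_distrib, ← Finset.sum_neg_distrib]
      congr 1
      refine Finset.sum_congr rfl fun i _ => ?_
      have h3 := congrArg (· * invCoeff e lam i) (B.eh (-((j : ℤ) - i)) l)
      simp only [sub_mul, smul_mul_assoc] at h3
      rw [mul_sub, ← mul_assoc (e _) (h l), h3]
      noncomm_ring
    rw [h1]
    simp only [LinearMap.smul_apply, LinearMap.neg_apply, LinearMap.sum_apply]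
    refine N.smul_mem _ (N.neg_mem (N.sum_mem fun i _ => N.sub_mem ?_ (N.smul_mem _ ?_)))
    · exact hN _ _ (ih i i.2 u hu)
    · exact hN _ _ (invCoeff_mem hN _ _ hu)

theorem locFin_hDer_aux (i : ℤ) :
    LocFin fun j : ℕ => invCoeff e lam j * ePos e lam (i + j) :=
  locFin_invCoeff_mul (B.locFin_ePos_add _)

/-- The commutator of `ePos` (i+j) with h(-l) is -2e(i-l+j), as i + j ≥ 0. With the factor -1/2 this
gives a coefficient of the inverse series times e(z), hence δ. All other terms end in `ePos`,
including those from the commutators of `invCoeff` with h(-l). -/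
theorem hDer_comm (hlam : lam ≠ 0) (i l : ℕ) :
    hDer e lam i * h (-(l : ℤ)) - h (-(l : ℤ)) * hDer e lam i =
      (if i = l then 1 else 0) +
      ((locSum fun j : ℕ => invCoeff e lam j * ePos e lam (i - l + j)) +
      (-1 / 2 : ℂ) • locSum fun j : ℕ =>
        (invCoeff e lam j * h (-(l : ℤ)) - h (-(l : ℤ)) * invCoeff e lam j) *
          ePos e lam (i + j)) := by
  have h1 := B.locFin_hDer_aux (lam := lam) i
  have h5 : (if (i : ℤ) - l = 0 then (1 : Module.End ℂ V) else 0) = if i = l then 1 else 0 := by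
    simp [sub_eq_zero]
  have h2 := B.locSum_invCoeff_mul_e hlam ((i : ℤ) - l)
  have h3 : LocFin fun j : ℕ =>
      (invCoeff e lam j * h (-(l : ℤ)) - h (-(l : ℤ)) * invCoeff e lam j) *
          ePos e lam (i + j) := fun v =>
    (B.locFin_ePos_add (lam := lam) i v).subset fun j hj => by
      simp only [Function.mem_support, Module.End.mul_apply] at hj ⊢
      exact fun h => hj (by rw [h, map_zero])
  have h4 : LocFin fun j : ℕ => invCoeff e lam j * e ((i : ℤ) - l + j) :=
    locFin_invCoeff_mul (B.locFin_e_add _)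
  rw [h5] at h2
  rw [← add_assoc, ← h2, hDer, smul_mul_assoc, mul_smul_comm, ← smul_sub, locSum_mul_right h1,
    locSum_mul_left h1, ← locSum_sub (h1.mul_right _) (h1.mul_left _),
    ← locSum_smul ((h1.mul_right _).sub (h1.mul_left _)), ← locSum_smul h3,
    ← locSum_add h4 (h3.smul fun _ => _)]
  congr 1
  funext j
  rw [mul_assoc, B.ePos_h, if_pos (by positivity), mul_sub, mul_smul_comm,
    show (i : ℤ) + j + -(l : ℤ) = i - l + j by ring, sub_mul, smul_sub, smul_sub, smul_smul,
    smul_sub, ← mul_assoc, ← mul_assoc]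
  norm_num
  abel

theorem locFin_hDer : LocFin (hDer e lam) := fun v => by
  obtain ⟨N, hN⟩ := B.loc_e v
  refine (Set.finite_lt_nat (max N 1).toNat).subset fun i hi => ?_
  by_contra hc
  simp only [Set.mem_ofPred_eq, not_lt] at hc
  refine hi ?_
  change hDer e lam i v = 0
  rw [hDer, LinearMap.smul_apply, locSum_apply (B.locFin_hDer_aux i)]
  have : ∀ j : ℕ, (invCoeff e lam j * ePos e lam ((i : ℤ) + j)) v = 0 := fun j => by
    have h0 : (i : ℤ) + j ≠ 0 := by omega
    rw [Module.End.mul_apply, ePos, if_pos (by omega), if_neg h0, sub_zero, hN _ (by omega),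
      map_zero]
  simp [this]

theorem hDer_mem (hN : StableUnder e N) (i : ℕ) : ∀ u ∈ N, hDer e lam i u ∈ N := fun _ hu =>
  N.smul_mem _ ((B.locFin_hDer_aux i).mem_of fun _ => invCoeff_mem hN _ _ (ePos_mem hN _ _ hu))

theorem hDer_eSpan (hX : X ≤ whittakerVectors e h lam) (i : ℕ) :
    ∀ y ∈ eSpan e X, hDer e lam i y = 0 := fun y hy => by
  rw [hDer, LinearMap.smul_apply, locSum_apply (B.locFin_hDer_aux i)]
  simp [B.ePos_eSpan hX _ y hy]

/-- The error terms in `hDer_comm` end in `ePos`, which lowers the number of factors h by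
`ePos_hFilt`. What stands to the left of it preserves subspaces stable under the e(n). -/
theorem hDer_hFilt (hlam : lam ≠ 0) (hX : X ≤ whittakerVectors e h lam) (k : ℕ) :
    ∀ u ∈ filt (fun n : ℕ => h (-(n : ℤ))) (eSpan e X) k, ∀ i l : ℕ,
      hDer e lam i (h (-(l : ℤ)) u) - h (-(l : ℤ)) (hDer e lam i u) -
        (if i = l then u else 0) ∈ filt (fun n : ℕ => h (-(n : ℤ))) (eSpan e X) (k - 1) := by
  intro u hu i l
  have h1 := LinearMap.congr_fun (B.hDer_comm hlam i l) u
  have h0 : (if i = l then (1 : Module.End ℂ V) else 0) u = if i = l then u else 0 := by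
    split_ifs <;> rfl
  simp only [LinearMap.sub_apply, Module.End.mul_apply, LinearMap.add_apply,
    LinearMap.smul_apply, h0] at h1
  rw [h1, add_sub_cancel_left]
  rcases k with _ | k
  · rw [show u = 0 from hu]
    simp
  have hp : ∀ q, ePos e lam q u ∈ hFilt e h X k := fun q => B.ePos_hFilt hX k q u hu
  have hs := B.hFilt_stable_e hX k
  have h3 : LocFin fun j : ℕ =>
      (invCoeff e lam j * h (-(l : ℤ)) - h (-(l : ℤ)) * invCoeff e lam j) *
          ePos e lam (i + j) := fun v =>
    (B.locFin_ePos_add (lam := lam) i v).subset fun j hj => by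
      simp only [Function.mem_support, Module.End.mul_apply] at hj ⊢
      exact fun h => hj (by rw [h, map_zero])
  refine Submodule.add_mem _ ((B.locFin_hDer_aux _).mem_of fun j => ?_)
    (Submodule.smul_mem _ _ (h3.mem_of fun j => ?_))
  · exact invCoeff_mem hs _ _ (hp _)
  · exact B.invCoeff_h_mem hs _ _ _ (hp _)

/-- A central term requires i + j = 0, hence i = j = 0, and there its coefficient -4 · 0 vanishes.
-/
theorem h_comm_nonpos (i j : ℕ) : h (-(i : ℤ)) * h (-(j : ℤ)) = h (-(j : ℤ)) * h (-(i : ℤ)) := by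
  rw [B.hh]
  split_ifs with hij
  · have : i = 0 := by omega
    simp [this]
  · simp

/-- The space generated by `X` is exhausted by the filtration. -/
theorem borelSpan_le_iSup (hX : X ≤ whittakerVectors e h lam) :
    borelSpan e h X ≤ ⨆ k, filt (fun n : ℕ => h (-(n : ℤ))) (eSpan e X) k := by
  refine borelSpan_le (fun x hx => ?_) (fun q u hu => ?_) fun q => ?_
  · refine mem_iSup_filt.mpr ⟨1, ?_⟩
    rw [filt_one]
    exact mem_iSup_filt.mpr ⟨1, by rwa [filt_one]⟩
  · obtain ⟨k, hk⟩ := mem_iSup_filt.mp hu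
    exact mem_iSup_filt.mpr ⟨k, B.hFilt_stable_e hX k q u hk⟩
  · rcases le_or_gt q 0 with hq | hq
    · intro u hu
      obtain ⟨k, hk⟩ := mem_iSup_filt.mp hu
      refine mem_iSup_filt.mpr ⟨k + 1, ?_⟩
      have := apply_mem_filt (S := fun n : ℕ => h (-(n : ℤ))) (-q).toNat hk
      rwa [show -((-q).toNat : ℤ) = q by omega] at this
    · suffices H : ∀ k, filt (fun n : ℕ => h (-(n : ℤ))) (eSpan e X) k ≤
          (⨆ k, filt (fun n : ℕ => h (-(n : ℤ))) (eSpan e X) k) ⊓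
          (⨆ k, filt (fun n : ℕ => h (-(n : ℤ))) (eSpan e X) k).comap (h q) by
        intro u hu
        obtain ⟨k, hk⟩ := mem_iSup_filt.mp hu
        exact (H k hk).2
      have hS : ∀ (l : ℕ) (u : V), u ∈ (⨆ k, filt (fun n : ℕ => h (-(n : ℤ))) (eSpan e X) k) →
          h (-(l : ℤ)) u ∈ ⨆ k, filt (fun n : ℕ => h (-(n : ℤ))) (eSpan e X) k := by
        intro l u hu
        obtain ⟨k, hk⟩ := mem_iSup_filt.mp hu
        exact mem_iSup_filt.mpr
          ⟨k + 1, apply_mem_filt (S := fun n : ℕ => h (-(n : ℤ))) l hk⟩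
      refine filt_le (fun y hy => ⟨?_, ?_⟩) fun l u hu => ⟨hS l u hu.1, ?_⟩
      · exact mem_iSup_filt.mpr ⟨1, by rwa [filt_one]⟩
      · exact mem_iSup_filt.mpr ⟨1, by rw [filt_one]; exact B.eSpan_stable_h hX q hq y hy⟩
      · have h1 := LinearMap.congr_fun (B.hh q (-(l : ℤ))) u
        simp only [Module.End.mul_apply, LinearMap.add_apply, LinearMap.smul_apply] at h1
        change h q (h (-(l : ℤ)) u) ∈ (⨆ k, filt (fun n : ℕ => h (-(n : ℤ))) (eSpan e X) k)
        rw [h1]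
        exact Submodule.add_mem _ (hS l _ hu.2) (Submodule.smul_mem _ _ hu.1)

/-- Every nonzero submodule of the module generated by a space `X` of Whittaker vectors meets
`X`. -/
theorem exists_mem_of_mem_borelSpan (hlam : lam ≠ 0) (hX : X ≤ whittakerVectors e h lam)
    (hN : StableUnder e N) (hN' : StableUnder h N) {u : V} (hu : u ∈ borelSpan e h X)
    (huN : u ∈ N) (hu0 : u ≠ 0) : ∃ x ∈ X, x ∈ N ∧ x ≠ 0 := by
  obtain ⟨k, hk⟩ := mem_iSup_filt.mp (B.borelSpan_le_iSup hX hu)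
  -- The factors h are stripped off by `hDer`, which leads into the span of the words in the e(-n).
  -- The factors e are then stripped off by `eDer`.
  obtain ⟨y, hy, hyN, hy0⟩ := filt_meets (B.hDer_eSpan hX) (fun i j => B.h_comm_nonpos _ _)
    B.locFin_hDer (B.hDer_hFilt hlam hX) (B.hDer_mem hN) hk huN hu0
  exact B.eSpan_meets hlam hX hN hN' hy hyN hy0

/-- The Whittaker vectors of the module generated by a space `X` of Whittaker vectors are the
elements of `X`. -/
theorem mem_of_mem_borelSpan (hlam : lam ≠ 0) (hX : X ≤ whittakerVectors e h lam) {u : V}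
    (hu : u ∈ borelSpan e h X) (hu' : u ∈ whittakerVectors e h lam) : u ∈ X := by
  obtain ⟨k, hk⟩ := mem_iSup_filt.mp (B.borelSpan_le_iSup hX hu)
  refine B.eSpan_kernel hlam hX ?_ fun i hi => (hu'.2 i hi).2
  refine filt_kernel (B.hDer_eSpan hX) (fun i j => B.h_comm_nonpos _ _)
    B.locFin_hDer (B.hDer_hFilt hlam hX) hk fun i => ?_
  rw [hDer, LinearMap.smul_apply, locSum_apply (B.locFin_hDer_aux i)]
  -- A Whittaker vector is killed by all `ePos`, so by all `hDer`, and therefore contains no factor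
  -- h.
  have h1 : ∀ q, ePos e lam q u = 0 := fun q => by
    unfold ePos
    split_ifs with h1 h2
    · subst h2; simp [hu'.1]
    · simpa using (hu'.2 q (by omega)).1
    · rfl
  simp [h1]

end BorelCurrents

/-! ### Two modules generated by the same space of Whittaker vectors are isomorphic -/

variable {V' X₀ : Type*} [AddCommGroup V'] [Module ℂ V'] [AddCommGroup X₀] [Module ℂ X₀]
  {e' h' : ℤ → Module.End ℂ V'}

theorem BorelCurrents.prod (B : BorelCurrents e h) (B' : BorelCurrents e' h') :
    BorelCurrents (fun n => (e n).prodMap (e' n)) (fun n => (h n).prodMap (h' n)) where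
  ee m n := by
    refine LinearMap.ext fun v => Prod.ext ?_ ?_
    · exact LinearMap.congr_fun (B.ee m n) v.1
    · exact LinearMap.congr_fun (B'.ee m n) v.2
  he m n := by
    refine LinearMap.ext fun v => Prod.ext ?_ ?_
    · exact LinearMap.congr_fun (B.he m n) v.1
    · exact LinearMap.congr_fun (B'.he m n) v.2
  hh m n := by
    refine LinearMap.ext fun v => Prod.ext ?_ ?_
    · exact LinearMap.congr_fun (B.hh m n) v.1
    · exact LinearMap.congr_fun (B'.hh m n) v.2
  loc_e v := by
    obtain ⟨N, hN⟩ := B.loc_e v.1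
    obtain ⟨N', hN'⟩ := B'.loc_e v.2
    exact ⟨max N N', fun n hn => Prod.ext (hN n (le_trans (le_max_left _ _) hn))
      (hN' n (le_trans (le_max_right _ _) hn))⟩
  loc_h v := by
    obtain ⟨N, hN⟩ := B.loc_h v.1
    obtain ⟨N', hN'⟩ := B'.loc_h v.2
    exact ⟨max N N', fun n hn => Prod.ext (hN n (le_trans (le_max_left _ _) hn))
      (hN' n (le_trans (le_max_right _ _) hn))⟩

/-- Goursat's argument: let G be the submodule of V × V' generated by the pairs (i x, i' x). The
kernel of each projection of G is stable under both families. If it were nonzero it would contain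
some nonzero (i x, i' x), which the injectivity of i and i' excludes. So G is the graph of an
isomorphism. -/
theorem exists_equiv_of_borelSpan_eq_top (B : BorelCurrents e h) (B' : BorelCurrents e' h')
    (hlam : lam ≠ 0) (i : X₀ →ₗ[ℂ] V) (i' : X₀ →ₗ[ℂ] V') (hi : Function.Injective i)
    (hi' : Function.Injective i') (hX : LinearMap.range i ≤ whittakerVectors e h lam)
    (hX' : LinearMap.range i' ≤ whittakerVectors e' h' lam)
    (htop : borelSpan e h (LinearMap.range i) = ⊤)
    (htop' : borelSpan e' h' (LinearMap.range i') = ⊤) :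
    ∃ Θ : V ≃ₗ[ℂ] V', (∀ x, Θ (i x) = i' x) ∧ (∀ n v, Θ (e n v) = e' n (Θ v)) ∧
      ∀ n v, Θ (h n v) = h' n (Θ v) := by
  have P := B.prod B'
  let Δ : Submodule ℂ (V × V') := LinearMap.range (i.prod i')
  let G : Submodule ℂ (V × V') := borelSpan (fun n => (e n).prodMap (e' n))
    (fun n => (h n).prodMap (h' n)) Δ
  have hΔ : Δ ≤ whittakerVectors (fun n => (e n).prodMap (e' n))
      (fun n => (h n).prodMap (h' n)) lam := by
    rintro _ ⟨x, rfl⟩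
    have h1 := hX ⟨x, rfl⟩
    have h2 := hX' ⟨x, rfl⟩
    exact ⟨Prod.ext h1.1 h2.1, fun n hn =>
      ⟨Prod.ext (h1.2 n hn).1 (h2.2 n hn).1, Prod.ext (h1.2 n hn).2 (h2.2 n hn).2⟩⟩
  have hGe : StableUnder (fun n => (e n).prodMap (e' n)) G := borelSpan_stable_e
  have hGh : StableUnder (fun n => (h n).prodMap (h' n)) G := borelSpan_stable_h
  have hΔG : Δ ≤ G := le_borelSpan
  have inj1 : ∀ u ∈ G, u.1 = 0 → u = 0 := by
    intro u hu h0
    by_contra hne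
    obtain ⟨_, ⟨x, rfl⟩, hx, hx0⟩ := P.exists_mem_of_mem_borelSpan hlam hΔ
      (N := LinearMap.ker (LinearMap.fst ℂ V V'))
      (fun n v (hv : v.1 = 0) => by change e n v.1 = 0; rw [hv, map_zero])
      (fun n v (hv : v.1 = 0) => by change h n v.1 = 0; rw [hv, map_zero]) hu h0 hne
    have : x = 0 := hi (by rw [map_zero]; exact hx)
    exact hx0 (by rw [this, map_zero])
  have inj2 : ∀ u ∈ G, u.2 = 0 → u = 0 := by
    intro u hu h0
    by_contra hne
    obtain ⟨_, ⟨x, rfl⟩, hx, hx0⟩ := P.exists_mem_of_mem_borelSpan hlam hΔ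
      (N := LinearMap.ker (LinearMap.snd ℂ V V'))
      (fun n v (hv : v.2 = 0) => by change e' n v.2 = 0; rw [hv, map_zero])
      (fun n v (hv : v.2 = 0) => by change h' n v.2 = 0; rw [hv, map_zero]) hu h0 hne
    have : x = 0 := hi' (by rw [map_zero]; exact hx)
    exact hx0 (by rw [this, map_zero])
  have surj1 : G.map (LinearMap.fst ℂ V V') = ⊤ := by
    refine top_le_iff.mp (htop ▸ borelSpan_le ?_ ?_ ?_)
    · rintro _ ⟨x, rfl⟩; exact ⟨_, hΔG ⟨x, rfl⟩, rfl⟩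
    · rintro n _ ⟨u, hu, rfl⟩; exact ⟨_, hGe n u hu, rfl⟩
    · rintro n _ ⟨u, hu, rfl⟩; exact ⟨_, hGh n u hu, rfl⟩
  have surj2 : G.map (LinearMap.snd ℂ V V') = ⊤ := by
    refine top_le_iff.mp (htop' ▸ borelSpan_le ?_ ?_ ?_)
    · rintro _ ⟨x, rfl⟩; exact ⟨_, hΔG ⟨x, rfl⟩, rfl⟩
    · rintro n _ ⟨u, hu, rfl⟩; exact ⟨_, hGe n u hu, rfl⟩
    · rintro n _ ⟨u, hu, rfl⟩; exact ⟨_, hGh n u hu, rfl⟩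
  let p1 : G ≃ₗ[ℂ] V := LinearEquiv.ofBijective ((LinearMap.fst ℂ V V').comp G.subtype)
    ⟨(injective_iff_map_eq_zero _).mpr fun u hu => Subtype.ext (inj1 u u.2 hu), fun v => by
      obtain ⟨u, hu, rfl⟩ := (Submodule.mem_map.mp (surj1 ▸ Submodule.mem_top : v ∈ G.map _))
      exact ⟨⟨u, hu⟩, rfl⟩⟩
  let p2 : G ≃ₗ[ℂ] V' := LinearEquiv.ofBijective ((LinearMap.snd ℂ V V').comp G.subtype)
    ⟨(injective_iff_map_eq_zero _).mpr fun u hu => Subtype.ext (inj2 u u.2 hu), fun v => by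
      obtain ⟨u, hu, rfl⟩ := (Submodule.mem_map.mp (surj2 ▸ Submodule.mem_top : v ∈ G.map _))
      exact ⟨⟨u, hu⟩, rfl⟩⟩
  have key : ∀ u (hu : u ∈ G), (p1.symm.trans p2) u.1 = u.2 := fun u hu => by
    have : p1.symm u.1 = ⟨u, hu⟩ := p1.symm_apply_eq.mpr rfl
    rw [LinearEquiv.trans_apply, this]; rfl
  have mem : ∀ v, (v, (p1.symm.trans p2) v) ∈ G := fun v => by
    have : (p1.symm v : V × V') = (v, (p1.symm.trans p2) v) :=
      Prod.ext (p1.apply_symm_apply v) rfl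
    rw [← this]; exact (p1.symm v).2
  exact ⟨p1.symm.trans p2, fun x => key _ (hΔG ⟨x, rfl⟩), fun n v => key _ (hGe n _ (mem v)),
    fun n v => key _ (hGh n _ (mem v))⟩

end BorelCurrents

end

end WhittakerSl2

namespace WhittakerSl2

noncomputable section

/-! ### Brackets of the affine algebra -/

theorem h0_val : h0.val = Matrix.single (0 : Fin 2) (0 : Fin 2) (1 : ℂ) - Matrix.single 1 1 1 := rfl

theorem e0_val : e0.val = Matrix.single (0 : Fin 2) (1 : Fin 2) (1 : ℂ) := rfl

theorem f0_val : f0.val = Matrix.single (1 : Fin 2) (0 : Fin 2) (1 : ℂ) := rfl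

theorem e0_lie_f0 : ⁅e0, f0⁆ = h0 := by
  apply Subtype.ext
  change e0.val * f0.val - f0.val * e0.val = h0.val
  rw [h0_val, e0_val, f0_val]
  ext a b
  fin_cases a <;> fin_cases b <;> simp

theorem h0_lie_f0 : ⁅h0, f0⁆ = (-2 : ℂ) • f0 := by
  apply Subtype.ext
  change h0.val * f0.val - f0.val * h0.val = (-2 : ℂ) • f0.val
  rw [h0_val, f0_val]
  ext a b
  fin_cases a <;> fin_cases b <;> (simp [Matrix.mul_apply, Matrix.single_apply]; try norm_num)

theorem form_e0_f0 : form e0 f0 = 1 := by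
  change Matrix.trace (e0.val * f0.val) = 1
  rw [e0_val, f0_val]; simp

theorem form_h0_h0 : form h0 h0 = 2 := by
  change Matrix.trace (h0.val * h0.val) = 2
  rw [h0_val]; simp [Matrix.trace_fin_two, Matrix.mul_apply, Matrix.single_apply]; norm_num

theorem form_e0_e0 : form e0 e0 = 0 := by
  change Matrix.trace (e0.val * e0.val) = 0
  rw [e0_val]; simp

theorem form_h0_e0 : form h0 e0 = 0 := by
  change Matrix.trace (h0.val * e0.val) = 0
  rw [h0_val, e0_val]; simp [Matrix.trace_fin_two, Matrix.mul_apply, Matrix.single_apply]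

theorem form_h0_f0 : form h0 f0 = 0 := by
  change Matrix.trace (h0.val * f0.val) = 0
  rw [h0_val, f0_val]; simp [Matrix.trace_fin_two, Matrix.mul_apply, Matrix.single_apply]

theorem sl2_decomp (x : Sl2) : x = x.val 0 1 • e0 + x.val 0 0 • h0 + x.val 1 0 • f0 := by
  apply Subtype.ext
  change x.val = x.val 0 1 • e0.val + x.val 0 0 • h0.val + x.val 1 0 • f0.val
  have ht : Matrix.trace x.val = 0 := LinearMap.mem_ker.mp x.2
  rw [Matrix.trace_fin_two] at ht
  rw [h0_val, e0_val, f0_val]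
  ext a b
  fin_cases a <;> fin_cases b <;> simp
  linear_combination ht

theorem cur_add (x y : Sl2) (n : ℤ) : cur (x + y) n = cur x n + cur y n := by
  apply Subtype.ext
  refine Prod.ext ?_ (Prod.ext ?_ ?_)
  · exact Finsupp.single_add _ _ _
  · exact (add_zero (0 : ℂ)).symm
  · exact (add_zero (0 : ℂ)).symm

theorem cur_smul (t : ℂ) (x : Sl2) (n : ℤ) : cur (t • x) n = t • cur x n := by
  apply Subtype.ext
  refine Prod.ext ?_ (Prod.ext ?_ ?_)
  · exact (Finsupp.smul_single t n x).symm
  · exact (mul_zero t).symm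
  · exact (mul_zero t).symm

theorem cur_zero (n : ℤ) : cur 0 n = 0 := by
  simpa using cur_smul 0 0 n

theorem cur_lie (x y : Sl2) (n m : ℤ) : ⁅cur x n, cur y m⁆ =
    cur ⁅x, y⁆ (n + m) + (if n + m = 0 then (n : ℂ) * form x y else 0) • cen := by
  apply Subtype.ext
  refine Prod.ext ?_ (Prod.ext ?_ ?_)
  · change loopBr (Finsupp.single n x) (Finsupp.single m y) + (0 : ℂ) • loopD _ -
      (0 : ℂ) • loopD _ = Finsupp.single (n + m) ⁅x, y⁆ + _ • 0
    rw [loopBr_single]; simp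
  · change loopCocycle (Finsupp.single n x) (Finsupp.single m y) = 0 + _ * 1
    rw [loopCocycle_single]; simp
  · change (0 : ℂ) = 0 + _ * 0
    simp

theorem cen_lie (z : AffTilde) : ⁅(cen : AffTilde), z⁆ = 0 := by
  refine Prod.ext ?_ (Prod.ext ?_ rfl)
  · change loopBr 0 z.1 + (0 : ℂ) • loopD z.1 - z.2.2 • loopD 0 = 0
    simp
  · change loopCocycle 0 z.1 = 0
    simp

theorem der_lie_cur (x : Sl2) (n : ℤ) :
    ⁅der, (cur x n : AffTilde)⁆ = (n : ℂ) • (cur x n : AffTilde) := by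
  refine Prod.ext ?_ (Prod.ext ?_ ?_)
  · change loopBr 0 (Finsupp.single n x) + (1 : ℂ) • loopD (Finsupp.single n x) -
      (0 : ℂ) • loopD 0 = (n : ℂ) • Finsupp.single n x
    rw [loopD_single]; simp
  · change loopCocycle 0 (Finsupp.single n x) = (n : ℂ) * 0
    simp
  · change (0 : ℂ) = (n : ℂ) * 0
    simp

theorem affHat_mem (S : Submodule ℂ AffHat) (he : ∀ n, cur e0 n ∈ S) (hh : ∀ n, cur h0 n ∈ S)
    (hf : ∀ n, cur f0 n ∈ S) (hc : cen ∈ S) (z : AffHat) : z ∈ S := by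
  have hcur : ∀ x n, cur x n ∈ S := fun x n => by
    rw [sl2_decomp x, cur_add, cur_add, cur_smul, cur_smul, cur_smul]
    exact S.add_mem (S.add_mem (S.smul_mem _ (he n)) (S.smul_mem _ (hh n))) (S.smul_mem _ (hf n))
  obtain ⟨⟨l, a, b⟩, hz⟩ := z
  have hb : b = 0 := hz
  subst hb
  have h1 : ∀ l : LoopSl2, (⟨(l, 0, 0), rfl⟩ : AffHat) ∈ S := fun l => by
    induction l using Finsupp.induction_linear with
    | zero => exact S.zero_mem
    | add l l' hl hl' =>
      have := S.add_mem hl hl'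
      convert this using 1
      apply Subtype.ext
      refine Prod.ext rfl (Prod.ext ?_ ?_)
      · exact (add_zero (0 : ℂ)).symm
      · exact (add_zero (0 : ℂ)).symm
    | single n x => exact hcur x n
  have h2 := S.add_mem (h1 l) (S.smul_mem a hc)
  convert h2 using 1
  apply Subtype.ext
  refine Prod.ext ?_ (Prod.ext ?_ ?_)
  · change l = l + a • 0
    simp
  · change a = 0 + a * 1
    simp
  · change (0 : ℂ) = 0 + a * 0
    simp

theorem affTilde_mem (S : Submodule ℂ AffTilde) (he : ∀ n, (cur e0 n : AffTilde) ∈ S)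
    (hh : ∀ n, (cur h0 n : AffTilde) ∈ S) (hf : ∀ n, (cur f0 n : AffTilde) ∈ S)
    (hc : (cen : AffTilde) ∈ S) (hd : der ∈ S) (z : AffTilde) : z ∈ S := by
  have h1 := affHat_mem (S.comap (AffHat.incl : AffHat →ₗ[ℂ] AffTilde)) he hh hf hc
    ⟨(z.1, z.2.1, 0), rfl⟩
  have h2 := S.add_mem h1 (S.smul_mem z.2.2 hd)
  convert h2 using 1
  refine Prod.ext ?_ (Prod.ext ?_ ?_)
  · change z.1 = z.1 + z.2.2 • 0
    simp
  · change z.2.1 = z.2.1 + z.2.2 * 0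
    simp
  · change z.2.2 = 0 + z.2.2 * 1
    simp

/-! ### Restricted representations at the critical level -/

section Critical

variable {V : Type*} [AddCommGroup V] [Module ℂ V]

theorem LieHom.map_mul {L : Type*} [LieRing L] [LieAlgebra ℂ L] (ρ : L →ₗ⁅ℂ⁆ Module.End ℂ V)
    (x y : L) : ρ x * ρ y = ρ y * ρ x + ρ ⁅x, y⁆ := by
  rw [LieHom.map_lie, LieRing.of_associative_ring_bracket]; abel

/-- A restricted representation on which the central element acts by `-2`. -/
structure IsCritical (ρ : AffHat →ₗ⁅ℂ⁆ Module.End ℂ V) : Prop where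
  restricted : IsRestricted ρ
  level : ρ cen = (-2 : ℂ) • 1

variable {ρ : AffHat →ₗ⁅ℂ⁆ Module.End ℂ V}

namespace IsCritical

variable (C : IsCritical ρ)
include C

theorem cur_mul (x y : Sl2) (m n : ℤ) : ρ (cur x m) * ρ (cur y n) =
    ρ (cur y n) * ρ (cur x m) + (ρ (cur ⁅x, y⁆ (m + n)) +
      (if m + n = 0 then -2 * (m : ℂ) * form x y else 0) • 1) := by
  rw [LieHom.map_mul, cur_lie, map_add, map_smul, C.level, smul_smul]
  congr 3
  split_ifs <;> ring

theorem ee (m n : ℤ) : ρ (cur e0 m) * ρ (cur e0 n) = ρ (cur e0 n) * ρ (cur e0 m) := by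
  rw [C.cur_mul, lie_self, cur_zero, form_e0_e0]; simp

theorem hh (m n : ℤ) : ρ (cur h0 m) * ρ (cur h0 n) = ρ (cur h0 n) * ρ (cur h0 m) +
    (if m + n = 0 then -4 * (m : ℂ) else 0) • 1 := by
  rw [C.cur_mul, lie_self, cur_zero, form_h0_h0, map_zero, zero_add]
  congr 2
  split_ifs <;> ring

theorem he (m n : ℤ) : ρ (cur h0 m) * ρ (cur e0 n) = ρ (cur e0 n) * ρ (cur h0 m) +
    (2 : ℂ) • ρ (cur e0 (m + n)) := by
  rw [C.cur_mul, h0_lie_e0, cur_smul, map_smul, form_h0_e0]; simp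

theorem hf (m n : ℤ) : ρ (cur h0 m) * ρ (cur f0 n) = ρ (cur f0 n) * ρ (cur h0 m) +
    (-2 : ℂ) • ρ (cur f0 (m + n)) := by
  rw [C.cur_mul, h0_lie_f0, cur_smul, map_smul, form_h0_f0]; simp

theorem ef (m n : ℤ) : ρ (cur e0 m) * ρ (cur f0 n) = ρ (cur f0 n) * ρ (cur e0 m) +
    (ρ (cur h0 (m + n)) + (if m + n = 0 then -2 * (m : ℂ) else 0) • 1) := by
  rw [C.cur_mul, e0_lie_f0, form_e0_f0, mul_one]

theorem borelCurrents : BorelCurrents (fun n => ρ (cur e0 n)) (fun n => ρ (cur h0 n)) where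
  ee := C.ee
  he := C.he
  hh := C.hh
  loc_e v := C.restricted v e0
  loc_h v := C.restricted v h0

end IsCritical

/-! ### The Sugawara operators -/

/-- The summand of index `m` of a sum `∑ x(m) y(p-m)`, where `x(m)` stands to the left if `m < t`
and to the right if `m ≥ t`. -/
def ordTerm (ρ : AffHat →ₗ⁅ℂ⁆ Module.End ℂ V) (x y : Sl2) (p t m : ℤ) : Module.End ℂ V :=
  if m < t then ρ (cur x m) * ρ (cur y (p - m)) else ρ (cur y (p - m)) * ρ (cur x m)

/-- The sum of the terms `ordTerm ρ x y p t m`. -/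
def ordSum (ρ : AffHat →ₗ⁅ℂ⁆ Module.End ℂ V) (x y : Sl2) (p t : ℤ) : Module.End ℂ V :=
  locSum (ordTerm ρ x y p t)

theorem IsRestricted.locFin_ordTerm (R : IsRestricted ρ) (x y : Sl2) (p t : ℤ) :
    LocFin (ordTerm ρ x y p t) := fun v => by
  obtain ⟨N, hN⟩ := R v x
  obtain ⟨N', hN'⟩ := R v y
  refine (Set.finite_Icc (min t (p - N')) (max t N)).subset fun m hm => ?_
  rw [Set.mem_Icc]
  by_contra hc
  refine hm ?_
  change ordTerm ρ x y p t m v = 0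
  rw [ordTerm]
  split_ifs with h
  · rw [Module.End.mul_apply, hN' _ (by omega), map_zero]
  · rw [Module.End.mul_apply, hN _ (by omega), map_zero]

/-- Only the term of index t is reordered when the threshold moves from t to t + 1. -/
theorem IsRestricted.ordSum_succ (R : IsRestricted ρ) (x y : Sl2) (p t : ℤ) :
    ordSum ρ x y p (t + 1) = ordSum ρ x y p t +
      (ρ (cur x t) * ρ (cur y (p - t)) - ρ (cur y (p - t)) * ρ (cur x t)) := by
  rw [← sub_eq_iff_eq_add', ordSum, ordSum,
    ← locSum_sub (R.locFin_ordTerm x y p (t + 1)) (R.locFin_ordTerm x y p t)]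
  conv_rhs => rw [← locSum_single t (_ - _)]
  congr 1
  funext m
  unfold ordTerm
  rcases lt_trichotomy m t with h | h | h
  · rw [if_pos (by omega), if_pos h, if_neg h.ne, sub_self]
  · subst h; simp
  · rw [if_neg (by omega), if_neg (by omega), if_neg h.ne', sub_self]

theorem IsRestricted.ordSum_eq (R : IsRestricted ρ) (x y : Sl2) (p : ℤ) (A : Module.End ℂ V)
    (hA : ∀ m, ρ (cur x m) * ρ (cur y (p - m)) - ρ (cur y (p - m)) * ρ (cur x m) = A) (t : ℤ) :
    ordSum ρ x y p t = ordSum ρ x y p 0 + (t : ℂ) • A := by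
  induction t using Int.induction_on with
  | zero => simp
  | succ i ih => rw [R.ordSum_succ, ih, hA]; push_cast; module
  | pred i ih =>
    have := R.ordSum_succ x y p (-i - 1)
    rw [hA, sub_add_cancel, ih] at this
    rw [← sub_eq_iff_eq_add] at this
    rw [← this]; push_cast; module

/-- Substitute p - m for m: the condition p - m < t means m ≥ p + 1 - t, which explains the shift by
one. -/
theorem ordSum_flip (x y : Sl2) (p t : ℤ) : ordSum ρ y x p t = ordSum ρ x y p (p + 1 - t) := by
  rw [ordSum, ordSum, ← locSum_comp_equiv _ (Equiv.subLeft p)]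
  congr 1
  funext m
  rw [Equiv.subLeft_apply, ordTerm, ordTerm, sub_sub_cancel]
  by_cases h : m < p + 1 - t
  · rw [if_pos h, if_neg (by omega)]
  · rw [if_neg h, if_pos (by omega)]

/-- The Sugawara operator as a linear map. -/
def sugawaraEnd (ρ : AffHat →ₗ⁅ℂ⁆ Module.End ℂ V) (n : ℤ) : Module.End ℂ V :=
  (1 / 2 : ℂ) • (ordSum ρ e0 f0 n 0 + ordSum ρ f0 e0 n 0 + (1 / 2 : ℂ) • ordSum ρ h0 h0 n 0)

theorem normalTerm_eq (x y : Sl2) (n m : ℤ) : normalTerm ρ x y n m = ordTerm ρ x y n 0 m := rfl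

theorem IsRestricted.sugawaraEnd_eq_locSum (R : IsRestricted ρ) (n : ℤ) :
    sugawaraEnd ρ n = (1 / 2 : ℂ) • locSum fun m => normalTerm ρ e0 f0 n m +
      normalTerm ρ f0 e0 n m + (1 / 2 : ℂ) • normalTerm ρ h0 h0 n m := by
  have h1 := R.locFin_ordTerm e0 f0 n 0
  have h2 := R.locFin_ordTerm f0 e0 n 0
  have h3 := R.locFin_ordTerm h0 h0 n 0
  simp only [normalTerm_eq]
  rw [locSum_add (h1.add h2) (h3.smul _), locSum_add h1 h2, locSum_smul h3]
  rfl

theorem IsRestricted.sugawara_eq (R : IsRestricted ρ) (n : ℤ) (v : V) :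
    sugawara ρ n v = sugawaraEnd ρ n v := by
  have h1 := R.locFin_ordTerm e0 f0 n 0
  have h2 := R.locFin_ordTerm f0 e0 n 0
  have h3 := R.locFin_ordTerm h0 h0 n 0
  have h4 : LocFin fun m => normalTerm ρ e0 f0 n m + normalTerm ρ f0 e0 n m +
      (1 / 2 : ℂ) • normalTerm ρ h0 h0 n m := (h1.add h2).add (h3.smul fun _ => _)
  rw [R.sugawaraEnd_eq_locSum, LinearMap.smul_apply, locSum_apply h4]
  rfl

namespace IsCritical

variable (C : IsCritical ρ)
include C

/-- After exchanging the two fields the threshold is n + 1. Moving it back to 0 costs h(n) per unit;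
for n = 0 only the index m = 0 is reordered, where the central term has coefficient 0. -/
theorem ordSum_f_e (n : ℤ) :
    ordSum ρ f0 e0 n 0 = ordSum ρ e0 f0 n 0 + ((n : ℂ) + 1) • ρ (cur h0 n) := by
  rw [ordSum_flip, sub_zero]
  by_cases hn : n = 0
  · subst hn
    rw [C.restricted.ordSum_succ, C.ef]
    simp
  · rw [C.restricted.ordSum_eq e0 f0 n (ρ (cur h0 n)) (fun m => by
      rw [C.ef, add_sub_cancel, if_neg hn, add_sub_cancel_left]; simp) (n + 1)]
    push_cast; rfl

theorem sugawaraEnd_eq (n : ℤ) : sugawaraEnd ρ n = ordSum ρ e0 f0 n 0 +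
    (((n : ℂ) + 1) / 2) • ρ (cur h0 n) + (1 / 4 : ℂ) • ordSum ρ h0 h0 n 0 := by
  rw [sugawaraEnd, C.ordSum_f_e]; module

/-- This is where the level is decisive. Let S be the ordered sum of e and h of total mode n + k
with threshold 0. Commuting e(k) with the three summands of `sugawaraEnd_eq` produces S - 2k e(n+k),
then -(n+1) e(n+k), then -S + (n+2k+1) e(n+k). The term -2k comes from the central element c = -2,
and with it the sum is zero. -/
theorem sugawaraEnd_comm_e (n k : ℤ) :
    ρ (cur e0 k) * sugawaraEnd ρ n = sugawaraEnd ρ n * ρ (cur e0 k) := by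
  have R := C.restricted
  have h1 := R.locFin_ordTerm e0 f0 n 0
  have h3 := R.locFin_ordTerm h0 h0 n 0
  -- All commutators of e(m) with h(n+k-m) equal -2e(n+k), so moving a threshold by t units costs t
  -- times this operator.
  have hA := R.ordSum_eq e0 h0 (n + k) ((-2 : ℂ) • ρ (cur e0 (n + k))) fun m => by
    rw [C.he, sub_add_cancel]; module
  have a1 : ρ (cur e0 k) * ordSum ρ e0 f0 n 0 = ordSum ρ e0 f0 n 0 * ρ (cur e0 k) +
      (ordSum ρ e0 h0 (n + k) 0 + (-2 * (k : ℂ)) • ρ (cur e0 (n + k))) := by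
    rw [← sub_eq_iff_eq_add', ordSum, locSum_mul_left h1, locSum_mul_right h1,
      ← locSum_sub (h1.mul_left _) (h1.mul_right _)]
    rw [← locSum_single (n + k) ((-2 * (k : ℂ)) • ρ (cur e0 (n + k))), ordSum,
      ← locSum_add (R.locFin_ordTerm e0 h0 (n + k) 0) (locFin_single _ _)]
    congr 1
    funext m
    have hf : ρ (cur e0 k) * ρ (cur f0 (n - m)) = ρ (cur f0 (n - m)) * ρ (cur e0 k) +
        (ρ (cur h0 (n + k - m)) + (if m = n + k then -2 * (k : ℂ) else 0) • 1) := by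
      rw [C.ef, show k + (n - m) = n + k - m by ring]
      simp only [show n + k - m = 0 ↔ m = n + k by omega]
    have he := C.ee k m
    have hd : (if m = n + k then (-2 * (k : ℂ)) • ρ (cur e0 (n + k)) else 0) =
        (if m = n + k then -2 * (k : ℂ) else 0) • ρ (cur e0 m) := by
      split_ifs with h
      · rw [h]
      · rw [zero_smul]
    rw [hd]
    generalize (if m = n + k then -2 * (k : ℂ) else 0) = δ at *
    unfold ordTerm
    split_ifs
    · rw [← mul_assoc, he, mul_assoc, hf, mul_add, mul_add, mul_smul_comm, mul_one]
      noncomm_ring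
    · rw [← mul_assoc, hf, mul_assoc _ _ (ρ (cur e0 k)), ← he, add_mul, add_mul, smul_mul_assoc,
        one_mul]
      noncomm_ring
  have a2 : ρ (cur e0 k) * ordSum ρ h0 h0 n 0 = ordSum ρ h0 h0 n 0 * ρ (cur e0 k) +
      (-2 : ℂ) • (ordSum ρ e0 h0 (n + k) k + ordSum ρ h0 e0 (n + k) 0) := by
    rw [← sub_eq_iff_eq_add', ordSum, locSum_mul_left h3, locSum_mul_right h3,
      ← locSum_sub (h3.mul_left _) (h3.mul_right _)]
    -- The commutator with the factor h(m) produces e(m+k) in a term still ordered by the sign of m.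
    -- In the new index m + k the threshold is k.
    have b1 := (R.locFin_ordTerm e0 h0 (n + k) k).comp_injective (Equiv.addRight k).injective
    have b2 := R.locFin_ordTerm h0 e0 (n + k) 0
    rw [ordSum, ← locSum_comp_equiv (ordTerm ρ e0 h0 (n + k) k) (Equiv.addRight k), ordSum,
      ← locSum_add b1 b2,
      ← locSum_smul (b1.add b2)]
    congr 1
    funext m
    have c1 : ρ (cur e0 k) * ρ (cur h0 m) = ρ (cur h0 m) * ρ (cur e0 k) -
        (2 : ℂ) • ρ (cur e0 (m + k)) := by rw [C.he]; abel
    have c2 : ρ (cur e0 k) * ρ (cur h0 (n - m)) = ρ (cur h0 (n - m)) * ρ (cur e0 k) -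
        (2 : ℂ) • ρ (cur e0 (n + k - m)) := by
      rw [C.he, show n - m + k = n + k - m by ring]; abel
    simp only [Equiv.coe_addRight]
    rw [ordTerm, ordTerm, ordTerm, show n + k - (m + k) = n - m by ring]
    by_cases hm : m < 0
    · rw [if_pos hm, if_pos (by omega), if_pos hm, ← mul_assoc, c1, sub_mul, mul_assoc, c2,
        mul_sub, smul_mul_assoc, mul_smul_comm, mul_assoc]
      module
    · rw [if_neg hm, if_neg (by omega), if_neg hm, ← mul_assoc, c2, sub_mul, mul_assoc, c1,
        mul_sub, smul_mul_assoc, mul_smul_comm, mul_assoc]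
      module
  have a3 : ρ (cur e0 k) * ρ (cur h0 n) = ρ (cur h0 n) * ρ (cur e0 k) -
      (2 : ℂ) • ρ (cur e0 (n + k)) := by rw [C.he]; abel
  rw [C.sugawaraEnd_eq]
  simp only [mul_add, add_mul, mul_smul_comm, smul_mul_assoc]
  rw [a1, a2, a3, ordSum_flip e0 h0, hA k, hA (n + k + 1 - 0)]
  push_cast
  module

omit C in
theorem cur_zero_mul_ordTerm (x y z : Sl2) (p t m : ℤ) :
    ρ (cur x 0) * ordTerm ρ y z p t m - ordTerm ρ y z p t m * ρ (cur x 0) =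
      ordTerm ρ ⁅x, y⁆ z p t m + ordTerm ρ y ⁅x, z⁆ p t m := by
  have h1 : ∀ (y : Sl2) (m : ℤ), ρ (cur x 0) * ρ (cur y m) =
      ρ (cur y m) * ρ (cur x 0) + ρ (cur ⁅x, y⁆ m) := fun y m => by
    rw [LieHom.map_mul, cur_lie]; simp
  unfold ordTerm
  split_ifs
  · rw [← mul_assoc, h1, add_mul, mul_assoc, h1]; noncomm_ring
  · rw [← mul_assoc, h1, add_mul, mul_assoc, h1]; noncomm_ring

theorem cur_zero_mul_ordSum (x y z : Sl2) (p t : ℤ) :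
    ρ (cur x 0) * ordSum ρ y z p t = ordSum ρ y z p t * ρ (cur x 0) +
      (ordSum ρ ⁅x, y⁆ z p t + ordSum ρ y ⁅x, z⁆ p t) := by
  have R := C.restricted
  have h := R.locFin_ordTerm y z p t
  rw [← sub_eq_iff_eq_add', ordSum, locSum_mul_left h, locSum_mul_right h,
      ← locSum_sub (h.mul_left _) (h.mul_right _), ordSum, ordSum,
      ← locSum_add (R.locFin_ordTerm _ _ _ _) (R.locFin_ordTerm _ _ _ _)]
  congr 1
  funext m
  exact cur_zero_mul_ordTerm x y z p t m

theorem ordSum_smul_left (a : ℂ) (x y : Sl2) (p t : ℤ) :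
    ordSum ρ (a • x) y p t = a • ordSum ρ x y p t := by
  rw [ordSum, ordSum, ← locSum_smul (C.restricted.locFin_ordTerm _ _ _ _)]
  congr 1
  funext m
  unfold ordTerm
  rw [cur_smul, map_smul, smul_mul_assoc, mul_smul_comm]
  split_ifs <;> rfl

theorem ordSum_smul_right (a : ℂ) (x y : Sl2) (p t : ℤ) :
    ordSum ρ x (a • y) p t = a • ordSum ρ x y p t := by
  rw [ordSum, ordSum, ← locSum_smul (C.restricted.locFin_ordTerm _ _ _ _)]
  congr 1
  funext m
  unfold ordTerm
  rw [cur_smul, map_smul, smul_mul_assoc, mul_smul_comm]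
  split_ifs <;> rfl

/-- Invariance of the Casimir element: a zero mode produces no central term and keeps the
thresholds, so no reordering is needed. -/
theorem sugawaraEnd_comm_f_zero (n : ℤ) :
    ρ (cur f0 0) * sugawaraEnd ρ n = sugawaraEnd ρ n * ρ (cur f0 0) := by
  have h1 : ⁅f0, e0⁆ = (-1 : ℂ) • h0 := by rw [← lie_skew, e0_lie_f0, neg_one_smul]
  have h2 : ⁅f0, h0⁆ = (2 : ℂ) • f0 := by rw [← lie_skew, h0_lie_f0, neg_smul, neg_neg]
  have h3 : ⁅f0, f0⁆ = (0 : ℂ) • f0 := by rw [lie_self, zero_smul]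
  rw [sugawaraEnd]
  simp only [mul_add, add_mul, mul_smul_comm, smul_mul_assoc, C.cur_zero_mul_ordSum, h1, h2, h3,
    C.ordSum_smul_left, C.ordSum_smul_right]
  module

/-- At the critical level the Sugawara operators commute with the affine algebra. -/
theorem sugawaraEnd_comm (n : ℤ) (z : AffHat) :
    ρ z * sugawaraEnd ρ n = sugawaraEnd ρ n * ρ z := by
  have he := C.sugawaraEnd_comm_e n
  have hf := C.sugawaraEnd_comm_f_zero n
  -- It suffices to treat e(k) and f(0): they generate the other modes, since h(k) = [e(k), f(0)]
  -- and f(k) = -½ [h(k), f(0)].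
  have hh : ∀ k, ρ (cur h0 k) * sugawaraEnd ρ n = sugawaraEnd ρ n * ρ (cur h0 k) := fun k => by
    have h1 : ρ (cur h0 k) = ρ (cur e0 k) * ρ (cur f0 0) - ρ (cur f0 0) * ρ (cur e0 k) := by
      rw [C.ef, add_zero]
      split_ifs with hk
      · subst hk; simp
      · simp
    rw [h1, sub_mul, mul_sub, mul_assoc, mul_assoc, he, hf, ← mul_assoc, ← mul_assoc, he, hf,
      mul_assoc, mul_assoc]
  have hf' : ∀ k, ρ (cur f0 k) * sugawaraEnd ρ n = sugawaraEnd ρ n * ρ (cur f0 k) := fun k => by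
    have h1 : ρ (cur f0 k) = (-1 / 2 : ℂ) •
        (ρ (cur h0 k) * ρ (cur f0 0) - ρ (cur f0 0) * ρ (cur h0 k)) := by
      rw [C.hf, add_zero]; module
    rw [h1, smul_mul_assoc, mul_smul_comm, sub_mul, mul_sub, mul_assoc, mul_assoc, hh, hf,
      ← mul_assoc, ← mul_assoc, hh, hf, mul_assoc, mul_assoc]
  let S : Submodule ℂ AffHat :=
    { carrier := {z | ρ z * sugawaraEnd ρ n = sugawaraEnd ρ n * ρ z}
      zero_mem' := by simp
      add_mem' := fun {a b} (ha : _ = _) (hb : _ = _) => by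
        change ρ (a + b) * _ = _ * ρ (a + b)
        rw [map_add, add_mul, mul_add, ha, hb]
      smul_mem' := fun t a (ha : _ = _) => by
        change ρ (t • a) * _ = _ * ρ (t • a)
        rw [map_smul, smul_mul_assoc, mul_smul_comm, ha] }
  refine affHat_mem S he hh hf' ?_ z
  change ρ cen * _ = _ * ρ cen
  rw [C.level]; simp

theorem ordSum_der {D : Module.End ℂ V}
    (hD : ∀ x n, D * ρ (cur x n) = ρ (cur x n) * D + (n : ℂ) • ρ (cur x n)) (x y : Sl2)
    (p t : ℤ) :
    D * ordSum ρ x y p t = ordSum ρ x y p t * D + (p : ℂ) • ordSum ρ x y p t := by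
  have R := C.restricted
  have h := R.locFin_ordTerm x y p t
  rw [← sub_eq_iff_eq_add', ordSum, locSum_mul_left h, locSum_mul_right h,
      ← locSum_sub (h.mul_left _) (h.mul_right _), ← locSum_smul h]
  congr 1
  funext m
  unfold ordTerm
  split_ifs
  · rw [← mul_assoc, hD, add_mul, mul_assoc, hD, mul_add, smul_mul_assoc, mul_smul_comm, mul_assoc]
    push_cast; module
  · rw [← mul_assoc, hD, add_mul, mul_assoc, hD, mul_add, smul_mul_assoc, mul_smul_comm, mul_assoc]
    push_cast; module

theorem sugawaraEnd_der {D : Module.End ℂ V}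
    (hD : ∀ x n, D * ρ (cur x n) = ρ (cur x n) * D + (n : ℂ) • ρ (cur x n)) (n : ℤ) :
    D * sugawaraEnd ρ n = sugawaraEnd ρ n * D + (n : ℂ) • sugawaraEnd ρ n := by
  rw [sugawaraEnd]
  simp only [mul_add, add_mul, mul_smul_comm, smul_mul_assoc, C.ordSum_der hD]
  module

end IsCritical

end Critical

end

end WhittakerSl2

namespace WhittakerSl2

noncomputable section

theorem Int.downward_induction {P : ℤ → Prop} (N : ℤ) (hN : ∀ n ≥ N, P n)
    (step : ∀ n, (∀ m > n, P m) → P n) (n : ℤ) : P n := by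
  have H : ∀ k : ℕ, ∀ n ≥ N - k, P n := fun k => by
    induction k with
    | zero => simpa using hN
    | succ k ih =>
      intro n hn
      exact step n fun m hm => ih m (by push_cast at hn; omega)
  exact H (N - n).toNat n (by omega)

/-! ### Stability of the vectors killed by all large modes -/

section Restricted

variable {V : Type*} [AddCommGroup V] [Module ℂ V] (ρ : AffHat →ₗ⁅ℂ⁆ Module.End ℂ V)

/-- The vectors killed by `x(n)` for all sufficiently large `n`, for each `x ∈ sl₂`. -/
def restrictedVectors : Submodule ℂ V where
  carrier := {v | ∀ x : Sl2, ∃ N : ℤ, ∀ n ≥ N, ρ (cur x n) v = 0}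
  zero_mem' x := ⟨0, by simp⟩
  add_mem' {v w} hv hw x := by
    obtain ⟨N, hN⟩ := hv x
    obtain ⟨M, hM⟩ := hw x
    exact ⟨max N M, fun n hn => by
      rw [map_add, hN n (le_trans (le_max_left _ _) hn), hM n (le_trans (le_max_right _ _) hn),
        add_zero]⟩
  smul_mem' t v hv x := by
    obtain ⟨N, hN⟩ := hv x
    exact ⟨N, fun n hn => by rw [map_smul, hN n hn, smul_zero]⟩

/-- With the analogous statement for the derivation, this reduces restrictedness of a module to a
check on a generator. -/
theorem restrictedVectors_stable (z : AffHat) (v : V) (hv : v ∈ restrictedVectors ρ) :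
    ρ z v ∈ restrictedVectors ρ := by
  have hcur : ∀ y m, ρ (cur y m) v ∈ restrictedVectors ρ := fun y m x => by
    obtain ⟨N, hN⟩ := hv x
    obtain ⟨M, hM⟩ := hv ⁅x, y⁆
    refine ⟨max (max N (M - m)) (1 - m), fun n hn => ?_⟩
    have h1 := LinearMap.congr_fun (LieHom.map_mul ρ (cur x n) (cur y m)) v
    rw [cur_lie, if_neg (by omega), zero_smul, add_zero] at h1
    simp only [Module.End.mul_apply, LinearMap.add_apply] at h1
    rw [h1, hN n (by omega), hM _ (by omega), map_zero, add_zero]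
  refine affHat_mem ((restrictedVectors ρ).comap
    ((LinearMap.applyₗ v).comp (ρ : AffHat →ₗ[ℂ] Module.End ℂ V)))
    (hcur e0) (hcur h0) (hcur f0) (fun x => ?_) z
  obtain ⟨N, hN⟩ := hv x
  refine ⟨N, fun n hn => ?_⟩
  have h1 := LinearMap.congr_fun (LieHom.map_mul ρ (cur x n) cen) v
  have h2 : ⁅cur x n, cen⁆ = 0 := by
    rw [← lie_skew, neg_eq_zero]
    exact Subtype.ext (cen_lie _)
  rw [h2, map_zero, add_zero] at h1
  simp only [Module.End.mul_apply] at h1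
  change ρ (cur x n) (ρ cen v) = 0
  rw [h1, hN n hn, map_zero]

theorem restrictedVectors_stable_der {D : Module.End ℂ V}
    (hD : ∀ x n, D * ρ (cur x n) = ρ (cur x n) * D + (n : ℂ) • ρ (cur x n)) (v : V)
    (hv : v ∈ restrictedVectors ρ) : D v ∈ restrictedVectors ρ := fun x => by
  obtain ⟨N, hN⟩ := hv x
  refine ⟨N, fun n hn => ?_⟩
  have h1 := LinearMap.congr_fun (hD x n) v
  simp only [Module.End.mul_apply, LinearMap.add_apply, LinearMap.smul_apply, hN n hn, map_zero,
    smul_zero, add_zero] at h1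
  exact h1.symm

end Restricted

/-! ### Recovering the f(n) from the Sugawara operators on Whittaker vectors -/

section Whittaker

variable {V : Type*} [AddCommGroup V] [Module ℂ V] {ρ : AffHat →ₗ⁅ℂ⁆ Module.End ℂ V} {lam : ℂ}

/-- The Whittaker vectors of a representation of the affine algebra. -/
abbrev whit (ρ : AffHat →ₗ⁅ℂ⁆ Module.End ℂ V) (lam : ℂ) : Submodule ℂ V :=
  whittakerVectors (fun n => ρ (cur e0 n)) (fun n => ρ (cur h0 n)) lam

/-- The subspace generated by `X` under the `e(n)` and `h(n)`. -/
abbrev bspan (ρ : AffHat →ₗ⁅ℂ⁆ Module.End ℂ V) (X : Submodule ℂ V) : Submodule ℂ V :=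
  borelSpan (fun n => ρ (cur e0 n)) (fun n => ρ (cur h0 n)) X

namespace IsCritical

variable (C : IsCritical ρ)
include C

theorem finite_support_e_f (n : ℤ) (x : V) : (Function.support fun m : ℤ =>
    if m < 0 then ρ (cur e0 m) (ρ (cur f0 (n - m)) x) else 0).Finite := by
  refine (C.restricted.locFin_ordTerm e0 f0 n 0 x).subset fun m hm => ?_
  simp only [Function.mem_support] at hm ⊢
  rw [ordTerm]
  split_ifs at hm ⊢ with h
  · exact hm
  · exact absurd rfl hm

/-- The terms with m > 0 end in e(m), which kills x, and the term m = 0 gives lam • f(n)x. The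
remaining ones involve modes n - m > n of f, so the system is triangular in the f(n)x. -/
theorem ordSum_e_f_whit {x : V} (hx : x ∈ whit ρ lam) (n : ℤ) :
    ordSum ρ e0 f0 n 0 x = lam • ρ (cur f0 n) x +
      ∑ᶠ m : ℤ, if m < 0 then ρ (cur e0 m) (ρ (cur f0 (n - m)) x) else 0 := by
  have h1 : (∑ᶠ m : ℤ, if m = 0 then lam • ρ (cur f0 n) x else 0) = lam • ρ (cur f0 n) x := by
    rw [finsum_eq_single _ 0 fun m hm => if_neg hm, if_pos rfl]
  have h2 : (Function.support fun m : ℤ => if m = 0 then lam • ρ (cur f0 n) x else 0).Finite :=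
    (Set.finite_singleton 0).subset fun m hm => by
      by_contra h
      exact hm (if_neg h)
  conv_rhs => rw [← h1]
  rw [← finsum_add_distrib h2 (C.finite_support_e_f n x), ordSum,
    locSum_apply (C.restricted.locFin_ordTerm e0 f0 n 0)]
  refine finsum_congr fun m => ?_
  rw [ordTerm]
  rcases lt_trichotomy m 0 with h | h | h
  · rw [if_pos h, if_neg h.ne, if_pos h, zero_add]; rfl
  · subst h
    simp [hx.1]
  · rw [if_neg h.not_gt, if_neg h.ne', if_neg h.not_gt, add_zero, Module.End.mul_apply,
      (hx.2 m h).1, map_zero]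

theorem ordSum_h_h_mem {N : Submodule ℂ V} (hN : StableUnder (fun n => ρ (cur h0 n)) N)
    (n : ℤ) {x : V} (hx : x ∈ N) : ordSum ρ h0 h0 n 0 x ∈ N := by
  refine (C.restricted.locFin_ordTerm h0 h0 n 0).mem_of fun m => ?_
  rw [ordTerm]
  split_ifs
  · exact hN _ _ (hN _ _ hx)
  · exact hN _ _ (hN _ _ hx)

/-- The Sugawara operators on Whittaker vectors. -/
theorem sugawaraEnd_whit {x : V} (hx : x ∈ whit ρ lam) (n : ℤ) :
    sugawaraEnd ρ n x = lam • ρ (cur f0 n) x +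
      (∑ᶠ m : ℤ, if m < 0 then ρ (cur e0 m) (ρ (cur f0 (n - m)) x) else 0) +
      ((((n : ℂ) + 1) / 2) • ρ (cur h0 n) x + (1 / 4 : ℂ) • ordSum ρ h0 h0 n 0 x) := by
  rw [C.sugawaraEnd_eq, LinearMap.add_apply, LinearMap.add_apply, C.ordSum_e_f_whit hx,
    LinearMap.smul_apply, LinearMap.smul_apply]
  abel

theorem sugawaraEnd_whit_pos {x : V} (hx : x ∈ whit ρ lam) {n : ℤ} (hn : 0 < n) :
    sugawaraEnd ρ n x = lam • ρ (cur f0 n) x +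
      ∑ᶠ m : ℤ, if m < 0 then ρ (cur e0 m) (ρ (cur f0 (n - m)) x) else 0 := by
  have h1 : ordSum ρ h0 h0 n 0 x = 0 := by
    rw [ordSum, locSum_apply (C.restricted.locFin_ordTerm h0 h0 n 0)]
    refine finsum_eq_zero_of_forall_eq_zero fun m => ?_
    rw [ordTerm]
    rcases lt_trichotomy m 0 with h | h | h
    · rw [if_pos h, Module.End.mul_apply, (hx.2 _ (by omega)).2, map_zero]
    · subst h
      rw [if_neg (lt_irrefl _), C.hh, if_neg (by omega), zero_smul, add_zero,
        Module.End.mul_apply, (hx.2 _ (by omega)).2, map_zero]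
    · rw [if_neg h.not_gt, Module.End.mul_apply, (hx.2 _ h).2, map_zero]
  rw [C.sugawaraEnd_whit hx, h1, (hx.2 n hn).2, smul_zero, smul_zero, add_zero, add_zero]

/-- Solve the formula for T(n)x for lam • f(n)x. For large n the vector f(n)x is zero; going down,
all other terms lie in N by the cases already treated. -/
theorem f_mem_of_whit (hlam : lam ≠ 0) {N : Submodule ℂ V}
    (hE : StableUnder (fun n => ρ (cur e0 n)) N) (hH : StableUnder (fun n => ρ (cur h0 n)) N)
    {x : V} (hx : x ∈ whit ρ lam) (hxN : x ∈ N) (hT : ∀ n, sugawaraEnd ρ n x ∈ N) (n : ℤ) :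
    ρ (cur f0 n) x ∈ N := by
  obtain ⟨M, hM⟩ := C.restricted x f0
  refine Int.downward_induction (P := fun n => ρ (cur f0 n) x ∈ N) M (fun n hn => by rw [hM n hn]; exact N.zero_mem)
    (fun n ih => ?_) n
  have h1 := C.sugawaraEnd_whit hx n
  rw [add_assoc, ← sub_eq_iff_eq_add] at h1
  refine (N.smul_mem_iff hlam).mp (h1 ▸ N.sub_mem (hT n) (N.add_mem ?_ (N.add_mem
    (N.smul_mem _ (hH _ _ hxN)) (N.smul_mem _ (C.ordSum_h_h_mem hH n hxN)))))
  refine finsum_induction (fun v => v ∈ N) N.zero_mem (fun _ _ => N.add_mem) fun m => ?_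
  split_ifs with hm
  · exact hE _ _ (ih _ (by omega))
  · exact N.zero_mem

theorem f_eq_zero_of_whit (hlam : lam ≠ 0) {x : V} (hx : x ∈ whit ρ lam)
    (hT : ∀ n > 0, sugawaraEnd ρ n x = 0) {n : ℤ} (hn : 0 < n) : ρ (cur f0 n) x = 0 := by
  obtain ⟨M, hM⟩ := C.restricted x f0
  refine Int.downward_induction (P := fun n => 0 < n → ρ (cur f0 n) x = 0) M
    (fun n hn _ => hM n hn) (fun n ih hn => ?_) n hn
  have h1 := C.sugawaraEnd_whit_pos hx hn
  rw [hT n hn, finsum_eq_zero_of_forall_eq_zero, add_zero] at h1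
  · exact (smul_eq_zero.mp h1.symm).resolve_left hlam
  · intro m
    split_ifs with hm
    · rw [ih _ (by omega) (by omega), map_zero]
    · rfl

theorem sugawaraEnd_whit_of_f {x : V} (hx : x ∈ whit ρ lam) {n : ℤ} (hn : 0 < n)
    (hf : ∀ m > n, ρ (cur f0 m) x = 0) : sugawaraEnd ρ n x = lam • ρ (cur f0 n) x := by
  rw [C.sugawaraEnd_whit_pos hx hn, finsum_eq_zero_of_forall_eq_zero, add_zero]
  intro m
  split_ifs with hm
  · rw [hf _ (by omega), map_zero]
  · rfl

/-- On Whittaker vectors the `f(n)` are determined by the `e(n)`, `h(n)` and `T(n)`. -/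
theorem f_eq_of_whit (hlam : lam ≠ 0) {ρ' : AffHat →ₗ⁅ℂ⁆ Module.End ℂ V} (C' : IsCritical ρ')
    (hE : ∀ n, ρ (cur e0 n) = ρ' (cur e0 n)) (hH : ∀ n, ρ (cur h0 n) = ρ' (cur h0 n))
    {x : V} (hx : x ∈ whit ρ lam) (hT : ∀ n, sugawaraEnd ρ n x = sugawaraEnd ρ' n x) (n : ℤ) :
    ρ (cur f0 n) x = ρ' (cur f0 n) x := by
  have hx' : x ∈ whit ρ' lam := by
    unfold whit at hx ⊢
    simpa only [hE, hH] using hx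
  obtain ⟨M, hM⟩ := C.restricted x f0
  obtain ⟨M', hM'⟩ := C'.restricted x f0
  refine Int.downward_induction (P := fun n => ρ (cur f0 n) x = ρ' (cur f0 n) x) (max M M')
    (fun n hn => ?_) (fun n ih => ?_) n
  · rw [hM n (le_trans (le_max_left _ _) hn), hM' n (le_trans (le_max_right _ _) hn)]
  · have h1 := C.sugawaraEnd_whit hx n
    have h2 := C'.sugawaraEnd_whit hx' n
    have h3 : ordSum ρ h0 h0 n 0 = ordSum ρ' h0 h0 n 0 := by
      unfold ordSum
      congr 1
      funext m
      simp only [ordTerm, hH]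
    rw [hT n, h2, h3, hH, add_left_inj] at h1
    have h4 : (∑ᶠ m : ℤ, if m < 0 then ρ (cur e0 m) (ρ (cur f0 (n - m)) x) else 0) =
        ∑ᶠ m : ℤ, if m < 0 then ρ' (cur e0 m) (ρ' (cur f0 (n - m)) x) else 0 := by
      refine finsum_congr fun m => ?_
      split_ifs with hm
      · rw [hE, ih _ (by omega)]
      · rfl
    rw [h4, add_left_inj] at h1
    exact (smul_right_injective V hlam h1).symm

/-- The commutators of f(n) with e(m) and h(m) stay within the e, h, f and scalars, so stability
under f only needs to be tested on generators. -/
theorem f_mem_bspan {X : Submodule ℂ V} (hX : ∀ x ∈ X, ∀ n, ρ (cur f0 n) x ∈ bspan ρ X) :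
    StableUnder (fun n => ρ (cur f0 n)) (bspan ρ X) := by
  suffices H : bspan ρ X ≤ bspan ρ X ⊓ ⨅ n, (bspan ρ X).comap (ρ (cur f0 n)) from
    fun n v hv => Submodule.mem_iInf _ |>.mp (H hv).2 n
  refine borelSpan_le (fun x hx => ⟨le_borelSpan hx, Submodule.mem_iInf _ |>.mpr (hX x hx)⟩)
    (fun m v hv => ⟨borelSpan_stable_e m v hv.1, Submodule.mem_iInf _ |>.mpr fun n => ?_⟩)
    (fun m v hv => ⟨borelSpan_stable_h m v hv.1, Submodule.mem_iInf _ |>.mpr fun n => ?_⟩)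
  · have hv2 := Submodule.mem_iInf _ |>.mp hv.2
    have h1 := LinearMap.congr_fun (C.ef m n) v
    simp only [Module.End.mul_apply, LinearMap.add_apply, LinearMap.smul_apply,
      Module.End.one_apply] at h1
    rw [Submodule.mem_comap]
    rw [← sub_eq_iff_eq_add] at h1
    rw [← h1]
    exact Submodule.sub_mem _ (borelSpan_stable_e m _ (hv2 n)) (Submodule.add_mem _
      (borelSpan_stable_h _ _ hv.1) (Submodule.smul_mem _ _ hv.1))
  · have hv2 := Submodule.mem_iInf _ |>.mp hv.2
    have h1 := LinearMap.congr_fun (C.hf m n) v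
    simp only [Module.End.mul_apply, LinearMap.add_apply, LinearMap.smul_apply] at h1
    rw [Submodule.mem_comap]
    rw [← sub_eq_iff_eq_add] at h1
    rw [← h1]
    exact Submodule.sub_mem _ (borelSpan_stable_h m _ (hv2 n))
      (Submodule.smul_mem _ _ (hv2 (m + n)))

omit C in
theorem der_mem_bspan {X : Submodule ℂ V} {D : Module.End ℂ V}
    (hD : ∀ x n, D * ρ (cur x n) = ρ (cur x n) * D + (n : ℂ) • ρ (cur x n))
    (hX : ∀ x ∈ X, D x ∈ bspan ρ X) : ∀ v ∈ bspan ρ X, D v ∈ bspan ρ X := by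
  suffices H : bspan ρ X ≤ bspan ρ X ⊓ (bspan ρ X).comap D from fun v hv => (H hv).2
  refine borelSpan_le (fun x hx => ⟨le_borelSpan hx, hX x hx⟩)
    (fun m v hv => ⟨borelSpan_stable_e m v hv.1, ?_⟩)
    (fun m v hv => ⟨borelSpan_stable_h m v hv.1, ?_⟩)
  · have h1 := LinearMap.congr_fun (hD e0 m) v
    simp only [Module.End.mul_apply, LinearMap.add_apply, LinearMap.smul_apply] at h1
    change D (ρ (cur e0 m) v) ∈ bspan ρ X
    rw [h1]
    exact Submodule.add_mem _ (borelSpan_stable_e m _ hv.2)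
      (Submodule.smul_mem _ _ (borelSpan_stable_e m _ hv.1))
  · have h1 := LinearMap.congr_fun (hD h0 m) v
    simp only [Module.End.mul_apply, LinearMap.add_apply, LinearMap.smul_apply] at h1
    change D (ρ (cur h0 m) v) ∈ bspan ρ X
    rw [h1]
    exact Submodule.add_mem _ (borelSpan_stable_h m _ hv.2)
      (Submodule.smul_mem _ _ (borelSpan_stable_h m _ hv.1))

omit C in
/-- An operator that commutes with the `e(n)` and `h(n)` is determined by its values on a
generating space. -/
theorem eq_of_comm {X : Submodule ℂ V} (htop : bspan ρ X = ⊤) {A A' : Module.End ℂ V}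
    (he : ∀ n, (A - A') * ρ (cur e0 n) = ρ (cur e0 n) * (A - A'))
    (hh : ∀ n, (A - A') * ρ (cur h0 n) = ρ (cur h0 n) * (A - A'))
    (hX : ∀ x ∈ X, A x = A' x) : A = A' := by
  have H : bspan ρ X ≤ LinearMap.ker (A - A') := by
    refine borelSpan_le (fun x hx => ?_) (fun m v hv => ?_) (fun m v hv => ?_)
    · rw [LinearMap.mem_ker, LinearMap.sub_apply, hX x hx, sub_self]
    · rw [LinearMap.mem_ker] at hv ⊢
      have := LinearMap.congr_fun (he m) v
      rw [Module.End.mul_apply, Module.End.mul_apply, hv, map_zero] at this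
      exact this
    · rw [LinearMap.mem_ker] at hv ⊢
      have := LinearMap.congr_fun (hh m) v
      rw [Module.End.mul_apply, Module.End.mul_apply, hv, map_zero] at this
      exact this
  refine LinearMap.ext fun v => ?_
  have hv : v ∈ LinearMap.ker (A - A') := H (htop ▸ Submodule.mem_top)
  rwa [LinearMap.mem_ker, LinearMap.sub_apply, sub_eq_zero] at hv

/-- The differences of the two actions of f(n) commute with e(m), because the central terms agree at
equal level, and are permuted up to scalars by h(m). So their common kernel is a submodule, and it
contains X by the triangular formula. -/
theorem f_eq {X : Submodule ℂ V} (hlam : lam ≠ 0) {ρ' : AffHat →ₗ⁅ℂ⁆ Module.End ℂ V}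
    (C' : IsCritical ρ') (htop : bspan ρ X = ⊤) (hX : X ≤ whit ρ lam)
    (hE : ∀ n, ρ (cur e0 n) = ρ' (cur e0 n)) (hH : ∀ n, ρ (cur h0 n) = ρ' (cur h0 n))
    (hT : ∀ x ∈ X, ∀ n, sugawaraEnd ρ n x = sugawaraEnd ρ' n x) (n : ℤ) :
    ρ (cur f0 n) = ρ' (cur f0 n) := by
  have H : bspan ρ X ≤ ⨅ n, LinearMap.ker (ρ (cur f0 n) - ρ' (cur f0 n)) := by
    refine borelSpan_le (fun x hx => Submodule.mem_iInf _ |>.mpr fun n => ?_)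
      (fun m v hv => Submodule.mem_iInf _ |>.mpr fun n => ?_)
      (fun m v hv => Submodule.mem_iInf _ |>.mpr fun n => ?_)
    · rw [LinearMap.mem_ker, LinearMap.sub_apply, sub_eq_zero]
      exact C.f_eq_of_whit hlam C' hE hH (hX hx) (hT x hx) n
    · have hv := Submodule.mem_iInf _ |>.mp hv
      have h1 : (ρ (cur f0 n) - ρ' (cur f0 n)) * ρ (cur e0 m) =
          ρ (cur e0 m) * (ρ (cur f0 n) - ρ' (cur f0 n)) := by
        have h2 := C'.ef m n
        rw [← hE, ← hH] at h2
        rw [sub_mul, mul_sub, C.ef, h2]; abel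
      have h3 := LinearMap.congr_fun h1 v
      rw [Module.End.mul_apply, Module.End.mul_apply, LinearMap.mem_ker.mp (hv n), map_zero] at h3
      exact h3
    · have hv := Submodule.mem_iInf _ |>.mp hv
      have h1 : (ρ (cur f0 n) - ρ' (cur f0 n)) * ρ (cur h0 m) =
          ρ (cur h0 m) * (ρ (cur f0 n) - ρ' (cur f0 n)) +
            (2 : ℂ) • (ρ (cur f0 (m + n)) - ρ' (cur f0 (m + n))) := by
        have h2 := C'.hf m n
        rw [← hH] at h2
        rw [sub_mul, mul_sub, C.hf, h2]; module
      have h3 := LinearMap.congr_fun h1 v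
      rw [Module.End.mul_apply, LinearMap.add_apply, LinearMap.smul_apply, Module.End.mul_apply,
        LinearMap.mem_ker.mp (hv n), LinearMap.mem_ker.mp (hv (m + n)), map_zero, smul_zero,
        add_zero] at h3
      exact h3
  refine LinearMap.ext fun v => ?_
  have hv : v ∈ ⨅ n, LinearMap.ker (ρ (cur f0 n) - ρ' (cur f0 n)) :=
    H (htop ▸ Submodule.mem_top)
  have := Submodule.mem_iInf _ |>.mp hv n
  rwa [LinearMap.mem_ker, LinearMap.sub_apply, sub_eq_zero] at this

end IsCritical

end Whittaker

end

end WhittakerSl2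

namespace WhittakerSl2

noncomputable section

/-! ### Free field realization at the critical level -/

section LieLocSum

variable {V ι : Type*} [AddCommGroup V] [Module ℂ V]

theorem LocFin.lie {F : ι → Module.End ℂ V} (hF : LocFin F) (A : Module.End ℂ V) :
    LocFin fun i => ⁅A, F i⁆ := (hF.mul_left A).sub (hF.mul_right A)

theorem lie_locSum {F : ι → Module.End ℂ V} (hF : LocFin F) (A : Module.End ℂ V) :
    ⁅A, locSum F⁆ = locSum fun i => ⁅A, F i⁆ := by
  rw [LieRing.of_associative_ring_bracket, locSum_mul_left hF, locSum_mul_right hF,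
    ← locSum_sub (hF.mul_left A) (hF.mul_right A)]
  rfl

theorem lie_mul (A B C : Module.End ℂ V) : ⁅A, B * C⁆ = ⁅A, B⁆ * C + B * ⁅A, C⁆ := by
  simp only [LieRing.of_associative_ring_bracket]; noncomm_ring

theorem lie_one (A : Module.End ℂ V) : ⁅A, (1 : Module.End ℂ V)⁆ = 0 := by
  simp [LieRing.of_associative_ring_bracket]

theorem mul_apply_of_lie {A B C : Module.End ℂ V} (h : ⁅A, B⁆ = C) (v : V) :
    A (B v) = B (A v) + C v := by
  rw [← h, LieRing.of_associative_ring_bracket]; simp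

end LieLocSum

section WeylSystem

variable {V X : Type*} [AddCommGroup V] [Module ℂ V] [AddCommGroup X] [Module ℂ X]

/-- Modes `a(n)`, `s(n)` of a Weyl algebra and commuting modes `b(n)` that act on a module which is
generated by a space `X` of vacuum vectors, on which `a(0)` acts by `lam`. -/
structure WeylSystem (lam : ℂ) (a s b : ℤ → Module.End ℂ V) (i : X →ₗ[ℂ] V) (p : V →ₗ[ℂ] X)
    (β : ℤ → Module.End ℂ X) : Prop where
  aa : ∀ m n, ⁅a m, a n⁆ = 0
  ss : ∀ m n, ⁅s m, s n⁆ = 0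
  as : ∀ m n, ⁅a m, s n⁆ = if m + n = 0 then 1 else 0
  ab : ∀ m n, ⁅a m, b n⁆ = 0
  sb : ∀ m n, ⁅s m, b n⁆ = 0
  bb : ∀ m n, ⁅b m, b n⁆ = 0
  loc_a : ∀ v, ∃ N : ℤ, ∀ n ≥ N, a n v = 0
  loc_s : ∀ v, ∃ N : ℤ, ∀ n ≥ N, s n v = 0
  b_pos : ∀ n > 0, b n = 0
  a_i : ∀ n > 0, ∀ x, a n (i x) = 0
  a_zero_i : ∀ x, a 0 (i x) = lam • i x
  s_i : ∀ n > 0, ∀ x, s n (i x) = 0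
  b_i : ∀ n x, b n (i x) = i (β n x)
  p_a : ∀ n < 0, ∀ v, p (a n v) = 0
  p_s : ∀ n ≤ 0, ∀ v, p (s n v) = 0
  p_b : ∀ n v, p (b n v) = β n (p v)
  p_i : ∀ x, p (i x) = x
  gen : ∀ N : Submodule ℂ V, LinearMap.range i ≤ N → StableUnder a N → StableUnder s N → N = ⊤
  vac : ∀ v, (∀ n > 0, a n v = 0) → a 0 v = lam • v → (∀ n > 0, s n v = 0) → v = i (p v)

/-- The summands of `:a(z) a*(z):`. -/
def hTerm (a s : ℤ → Module.End ℂ V) (n k : ℤ) : Module.End ℂ V :=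
  if k < 0 then a k * s (n - k) else s (n - k) * a k

/-- The modes of `-2 :a(z) a*(z): + b(z)`. -/
def hOp (a s b : ℤ → Module.End ℂ V) (n : ℤ) : Module.End ℂ V :=
  (-2 : ℂ) • locSum (hTerm a s n) + b n

/-- The modes of `a*(z)²`. -/
def sqOp (s : ℤ → Module.End ℂ V) (j : ℤ) : Module.End ℂ V :=
  locSum fun i => s i * s (j - i)

/-- The modes of `a*(z)³`. -/
def cubeOp (s : ℤ → Module.End ℂ V) (j : ℤ) : Module.End ℂ V :=
  locSum fun i => s i * sqOp s (j - i)

/-- The summands of `:a(z) a*(z)²:`. -/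
def fTerm (a s : ℤ → Module.End ℂ V) (n k : ℤ) : Module.End ℂ V :=
  if k < 0 then a k * sqOp s (n - k) else sqOp s (n - k) * a k

/-- The modes of `-:a(z) a*(z)²: - 2 ∂a*(z) + a*(z) b(z)`. -/
def fOp (a s b : ℤ → Module.End ℂ V) (n : ℤ) : Module.End ℂ V :=
  - locSum (fTerm a s n) + (2 * n : ℂ) • s n + locSum fun k => s (n - k) * b k

variable {lam : ℂ} {a s b : ℤ → Module.End ℂ V} {i : X →ₗ[ℂ] V} {p : V →ₗ[ℂ] X}
  {β : ℤ → Module.End ℂ X}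

namespace WeylSystem

variable (W : WeylSystem lam a s b i p β)
include W

theorem sa (m n : ℤ) : ⁅s m, a n⁆ = if n + m = 0 then -1 else 0 := by
  rw [← lie_skew, W.as]; split_ifs <;> simp

theorem s_comm (m n : ℤ) (v : V) : s m (s n v) = s n (s m v) := by
  simpa using mul_apply_of_lie (W.ss m n) v

theorem locFin_hTerm (n : ℤ) : LocFin (hTerm a s n) := fun v => by
  obtain ⟨N, hN⟩ := W.loc_a v
  obtain ⟨N', hN'⟩ := W.loc_s v
  refine (Set.finite_Icc (min 0 (n - N')) (max 0 N)).subset fun k hk => ?_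
  rw [Set.mem_Icc]
  by_contra hc
  refine hk ?_
  change hTerm a s n k v = 0
  rw [hTerm]
  split_ifs with h
  · rw [Module.End.mul_apply, hN' _ (by omega), map_zero]
  · rw [Module.End.mul_apply, hN _ (by omega), map_zero]

theorem locFin_sq (j : ℤ) : LocFin fun k => s k * s (j - k) := fun v => by
  obtain ⟨N, hN⟩ := W.loc_s v
  refine (Set.finite_Icc (j - N) N).subset fun k hk => ?_
  rw [Set.mem_Icc]
  by_contra hc
  refine hk ?_
  change s k (s (j - k) v) = 0
  rcases not_and_or.mp hc with hc | hc
  · rw [hN _ (by omega), map_zero]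
  · rw [W.s_comm, hN k (by omega), map_zero]

theorem sqOp_eq_zero (v : V) : ∃ N : ℤ, ∀ n ≥ N, sqOp s n v = 0 := by
  obtain ⟨N, hN⟩ := W.loc_s v
  refine ⟨2 * N, fun n hn => ?_⟩
  rw [sqOp, locSum_apply (W.locFin_sq n)]
  refine finsum_eq_zero_of_forall_eq_zero fun k => ?_
  rw [Module.End.mul_apply]
  by_cases hk : N ≤ k
  · rw [W.s_comm, hN k hk, map_zero]
  · rw [hN _ (by omega), map_zero]

theorem lie_s_sq (m j : ℤ) : ⁅s m, sqOp s j⁆ = 0 := by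
  rw [sqOp, lie_locSum (W.locFin_sq j)]
  ext v
  rw [locSum_apply ((W.locFin_sq j).lie _)]
  simp [lie_mul, W.ss]

theorem s_sq_comm (m n : ℤ) (v : V) : s m (sqOp s n v) = sqOp s n (s m v) := by
  simpa using mul_apply_of_lie (W.lie_s_sq m n) v

theorem locFin_cube (j : ℤ) : LocFin fun k => s k * sqOp s (j - k) := fun v => by
  obtain ⟨N, hN⟩ := W.loc_s v
  obtain ⟨N', hN'⟩ := W.sqOp_eq_zero v
  refine (Set.finite_Icc (j - N') N).subset fun k hk => ?_
  rw [Set.mem_Icc]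
  by_contra hc
  refine hk ?_
  change s k (sqOp s (j - k) v) = 0
  rcases not_and_or.mp hc with hc | hc
  · rw [hN' _ (by omega), map_zero]
  · rw [W.s_sq_comm, hN k (by omega), map_zero]

theorem locFin_fTerm (n : ℤ) : LocFin (fTerm a s n) := fun v => by
  obtain ⟨N, hN⟩ := W.loc_a v
  obtain ⟨N', hN'⟩ := W.sqOp_eq_zero v
  refine (Set.finite_Icc (min 0 (n - N')) (max 0 N)).subset fun k hk => ?_
  rw [Set.mem_Icc]
  by_contra hc
  refine hk ?_
  change fTerm a s n k v = 0
  rw [fTerm]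
  split_ifs with h
  · rw [Module.End.mul_apply, hN' _ (by omega), map_zero]
  · rw [Module.End.mul_apply, hN _ (by omega), map_zero]

theorem s_b_comm (m n : ℤ) (v : V) : s m (b n v) = b n (s m v) := by
  simpa using mul_apply_of_lie (W.sb m n) v

theorem locFin_sb (n : ℤ) : LocFin fun k => s (n - k) * b k := fun v => by
  obtain ⟨N, hN⟩ := W.loc_s v
  refine (Set.finite_Icc (n - N) 0).subset fun k hk => ?_
  rw [Set.mem_Icc]
  by_contra hc
  refine hk ?_
  change s (n - k) (b k v) = 0
  rcases not_and_or.mp hc with hc | hc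
  · rw [W.s_b_comm, hN _ (by omega), map_zero]
  · rw [W.b_pos k (by omega), LinearMap.zero_apply, map_zero]

/-! #### Commutation relations with the modes -/

theorem lie_a_sq (k j : ℤ) : ⁅a k, sqOp s j⁆ = (2 : ℂ) • s (j + k) := by
  have h0 : s (j + k) + s (j + k) = locSum fun m =>
      (if m = -k then s (j + k) else 0) + if m = j + k then s (j + k) else 0 := by
    rw [locSum_add (locFin_single _ _) (locFin_single _ _), locSum_single, locSum_single]
  rw [sqOp, lie_locSum (W.locFin_sq j), two_smul, h0]
  congr 1
  funext m
  rw [lie_mul, W.as, W.as]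
  congr 1
  · by_cases h : m = -k
    · subst h; simp
    · rw [if_neg (by omega), if_neg h, zero_mul]
  · by_cases h : m = j + k
    · subst h; simp
    · rw [if_neg (by omega), if_neg h, mul_zero]

theorem lie_a_h (k n : ℤ) : ⁅a k, hOp a s b n⁆ = (-2 : ℂ) • a (n + k) := by
  rw [hOp, lie_add, lie_smul, lie_locSum (W.locFin_hTerm n), W.ab, add_zero]
  conv_rhs => rw [← locSum_single (n + k) (a (n + k))]
  congr 2
  funext m
  have h1 : ⁅a k, s (n - m)⁆ = if m = n + k then 1 else 0 := by
    rw [W.as]; congr 1; rw [eq_iff_iff]; omega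
  unfold hTerm
  by_cases h : m = n + k
  · rw [if_pos h] at h1 ⊢
    split_ifs <;> simp [lie_mul, W.aa, h1] <;> rw [h]
  · rw [if_neg h] at h1 ⊢
    split_ifs <;> simp [lie_mul, W.aa, h1]

theorem lie_s_h (k n : ℤ) : ⁅s k, hOp a s b n⁆ = (2 : ℂ) • s (n + k) := by
  rw [hOp, lie_add, lie_smul, lie_locSum (W.locFin_hTerm n), W.sb, add_zero]
  have : (2 : ℂ) • s (n + k) = (-2 : ℂ) • -s (n + k) := by module
  rw [this]
  conv_rhs => rw [← locSum_single (-k) (-s (n + k))]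
  congr 2
  funext m
  have h1 : ⁅s k, a m⁆ = if m = -k then -1 else 0 := by
    rw [W.sa]; congr 1; rw [eq_iff_iff]; omega
  unfold hTerm
  by_cases h : m = -k
  · rw [if_pos h] at h1 ⊢
    split_ifs <;> simp [lie_mul, W.ss, h1] <;> rw [h, sub_neg_eq_add]
  · rw [if_neg h] at h1 ⊢
    split_ifs <;> simp [lie_mul, W.ss, h1]

/-- The cubic term contributes -2:aa*: and the term a*b contributes b, which together are h(n+k).
The term 2n s(n) gives the scalar 2n = -2k when n + k = 0: the derivative of a* produces the level.
-/
theorem lie_a_f (k n : ℤ) : ⁅a k, fOp a s b n⁆ =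
    hOp a s b (n + k) + (if n + k = 0 then -2 * k else 0 : ℂ) • 1 := by
  have h1 : ⁅a k, locSum (fTerm a s n)⁆ = (2 : ℂ) • locSum (hTerm a s (n + k)) := by
    rw [lie_locSum (W.locFin_fTerm n), ← locSum_smul (W.locFin_hTerm _)]
    congr 1
    funext m
    unfold fTerm hTerm
    split_ifs
    · rw [lie_mul, W.aa, W.lie_a_sq, zero_mul, zero_add, mul_smul_comm,
        show n - m + k = n + k - m by ring]
    · rw [lie_mul, W.aa, W.lie_a_sq, mul_zero, add_zero, smul_mul_assoc,
        show n - m + k = n + k - m by ring]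
  have h2 : ⁅a k, locSum fun m => s (n - m) * b m⁆ = b (n + k) := by
    rw [lie_locSum (W.locFin_sb n), ← locSum_single (n + k) (b (n + k))]
    congr 1
    funext m
    rw [lie_mul, W.ab, W.as, mul_zero, add_zero]
    by_cases h : m = n + k
    · subst h; simp
    · rw [if_neg (by omega), if_neg h, zero_mul]
  rw [fOp, lie_add, lie_add, lie_neg, h1, h2, lie_smul, W.as, hOp, add_comm k n]
  split_ifs with h
  · have : (n : ℂ) = -k := by rw [eq_neg_iff_add_eq_zero]; exact_mod_cast h
    rw [this]; module
  · module

theorem lie_s_f (k n : ℤ) : ⁅s k, fOp a s b n⁆ = sqOp s (n + k) := by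
  have h1 : ⁅s k, locSum (fTerm a s n)⁆ = - sqOp s (n + k) := by
    rw [lie_locSum (W.locFin_fTerm n), ← locSum_single (-k) (-sqOp s (n + k))]
    congr 1
    funext m
    have h1 : ⁅s k, a m⁆ = if m = -k then -1 else 0 := by
      rw [W.sa]; congr 1; rw [eq_iff_iff]; omega
    unfold fTerm
    by_cases h : m = -k
    · rw [if_pos h] at h1 ⊢
      split_ifs <;> simp [lie_mul, W.lie_s_sq, h1] <;> rw [h, sub_neg_eq_add]
    · rw [if_neg h] at h1 ⊢
      split_ifs <;> simp [lie_mul, W.lie_s_sq, h1]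
  have h2 : ⁅s k, locSum fun m => s (n - m) * b m⁆ = 0 := by
    rw [lie_locSum (W.locFin_sb n)]
    ext v
    rw [locSum_apply ((W.locFin_sb n).lie _)]
    simp [lie_mul, W.ss, W.sb]
  rw [fOp, lie_add, lie_add, lie_neg, h1, h2, lie_smul, W.ss]
  simp

theorem lie_h_s (m k : ℤ) : ⁅hOp a s b m, s k⁆ = (-2 : ℂ) • s (m + k) := by
  rw [← lie_skew, W.lie_s_h, neg_smul]

theorem lie_h_a (m k : ℤ) : ⁅hOp a s b m, a k⁆ = (2 : ℂ) • a (m + k) := by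
  rw [← lie_skew, W.lie_a_h, neg_smul, neg_neg]

theorem lie_h_sq (m j : ℤ) : ⁅hOp a s b m, sqOp s j⁆ = (-4 : ℂ) • sqOp s (m + j) := by
  have h0 := W.locFin_sq (m + j)
  have h1 := h0.comp_injective (Equiv.addLeft m).injective
  have h2 : sqOp s (m + j) = locSum fun k => s (m + k) * s (j - k) := by
    rw [sqOp, ← locSum_comp_equiv _ (Equiv.addLeft m)]
    congr 1
    funext k
    rw [Equiv.coe_addLeft, show m + j - (m + k) = j - k by ring]
  have h3 : LocFin fun k => s (m + k) * s (j - k) := h1.congr fun k => by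
    rw [Equiv.coe_addLeft, show m + j - (m + k) = j - k by ring]
  have : (-4 : ℂ) • sqOp s (m + j) = (-2 : ℂ) • sqOp s (m + j) + (-2 : ℂ) • sqOp s (m + j) := by
    module
  rw [this]
  nth_rewrite 2 [h2]
  rw [sqOp, sqOp, lie_locSum (W.locFin_sq j), ← locSum_smul h0, ← locSum_smul h3,
    ← locSum_add (h0.smul fun _ => _) (h3.smul fun _ => _)]
  congr 1
  funext k
  rw [lie_mul, W.lie_h_s, W.lie_h_s, smul_mul_assoc, mul_smul_comm,
    show m + (j - k) = m + j - k by ring, add_comm]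

theorem lie_sq_f (j n : ℤ) : ⁅sqOp s j, fOp a s b n⁆ = (2 : ℂ) • cubeOp s (n + j) := by
  have h0 := W.locFin_cube (n + j)
  have h1 : ∀ k, sqOp s (n + k) * s (j - k) = s (j - k) * sqOp s (n + k) := fun k => by
    have := W.lie_s_sq (j - k) (n + k)
    rw [LieRing.of_associative_ring_bracket, sub_eq_zero] at this
    exact this.symm
  have h3 : ∀ k, s (Equiv.subLeft j k) * sqOp s (n + j - Equiv.subLeft j k) =
      s (j - k) * sqOp s (n + k) := fun k => by
    rw [Equiv.subLeft_apply, show n + j - (j - k) = n + k by ring]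
  have h4 : LocFin fun k => s (j - k) * sqOp s (n + k) :=
    (h0.comp_injective (Equiv.subLeft j).injective).congr h3
  have h5 : cubeOp s (n + j) = locSum fun k => s (j - k) * sqOp s (n + k) := by
    rw [cubeOp, ← locSum_comp_equiv _ (Equiv.subLeft j)]
    exact congrArg _ (funext h3)
  rw [two_smul]
  nth_rewrite 1 [h5]
  rw [cubeOp, ← locSum_add h4 h0, ← lie_skew, sqOp, lie_locSum (W.locFin_sq j),
    ← locSum_neg ((W.locFin_sq j).lie _)]
  congr 1
  funext k
  rw [lie_mul, ← lie_skew, ← lie_skew _ (s (j - k)), W.lie_s_f, W.lie_s_f, neg_mul, mul_neg, h1,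
    show n + (j - k) = n + j - k by ring]
  abel

/-! #### Vacuum expectation values -/

/-- An operator that commutes with the modes and has vanishing vacuum expectation values is
zero. -/
theorem eq_zero_of_comm {Φ : Module.End ℂ V} (ha : ∀ k, ⁅a k, Φ⁆ = 0) (hs : ∀ k, ⁅s k, Φ⁆ = 0)
    (hp : ∀ x, p (Φ (i x)) = 0) : Φ = 0 := by
  have ha' : ∀ k v, a k (Φ v) = Φ (a k v) := fun k v => by simpa using mul_apply_of_lie (ha k) v
  have hs' : ∀ k v, s k (Φ v) = Φ (s k v) := fun k v => by simpa using mul_apply_of_lie (hs k) v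
  have h1 : LinearMap.ker Φ = ⊤ := by
    refine W.gen _ ?_ (fun n v hv => ?_) (fun n v hv => ?_)
    · rintro _ ⟨x, rfl⟩
      -- The operator commutes with all modes, so it maps a vacuum vector to a vacuum vector. Such a
      -- vector is determined by its image under p, which is zero.
      rw [LinearMap.mem_ker, W.vac (Φ (i x)), hp, map_zero]
      · intro n hn; rw [ha', W.a_i n hn, map_zero]
      · rw [ha', W.a_zero_i, map_smul]
      · intro n hn; rw [hs', W.s_i n hn, map_zero]
    · rw [LinearMap.mem_ker] at hv ⊢; rw [← ha', hv, map_zero]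
    · rw [LinearMap.mem_ker] at hv ⊢; rw [← hs', hv, map_zero]
  exact LinearMap.ker_eq_top.mp h1

theorem a_i_nonneg {k : ℤ} (hk : 0 ≤ k) (x : X) : a k (i x) = (if k = 0 then lam else 0) • i x := by
  rcases hk.eq_or_lt with rfl | hk
  · simp [W.a_zero_i]
  · rw [W.a_i k hk, if_neg hk.ne', zero_smul]

theorem p_s_i (j : ℤ) (x : X) : p (s j (i x)) = 0 := by
  rcases le_or_gt j 0 with hj | hj
  · exact W.p_s j hj _
  · rw [W.s_i j hj, map_zero]

theorem p_s_s {v : V} (h : ∀ j > 0, ∀ k > 0, p (s j (s k v)) = 0) (j k : ℤ) :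
    p (s j (s k v)) = 0 := by
  rcases le_or_gt j 0 with hj | hj
  · exact W.p_s j hj _
  · rcases le_or_gt k 0 with hk | hk
    · rw [W.s_comm]; exact W.p_s k hk _
    · exact h j hj k hk

theorem p_s_s_i (j k : ℤ) (x : X) : p (s j (s k (i x))) = 0 :=
  W.p_s_s (fun j _ k hk => by rw [W.s_i k hk, map_zero, map_zero]) j k

theorem p_sq_of {v : V} (h : ∀ j k, p (s j (s k v)) = 0) (n : ℤ) : p (sqOp s n v) = 0 :=
  (W.locFin_sq n).mem_of (N := LinearMap.ker p) fun _ => h _ _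

theorem sq_i_mem (n k : ℤ) (x : X) : p (s k (sqOp s n (i x))) = 0 := by
  rw [W.s_sq_comm]
  refine W.p_sq_of (fun j l => ?_) n
  rcases le_or_gt k 0 with hk | hk
  · rw [W.s_comm l, W.s_comm j]; exact W.p_s k hk _
  · rw [W.s_i k hk]; simp

theorem p_hTerm_neg (n : ℤ) {k : ℤ} (hk : k < 0) (v : V) : p (hTerm a s n k v) = 0 := by
  rw [hTerm, if_pos hk]; exact W.p_a k hk _

theorem p_h (m : ℤ) (v : V) : p (hOp a s b m v) =
    (-2 : ℂ) • (∑ᶠ k, p (hTerm a s m k v)) + β m (p v) := by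
  rw [hOp, LinearMap.add_apply, map_add, LinearMap.smul_apply, map_smul, W.p_b,
    locSum_apply (W.locFin_hTerm m)]
  congr 2
  exact (LinearMap.toAddMonoidHom p).map_finsum (W.locFin_hTerm m v)

theorem p_h_of {v : V} (m : ℤ) (h : ∀ k ≥ 0, p (s (m - k) (a k v)) = 0) :
    p (hOp a s b m v) = β m (p v) := by
  rw [W.p_h, finsum_eq_zero_of_forall_eq_zero, smul_zero, zero_add]
  intro k
  rcases lt_or_ge k 0 with hk | hk
  · exact W.p_hTerm_neg m hk v
  · rw [hTerm, if_neg (by omega)]; exact h k hk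

theorem p_h_nonpos {m : ℤ} (hm : m ≤ 0) (v : V) : p (hOp a s b m v) = β m (p v) :=
  W.p_h_of m fun k hk => W.p_s _ (by omega) _

theorem p_h_i (m : ℤ) (x : X) : p (hOp a s b m (i x)) = β m x := by
  rw [W.p_h_of m fun k hk => by rw [W.a_i_nonneg hk, map_smul, map_smul, W.p_s_i, smul_zero],
    W.p_i]

theorem h_i_pos {n : ℤ} (hn : 0 < n) (x : X) : hOp a s b n (i x) = 0 := by
  rw [hOp, W.b_pos n hn, add_zero, LinearMap.smul_apply, locSum_apply (W.locFin_hTerm n),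
    finsum_eq_zero_of_forall_eq_zero, smul_zero]
  intro k
  rw [hTerm]
  split_ifs with hk
  · rw [Module.End.mul_apply, W.s_i _ (by omega), map_zero]
  · rw [Module.End.mul_apply, W.a_i_nonneg (by omega), map_smul]
    split_ifs with h0
    · rw [W.s_i _ (by omega), smul_zero]
    · rw [zero_smul]

theorem s_h_i {j : ℤ} (hj : 0 < j) (n : ℤ) (x : X) :
    s j (hOp a s b n (i x)) = (2 : ℂ) • s (n + j) (i x) := by
  rw [mul_apply_of_lie (W.lie_s_h j n), W.s_i j hj, map_zero, zero_add, LinearMap.smul_apply]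

theorem p_s_h_i (j n : ℤ) (x : X) : p (s j (hOp a s b n (i x))) = 0 := by
  rcases le_or_gt j 0 with hj | hj
  · exact W.p_s j hj _
  · rw [W.s_h_i hj, map_smul, W.p_s_i, smul_zero]

theorem p_s_s_h_i (j k n : ℤ) (x : X) : p (s j (s k (hOp a s b n (i x)))) = 0 :=
  W.p_s_s (fun j _ k hk => by rw [W.s_h_i hk, map_smul, map_smul, W.p_s_s_i, smul_zero]) j k

theorem s_f_i {j : ℤ} (hj : 0 < j) (n : ℤ) (x : X) :
    s j (fOp a s b n (i x)) = sqOp s (n + j) (i x) := by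
  rw [mul_apply_of_lie (W.lie_s_f j n), W.s_i j hj, map_zero, zero_add]

theorem p_s_f_i (j n : ℤ) (x : X) : p (s j (fOp a s b n (i x))) = 0 := by
  rcases le_or_gt j 0 with hj | hj
  · exact W.p_s j hj _
  · rw [W.s_f_i hj]; exact W.p_sq_of (fun _ _ => W.p_s_s_i _ _ _) _

theorem p_s_s_f_i (j k n : ℤ) (x : X) : p (s j (s k (fOp a s b n (i x)))) = 0 :=
  W.p_s_s (fun j _ k hk => by rw [W.s_f_i hk]; exact W.sq_i_mem _ _ _) j k

theorem p_s_a_i (j q : ℤ) (x : X) :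
    p (s j (a q (i x))) = if q < 0 ∧ q + j = 0 then -x else 0 := by
  rcases lt_or_ge q 0 with hq | hq
  · rw [mul_apply_of_lie (W.sa j q), map_add, W.p_a q hq, zero_add]
    by_cases h : q + j = 0
    · simp [h, hq, W.p_i]
    · simp [h]
  · rw [W.a_i_nonneg hq, map_smul, map_smul, W.p_s_i, smul_zero, if_neg (by omega)]

theorem p_s_s_a_i (j l q : ℤ) (x : X) : p (s j (s l (a q (i x)))) = 0 := by
  rcases lt_or_ge q 0 with hq | hq
  · refine W.p_s_s (fun j hj l hl => ?_) j l
    rw [mul_apply_of_lie (W.sa l q), W.s_i l hl, map_zero, zero_add]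
    have : (if q + l = 0 then (-1 : Module.End ℂ V) else 0) (i x) =
        (if q + l = 0 then (-1 : ℂ) else 0) • i x := by split_ifs <;> simp
    rw [this, map_smul, map_smul, W.p_s_i, smul_zero]
  · rw [W.a_i_nonneg hq]
    simp only [map_smul, W.p_s_s_i, smul_zero]

theorem a_h_i {k : ℤ} (hk : 0 ≤ k) (n : ℤ) (x : X) : a k (hOp a s b n (i x)) =
    (if k = 0 then lam else 0) • hOp a s b n (i x) + (-2 : ℂ) • a (n + k) (i x) := by
  rw [mul_apply_of_lie (W.lie_a_h k n), W.a_i_nonneg hk, map_smul, LinearMap.smul_apply]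

theorem a_f_i {k : ℤ} (hk : 0 ≤ k) (n : ℤ) (x : X) : a k (fOp a s b n (i x)) =
    (if k = 0 then lam else 0) • fOp a s b n (i x) + (hOp a s b (n + k) (i x) +
      (if n + k = 0 then -2 * k else 0 : ℂ) • i x) := by
  rw [mul_apply_of_lie (W.lie_a_f k n), W.a_i_nonneg hk, map_smul, LinearMap.add_apply,
    LinearMap.smul_apply, Module.End.one_apply]

/-- A term of f(m) has on its left either a mode a(k) with k < 0, which p annihilates, or modes s.
So only words with one or two s on the left need to be tested. -/
theorem p_f_of {v : V} (h1 : ∀ j l, ∀ k ≥ 0, p (s j (s l (a k v))) = 0)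
    (h2 : ∀ j, p (s j v) = 0) (m : ℤ) : p (fOp a s b m v) = 0 := by
  have e1 : p (locSum (fTerm a s m) v) = 0 :=
    (W.locFin_fTerm m).mem_of (N := LinearMap.ker p) fun k => by
      rw [LinearMap.mem_ker, fTerm]
      split_ifs with hk
      · exact W.p_a k hk _
      · exact W.p_sq_of (fun j l => h1 j l k (by omega)) _
  have e2 : p (locSum (fun k => s (m - k) * b k) v) = 0 :=
    (W.locFin_sb m).mem_of (N := LinearMap.ker p) fun k => by
      rw [LinearMap.mem_ker, Module.End.mul_apply, W.s_b_comm, W.p_b, h2, map_zero]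
  rw [fOp, LinearMap.add_apply, LinearMap.add_apply, LinearMap.neg_apply, LinearMap.smul_apply,
    map_add, map_add, map_neg, map_smul, e1, e2, h2]
  simp

theorem p_f_i (n : ℤ) (x : X) : p (fOp a s b n (i x)) = 0 :=
  W.p_f_of (fun j l k hk => by
    rw [W.a_i_nonneg hk, map_smul, map_smul, map_smul, W.p_s_s_i, smul_zero]) (W.p_s_i · x) n

theorem p_f_h_i (m n : ℤ) (x : X) : p (fOp a s b m (hOp a s b n (i x))) = 0 :=
  W.p_f_of (fun j l k hk => by
    rw [W.a_h_i hk]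
    simp only [map_add, map_smul, W.p_s_s_h_i, W.p_s_s_a_i, smul_zero, add_zero])
    (W.p_s_h_i · n x) m

theorem p_f_f_i (m n : ℤ) (x : X) : p (fOp a s b m (fOp a s b n (i x))) = 0 :=
  W.p_f_of (fun j l k hk => by
    rw [W.a_f_i hk]
    simp only [map_add, map_smul, W.p_s_s_f_i, W.p_s_s_h_i, W.p_s_s_i, smul_zero, add_zero])
    (W.p_s_f_i · n x) m

theorem p_h_f_i (m n : ℤ) (x : X) : p (hOp a s b m (fOp a s b n (i x))) = 0 := by
  rw [W.p_h_of m, W.p_f_i, map_zero]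
  intro k hk
  rw [W.a_f_i hk]
  simp only [map_add, map_smul, W.p_s_f_i, W.p_s_h_i, W.p_s_i, smul_zero, add_zero]

/-- For m + n = 0 the index k contributes exactly when 0 ≤ k < m: contracting s(m-k) with a(n+k)
needs n + k < 0. Each contribution is 2x, and the factor -2 in `hOp` gives -4m; for m ≤ 0 there is
none, whence `toNat`. -/
theorem p_h_h_i (m n : ℤ) (x : X) : p (hOp a s b m (hOp a s b n (i x))) =
    (if m + n = 0 then -4 * (m.toNat : ℂ) else 0) • x + β m (β n x) := by
  have key : ∀ k ≥ 0, p (s (m - k) (a k (hOp a s b n (i x)))) =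
      if n + k < 0 ∧ m + n = 0 then (2 : ℂ) • x else 0 := fun k hk => by
    rw [W.a_h_i hk]
    simp only [map_add, map_smul, W.p_s_h_i, smul_zero, zero_add, W.p_s_a_i]
    rw [show n + k + (m - k) = m + n by ring]
    split_ifs <;> simp
  by_cases hmn : m + n = 0
  · rw [W.p_h, if_pos hmn, W.p_h_i]
    congr 1
    have : ∀ k, p (hTerm a s m k (hOp a s b n (i x))) =
        if k ∈ Finset.Ico 0 m then (2 : ℂ) • x else 0 := fun k => by
      rcases lt_or_ge k 0 with hk | hk
      · rw [W.p_hTerm_neg m hk, if_neg (by simp; omega)]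
      · rw [hTerm, if_neg (by omega), Module.End.mul_apply, key k hk]
        simp only [Finset.mem_Ico, hmn, and_true]
        congr 1
        rw [eq_iff_iff]; omega
    simp only [this]
    rw [finsum_eq_finsetSum_of_support_subset (s := Finset.Ico 0 m)]
    · rw [Finset.sum_congr rfl fun k hk => if_pos hk, Finset.sum_const, Int.card_Ico, sub_zero,
        ← Nat.cast_smul_eq_nsmul ℂ, smul_smul, smul_smul]
      congr 1; ring
    · intro k hk
      by_contra hc
      exact hk (if_neg fun h => hc h)
  · rw [W.p_h_of m, if_neg hmn, zero_smul, zero_add, W.p_h_i]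
    intro k hk
    rw [key k hk, if_neg (fun h => hmn h.2)]

/-! #### The relations of the affine algebra -/

theorem β_comm (m n : ℤ) (x : X) : β m (β n x) = β n (β m x) := by
  have h := mul_apply_of_lie (W.bb m n) (i x)
  rw [W.b_i, W.b_i, W.b_i, W.b_i, LinearMap.zero_apply, add_zero] at h
  simpa only [W.p_i] using congrArg p h

/-- The difference of the two sides commutes with all a(k), s(k) by the Jacobi identity and has zero
vacuum expectation, so it vanishes by `eq_zero_of_comm`. `lie_h_f` and `lie_f_f` follow in the same
way, each using the one before, so that no product of two infinite sums has to be reordered. -/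
theorem lie_h_h (m n : ℤ) :
    ⁅hOp a s b m, hOp a s b n⁆ = (if m + n = 0 then -4 * (m : ℂ) else 0) • 1 := by
  rw [← sub_eq_zero]
  refine W.eq_zero_of_comm (fun k => ?_) (fun k => ?_) fun x => ?_
  · rw [lie_sub, lie_smul, lie_one, leibniz_lie, W.lie_a_h, W.lie_a_h, smul_lie, lie_smul, W.lie_h_a,
      W.lie_a_h, show m + (n + k) = n + (m + k) by ring]
    module
  · rw [lie_sub, lie_smul, lie_one, leibniz_lie, W.lie_s_h, W.lie_s_h, smul_lie, lie_smul, W.lie_h_s,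
      W.lie_s_h, show m + (n + k) = n + (m + k) by ring]
    module
  · rw [LieRing.of_associative_ring_bracket]
    simp only [LinearMap.sub_apply, Module.End.mul_apply, map_sub, LinearMap.smul_apply,
      Module.End.one_apply, map_smul, W.p_h_h_i, W.p_i]
    rw [W.β_comm n m, add_comm n m]
    split_ifs with h
    -- Here n = -m, and the positive parts of m and -m differ by m.
    · have h1 : (n.toNat : ℤ) = m.toNat - m := by omega
      have h2 : (n.toNat : ℂ) = m.toNat - m := by exact_mod_cast congrArg (Int.cast (R := ℂ)) h1
      rw [h2]; module
    · module

theorem lie_h_f (m n : ℤ) :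
    ⁅hOp a s b m, fOp a s b n⁆ = (-2 : ℂ) • fOp a s b (m + n) := by
  rw [← sub_eq_zero]
  refine W.eq_zero_of_comm (fun k => ?_) (fun k => ?_) fun x => ?_
  · rw [lie_sub, lie_smul, leibniz_lie, W.lie_a_h, W.lie_a_f, W.lie_a_f, smul_lie, lie_add,
      lie_smul, lie_one, W.lie_a_f, W.lie_h_h, show n + (m + k) = m + n + k by ring,
      show m + (n + k) = m + n + k by ring]
    rw [smul_zero]
    split_ifs with h
    · push_cast; module
    · module
  · rw [lie_sub, lie_smul, leibniz_lie, W.lie_s_h, W.lie_s_f, W.lie_s_f, smul_lie, W.lie_s_f,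
      W.lie_h_sq, show n + (m + k) = m + n + k by ring,
      show m + (n + k) = m + n + k by ring]
    module
  · rw [LieRing.of_associative_ring_bracket]
    simp [W.p_h_f_i, W.p_f_h_i, W.p_f_i]

theorem lie_f_f (m n : ℤ) : ⁅fOp a s b m, fOp a s b n⁆ = 0 := by
  refine W.eq_zero_of_comm (fun k => ?_) (fun k => ?_) fun x => ?_
  · have h1 : ⁅(1 : Module.End ℂ V), fOp a s b n⁆ = 0 := by rw [← lie_skew, lie_one, neg_zero]
    have h2 : ⁅fOp a s b m, hOp a s b (n + k)⁆ = (2 : ℂ) • fOp a s b (n + k + m) := by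
      rw [← lie_skew, W.lie_h_f, neg_smul, neg_neg]
    rw [leibniz_lie, W.lie_a_f, W.lie_a_f, add_lie, lie_add, smul_lie, lie_smul, lie_one, h1, h2,
      W.lie_h_f, show m + k + n = n + k + m by ring, smul_zero, smul_zero]
    module
  · have h2 : ⁅fOp a s b m, sqOp s (n + k)⁆ = (-2 : ℂ) • cubeOp s (m + (n + k)) := by
      rw [← lie_skew, W.lie_sq_f, neg_smul]
    rw [leibniz_lie, W.lie_s_f, W.lie_s_f, W.lie_sq_f, h2,
      show n + (m + k) = m + (n + k) by ring]
    module
  · rw [LieRing.of_associative_ring_bracket]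
    simp [W.p_f_f_i]

/-! #### The derivation -/

variable {D : Module.End ℂ V} (ha : ∀ n, ⁅D, a n⁆ = (n : ℂ) • a n)
  (hs : ∀ n, ⁅D, s n⁆ = (n : ℂ) • s n) (hb : ∀ n, ⁅D, b n⁆ = (n : ℂ) • b n)
include ha hs hb

theorem lie_D_h (n : ℤ) : ⁅D, hOp a s b n⁆ = (n : ℂ) • hOp a s b n := by
  have h := W.locFin_hTerm n
  rw [hOp, lie_add, lie_smul, lie_locSum h, hb, smul_add, smul_comm, ← locSum_smul h]
  congr 3
  funext k
  unfold hTerm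
  split_ifs
  · rw [lie_mul, ha, hs, smul_mul_assoc, mul_smul_comm]; push_cast; module
  · rw [lie_mul, ha, hs, smul_mul_assoc, mul_smul_comm]; push_cast; module

omit ha hb in
theorem lie_D_sq (n : ℤ) : ⁅D, sqOp s n⁆ = (n : ℂ) • sqOp s n := by
  have h := W.locFin_sq n
  rw [sqOp, lie_locSum h, ← locSum_smul h]
  congr 1
  funext k
  rw [lie_mul, hs, hs, smul_mul_assoc, mul_smul_comm]; push_cast; module

theorem lie_D_f (n : ℤ) : ⁅D, fOp a s b n⁆ = (n : ℂ) • fOp a s b n := by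
  have h := W.locFin_fTerm n
  have h' := W.locFin_sb n
  have e1 : ⁅D, locSum (fTerm a s n)⁆ = (n : ℂ) • locSum (fTerm a s n) := by
    rw [lie_locSum h, ← locSum_smul h]
    congr 1
    funext k
    unfold fTerm
    split_ifs
    · rw [lie_mul, ha, W.lie_D_sq hs, smul_mul_assoc, mul_smul_comm]; push_cast; module
    · rw [lie_mul, ha, W.lie_D_sq hs, smul_mul_assoc, mul_smul_comm]; push_cast; module
  have e2 : ⁅D, locSum fun k => s (n - k) * b k⁆ = (n : ℂ) • locSum fun k => s (n - k) * b k := by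
    rw [lie_locSum h', ← locSum_smul h']
    congr 1
    funext k
    rw [lie_mul, hb, hs, smul_mul_assoc, mul_smul_comm]; push_cast; module
  rw [fOp, lie_add, lie_add, lie_neg, e1, e2, lie_smul, hs]
  module

end WeylSystem

end WeylSystem

end

end WhittakerSl2

namespace WhittakerSl2

noncomputable section

/-! ### Representations at the critical level from their modes -/

section AffineModes

variable {V : Type*} [AddCommGroup V] [Module ℂ V]

/-- The relations of the affine algebra at the critical level, with a derivation. -/
structure AffineModes (E H F : ℤ → Module.End ℂ V) (D : Module.End ℂ V) : Prop where
  ee : ∀ m n, ⁅E m, E n⁆ = 0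
  he : ∀ m n, ⁅H m, E n⁆ = (2 : ℂ) • E (m + n)
  hh : ∀ m n, ⁅H m, H n⁆ = (if m + n = 0 then -4 * (m : ℂ) else 0) • 1
  hf : ∀ m n, ⁅H m, F n⁆ = (-2 : ℂ) • F (m + n)
  ef : ∀ m n, ⁅E m, F n⁆ = H (m + n) + (if m + n = 0 then -2 * (m : ℂ) else 0) • 1
  ff : ∀ m n, ⁅F m, F n⁆ = 0
  de : ∀ n, ⁅D, E n⁆ = (n : ℂ) • E n
  dh : ∀ n, ⁅D, H n⁆ = (n : ℂ) • H n
  df : ∀ n, ⁅D, F n⁆ = (n : ℂ) • F n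

variable (E H F : ℤ → Module.End ℂ V)

/-- The matrix entries of an element of `sl₂`. -/
def sl2Entry (a b : Fin 2) : Sl2 →ₗ[ℂ] ℂ :=
  (Matrix.entryLinearMap ℂ ℂ a b).comp (Submodule.subtype _)

/-- The operator of `x(n)`. -/
def curOp (n : ℤ) : Sl2 →ₗ[ℂ] Module.End ℂ V :=
  (sl2Entry 0 1).smulRight (E n) + (sl2Entry 0 0).smulRight (H n) + (sl2Entry 1 0).smulRight (F n)

theorem curOp_apply (n : ℤ) (x : Sl2) :
    curOp E H F n x = x.val 0 1 • E n + x.val 0 0 • H n + x.val 1 0 • F n := rfl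

/-- The operator of an element of the loop algebra. -/
def loopOp : LoopSl2 →ₗ[ℂ] Module.End ℂ V := Finsupp.lsum ℂ (curOp E H F)

theorem loopOp_single (n : ℤ) (x : Sl2) :
    loopOp E H F (Finsupp.single n x) = curOp E H F n x := by
  simp [loopOp]

variable {E H F} {D : Module.End ℂ V}

theorem sl2_val_one_one (x : Sl2) : x.val 1 1 = - x.val 0 0 := by
  have ht : Matrix.trace x.val = 0 := LinearMap.mem_ker.mp x.2
  rw [Matrix.trace_fin_two] at ht
  exact eq_neg_of_add_eq_zero_right ht

theorem AffineModes.curOp_lie (R : AffineModes E H F D) (m n : ℤ) (x y : Sl2) :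
    ⁅curOp E H F m x, curOp E H F n y⁆ = curOp E H F (m + n) ⁅x, y⁆ +
      (if m + n = 0 then -2 * (m : ℂ) * form x y else 0) • 1 := by
  have eh : ⁅E m, H n⁆ = (-2 : ℂ) • E (m + n) := by
    rw [← lie_skew, R.he, add_comm n m, neg_smul]
  have fh : ⁅F m, H n⁆ = (2 : ℂ) • F (m + n) := by
    rw [← lie_skew, R.hf, add_comm n m, neg_smul, neg_neg]
  have fe : ⁅F m, E n⁆ = - H (m + n) + (if m + n = 0 then -2 * (m : ℂ) else 0) • 1 := by
    rw [← lie_skew, R.ef, add_comm n m, neg_add]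
    congr 1
    split_ifs with h
    · have : (n : ℂ) = - m := by rw [eq_neg_iff_add_eq_zero, add_comm]; exact_mod_cast h
      rw [this]; module
    · simp
  have hval : ⁅x, y⁆.val = x.val * y.val - y.val * x.val := rfl
  have hform : form x y = 2 * (x.val 0 0 * y.val 0 0) + x.val 0 1 * y.val 1 0 +
      x.val 1 0 * y.val 0 1 := by
    change Matrix.trace (x.val * y.val) = _
    rw [Matrix.trace_fin_two, Matrix.mul_apply, Matrix.mul_apply, Fin.sum_univ_two,
      Fin.sum_univ_two, sl2_val_one_one x, sl2_val_one_one y]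
    ring
  simp only [curOp_apply, add_lie, lie_add, smul_lie, lie_smul, R.ee, R.he, R.hh, R.hf, R.ef, R.ff,
    eh, fh, fe, hval, Matrix.sub_apply, Matrix.mul_apply, Fin.sum_univ_two, sl2_val_one_one, hform,
    smul_zero]
  split_ifs <;> module

theorem AffineModes.loopOp_lie (R : AffineModes E H F D) (x y : LoopSl2) :
    ⁅loopOp E H F x, loopOp E H F y⁆ = loopOp E H F (loopBr x y) +
      (-2 * loopCocycle x y) • 1 := by
  induction x using Finsupp.induction_linear with
  | zero => simp
  | add x x' hx hx' =>
    simp only [map_add, add_lie, LinearMap.add_apply, hx, hx', mul_add, add_smul]; abel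
  | single n a =>
    induction y using Finsupp.induction_linear with
    | zero => simp
    | add y y' hy hy' => simp only [map_add, lie_add, hy, hy', mul_add, add_smul]; abel
    | single m b =>
      rw [loopBr_single, loopCocycle_single, loopOp_single, loopOp_single, loopOp_single,
        R.curOp_lie]
      split_ifs
      · rw [mul_assoc]
      · rw [mul_zero]

theorem AffineModes.der_loopOp (R : AffineModes E H F D) (x : LoopSl2) :
    ⁅D, loopOp E H F x⁆ = loopOp E H F (loopD x) := by
  induction x using Finsupp.induction_linear with
  | zero => simp
  | add x x' hx hx' => simp only [map_add, lie_add, hx, hx']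
  | single n a =>
    rw [loopD_single, map_smul, loopOp_single, curOp_apply, lie_add, lie_add, lie_smul, lie_smul,
      lie_smul, R.de, R.dh, R.df]
    module

/-- The representation of the affine algebra at the critical level with given modes. -/
def affineRep (R : AffineModes E H F D) : AffTilde →ₗ⁅ℂ⁆ Module.End ℂ V where
  toFun X := loopOp E H F X.1 + (-2 * X.2.1) • 1 + X.2.2 • D
  map_add' X Y := by
    change loopOp E H F (X.1 + Y.1) + (-2 * (X.2.1 + Y.2.1)) • (1 : Module.End ℂ V) +
      (X.2.2 + Y.2.2) • D = _
    rw [map_add]; module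
  map_smul' t X := by
    change loopOp E H F (t • X.1) + (-2 * (t * X.2.1)) • (1 : Module.End ℂ V) + (t * X.2.2) • D = 
      t • (loopOp E H F X.1 + (-2 * X.2.1) • 1 + X.2.2 • D)
    rw [map_smul]; module
  map_lie' {X Y} := by
    change loopOp E H F (loopBr X.1 Y.1 + X.2.2 • loopD Y.1 - Y.2.2 • loopD X.1) +
      (-2 * loopCocycle X.1 Y.1) • (1 : Module.End ℂ V) + (0 : ℂ) • D =
      ⁅loopOp E H F X.1 + (-2 * X.2.1) • 1 + X.2.2 • D,
        loopOp E H F Y.1 + (-2 * Y.2.1) • 1 + Y.2.2 • D⁆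
    have h1 : ∀ A : Module.End ℂ V, ⁅(1 : Module.End ℂ V), A⁆ = 0 := fun A => by
      rw [← lie_skew, lie_one, neg_zero]
    rw [map_sub, map_add, map_smul, map_smul]
    simp only [add_lie, lie_add, smul_lie, lie_smul, h1, lie_one, lie_self, R.loopOp_lie,
      R.der_loopOp, smul_zero, add_zero]
    rw [← lie_skew, R.der_loopOp]
    module

variable (R : AffineModes E H F D)

theorem affineRep_cur (x : Sl2) (n : ℤ) : affineRep R (cur x n) = curOp E H F n x := by
  change loopOp E H F (Finsupp.single n x) + (-2 * 0 : ℂ) • 1 + (0 : ℂ) • D = _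
  rw [loopOp_single]; simp

theorem affineRep_e (n : ℤ) : affineRep R (cur e0 n) = E n := by
  rw [affineRep_cur, curOp_apply, e0_val]
  simp

theorem affineRep_h (n : ℤ) : affineRep R (cur h0 n) = H n := by
  rw [affineRep_cur, curOp_apply, h0_val]
  simp

theorem affineRep_f (n : ℤ) : affineRep R (cur f0 n) = F n := by
  rw [affineRep_cur, curOp_apply, f0_val]
  simp

theorem affineRep_cen : affineRep R cen = (-2 : ℂ) • 1 := by
  change loopOp E H F 0 + (-2 * 1 : ℂ) • (1 : Module.End ℂ V) + (0 : ℂ) • D = _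
  simp

theorem affineRep_der : affineRep R der = D := by
  change loopOp E H F 0 + (-2 * 0 : ℂ) • (1 : Module.End ℂ V) + (1 : ℂ) • D = _
  simp

theorem isCritical_affineRep (hE : ∀ v, ∃ N : ℤ, ∀ n ≥ N, E n v = 0)
    (hH : ∀ v, ∃ N : ℤ, ∀ n ≥ N, H n v = 0) (hF : ∀ v, ∃ N : ℤ, ∀ n ≥ N, F n v = 0) :
    IsCritical ((affineRep R).comp AffHat.incl) where
  level := affineRep_cen R
  restricted v x := by
    obtain ⟨N, hN⟩ := hE v
    obtain ⟨N', hN'⟩ := hH v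
    obtain ⟨N'', hN''⟩ := hF v
    refine ⟨max N (max N' N''), fun n hn => ?_⟩
    change affineRep R (cur x n) v = 0
    rw [affineRep_cur, curOp_apply]
    simp only [ge_iff_le, max_le_iff] at hn
    simp [hN n hn.1, hN' n hn.2.1, hN'' n hn.2.2]

end AffineModes

/-! ### The free field module as a module over the affine algebra -/

namespace WeylSystem

variable {V X : Type*} [AddCommGroup V] [Module ℂ V] [AddCommGroup X] [Module ℂ X]
  {lam : ℂ} {a s b : ℤ → Module.End ℂ V} {i : X →ₗ[ℂ] V} {p : V →ₗ[ℂ] X}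
  {β : ℤ → Module.End ℂ X} {D : Module.End ℂ V}

variable (W : WeylSystem lam a s b i p β)
include W

theorem affineModes (ha : ∀ n, ⁅D, a n⁆ = (n : ℂ) • a n) (hs : ∀ n, ⁅D, s n⁆ = (n : ℂ) • s n)
    (hb : ∀ n, ⁅D, b n⁆ = (n : ℂ) • b n) : AffineModes a (hOp a s b) (fOp a s b) D where
  ee := W.aa
  he := W.lie_h_a
  hh := W.lie_h_h
  hf := W.lie_h_f
  ef m n := by
    rw [W.lie_a_f, add_comm n m]
  ff := W.lie_f_f
  de := ha
  dh := W.lie_D_h ha hs hb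
  df := W.lie_D_f ha hs hb

end WeylSystem

end

end WhittakerSl2

namespace WhittakerSl2

noncomputable section

/-! ### Whittaker vectors and Sugawara operators of the free field module -/

namespace WeylSystem

variable {V X : Type*} [AddCommGroup V] [Module ℂ V] [AddCommGroup X] [Module ℂ X]
  {lam : ℂ} {a s b : ℤ → Module.End ℂ V} {i : X →ₗ[ℂ] V} {p : V →ₗ[ℂ] X}
  {β : ℤ → Module.End ℂ X} {D : Module.End ℂ V}

variable (W : WeylSystem lam a s b i p β)
include W

/-- A property of local vanishing that holds on the vacuum vectors and is preserved by the modes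
holds everywhere. -/
theorem loc_of {A : ℤ → Module.End ℂ V} (hi : ∀ x, ∃ N : ℤ, ∀ n ≥ N, A n (i x) = 0)
    (ha : ∀ k v, ∃ N : ℤ, ∀ n ≥ N, ⁅a k, A n⁆ v = 0)
    (hs : ∀ k v, ∃ N : ℤ, ∀ n ≥ N, ⁅s k, A n⁆ v = 0) (v : V) : ∃ N : ℤ, ∀ n ≥ N, A n v = 0 := by
  let S : Submodule ℂ V :=
    { carrier := {v | ∃ N : ℤ, ∀ n ≥ N, A n v = 0}
      zero_mem' := ⟨0, fun n _ => map_zero _⟩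
      add_mem' := by
        rintro v w ⟨N, hN⟩ ⟨N', hN'⟩
        refine ⟨max N N', fun n hn => ?_⟩
        rw [map_add, hN n (le_trans (le_max_left _ _) hn), hN' n (le_trans (le_max_right _ _) hn),
          add_zero]
      smul_mem' := by
        rintro t v ⟨N, hN⟩
        exact ⟨N, fun n hn => by rw [map_smul, hN n hn, smul_zero]⟩ }
  have key : ∀ (B : Module.End ℂ V) (v : V), (∃ N : ℤ, ∀ n ≥ N, ⁅B, A n⁆ v = 0) → v ∈ S →
      B v ∈ S := by
    rintro B v ⟨N, hN⟩ ⟨N', hN'⟩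
    refine ⟨max N N', fun n hn => ?_⟩
    have h1 := mul_apply_of_lie (A := B) (B := A n) rfl v
    rw [hN n (le_trans (le_max_left _ _) hn), hN' n (le_trans (le_max_right _ _) hn), map_zero,
      add_zero] at h1
    exact h1.symm
  have : S = ⊤ := W.gen S (by rintro _ ⟨x, rfl⟩; exact hi x) (fun k v => key _ _ (ha k v))
    (fun k v => key _ _ (hs k v))
  exact (this ▸ Submodule.mem_top : v ∈ S)

omit W [AddCommGroup X] [Module ℂ X] in
theorem loc_shift {A : ℤ → Module.End ℂ V} (hA : ∀ v, ∃ N : ℤ, ∀ n ≥ N, A n v = 0) (k : ℤ)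
    (v : V) : ∃ N : ℤ, ∀ n ≥ N, A (n + k) v = 0 := by
  obtain ⟨N, hN⟩ := hA v
  exact ⟨N - k, fun n hn => hN _ (by omega)⟩

theorem loc_h : ∀ v, ∃ N : ℤ, ∀ n ≥ N, hOp a s b n v = 0 := by
  refine W.loc_of (fun x => ⟨1, fun n hn => W.h_i_pos (by omega) x⟩) (fun k v => ?_) fun k v => ?_
  · obtain ⟨N, hN⟩ := loc_shift W.loc_a k v
    exact ⟨N, fun n hn => by rw [W.lie_a_h, LinearMap.smul_apply, hN n hn, smul_zero]⟩
  · obtain ⟨N, hN⟩ := loc_shift W.loc_s k v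
    exact ⟨N, fun n hn => by rw [W.lie_s_h, LinearMap.smul_apply, hN n hn, smul_zero]⟩

theorem sq_i_pos {n : ℤ} (hn : 0 < n) (x : X) : sqOp s n (i x) = 0 := by
  rw [sqOp, locSum_apply (W.locFin_sq n)]
  refine finsum_eq_zero_of_forall_eq_zero fun k => ?_
  rw [Module.End.mul_apply]
  by_cases hk : 0 < k
  · rw [W.s_comm, W.s_i k hk, map_zero]
  · rw [W.s_i _ (by omega), map_zero]

theorem f_i_pos {n : ℤ} (hn : 0 < n) (x : X) : fOp a s b n (i x) = 0 := by
  have h1 : locSum (fTerm a s n) (i x) = 0 := by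
    rw [locSum_apply (W.locFin_fTerm n)]
    refine finsum_eq_zero_of_forall_eq_zero fun k => ?_
    rw [fTerm]
    split_ifs with hk
    · rw [Module.End.mul_apply, W.sq_i_pos (by omega), map_zero]
    · rw [Module.End.mul_apply, W.a_i_nonneg (by omega), map_smul]
      split_ifs with h0
      · rw [W.sq_i_pos (by omega), smul_zero]
      · rw [zero_smul]
  have h2 : locSum (fun k => s (n - k) * b k) (i x) = 0 := by
    rw [locSum_apply (W.locFin_sb n)]
    refine finsum_eq_zero_of_forall_eq_zero fun k => ?_
    rw [Module.End.mul_apply]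
    rcases le_or_gt k 0 with hk | hk
    · rw [W.b_i, W.s_i _ (by omega)]
    · rw [W.b_pos k hk, LinearMap.zero_apply, map_zero]
  rw [fOp, LinearMap.add_apply, LinearMap.add_apply, LinearMap.neg_apply, LinearMap.smul_apply, h1,
    h2, W.s_i n hn]
  simp

theorem loc_f : ∀ v, ∃ N : ℤ, ∀ n ≥ N, fOp a s b n v = 0 := by
  refine W.loc_of (fun x => ⟨1, fun n hn => W.f_i_pos (by omega) x⟩) (fun k v => ?_) fun k v => ?_
  · obtain ⟨N, hN⟩ := loc_shift W.loc_h k v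
    refine ⟨max N (-k + 1), fun n hn => ?_⟩
    rw [ge_iff_le, max_le_iff] at hn
    rw [W.lie_a_f, if_neg (by omega), zero_smul, add_zero, hN n hn.1]
  · obtain ⟨N, hN⟩ := loc_shift W.sqOp_eq_zero k v
    exact ⟨N, fun n hn => by rw [W.lie_s_f, hN n hn]⟩

/-- The counterpart for s(n) of the triangular formula for f(n): as a(0) = lam ≠ 0 in the
applications, s(n)v can be recovered from h(n)v, b(n)v and the s(m)v with m > n. -/
theorem h_of_whit {v : V} (h0 : a 0 v = lam • v) (ha : ∀ k > 0, a k v = 0) (n : ℤ) :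
    hOp a s b n v = (-2 : ℂ) • (lam • s n v + ∑ᶠ k : ℤ, if k < 0 then a k (s (n - k) v) else 0) +
      b n v := by
  have h1 : (∑ᶠ k : ℤ, if k = 0 then lam • s n v else 0) = lam • s n v := by
    rw [finsum_eq_single _ 0 fun k hk => if_neg hk, if_pos rfl]
  have h2 : (Function.support fun k : ℤ => if k = 0 then lam • s n v else 0).Finite :=
    (Set.finite_singleton 0).subset fun k hk => by
      by_contra h
      exact hk (if_neg h)
  have h3 : (Function.support fun k : ℤ => if k < 0 then a k (s (n - k) v) else 0).Finite :=
    (W.locFin_hTerm n v).subset fun k hk => by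
      simp only [Function.mem_support, hTerm] at hk ⊢
      split_ifs at hk ⊢ with h
      · exact hk
      · exact absurd rfl hk
  rw [hOp, LinearMap.add_apply, LinearMap.smul_apply, locSum_apply (W.locFin_hTerm n)]
  nth_rewrite 1 [← h1]
  rw [← finsum_add_distrib h2 h3]
  congr 2
  refine finsum_congr fun k => ?_
  rw [hTerm]
  rcases lt_trichotomy k 0 with h | rfl | h
  · rw [if_pos h, if_pos h, if_neg h.ne, zero_add, Module.End.mul_apply]
  · simp [h0]
  · rw [if_neg h.not_gt, if_neg h.ne', if_neg h.not_gt, Module.End.mul_apply, ha k h]; simp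

theorem range_le_whit : LinearMap.range i ≤ whittakerVectors a (hOp a s b) lam := by
  rintro _ ⟨x, rfl⟩
  exact ⟨W.a_zero_i x, fun n hn => ⟨W.a_i n hn x, W.h_i_pos hn x⟩⟩

/-- Downward induction in the triangular formula of `h_of_whit` shows s(n)v = 0 for n > 0, since
h(n)v = 0 and b(n) = 0 there. So v is a vacuum vector. -/
theorem eq_of_whit (hlam : lam ≠ 0) {v : V} (hv : v ∈ whittakerVectors a (hOp a s b) lam) :
    v = i (p v) := by
  refine W.vac v (fun n hn => (hv.2 n hn).1) hv.1 ?_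
  obtain ⟨N, hN⟩ := W.loc_s v
  refine Int.downward_induction (P := fun n => n > 0 → s n v = 0) N (fun n hn _ => hN n hn)
    fun n ih hn => ?_
  have h1 := W.h_of_whit hv.1 (fun k hk => (hv.2 k hk).1) n
  rw [(hv.2 n hn).2, W.b_pos n hn, LinearMap.zero_apply, add_zero,
    finsum_eq_zero_of_forall_eq_zero, add_zero] at h1
  · simpa [hlam] using h1
  · intro k
    split_ifs with hk
    · rw [ih (n - k) (by omega) (by omega), map_zero]
    · rfl

/-- The triangular formula puts s(j)(i x) into the span of words in a and h. The commutators of s(j)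
with a(k) and h(k) extend stability under s to the whole span, and a and s generate everything. -/
theorem borelSpan_eq_top (hlam : lam ≠ 0) :
    borelSpan a (hOp a s b) (LinearMap.range i) = ⊤ := by
  set S := borelSpan a (hOp a s b) (LinearMap.range i) with hS
  have hSa : StableUnder a S := borelSpan_stable_e
  have hSh : StableUnder (hOp a s b) S := borelSpan_stable_h
  have hi : ∀ x, i x ∈ S := fun x => le_borelSpan ⟨x, rfl⟩
  have base : ∀ x j, s j (i x) ∈ S := fun x j => by
    refine Int.downward_induction (P := fun j => s j (i x) ∈ S) 1
      (fun n hn => by rw [W.s_i n (by omega)]; exact S.zero_mem) (fun n ih => ?_) j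
    have h1 := W.h_of_whit (W.a_zero_i x) (fun k hk => W.a_i k hk x) n
    have h2 : (∑ᶠ k : ℤ, if k < 0 then a k (s (n - k) (i x)) else 0) ∈ S := by
      refine finsum_induction (fun y => y ∈ S) S.zero_mem (fun _ _ => S.add_mem) fun k => ?_
      split_ifs with hk
      · exact hSa k _ (ih _ (by omega))
      · exact S.zero_mem
    have h3 : s n (i x) = (-(2 * lam)⁻¹) • (hOp a s b n (i x) - b n (i x) +
        (2 : ℂ) • (∑ᶠ k : ℤ, if k < 0 then a k (s (n - k) (i x)) else 0)) := by
      rw [h1]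
      match_scalars <;> field_simp <;> ring
    rw [h3, W.b_i]
    exact S.smul_mem _ (S.add_mem (S.sub_mem (hSh n _ (hi x)) (hi _)) (S.smul_mem _ h2))
  have H : S ≤ S ⊓ ⨅ j, S.comap (s j) := by
    refine borelSpan_le (le_inf le_borelSpan ?_) (fun k v hv => ?_) fun k v hv => ?_
    · rintro _ ⟨x, rfl⟩
      exact Submodule.mem_iInf _ |>.mpr fun j => base x j
    · refine ⟨hSa k v hv.1, Submodule.mem_iInf _ |>.mpr fun j => ?_⟩
      rw [Submodule.mem_comap, mul_apply_of_lie (W.sa j k)]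
      refine S.add_mem (hSa k _ (Submodule.mem_iInf _ |>.mp hv.2 j)) ?_
      split_ifs
      · exact S.neg_mem hv.1
      · exact S.zero_mem
    · refine ⟨hSh k v hv.1, Submodule.mem_iInf _ |>.mpr fun j => ?_⟩
      rw [Submodule.mem_comap, mul_apply_of_lie (W.lie_s_h j k)]
      exact S.add_mem (hSh k _ (Submodule.mem_iInf _ |>.mp hv.2 j))
        (S.smul_mem _ (Submodule.mem_iInf _ |>.mp hv.2 _))
  refine W.gen S (by rintro _ ⟨x, rfl⟩; exact hi x) hSa fun j v hv => ?_
  exact Submodule.mem_iInf _ |>.mp (H hv).2 j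

/-- The Sugawara operators on the vacuum vectors. -/
theorem sugawaraEnd_i (hlam : lam ≠ 0) (ha : ∀ n, ⁅D, a n⁆ = (n : ℂ) • a n)
    (hs : ∀ n, ⁅D, s n⁆ = (n : ℂ) • s n) (hb : ∀ n, ⁅D, b n⁆ = (n : ℂ) • b n) (n : ℤ) (x : X) :
    sugawaraEnd ((affineRep (W.affineModes ha hs hb)).comp AffHat.incl) n (i x) =
      i ((((n : ℂ) + 1) / 2) • β n x +
        (1 / 4 : ℂ) • ∑ᶠ m : ℤ, if m ≤ 0 then β m (β (n - m) x) else 0) := by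
  set R := W.affineModes ha hs hb
  set ρ := (affineRep R).comp AffHat.incl with hρ
  have C : IsCritical ρ := isCritical_affineRep R W.loc_a W.loc_h W.loc_f
  have hE : ∀ n, ρ (cur e0 n) = a n := affineRep_e R
  have hH : ∀ n, ρ (cur h0 n) = hOp a s b n := affineRep_h R
  have hF : ∀ n, ρ (cur f0 n) = fOp a s b n := affineRep_f R
  have hw : ∀ v, v ∈ whit ρ lam ↔ v ∈ whittakerVectors a (hOp a s b) lam := fun v => by
    unfold whit
    rw [funext hE, funext hH]
  have hx : i x ∈ whit ρ lam := (hw _).mpr (W.range_le_whit ⟨x, rfl⟩)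
  have hT : sugawaraEnd ρ n (i x) ∈ whit ρ lam := by
    have hc : ∀ z, ρ z (sugawaraEnd ρ n (i x)) = sugawaraEnd ρ n (ρ z (i x)) := fun z =>
      LinearMap.congr_fun (C.sugawaraEnd_comm n z) (i x)
    refine ⟨?_, fun k hk => ⟨?_, ?_⟩⟩
    · change ρ (cur e0 0) _ = _
      rw [hc, hx.1, map_smul]
    · change ρ (cur e0 k) _ = _
      rw [hc, (hx.2 k hk).1, map_zero]
    · change ρ (cur h0 k) _ = _
      rw [hc, (hx.2 k hk).2, map_zero]
  -- The vector T(n)(i x) is again a Whittaker vector, because T(n) commutes with the currents. So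
  -- it is determined by its image under p, where every term with a(m), m < 0, on the left drops
  -- out.
  rw [W.eq_of_whit hlam ((hw _).mp hT)]
  congr 1
  have e1 : p (∑ᶠ m : ℤ, if m < 0 then ρ (cur e0 m) (ρ (cur f0 (n - m)) (i x)) else 0) = 0 := by
    rw [← LinearMap.mem_ker]
    refine finsum_induction (fun y => y ∈ LinearMap.ker p) (Submodule.zero_mem _)
      (fun _ _ => Submodule.add_mem _) fun k => ?_
    split_ifs with hk
    · rw [LinearMap.mem_ker, hE]; exact W.p_a k hk _
    · exact Submodule.zero_mem _
  have e2 : p (ordSum ρ h0 h0 n 0 (i x)) =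
      ∑ᶠ m : ℤ, if m ≤ 0 then β m (β (n - m) x) else 0 := by
    have hl := C.restricted.locFin_ordTerm h0 h0 n 0
    rw [ordSum, locSum_apply hl]
    refine ((LinearMap.toAddMonoidHom p).map_finsum (hl (i x))).trans (finsum_congr fun m => ?_)
    change p (ordTerm ρ h0 h0 n 0 m (i x)) = _
    rw [ordTerm, hH, hH]
    rcases lt_trichotomy m 0 with h | rfl | h
    · rw [if_pos h, if_pos h.le, Module.End.mul_apply, W.p_h_nonpos h.le, W.p_h_i]
    · rw [if_neg (lt_irrefl _), if_pos le_rfl, Module.End.mul_apply, sub_zero, W.p_h_h_i,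
        W.β_comm 0 n]
      by_cases hn : n = 0
      · subst hn; simp
      · simp [hn]
    · rw [if_neg h.not_gt, if_neg h.not_ge, Module.End.mul_apply, W.h_i_pos h, map_zero, map_zero]
  rw [C.sugawaraEnd_whit hx, map_add, map_add, map_add, e1, map_smul, map_smul, map_smul, e2, hF, hH,
    W.p_f_i, W.p_h_i]
  simp

end WeylSystem

end

end WhittakerSl2

namespace WhittakerSl2

noncomputable section

/-! ### The Fock space -/

section Fock

/-- Monomials in the creation operators: `inl j` stands for `a(-j-1)` and `inr j` for `a*(-j)`. -/
abbrev FockIndex := (ℕ ⊕ ℕ) →₀ ℕ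

/-- The Fock space with vacuum space `X`. -/
abbrev Fock (X : Type*) [AddCommGroup X] := FockIndex →₀ X

variable {X : Type*} [AddCommGroup X] [Module ℂ X]

/-- Multiplication by a generator. -/
def mulOp (X : Type*) [AddCommGroup X] [Module ℂ X] (j : ℕ ⊕ ℕ) : Module.End ℂ (Fock X) :=
  Finsupp.lmapDomain X ℂ (· + Finsupp.single j 1)

/-- Derivation with respect to a generator. -/
def derOp (X : Type*) [AddCommGroup X] [Module ℂ X] (j : ℕ ⊕ ℕ) : Module.End ℂ (Fock X) :=
  Finsupp.lsum ℂ fun μ => (μ j : ℂ) • Finsupp.lsingle (μ - Finsupp.single j 1)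

/-- An operator on the vacuum space, extended to the Fock space. -/
def coeffOp (A : Module.End ℂ X) : Module.End ℂ (Fock X) :=
  Finsupp.mapRange.linearMap A

theorem mulOp_single (j : ℕ ⊕ ℕ) (μ : FockIndex) (x : X) :
    mulOp X j (Finsupp.single μ x) = Finsupp.single (μ + Finsupp.single j 1) x := by
  simp [mulOp]

theorem derOp_single (j : ℕ ⊕ ℕ) (μ : FockIndex) (x : X) :
    derOp X j (Finsupp.single μ x) = (μ j : ℂ) • Finsupp.single (μ - Finsupp.single j 1) x := by
  simp [derOp]

theorem coeffOp_single (A : Module.End ℂ X) (μ : FockIndex) (x : X) :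
    coeffOp A (Finsupp.single μ x) = Finsupp.single μ (A x) := by
  simp [coeffOp]

theorem end_ext {A B : Module.End ℂ (Fock X)}
    (h : ∀ μ x, A (Finsupp.single μ x) = B (Finsupp.single μ x)) : A = B :=
  Finsupp.lhom_ext h

theorem sub_single_add {μ : FockIndex} {j : ℕ ⊕ ℕ} (h : μ j ≠ 0) :
    μ - Finsupp.single j 1 + Finsupp.single j 1 = μ :=
  tsub_add_cancel_of_le (Finsupp.single_le_iff.mpr (Nat.one_le_iff_ne_zero.mpr h))

theorem mul_mulOp (j k : ℕ ⊕ ℕ) : ⁅mulOp X j, mulOp X k⁆ = 0 := by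
  rw [LieRing.of_associative_ring_bracket, sub_eq_zero]
  refine end_ext fun μ x => ?_
  simp only [Module.End.mul_apply, mulOp_single]
  rw [add_right_comm]

theorem der_derOp (j k : ℕ ⊕ ℕ) : ⁅derOp X j, derOp X k⁆ = 0 := by
  rcases eq_or_ne j k with rfl | hjk
  · exact lie_self _
  rw [LieRing.of_associative_ring_bracket, sub_eq_zero]
  refine end_ext fun μ x => ?_
  simp only [Module.End.mul_apply, derOp_single, map_smul, Finsupp.tsub_apply]
  rw [Finsupp.single_eq_of_ne hjk, Finsupp.single_eq_of_ne hjk.symm, tsub_zero, tsub_zero,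
    tsub_right_comm, smul_comm]

theorem der_mulOp (j k : ℕ ⊕ ℕ) : ⁅derOp X j, mulOp X k⁆ = if j = k then 1 else 0 := by
  rw [LieRing.of_associative_ring_bracket, sub_eq_iff_eq_add]
  refine end_ext fun μ x => ?_
  rw [LinearMap.add_apply, Module.End.mul_apply, Module.End.mul_apply, mulOp_single, derOp_single,
    derOp_single, map_smul, mulOp_single]
  rcases eq_or_ne j k with rfl | hjk
  · rw [if_pos rfl, Module.End.one_apply, add_tsub_cancel_right]
    by_cases h : μ j = 0
    · simp [h]
    · rw [sub_single_add h, Finsupp.add_apply, Finsupp.single_eq_same]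
      push_cast; module
  · rw [if_neg hjk, LinearMap.zero_apply, zero_add, Finsupp.add_apply,
      Finsupp.single_eq_of_ne hjk, add_zero]
    by_cases h : μ j = 0
    · simp [h]
    · congr 2
      rw [tsub_add_eq_add_tsub]
      exact Finsupp.single_le_iff.mpr (Nat.one_le_iff_ne_zero.mpr h)

theorem mul_derOp (j k : ℕ ⊕ ℕ) : ⁅mulOp X k, derOp X j⁆ = if j = k then -1 else 0 := by
  rw [← lie_skew, der_mulOp]; split_ifs <;> simp

theorem mul_coeffOp (j : ℕ ⊕ ℕ) (A : Module.End ℂ X) : ⁅mulOp X j, coeffOp A⁆ = 0 := by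
  rw [LieRing.of_associative_ring_bracket, sub_eq_zero]
  refine end_ext fun μ x => ?_
  simp only [Module.End.mul_apply, mulOp_single, coeffOp_single]

theorem der_coeffOp (j : ℕ ⊕ ℕ) (A : Module.End ℂ X) : ⁅derOp X j, coeffOp A⁆ = 0 := by
  rw [LieRing.of_associative_ring_bracket, sub_eq_zero]
  refine end_ext fun μ x => ?_
  simp only [Module.End.mul_apply, derOp_single, coeffOp_single, map_smul]

theorem coeff_coeffOp (A B : Module.End ℂ X) : ⁅coeffOp A, coeffOp B⁆ = coeffOp ⁅A, B⁆ := by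
  refine end_ext fun μ x => ?_
  simp [LieRing.of_associative_ring_bracket, coeffOp_single]

theorem coeffOp_smul (t : ℂ) (A : Module.End ℂ X) : coeffOp (t • A) = t • coeffOp A := by
  refine end_ext fun μ x => ?_
  simp [coeffOp_single]

/-- The weight of a monomial. -/
def weight : FockIndex →+ ℂ :=
  Finsupp.liftAddHom fun j => (AddMonoidHom.mulRight (Sum.elim (fun n : ℕ => -(n + 1 : ℂ))
    (fun n : ℕ => -(n : ℂ)) j)).comp (Nat.castAddMonoidHom ℂ)

theorem weight_single (j : ℕ ⊕ ℕ) : weight (Finsupp.single j 1) =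
    Sum.elim (fun n : ℕ => -(n + 1 : ℂ)) (fun n : ℕ => -(n : ℂ)) j := by
  simp [weight]

/-- The grading operator of the Fock space, twisted by an operator on the vacuum space. -/
def gradeOp (d : Module.End ℂ X) : Module.End ℂ (Fock X) :=
  Finsupp.lsum ℂ fun μ => (Finsupp.lsingle μ).comp (weight μ • LinearMap.id + d)

theorem gradeOp_single (d : Module.End ℂ X) (μ : FockIndex) (x : X) :
    gradeOp d (Finsupp.single μ x) = Finsupp.single μ (weight μ • x + d x) := by
  simp [gradeOp]

theorem grade_mulOp (d : Module.End ℂ X) (j : ℕ ⊕ ℕ) :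
    ⁅gradeOp d, mulOp X j⁆ = weight (Finsupp.single j 1) • mulOp X j := by
  rw [LieRing.of_associative_ring_bracket, sub_eq_iff_eq_add]
  refine end_ext fun μ x => ?_
  simp only [LinearMap.add_apply, LinearMap.smul_apply, Module.End.mul_apply, mulOp_single,
    gradeOp_single, map_add, Finsupp.smul_single, ← Finsupp.single_add]
  congr 1
  module

theorem grade_derOp (d : Module.End ℂ X) (j : ℕ ⊕ ℕ) :
    ⁅gradeOp d, derOp X j⁆ = (-weight (Finsupp.single j 1)) • derOp X j := by
  rw [LieRing.of_associative_ring_bracket, sub_eq_iff_eq_add]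
  refine end_ext fun μ x => ?_
  simp only [LinearMap.add_apply, LinearMap.smul_apply, Module.End.mul_apply, derOp_single,
    gradeOp_single, map_smul]
  by_cases h : μ j = 0
  · simp [h]
  · have h1 : weight μ = weight (μ - Finsupp.single j 1) + weight (Finsupp.single j 1) := by
      rw [← map_add, sub_single_add h]
    rw [h1, smul_comm, ← smul_add, Finsupp.smul_single (-_), ← Finsupp.single_add]
    congr 2
    module

theorem grade_coeffOp (d A : Module.End ℂ X) : ⁅gradeOp d, coeffOp A⁆ = coeffOp ⁅d, A⁆ := by
  refine end_ext fun μ x => ?_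
  simp [LieRing.of_associative_ring_bracket, coeffOp_single, gradeOp_single, ← Finsupp.single_sub]

theorem derOp_coeff (j : ℕ ⊕ ℕ) (v : Fock X) (ν : FockIndex) :
    derOp X j v ν = ((ν j : ℂ) + 1) • v (ν + Finsupp.single j 1) := by
  induction v using Finsupp.induction_linear with
  | zero => simp
  | add v w hv hw => rw [map_add, Finsupp.add_apply, hv, hw, Finsupp.add_apply, smul_add]
  | single μ x =>
    rw [derOp_single, Finsupp.smul_apply, Finsupp.single_apply, Finsupp.single_apply]
    by_cases h : μ = ν + Finsupp.single j 1
    · subst h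
      rw [if_pos (add_tsub_cancel_right _ _), if_pos rfl]
      simp
    · rw [if_neg h, smul_zero]
      by_cases h0 : μ j = 0
      · simp [h0]
      · rw [if_neg fun h1 => h (by rw [← h1, sub_single_add h0]), smul_zero]

/-- In characteristic zero a polynomial with vanishing partial derivatives is constant. -/
theorem eq_vacuum {v : Fock X} (h : ∀ j, derOp X j v = 0) : v = Finsupp.single 0 (v 0) := by
  ext ν
  rw [Finsupp.single_apply]
  split_ifs with h0
  · rw [h0]
  · obtain ⟨j, hj⟩ := Finsupp.ne_iff.mp (Ne.symm h0)
    have h1 := derOp_coeff j v (ν - Finsupp.single j 1)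
    rw [h j, sub_single_add hj, Finsupp.zero_apply] at h1
    exact (smul_eq_zero.mp h1.symm).resolve_left (Nat.cast_add_one_ne_zero _)

theorem fock_gen {N : Submodule ℂ (Fock X)} (h0 : ∀ x, Finsupp.single 0 x ∈ N)
    (hN : ∀ j, ∀ v ∈ N, mulOp X j v ∈ N) : N = ⊤ := by
  have H : ∀ (μ ν : FockIndex), (∀ x : X, Finsupp.single ν x ∈ N) →
      ∀ x : X, Finsupp.single (ν + μ) x ∈ N := fun μ => by
    induction μ using Finsupp.induction_linear with
    | zero => intro ν hν x; rw [add_zero]; exact hν x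
    | add μ μ' h h' => intro ν hν x; rw [← add_assoc]; exact h' _ (h ν hν) x
    | single j k =>
      induction k with
      | zero => intro ν hν x; rw [Finsupp.single_zero, add_zero]; exact hν x
      | succ k ih =>
        intro ν hν x
        rw [Finsupp.single_add, ← add_assoc, ← mulOp_single]
        exact hN j _ (ih ν hν x)
  refine eq_top_iff.mpr fun v _ => ?_
  induction v using Finsupp.induction_linear with
  | zero => exact N.zero_mem
  | add v w hv hw => exact N.add_mem (hv trivial) (hw trivial)
  | single μ x => simpa using H μ 0 h0 x

theorem mulOp_zero_coeff (j : ℕ ⊕ ℕ) (v : Fock X) : mulOp X j v 0 = 0 := by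
  induction v using Finsupp.induction_linear with
  | zero => simp
  | add v w hv hw => rw [map_add, Finsupp.add_apply, hv, hw, add_zero]
  | single μ x =>
    rw [mulOp_single, Finsupp.single_eq_of_ne]
    intro h
    have := DFunLike.congr_fun h j
    simp at this

theorem derOp_loc (f : ℕ → ℕ ⊕ ℕ) (hf : Function.Injective f) (v : Fock X) :
    ∃ N : ℕ, ∀ n ≥ N, derOp X (f n) v = 0 := by
  induction v using Finsupp.induction_linear with
  | zero => exact ⟨0, fun n _ => map_zero _⟩
  | add v w hv hw =>
    obtain ⟨N, hN⟩ := hv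
    obtain ⟨N', hN'⟩ := hw
    refine ⟨max N N', fun n hn => ?_⟩
    rw [map_add, hN n (le_trans (le_max_left _ _) hn), hN' n (le_trans (le_max_right _ _) hn),
      add_zero]
  | single μ x =>
    have hfin : {n | μ (f n) ≠ 0}.Finite :=
      (μ.hasFiniteSupport.preimage hf.injOn).subset fun n hn => hn
    obtain ⟨N, hN⟩ := hfin.bddAbove
    refine ⟨N + 1, fun n hn => ?_⟩
    have : μ (f n) = 0 := by
      by_contra h
      have := hN h
      omega
    rw [derOp_single, this, Nat.cast_zero, zero_smul]

variable (lam : ℂ) (β : ℤ → Module.End ℂ X)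

/-- The modes `a(n)` on the Fock space. -/
def fockA (X : Type*) [AddCommGroup X] [Module ℂ X] (n : ℤ) : Module.End ℂ (Fock X) :=
  if n < 0 then mulOp X (.inl (-n - 1).toNat)
  else derOp X (.inr n.toNat) + (if n = 0 then lam else 0) • 1

/-- The modes `a*(n)` on the Fock space. -/
def fockS (X : Type*) [AddCommGroup X] [Module ℂ X] (n : ℤ) : Module.End ℂ (Fock X) :=
  if n ≤ 0 then mulOp X (.inr (-n).toNat) else - derOp X (.inl (n - 1).toNat)

theorem lie_smul_one {V : Type*} [AddCommGroup V] [Module ℂ V] (A : Module.End ℂ V) (t : ℂ) :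
    ⁅A, t • (1 : Module.End ℂ V)⁆ = 0 := by
  rw [lie_smul, lie_one, smul_zero]

theorem smul_one_lie {V : Type*} [AddCommGroup V] [Module ℂ V] (A : Module.End ℂ V) (t : ℂ) :
    ⁅t • (1 : Module.End ℂ V), A⁆ = 0 := by
  rw [← lie_skew, lie_smul_one, neg_zero]

theorem coeffOp_zero : coeffOp (0 : Module.End ℂ X) = 0 :=
  end_ext fun μ x => by rw [coeffOp_single]; simp

/-- The modes a(n), n < 0, and s(n), n ≤ 0, are multiplications, and the others are derivations with
respect to them up to sign. The shift of a(0) by lam does not change any commutator and turns the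
vacuum vectors into Whittaker vectors. The b(n) act on the coefficients only. -/
theorem fock_weylSystem (hβ : ∀ m n, ⁅β m, β n⁆ = 0) (hβ' : ∀ n > 0, β n = 0) :
    WeylSystem lam (fockA lam X) (fockS X) (fun n => coeffOp (β n)) (Finsupp.lsingle 0)
      (Finsupp.lapply 0) β where
  aa m n := by
    unfold fockA
    split_ifs <;>
      simp only [add_lie, lie_add, lie_smul_one, smul_one_lie, mul_mulOp, der_derOp, der_mulOp,
        mul_derOp, reduceCtorEq, if_false, add_zero]
  ss m n := by
    unfold fockS
    split_ifs <;> simp [mul_mulOp, der_derOp, der_mulOp, mul_derOp]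
  as m n := by
    unfold fockA fockS
    by_cases hm : m < 0 <;> by_cases hn : n ≤ 0 <;>
      simp only [hm, hn, if_true, if_false, add_lie, lie_neg, smul_one_lie, mul_mulOp, der_derOp,
        der_mulOp, mul_derOp, add_zero, neg_zero, Sum.inl.injEq, Sum.inr.injEq]
    · rw [if_neg (by omega)]
    · by_cases h : m + n = 0
      · rw [if_pos h, if_pos (by omega), neg_neg]
      · rw [if_neg h, if_neg (by omega), neg_zero]
    · by_cases h : m + n = 0
      · rw [if_pos h, if_pos (by omega)]
      · rw [if_neg h, if_neg (by omega)]
    · rw [if_neg (by omega)]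
  ab m n := by
    unfold fockA
    split_ifs <;> simp only [add_lie, smul_one_lie, mul_coeffOp, der_coeffOp, add_zero]
  sb m n := by
    unfold fockS
    split_ifs <;> simp [mul_coeffOp, der_coeffOp]
  bb m n := by
    rw [coeff_coeffOp, hβ, coeffOp_zero]
  loc_a v := by
    obtain ⟨N, hN⟩ := derOp_loc Sum.inr Sum.inr_injective v
    refine ⟨N + 1, fun n hn => ?_⟩
    rw [fockA, if_neg (by omega), if_neg (by omega), zero_smul, add_zero]
    exact hN _ (by omega)
  loc_s v := by
    obtain ⟨N, hN⟩ := derOp_loc Sum.inl Sum.inl_injective v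
    refine ⟨N + 1, fun n hn => ?_⟩
    rw [fockS, if_neg (by omega), LinearMap.neg_apply, hN _ (by omega), neg_zero]
  b_pos n hn := by
    rw [hβ' n hn, coeffOp_zero]
  a_i n hn x := by
    rw [fockA, if_neg (by omega), if_neg (by omega)]
    simp [derOp_single]
  a_zero_i x := by
    rw [fockA, if_neg (by omega), if_pos rfl]
    simp [derOp_single]
  s_i n hn x := by
    rw [fockS, if_neg (by omega)]
    simp [derOp_single]
  b_i n x := coeffOp_single _ _ _
  p_a n hn v := by
    rw [fockA, if_pos hn]; exact mulOp_zero_coeff _ v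
  p_s n hn v := by
    rw [fockS, if_pos hn]; exact mulOp_zero_coeff _ v
  p_b n v := by simp [coeffOp]
  p_i x := by simp
  gen N hi hA hS := by
    refine fock_gen (fun x => hi ⟨x, rfl⟩) fun j v hv => ?_
    rcases j with j | j
    · have := hA (-(j : ℤ) - 1) v hv
      rwa [fockA, if_pos (by omega), show (-(-(j : ℤ) - 1) - 1).toNat = j by omega] at this
    · have := hS (-(j : ℤ)) v hv
      rwa [fockS, if_pos (by omega), show (- -(j : ℤ)).toNat = j by omega] at this
  vac v ha h0 hs := by
    refine eq_vacuum fun j => ?_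
    rcases j with j | j
    · have := hs ((j : ℤ) + 1) (by omega)
      rw [fockS, if_neg (by omega), show ((j : ℤ) + 1 - 1).toNat = j by omega] at this
      simpa using this
    · rcases Nat.eq_zero_or_pos j with rfl | hj
      · rw [fockA, if_neg (by omega), if_pos rfl] at h0
        simpa using h0
      · have := ha (j : ℤ) (by omega)
        rw [fockA, if_neg (by omega), if_neg (by omega), Int.toNat_natCast] at this
        simpa using this

theorem grade_fockA (d : Module.End ℂ X) (n : ℤ) :
    ⁅gradeOp d, fockA lam X n⁆ = (n : ℂ) • fockA lam X n := by
  unfold fockA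
  split_ifs with h h0
  · rw [grade_mulOp, weight_single]
    congr 1
    have h1 : (((-n - 1).toNat : ℕ) : ℤ) = -n - 1 := by omega
    have h2 : (((-n - 1).toNat : ℕ) : ℂ) = -n - 1 := by exact_mod_cast congrArg (Int.cast (R := ℂ)) h1
    rw [Sum.elim_inl, h2]; ring
  · subst h0
    rw [lie_add, grade_derOp, weight_single, lie_smul_one]
    simp
  · rw [lie_add, grade_derOp, weight_single, lie_smul_one, zero_smul, add_zero, add_zero]
    congr 1
    have h1 : ((n.toNat : ℕ) : ℤ) = n := by omega
    have h2 : ((n.toNat : ℕ) : ℂ) = n := by exact_mod_cast congrArg (Int.cast (R := ℂ)) h1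
    simp [h2]

theorem grade_fockS (d : Module.End ℂ X) (n : ℤ) :
    ⁅gradeOp d, fockS X n⁆ = (n : ℂ) • fockS X n := by
  unfold fockS
  split_ifs with h
  · rw [grade_mulOp, weight_single]
    congr 1
    have h1 : (((-n).toNat : ℕ) : ℤ) = -n := by omega
    have h2 : (((-n).toNat : ℕ) : ℂ) = -n := by exact_mod_cast congrArg (Int.cast (R := ℂ)) h1
    simp [h2]
  · rw [lie_neg, grade_derOp, weight_single, smul_neg]
    congr 2
    have h1 : (((n - 1).toNat : ℕ) : ℤ) = n - 1 := by omega
    have h2 : (((n - 1).toNat : ℕ) : ℂ) = n - 1 := by exact_mod_cast congrArg (Int.cast (R := ℂ)) h1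
    rw [Sum.elim_inl, h2]; ring

theorem gradeOp_vacuum (d : Module.End ℂ X) (x : X) :
    gradeOp d (Finsupp.lsingle (R := ℂ) 0 x) = Finsupp.lsingle (R := ℂ) 0 (d x) := by
  simp [gradeOp_single]

end Fock

end

end WhittakerSl2

namespace WhittakerSl2

noncomputable section

/-! ### Irreducible modules and Schur's lemma -/

section Generated

variable {L M : Type*} [LieRing L] [LieAlgebra ℂ L] [AddCommGroup M] [Module ℂ M]
  [LieRingModule L M] [LieModule ℂ L M] {G : Set L}

theorem lie_mem_of_span (hG : Submodule.span ℂ G = ⊤) {N : Submodule ℂ M}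
    (hN : ∀ g ∈ G, ∀ m ∈ N, ⁅g, m⁆ ∈ N) (x : L) {m : M} (hm : m ∈ N) : ⁅x, m⁆ ∈ N := by
  have hx : x ∈ Submodule.span ℂ G := hG ▸ Submodule.mem_top
  induction hx using Submodule.span_induction with
  | mem g hg => exact hN g hg m hm
  | zero => rw [zero_lie]; exact N.zero_mem
  | add x y _ _ hx hy => rw [add_lie]; exact N.add_mem hx hy
  | smul t x _ hx => rw [smul_lie]; exact N.smul_mem t hx

theorem isIrreducible_iff_of_span (hG : Submodule.span ℂ G = ⊤) :
    LieModule.IsIrreducible ℂ L M ↔ Nontrivial M ∧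
      ∀ N : Submodule ℂ M, (∀ g ∈ G, ∀ m ∈ N, ⁅g, m⁆ ∈ N) → N = ⊥ ∨ N = ⊤ := by
  constructor
  · intro h
    refine ⟨LieModule.nontrivial_of_isIrreducible ℂ L M, fun N hN => ?_⟩
    let N' : LieSubmodule ℂ L M := ⟨N, fun {x m} hm => lie_mem_of_span hG hN x hm⟩
    rcases h.eq_bot_or_eq_top N' with h | h
    · exact Or.inl (congrArg LieSubmodule.toSubmodule h)
    · exact Or.inr (congrArg LieSubmodule.toSubmodule h)
  · rintro ⟨_, h⟩
    refine LieModule.IsIrreducible.mk fun N hN => ?_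
    rcases h N.toSubmodule (fun g _ m hm => N.lie_mem hm) with h | h
    · exact absurd ((LieSubmodule.toSubmodule_eq_bot N).mp h) hN
    · exact (LieSubmodule.toSubmodule_eq_top N).mp h

theorem comm_of_span {M' : Type*} [AddCommGroup M'] [Module ℂ M'] [LieRingModule L M']
    [LieModule ℂ L M'] (hG : Submodule.span ℂ G = ⊤) (A : M →ₗ[ℂ] M')
    (hA : ∀ g ∈ G, ∀ m, A ⁅g, m⁆ = ⁅g, A m⁆) (x : L) (m : M) : A ⁅x, m⁆ = ⁅x, A m⁆ := by
  have hx : x ∈ Submodule.span ℂ G := hG ▸ Submodule.mem_top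
  induction hx using Submodule.span_induction with
  | mem g hg => exact hA g hg m
  | zero => rw [zero_lie, zero_lie, map_zero]
  | add x y _ _ hx hy => rw [add_lie, map_add, add_lie, hx, hy]
  | smul t x _ hx => rw [smul_lie, map_smul, smul_lie, hx]

/-- An invertible linear map that commutes with the action of a spanning set is an isomorphism of
modules. -/
def lieEquivOfSpan {M' : Type*} [AddCommGroup M'] [Module ℂ M'] [LieRingModule L M']
    [LieModule ℂ L M'] (hG : Submodule.span ℂ G = ⊤) (A : M ≃ₗ[ℂ] M')
    (hA : ∀ g ∈ G, ∀ m, A ⁅g, m⁆ = ⁅g, A m⁆) : M ≃ₗ⁅ℂ,L⁆ M' :=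
  { A with map_lie' := fun {x m} => comm_of_span hG (A : M →ₗ[ℂ] M') hA x m }

open Polynomial in
-- Over ℂ a nonzero polynomial is a nonzero constant times a product of linear factors, each of
-- which is injective at A.
theorem injective_aeval {A : Module.End ℂ M}
    (h : ∀ c : ℂ, Function.Injective (A - c • (1 : Module.End ℂ M))) {q : ℂ[X]} (hq : q ≠ 0) :
    Function.Injective (aeval A q) := by
  have h1 : ∀ s : Multiset ℂ, Function.Injective (aeval A (s.map fun c => X - C c).prod) :=
    fun s => by
      induction s using Multiset.induction with
      | empty => rw [Multiset.map_zero, Multiset.prod_zero, map_one]; exact Function.injective_id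
      | cons c s ih =>
        rw [Multiset.map_cons, Multiset.prod_cons, map_mul, map_sub, aeval_X, aeval_C,
          Algebra.algebraMap_eq_smul_one]
        exact (h c).comp ih
  rw [(IsAlgClosed.splits q).eq_prod_roots, map_mul, aeval_C, Algebra.algebraMap_eq_smul_one,
    smul_one_mul]
  exact fun v w hvw => h1 _ (smul_right_injective M (leadingCoeff_ne_zero.mpr hq) hvw)

open Polynomial in
-- Clearing denominators turns a relation among the vectors (A - c)⁻¹ x into q(A)x = 0, so q = 0 by
-- `injective_aeval`. Evaluating q at c isolates the coefficient of index c.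
theorem linearIndependent_resolvent {A : Module.End ℂ M}
    (h : ∀ c : ℂ, Function.Injective (A - c • (1 : Module.End ℂ M))) {x : M} (hx : x ≠ 0)
    {v : ℂ → M} (hv : ∀ c, (A - c • (1 : Module.End ℂ M)) (v c) = x) :
    LinearIndependent ℂ v := by
  rw [linearIndependent_iff']
  intro s g hg c hc
  have h1 : ∀ c ∈ s, aeval A (∏ c' ∈ s, (X - C c')) (v c) =
      aeval A (∏ c' ∈ s.erase c, (X - C c')) x := fun c hc => by
    rw [← Finset.prod_erase_mul s _ hc, map_mul, map_sub, aeval_X, aeval_C,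
      Algebra.algebraMap_eq_smul_one, Module.End.mul_apply, hv]
  have h2 : aeval A (∑ c ∈ s, C (g c) * ∏ c' ∈ s.erase c, (X - C c')) x = 0 := by
    rw [map_sum, LinearMap.sum_apply, ← map_zero (aeval A (∏ c' ∈ s, (X - C c'))), ← hg, map_sum]
    refine Finset.sum_congr rfl fun c hc => ?_
    rw [map_smul, h1 c hc, map_mul, aeval_C, Algebra.algebraMap_eq_smul_one, smul_one_mul,
      LinearMap.smul_apply]
  have h3 : ∑ c ∈ s, C (g c) * ∏ c' ∈ s.erase c, (X - C c') = 0 := by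
    by_contra h0
    exact hx (injective_aeval h h0 (h2.trans (map_zero _).symm))
  have h4 := congrArg (eval c) h3
  rw [eval_finsetSum, Finset.sum_eq_single c, eval_mul, eval_C, eval_prod, eval_zero] at h4
  · refine (mul_eq_zero.mp h4).resolve_right (Finset.prod_ne_zero_iff.mpr fun c' hc' => ?_)
    rw [eval_sub, eval_X, eval_C, sub_ne_zero]
    exact (Finset.ne_of_mem_erase hc').symm
  · intro c' _ hne
    rw [eval_mul, eval_prod, Finset.prod_eq_zero (Finset.mem_erase.mpr ⟨hne.symm, hc⟩), mul_zero]
    simp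
  · exact fun h => absurd hc h

/-- **Schur's lemma** in countable dimension. -/
theorem eq_smul_one_of_comm (hG : Submodule.span ℂ G = ⊤) (hc : G.Countable)
    (hM : LieModule.IsIrreducible ℂ L M) {A : Module.End ℂ M}
    (hA : ∀ g ∈ G, ∀ m, A ⁅g, m⁆ = ⁅g, A m⁆) : ∃ t : ℂ, A = t • (1 : Module.End ℂ M) := by
  obtain ⟨hnt, hirr⟩ := (isIrreducible_iff_of_span hG).mp hM
  obtain ⟨x, hx⟩ := exists_ne (0 : M)
  by_contra! hne
  have hcomm : ∀ c : ℂ, ∀ g ∈ G, ∀ m, (A - c • (1 : Module.End ℂ M)) ⁅g, m⁆ =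
      ⁅g, (A - c • (1 : Module.End ℂ M)) m⁆ := fun c g hg m => by
    simp [hA g hg]
  have hinj : ∀ c : ℂ, Function.Injective (A - c • (1 : Module.End ℂ M)) := fun c => by
    rw [← LinearMap.ker_eq_bot]
    refine (hirr _ fun g hg m hm => ?_).resolve_right fun h => hne c ?_
    · rw [LinearMap.mem_ker] at hm ⊢
      rw [hcomm c g hg, hm, lie_zero]
    · exact sub_eq_zero.mp (LinearMap.ker_eq_top.mp h)
  have hsurj : ∀ c : ℂ, Function.Surjective (A - c • (1 : Module.End ℂ M)) := fun c => by
    rw [← LinearMap.range_eq_top]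
    refine (hirr _ ?_).resolve_left fun h => hne c ?_
    · rintro g hg _ ⟨m, rfl⟩
      exact ⟨⁅g, m⁆, hcomm c g hg m⟩
    · exact sub_eq_zero.mp (LinearMap.range_eq_bot.mp h)
  choose v hv using fun c => hsurj c x
  have hlin := linearIndependent_resolvent hinj hx hv
  -- Words in the countable set G applied to x span M, so its dimension is countable. This
  -- contradicts the linear independence of the resolvent vectors, which are indexed by ℂ.
  let word : List G → M := fun l => l.foldr (fun g m => ⁅(g : L), m⁆) x
  have htop : Submodule.span ℂ (Set.range word) = ⊤ := by
    refine (hirr _ fun g hg m hm => ?_).resolve_left fun h => hx ?_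
    · induction hm using Submodule.span_induction with
      | mem m hm =>
        obtain ⟨l, rfl⟩ := hm
        exact Submodule.subset_span ⟨⟨g, hg⟩ :: l, rfl⟩
      | zero => rw [lie_zero]; exact Submodule.zero_mem _
      | add m m' _ _ hm hm' => rw [lie_add]; exact Submodule.add_mem _ hm hm'
      | smul t m _ hm => rw [lie_smul]; exact Submodule.smul_mem _ t hm
    · have : x ∈ Submodule.span ℂ (Set.range word) := Submodule.subset_span ⟨[], rfl⟩
      rwa [h, Submodule.mem_bot] at this
  have : Countable G := hc
  have hcount : Module.rank ℂ M ≤ Cardinal.aleph0 := by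
    rw [← rank_top, ← htop]
    exact (rank_span_le _).trans (Cardinal.mk_le_aleph0_iff.mpr (Set.countable_range word).to_subtype)
  have h1 := hlin.cardinal_lift_le_rank
  rw [Cardinal.mk_complex] at h1
  have h2 := h1.trans (Cardinal.lift_le.mpr hcount)
  simp only [Cardinal.lift_continuum, Cardinal.lift_aleph0] at h2
  exact absurd h2 (not_le.mpr Cardinal.aleph0_lt_continuum)

end Generated

/-! ### Generators and representations of the Lie algebra of d and the T(n) -/

section TNeg

/-- The standard basis of `TNeg`. -/
def tGen : Set TNeg := insert tder (Set.range tT)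

theorem countable_tGen : tGen.Countable := (Set.countable_range tT).insert tder

theorem tT_of_pos {n : ℤ} (hn : 0 < n) : tT n = 0 := dif_neg (by omega)

/-- The inclusion of the span of the `T(n)` in `TNeg`. -/
def tIncl : TSpace →ₗ[ℂ] TNeg where
  toFun x := (x, 0)
  map_add' _ _ := Prod.ext rfl (add_zero (0 : ℂ)).symm
  map_smul' t _ := Prod.ext rfl (mul_zero t).symm

theorem tT_of_nonpos {n : ℤ} (hn : n ≤ 0) : tT n = tIncl (Finsupp.single ⟨n, hn⟩ 1) := dif_pos hn

theorem tIncl_lie (x y : TSpace) : ⁅tIncl x, tIncl y⁆ = 0 := by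
  refine Prod.ext ?_ rfl
  change (0 : ℂ) • tD y - (0 : ℂ) • tD x = 0
  simp

theorem tder_lie_tIncl (x : TSpace) : ⁅tder, tIncl x⁆ = tIncl (tD x) := by
  refine Prod.ext ?_ rfl
  change (1 : ℂ) • tD x - (0 : ℂ) • tD 0 = tD x
  simp

theorem eq_tIncl_add (z : TNeg) : z = tIncl z.1 + z.2 • tder := by
  refine Prod.ext ?_ ?_
  · change z.1 = z.1 + z.2 • (0 : TSpace)
    simp
  · change z.2 = 0 + z.2 * 1
    simp

theorem span_tGen : Submodule.span ℂ tGen = ⊤ := by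
  refine eq_top_iff.mpr fun z _ => ?_
  have h1 : ∀ x : TSpace, tIncl x ∈ Submodule.span ℂ tGen := fun x => by
    induction x using Finsupp.induction_linear with
    | zero => rw [map_zero]; exact Submodule.zero_mem _
    | add x y hx hy => rw [map_add]; exact Submodule.add_mem _ hx hy
    | single n t =>
      have : tT n ∈ Submodule.span ℂ tGen := Submodule.subset_span (Or.inr ⟨n, rfl⟩)
      rw [tT_of_nonpos n.2] at this
      rw [← mul_one t, ← smul_eq_mul, ← Finsupp.smul_single, map_smul]
      exact Submodule.smul_mem _ t this
  rw [eq_tIncl_add z]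
  exact Submodule.add_mem _ (h1 _) (Submodule.smul_mem _ _ (Submodule.subset_span (Or.inl rfl)))

theorem tT_lie (m n : ℤ) : ⁅tT m, tT n⁆ = 0 := by
  rcases le_or_gt m 0 with hm | hm
  · rcases le_or_gt n 0 with hn | hn
    · rw [tT_of_nonpos hm, tT_of_nonpos hn, tIncl_lie]
    · rw [tT_of_pos hn, lie_zero]
  · rw [tT_of_pos hm, zero_lie]

theorem tder_lie (n : ℤ) : ⁅tder, tT n⁆ = (n : ℂ) • tT n := by
  rcases le_or_gt n 0 with hn | hn
  · rw [tT_of_nonpos hn, tder_lie_tIncl, ← map_smul]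
    simp [tD]
  · rw [tT_of_pos hn, lie_zero, smul_zero]

variable {X : Type*} [AddCommGroup X] [Module ℂ X]

/-- The representation of `TNeg` given by commuting operators `T(n)` of degree `n`. -/
def tRep (d : Module.End ℂ X) (τ : ℤ → Module.End ℂ X) (hτ : ∀ m n, ⁅τ m, τ n⁆ = 0)
    (hd : ∀ n, ⁅d, τ n⁆ = (n : ℂ) • τ n) : TNeg →ₗ⁅ℂ⁆ Module.End ℂ X :=
  let Λ : TSpace →ₗ[ℂ] Module.End ℂ X := Finsupp.lsum ℂ fun n => LinearMap.toSpanSingleton ℂ _ (τ n)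
  have hΛ : ∀ n t, Λ (Finsupp.single n t) = t • τ n := fun n t => by simp [Λ]
  have h1 : ∀ x y, ⁅Λ x, Λ y⁆ = 0 := fun x y => by
    induction x using Finsupp.induction_linear with
    | zero => simp
    | add x x' hx hx' => rw [map_add, add_lie, hx, hx', add_zero]
    | single n a =>
      induction y using Finsupp.induction_linear with
      | zero => simp
      | add y y' hy hy' => rw [map_add, lie_add, hy, hy', add_zero]
      | single m b => rw [hΛ, hΛ, smul_lie, lie_smul, hτ, smul_zero, smul_zero]
  have h2 : ∀ x, ⁅d, Λ x⁆ = Λ (tD x) := fun x => by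
    induction x using Finsupp.induction_linear with
    | zero => simp
    | add x x' hx hx' => rw [map_add, lie_add, hx, hx', map_add, map_add]
    | single n a =>
      have h : tD (Finsupp.single n a) = ((n : ℤ) : ℂ) • Finsupp.single n a := by simp [tD]
      rw [h, map_smul, hΛ, lie_smul, hd, smul_comm]
  { toFun := fun Z => Λ Z.1 + Z.2 • d
    map_add' := fun Z Y => by
      change Λ (Z.1 + Y.1) + (Z.2 + Y.2) • d = _
      rw [map_add, add_smul]; abel
    map_smul' := fun t Z => by
      change Λ (t • Z.1) + (t * Z.2) • d = t • (Λ Z.1 + Z.2 • d)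
      rw [map_smul, mul_smul, smul_add]
    map_lie' := fun {Z Y} => by
      change Λ (Z.2 • tD Y.1 - Y.2 • tD Z.1) + (0 : ℂ) • d = ⁅Λ Z.1 + Z.2 • d, Λ Y.1 + Y.2 • d⁆
      rw [map_sub, map_smul, map_smul, zero_smul, add_zero, add_lie, lie_add, lie_add, h1, smul_lie,
        smul_lie, lie_smul, lie_smul, lie_self, smul_zero, smul_zero, h2, ← lie_skew, h2, smul_neg]
      abel }

variable {d : Module.End ℂ X} {τ : ℤ → Module.End ℂ X} {hτ : ∀ m n, ⁅τ m, τ n⁆ = 0}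
  {hd : ∀ n, ⁅d, τ n⁆ = (n : ℂ) • τ n}

theorem tRep_tder : tRep d τ hτ hd tder = d := by
  change (Finsupp.lsum ℂ fun n : {n : ℤ // n ≤ 0} => LinearMap.toSpanSingleton ℂ _ (τ n)) 0 +
    (1 : ℂ) • d = d
  simp

theorem tRep_tT {n : ℤ} (hn : n ≤ 0) : tRep d τ hτ hd (tT n) = τ n := by
  rw [tT_of_nonpos hn]
  change (Finsupp.lsum ℂ fun n : {n : ℤ // n ≤ 0} => LinearMap.toSpanSingleton ℂ _ (τ n))
    (Finsupp.single ⟨n, hn⟩ 1) + (0 : ℂ) • d = τ n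
  simp

end TNeg

section AffTilde

/-- A countable spanning set of the affine algebra. -/
def affGen : Set AffTilde :=
  {der, (cen : AffTilde)} ∪ (Set.range (fun n => (cur e0 n : AffTilde)) ∪
    (Set.range (fun n => (cur h0 n : AffTilde)) ∪ Set.range (fun n => (cur f0 n : AffTilde))))

theorem countable_affGen : affGen.Countable :=
  ((Set.countable_singleton _).insert _).union ((Set.countable_range _).union
    ((Set.countable_range _).union (Set.countable_range _)))

theorem span_affGen : Submodule.span ℂ affGen = ⊤ :=
  eq_top_iff.mpr fun z _ => affTilde_mem _
    (fun n => Submodule.subset_span (Or.inr (Or.inl ⟨n, rfl⟩)))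
    (fun n => Submodule.subset_span (Or.inr (Or.inr (Or.inl ⟨n, rfl⟩))))
    (fun n => Submodule.subset_span (Or.inr (Or.inr (Or.inr ⟨n, rfl⟩))))
    (Submodule.subset_span (Or.inl (Or.inr rfl))) (Submodule.subset_span (Or.inl (Or.inl rfl))) z

theorem forall_affGen {P : AffTilde → Prop} (he : ∀ n, P (cur e0 n)) (hh : ∀ n, P (cur h0 n))
    (hf : ∀ n, P (cur f0 n)) (hc : P cen) (hd : P der) : ∀ g ∈ affGen, P g := by
  rintro _ ((rfl | rfl) | ⟨n, rfl⟩ | ⟨n, rfl⟩ | ⟨n, rfl⟩)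
  exacts [hd, hc, he n, hh n, hf n]

end AffTilde

end

end WhittakerSl2

namespace WhittakerSl2

noncomputable section

/-! ### Modules with prescribed Sugawara operators -/

section Miura

variable {X : Type*} [AddCommGroup X] [Module ℂ X]

/-- The solution of `½ ∂b + ¼ b² = τ` with leading coefficient `b₀`. -/
def miura (τ : ℤ → Module.End ℂ X) (b₀ : ℂ) : ℕ → Module.End ℂ X
  | 0 => b₀ • 1
  | k + 1 => (2 / (b₀ - k)) • (τ (-(k + 1 : ℕ)) -
      (1 / 4 : ℂ) • ∑ j : Fin k, miura τ b₀ (j + 1) * miura τ b₀ (k - j))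

variable {τ : ℤ → Module.End ℂ X} {b₀ : ℂ}

theorem miura_zero : miura τ b₀ 0 = b₀ • 1 := by rw [miura]

theorem miura_succ (k : ℕ) : miura τ b₀ (k + 1) = (2 / (b₀ - k)) • (τ (-(k + 1 : ℕ)) -
      (1 / 4 : ℂ) • ∑ j ∈ Finset.range k, miura τ b₀ (j + 1) * miura τ b₀ (k - j)) := by
  rw [miura, Finset.sum_range fun j => miura τ b₀ (j + 1) * miura τ b₀ (k - j)]

/-- In the equation of index k + 1 the unknown of that index has coefficient -k/2 + b₀/2, so b₀ has
to avoid the natural numbers. The equation of index 0 is the quadratic condition relating τ(0) to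
b₀. -/
theorem miura_spec (hb : ∀ k : ℕ, b₀ ≠ k) (h0 : τ 0 = (b₀ ^ 2 / 4 + b₀ / 2) • 1) (k : ℕ) :
    ((1 - k : ℂ) / 2) • miura τ b₀ k + (1 / 4 : ℂ) •
      ∑ j ∈ Finset.range (k + 1), miura τ b₀ j * miura τ b₀ (k - j) = τ (-(k : ℕ)) := by
  cases k with
  | zero =>
    simp only [zero_add, Finset.sum_range_one, Nat.sub_zero, miura_zero, Nat.cast_zero, neg_zero, h0]
    rw [smul_mul_smul_comm, one_mul]
    module
  | succ k =>
    rw [Finset.sum_range_succ, Finset.sum_range_succ', Nat.sub_self, miura_zero, Nat.sub_zero,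
      smul_one_mul, mul_smul_one]
    have h1 : ∑ j ∈ Finset.range k, miura τ b₀ (j + 1) * miura τ b₀ (k + 1 - (j + 1)) =
        ∑ j ∈ Finset.range k, miura τ b₀ (j + 1) * miura τ b₀ (k - j) :=
      Finset.sum_congr rfl fun j _ => by rw [Nat.add_sub_add_right]
    have h2 : b₀ - k ≠ 0 := sub_ne_zero.mpr (hb k)
    rw [h1, miura_succ]
    generalize ∑ j ∈ Finset.range k, miura τ b₀ (j + 1) * miura τ b₀ (k - j) = S
    push_cast
    match_scalars <;> field_simp <;> ring

theorem miura_mem (k : ℕ) : miura τ b₀ k ∈ Algebra.adjoin ℂ (Set.range τ) := by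
  induction k using Nat.strong_induction_on with
  | _ k ih =>
    cases k with
    | zero => rw [miura_zero]; exact Subalgebra.smul_mem _ (one_mem _) _
    | succ k =>
      rw [miura_succ]
      refine Subalgebra.smul_mem _ (sub_mem (Algebra.subset_adjoin (Set.mem_range_self _))
        (Subalgebra.smul_mem _ (sum_mem fun j hj => ?_) _)) _
      have := Finset.mem_range.mp hj
      exact mul_mem (ih _ (by omega)) (ih _ (by omega))

/-- The solution consists of polynomials in the τ(n), by `miura_mem`, and these commute. -/
theorem miura_comm (hτ : ∀ m n, ⁅τ m, τ n⁆ = 0) (j k : ℕ) : ⁅miura τ b₀ j, miura τ b₀ k⁆ = 0 := by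
  have hc : ∀ m n, Commute (τ m) (τ n) := fun m n => sub_eq_zero.mp (hτ m n)
  refine sub_eq_zero.mpr (Algebra.commute_of_mem_adjoin_of_forall_mem_commute (miura_mem k) ?_)
  rintro _ ⟨n, rfl⟩
  refine (Algebra.commute_of_mem_adjoin_of_forall_mem_commute (miura_mem j) ?_).symm
  rintro _ ⟨m, rfl⟩
  exact hc n m

theorem miura_der {d : Module.End ℂ X} (hd : ∀ n, ⁅d, τ n⁆ = (n : ℂ) • τ n) (k : ℕ) :
    ⁅d, miura τ b₀ k⁆ = (-k : ℂ) • miura τ b₀ k := by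
  induction k using Nat.strong_induction_on with
  | _ k ih =>
    cases k with
    | zero => rw [miura_zero, lie_smul_one]; simp
    | succ k =>
      have h1 : ⁅d, ∑ j ∈ Finset.range k, miura τ b₀ (j + 1) * miura τ b₀ (k - j)⁆ =
          (-(k + 1 : ℕ) : ℂ) •
            ∑ j ∈ Finset.range k, miura τ b₀ (j + 1) * miura τ b₀ (k - j) := by
        rw [lie_sum, Finset.smul_sum]
        refine Finset.sum_congr rfl fun j hj => ?_
        have := Finset.mem_range.mp hj
        rw [lie_mul, ih _ (by omega), ih _ (by omega), smul_mul_assoc, mul_smul_comm, ← add_smul,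
          Nat.cast_sub this.le]
        congr 1
        push_cast; ring
      rw [miura_succ, lie_smul, lie_sub, lie_smul, h1, hd]
      push_cast
      module

end Miura

/-! ### Existence of modules with prescribed Sugawara operators -/

section Model

variable {X : Type*} [AddCommGroup X] [Module ℂ X]

/-- The equation says (b₀ + 1)² = 1 + 4t. Choosing the square root z with real part at most 0, the
number z - 1 has negative real part and is not a natural number. -/
theorem exists_miura_root (t : ℂ) : ∃ b₀ : ℂ, (∀ k : ℕ, b₀ ≠ k) ∧ t = b₀ ^ 2 / 4 + b₀ / 2 := by
  obtain ⟨z, hz⟩ : ∃ z : ℂ, z ^ 2 = 1 + 4 * t := IsAlgClosed.exists_pow_nat_eq _ two_pos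
  obtain ⟨z, hz, hre⟩ : ∃ z : ℂ, z ^ 2 = 1 + 4 * t ∧ z.re ≤ 0 := by
    rcases le_total z.re 0 with h | h
    · exact ⟨z, hz, h⟩
    · exact ⟨-z, by rw [neg_sq, hz], by simpa using h⟩
  refine ⟨z - 1, fun k hk => ?_, ?_⟩
  · have := congrArg Complex.re hk
    rw [Complex.sub_re, Complex.one_re, Complex.natCast_re] at this
    have := Nat.cast_nonneg (α := ℝ) k
    linarith
  · linear_combination -(1 / 4) * hz

/-- For commuting operators `τ n` of degree `n` on `X`, with `τ n = 0` for `n > 0` and `τ 0` a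
scalar, there is a module at the critical level that is generated by the space `X` of Whittaker
vectors, on which the Sugawara operators act as the `τ n`. -/
theorem exists_model {lam : ℂ} (hlam : lam ≠ 0) {d : Module.End ℂ X} {τ : ℤ → Module.End ℂ X}
    (hτ : ∀ m n, ⁅τ m, τ n⁆ = 0) (hd : ∀ n, ⁅d, τ n⁆ = (n : ℂ) • τ n) (hpos : ∀ n > 0, τ n = 0)
    {t : ℂ} (ht : τ 0 = t • 1) :
    ∃ ρ : AffTilde →ₗ⁅ℂ⁆ Module.End ℂ (Fock X), IsCritical (ρ.comp AffHat.incl) ∧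
      LinearMap.range (Finsupp.lsingle (R := ℂ) 0 : X →ₗ[ℂ] Fock X) ≤
        whit (ρ.comp AffHat.incl) lam ∧
      bspan (ρ.comp AffHat.incl)
        (LinearMap.range (Finsupp.lsingle (R := ℂ) 0 : X →ₗ[ℂ] Fock X)) = ⊤ ∧
      (∀ x : X, ρ der (Finsupp.single 0 x) = Finsupp.single 0 (d x)) ∧
      ∀ n (x : X), sugawaraEnd (ρ.comp AffHat.incl) n (Finsupp.single 0 x) =
        Finsupp.single 0 (τ n x) := by
  obtain ⟨b₀, hb₀, rfl⟩ := exists_miura_root t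
  -- The commuting modes b(n) are the solution of the Riccati equation, indexed so that b(-k) has
  -- degree -k.
  let β : ℤ → Module.End ℂ X := fun n => if n ≤ 0 then miura τ b₀ (-n).toNat else 0
  have hβ : ∀ m n, ⁅β m, β n⁆ = 0 := fun m n => by
    simp only [β]
    split_ifs <;> simp [miura_comm hτ]
  have hβ' : ∀ n > 0, β n = 0 := fun n hn => if_neg (by omega)
  have W := fock_weylSystem lam β hβ hβ'
  have hb : ∀ n, ⁅gradeOp d, coeffOp (β n)⁆ = (n : ℂ) • coeffOp (β n) := fun n => by
    rw [grade_coeffOp, ← coeffOp_smul]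
    congr 1
    simp only [β]
    split_ifs with h
    · rw [miura_der hd]
      congr 1
      have h1 : (((-n).toNat : ℕ) : ℤ) = -n := by omega
      have h2 : (((-n).toNat : ℕ) : ℂ) = -n := by exact_mod_cast congrArg (Int.cast (R := ℂ)) h1
      rw [h2, neg_neg]
    · simp
  have ha := grade_fockA lam d
  have hs := grade_fockS d
  have R := W.affineModes ha hs hb
  have hE : ∀ n, affineRep R (cur e0 n) = fockA lam X n := affineRep_e R
  have hH : ∀ n, affineRep R (cur h0 n) = _ := affineRep_h R
  refine ⟨affineRep R, isCritical_affineRep R W.loc_a W.loc_h W.loc_f, ?_, ?_, fun x => ?_,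
    fun n x => ?_⟩
  · unfold whit
    simp only [LieHom.comp_apply, LieSubalgebra.coe_incl, hE, hH]
    exact W.range_le_whit
  · unfold bspan
    simp only [LieHom.comp_apply, LieSubalgebra.coe_incl, hE, hH]
    exact W.borelSpan_eq_top hlam
  · rw [affineRep_der]
    exact gradeOp_vacuum d x
  · refine (W.sugawaraEnd_i hlam ha hs hb n x).trans ?_
    change Finsupp.single 0 _ = _
    congr 1
    rcases le_or_gt n 0 with hn | hn
    · obtain ⟨k, rfl⟩ : ∃ k : ℕ, n = -(k : ℤ) := ⟨n.natAbs, by omega⟩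
      have h1 : (∑ᶠ m : ℤ, if m ≤ 0 then β m (β (-(k : ℤ) - m) x) else 0) =
          ∑ j ∈ Finset.range (k + 1), (miura τ b₀ j * miura τ b₀ (k - j)) x := by
        have hinj : Function.Injective fun j : ℕ => -(j : ℤ) := fun i j h => by
          simpa using h
        rw [finsum_eq_finsetSum_of_support_subset
          (s := (Finset.range (k + 1)).map ⟨fun j : ℕ => -(j : ℤ), hinj⟩), Finset.sum_map]
        · refine Finset.sum_congr rfl fun j hj => ?_
          have := Finset.mem_range.mp hj
          simp only [Function.Embedding.coeFn_mk, β]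
          rw [if_pos (by omega), if_pos (by omega), if_pos (by omega), Module.End.mul_apply,
            show (- -(j : ℤ)).toNat = j by omega, show (-(-(k : ℤ) - -(j : ℤ))).toNat = k - j by omega]
        · intro m hm
          by_contra hc
          refine hm ?_
          rcases le_or_gt m 0 with h | h
          · have : 0 < -(k : ℤ) - m := by
              by_contra h'
              refine hc (Finset.mem_coe.mpr (Finset.mem_map.mpr ⟨(-m).toNat,
                Finset.mem_range.mpr (by omega), ?_⟩))
              simp only [Function.Embedding.coeFn_mk]; omega
            simp only [if_pos h, hβ' _ this, LinearMap.zero_apply, map_zero]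
          · exact if_neg (by omega)
      rw [h1, ← miura_spec hb₀ ht k]
      simp only [β]
      rw [if_pos hn, show (- -(k : ℤ)).toNat = k by omega, LinearMap.add_apply, LinearMap.smul_apply,
        LinearMap.smul_apply, LinearMap.sum_apply]
      congr 3
      push_cast; ring
    · rw [hβ' n hn, hpos n hn, finsum_eq_zero_of_forall_eq_zero]
      · simp
      · intro m
        split_ifs with h
        · rw [hβ' _ (show n - m > 0 by omega)]; simp
        · rfl

end Model

end

end WhittakerSl2

namespace WhittakerSl2

noncomputable section

/-! ### Universal Whittaker modules -/

section Env

variable {L : Type*} [LieRing L] [LieAlgebra ℂ L]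

/-- By the universal property the identity of U(L) factors through the subalgebra generated by L. -/
theorem adjoin_range_env_ι :
    Algebra.adjoin ℂ (Set.range (UniversalEnvelopingAlgebra.ι ℂ (L := L))) = ⊤ := by
  set S := Algebra.adjoin ℂ (Set.range (UniversalEnvelopingAlgebra.ι ℂ (L := L)))
  let f : L →ₗ⁅ℂ⁆ S :=
    { toFun := fun x => ⟨UniversalEnvelopingAlgebra.ι ℂ x, Algebra.subset_adjoin ⟨x, rfl⟩⟩
      map_add' := fun x y => Subtype.ext (map_add _ x y)
      map_smul' := fun t x => Subtype.ext (map_smul (UniversalEnvelopingAlgebra.ι ℂ) t x)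
      map_lie' := fun {x y} => Subtype.ext (LieHom.map_lie (UniversalEnvelopingAlgebra.ι ℂ) x y) }
  have h : S.val.comp (UniversalEnvelopingAlgebra.lift ℂ f) = AlgHom.id ℂ _ := by
    refine UniversalEnvelopingAlgebra.hom_ext ℂ (LieHom.ext fun x => ?_)
    change S.val (UniversalEnvelopingAlgebra.lift ℂ f (UniversalEnvelopingAlgebra.ι ℂ x)) = _
    rw [UniversalEnvelopingAlgebra.lift_ι_apply]
    rfl
  refine eq_top_iff.mpr fun u _ => ?_
  have := AlgHom.congr_fun h u
  rw [AlgHom.id_apply] at this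
  rw [← this]
  exact (UniversalEnvelopingAlgebra.lift ℂ f u).2

theorem env_smul_mem {P : Type*} [AddCommGroup P] [Module ℂ P]
    [Module (UniversalEnvelopingAlgebra ℂ L) P]
    [IsScalarTower ℂ (UniversalEnvelopingAlgebra ℂ L) P] {N : Submodule ℂ P}
    (hN : ∀ (x : L), ∀ v ∈ N, UniversalEnvelopingAlgebra.ι ℂ x • v ∈ N)
    (u : UniversalEnvelopingAlgebra ℂ L) : ∀ v ∈ N, u • v ∈ N := by
  have hu : u ∈ Algebra.adjoin ℂ (Set.range (UniversalEnvelopingAlgebra.ι ℂ (L := L))) := by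
    rw [adjoin_range_env_ι]; trivial
  induction hu using Algebra.adjoin_induction with
  | mem u hu => obtain ⟨x, rfl⟩ := hu; exact hN x
  | algebraMap t => intro v hv; rw [algebraMap_smul]; exact N.smul_mem t hv
  | add u u' _ _ h h' => intro v hv; rw [add_smul]; exact N.add_mem (h v hv) (h' v hv)
  | mul u u' _ _ h h' => intro v hv; rw [mul_smul]; exact h _ (h' v hv)

end Env

section Whittaker

variable {L : Type*} [LieRing L] [LieAlgebra ℂ L] (j : AffHat →ₗ⁅ℂ⁆ L) (lam mu kappa : ℂ)

/-- The universal Whittaker module. -/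
abbrev WhittakerModule : Type _ :=
  RepSpace (envRep L (UniversalEnvelopingAlgebra ℂ L ⧸ whittakerIdeal L j lam mu kappa))

/-- The generator of the universal Whittaker module. -/
def whittakerGen : WhittakerModule j lam mu kappa :=
  Submodule.Quotient.mk (p := whittakerIdeal L j lam mu kappa) 1

/-- The conditions on a vector to be the image of the generator of a universal Whittaker module. -/
structure IsWhittakerVector {M : Type*} [AddCommGroup M] [Module ℂ M] [LieRingModule L M]
    (w : M) : Prop where
  e_zero : ⁅j (cur e0 0), w⁆ = lam • w
  f_one : ⁅j (cur f0 1), w⁆ = mu • w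
  c : ⁅j cen, w⁆ = kappa • w
  e_pos : ∀ i > 0, ⁅j (cur e0 i), w⁆ = 0
  h_pos : ∀ i > 0, ⁅j (cur h0 i), w⁆ = 0
  f_pos : ∀ i > 0, ⁅j (cur f0 (i + 1)), w⁆ = 0

variable {j lam mu kappa}

theorem lie_whittakerModule (x : L) (u : UniversalEnvelopingAlgebra ℂ L) :
    (⁅x, (Submodule.Quotient.mk u : WhittakerModule j lam mu kappa)⁆ :
      WhittakerModule j lam mu kappa) =
      (Submodule.Quotient.mk (UniversalEnvelopingAlgebra.ι ℂ x * u) :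
        UniversalEnvelopingAlgebra ℂ L ⧸ whittakerIdeal L j lam mu kappa) := rfl

theorem isWhittakerVector_gen :
    IsWhittakerVector j lam mu kappa (whittakerGen j lam mu kappa) := by
  have key : ∀ (x : L) (t : ℂ), UniversalEnvelopingAlgebra.ι ℂ x - algebraMap ℂ _ t ∈
      whittakerIdeal L j lam mu kappa →
      ⁅x, whittakerGen j lam mu kappa⁆ = t • whittakerGen j lam mu kappa := fun x t h => by
    rw [whittakerGen, lie_whittakerModule, mul_one]
    refine ((Submodule.Quotient.eq _).mpr h).trans ?_
    rw [Algebra.algebraMap_eq_smul_one]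
    rfl
  have key' : ∀ x : L, UniversalEnvelopingAlgebra.ι ℂ x ∈ whittakerIdeal L j lam mu kappa →
      ⁅x, whittakerGen j lam mu kappa⁆ = 0 := fun x h => by
    rw [key x 0 (by rwa [map_zero, sub_zero]), zero_smul]
  exact
    { e_zero := key _ _ (Submodule.subset_span (Or.inl (Or.inl rfl)))
      f_one := key _ _ (Submodule.subset_span (Or.inl (Or.inr (Or.inl rfl))))
      c := key _ _ (Submodule.subset_span (Or.inl (Or.inr (Or.inr rfl))))
      e_pos := fun i hi => key' _ (Submodule.subset_span (Or.inr ⟨i, hi, Or.inl rfl⟩))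
      h_pos := fun i hi => key' _ (Submodule.subset_span (Or.inr ⟨i, hi, Or.inr (Or.inl rfl)⟩))
      f_pos := fun i hi => key' _ (Submodule.subset_span (Or.inr ⟨i, hi, Or.inr (Or.inr rfl)⟩)) }

theorem eq_top_of_gen_mem {N : Submodule ℂ (WhittakerModule j lam mu kappa)}
    (hw : whittakerGen j lam mu kappa ∈ N) (hN : ∀ (x : L), ∀ v ∈ N, ⁅x, v⁆ ∈ N) : N = ⊤ := by
  refine eq_top_iff.mpr fun v _ => ?_
  obtain ⟨u, rfl⟩ := Submodule.Quotient.mk_surjective _ v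
  let N' : Submodule ℂ (UniversalEnvelopingAlgebra ℂ L ⧸ whittakerIdeal L j lam mu kappa) :=
    { carrier := {v | (v : WhittakerModule j lam mu kappa) ∈ N}
      zero_mem' := N.zero_mem
      add_mem' := fun h h' => N.add_mem h h'
      smul_mem' := fun t _ h => N.smul_mem t h }
  have h : (Submodule.Quotient.mk (u * 1) :
      UniversalEnvelopingAlgebra ℂ L ⧸ whittakerIdeal L j lam mu kappa) ∈ N' :=
    env_smul_mem (N := N') hN u _ hw
  rw [mul_one] at h
  exact h

/-- The elements of U(L) that kill w form a left ideal, and it contains the generators of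
`whittakerIdeal`. -/
theorem exists_hom {M : Type*} [AddCommGroup M] [Module ℂ M] [LieRingModule L M]
    [LieModule ℂ L M] {w : M} (hw : IsWhittakerVector j lam mu kappa w) :
    ∃ φ : WhittakerModule j lam mu kappa →ₗ⁅ℂ,L⁆ M, φ (whittakerGen j lam mu kappa) = w := by
  let F := UniversalEnvelopingAlgebra.lift ℂ (LieModule.toEnd ℂ L M)
  have hF : ∀ x v, F (UniversalEnvelopingAlgebra.ι ℂ x) v = ⁅x, v⁆ := fun x v => by
    rw [UniversalEnvelopingAlgebra.lift_ι_apply]; rfl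
  let K : Submodule (UniversalEnvelopingAlgebra ℂ L) (UniversalEnvelopingAlgebra ℂ L) :=
    { carrier := {u | F u w = 0}
      zero_mem' := by
        change F 0 w = 0
        rw [map_zero, LinearMap.zero_apply]
      add_mem' := fun {u v} hu hv => by
        change F (u + v) w = 0
        rw [map_add, LinearMap.add_apply, show F u w = 0 from hu, show F v w = 0 from hv, add_zero]
      smul_mem' := fun u v hv => by
        change F (u * v) w = 0
        rw [map_mul, Module.End.mul_apply, show F v w = 0 from hv, map_zero] }
  have hs : ∀ (x : L) (t : ℂ), ⁅x, w⁆ = t • w →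
      UniversalEnvelopingAlgebra.ι ℂ x - algebraMap ℂ _ t ∈ K := fun x t h => by
    change F _ w = 0
    rw [map_sub, LinearMap.sub_apply, hF, AlgHom.commutes, Module.algebraMap_end_apply, h, sub_self]
  have h0 : ∀ x : L, ⁅x, w⁆ = 0 → UniversalEnvelopingAlgebra.ι ℂ x ∈ K := fun x h => by
    change F _ w = 0
    rw [hF, h]
  have hK : whittakerIdeal L j lam mu kappa ≤ K := by
    refine Submodule.span_le.mpr ?_
    rintro _ ((rfl | rfl | rfl) | ⟨i, hi, rfl | rfl | rfl⟩)
    exacts [hs _ _ hw.e_zero, hs _ _ hw.f_one, hs _ _ hw.c, h0 _ (hw.e_pos i hi),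
      h0 _ (hw.h_pos i hi), h0 _ (hw.f_pos i hi)]
  let G : UniversalEnvelopingAlgebra ℂ L →ₗ[ℂ] M := (LinearMap.applyₗ w).comp F.toLinearMap
  let φ : (UniversalEnvelopingAlgebra ℂ L ⧸ whittakerIdeal L j lam mu kappa) →ₗ[ℂ] M :=
    ((whittakerIdeal L j lam mu kappa).restrictScalars ℂ).liftQ G (fun u hu => hK hu) ∘ₗ
      (Submodule.Quotient.restrictScalarsEquiv ℂ (whittakerIdeal L j lam mu kappa)).symm
  have hφ : ∀ u, φ (Submodule.Quotient.mk u) = F u w := fun u => rfl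
  refine ⟨{ (φ : WhittakerModule j lam mu kappa →ₗ[ℂ] M) with
    map_lie' := fun {x v} => ?_ }, ?_⟩
  · obtain ⟨u, rfl⟩ := Submodule.Quotient.mk_surjective _ v
    change φ (Submodule.Quotient.mk (UniversalEnvelopingAlgebra.ι ℂ x * u)) =
      ⁅x, φ (Submodule.Quotient.mk u)⁆
    rw [hφ, hφ, map_mul, Module.End.mul_apply, hF]
  · change φ (Submodule.Quotient.mk 1) = w
    rw [hφ, map_one, Module.End.one_apply]

theorem IsWhittakerVector.map {M M' : Type*} [AddCommGroup M] [Module ℂ M] [LieRingModule L M]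
    [AddCommGroup M'] [Module ℂ M'] [LieRingModule L M'] {w : M}
    (hw : IsWhittakerVector j lam mu kappa w) (φ : M →ₗ⁅ℂ,L⁆ M') :
    IsWhittakerVector j lam mu kappa (φ w) where
  e_zero := by rw [← LieModuleHom.map_lie, hw.e_zero, map_smul]
  f_one := by rw [← LieModuleHom.map_lie, hw.f_one, map_smul]
  c := by rw [← LieModuleHom.map_lie, hw.c, map_smul]
  e_pos i hi := by rw [← LieModuleHom.map_lie, hw.e_pos i hi, map_zero]
  h_pos i hi := by rw [← LieModuleHom.map_lie, hw.h_pos i hi, map_zero]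
  f_pos i hi := by rw [← LieModuleHom.map_lie, hw.f_pos i hi, map_zero]

/-- A module over the affine algebra, or its extension, that is generated by a Whittaker vector at
the critical level, is critical. -/
theorem isCritical_of_generated {M : Type*} [AddCommGroup M] [Module ℂ M]
    {ρ : AffHat →ₗ⁅ℂ⁆ Module.End ℂ M} {w : M}
    (hw : ∀ x : Sl2, ∃ N : ℤ, ∀ n ≥ N, ρ (cur x n) w = 0) (hc : ρ cen w = (-2 : ℂ) • w)
    (hgen : ∀ N : Submodule ℂ M, w ∈ N → (∀ z, ∀ v ∈ N, ρ z v ∈ N) →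
      (∀ D : Module.End ℂ M, (∀ x n, D * ρ (cur x n) = ρ (cur x n) * D + (n : ℂ) • ρ (cur x n)) →
        D * ρ cen = ρ cen * D → ∀ v ∈ N, D v ∈ N) → N = ⊤) : IsCritical ρ where
  restricted v := by
    have h := hgen (restrictedVectors ρ) hw (restrictedVectors_stable ρ)
      fun D hD _ v hv => restrictedVectors_stable_der ρ hD v hv
    exact (h ▸ Submodule.mem_top : v ∈ restrictedVectors ρ)
  level := by
    have h := hgen (LinearMap.ker (ρ cen - (-2 : ℂ) • 1)) (by simp [hc]) (fun z v hv => ?_)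
      fun D _ hD v hv => ?_
    · exact sub_eq_zero.mp (LinearMap.ker_eq_top.mp h)
    · have h1 := LinearMap.congr_fun (LieHom.map_mul ρ cen z) v
      rw [show ⁅cen, z⁆ = 0 from Subtype.ext (cen_lie z), map_zero, add_zero] at h1
      rw [LinearMap.mem_ker, LinearMap.sub_apply, sub_eq_zero] at hv ⊢
      refine h1.trans ?_
      rw [Module.End.mul_apply, hv]
      simp
    · have h1 := LinearMap.congr_fun hD v
      rw [LinearMap.mem_ker, LinearMap.sub_apply, sub_eq_zero] at hv ⊢
      refine h1.symm.trans ?_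
      rw [Module.End.mul_apply, hv]
      simp

theorem restricted_of_whittaker {M : Type*} [AddCommGroup M] [Module ℂ M]
    {ρ : AffHat →ₗ⁅ℂ⁆ Module.End ℂ M} {w : M} {m : ℤ} (he : ∀ i > m, ρ (cur e0 i) w = 0)
    (hh : ∀ i > m, ρ (cur h0 i) w = 0) (hf : ∀ i > m, ρ (cur f0 i) w = 0) (x : Sl2) :
    ∃ N : ℤ, ∀ n ≥ N, ρ (cur x n) w = 0 := by
  refine ⟨m + 1, fun n hn => ?_⟩
  rw [sl2_decomp x, cur_add, cur_add, cur_smul, cur_smul, cur_smul]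
  simp [he n (by omega), hh n (by omega), hf n (by omega)]

end Whittaker

/-! ### Sugawara operators under equivariant maps and on submodules -/

section Hom

variable {M M' : Type*} [AddCommGroup M] [Module ℂ M] [AddCommGroup M'] [Module ℂ M']
  {ρ : AffHat →ₗ⁅ℂ⁆ Module.End ℂ M} {ρ' : AffHat →ₗ⁅ℂ⁆ Module.End ℂ M'}

/-- Only the source needs to be restricted: the sum at v is finite, and the map carries it term by
term to the sum at the image. -/
theorem IsRestricted.map_sugawara (R : IsRestricted ρ) {φ : M →ₗ[ℂ] M'}
    (hφ : ∀ z v, φ (ρ z v) = ρ' z (φ v)) (n : ℤ) (v : M) :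
    φ (sugawara ρ n v) = sugawara ρ' n (φ v) := by
  have h1 := R.locFin_ordTerm e0 f0 n 0
  have h2 := R.locFin_ordTerm f0 e0 n 0
  have h3 := R.locFin_ordTerm h0 h0 n 0
  have h4 : LocFin fun m => normalTerm ρ e0 f0 n m + normalTerm ρ f0 e0 n m +
      (1 / 2 : ℂ) • normalTerm ρ h0 h0 n m := (h1.add h2).add (h3.smul fun _ => _)
  have hterm : ∀ x y m, φ (normalTerm ρ x y n m v) = normalTerm ρ' x y n m (φ v) := fun x y m => by
    unfold normalTerm
    split_ifs <;> simp [hφ]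
  unfold sugawara
  rw [map_smul]
  congr 1
  refine ((LinearMap.toAddMonoidHom φ).map_finsum (h4 v)).trans (finsum_congr fun m => ?_)
  simp [hterm]

theorem sugawaraEnd_mem (R : IsRestricted ρ) {N : Submodule ℂ M} (hN : ∀ z, ∀ v ∈ N, ρ z v ∈ N)
    (n : ℤ) {v : M} (hv : v ∈ N) : sugawaraEnd ρ n v ∈ N := by
  have h : ∀ x y, ordSum ρ x y n 0 v ∈ N := fun x y =>
    (R.locFin_ordTerm x y n 0).mem_of fun m => by
      rw [ordTerm]
      split_ifs <;> exact hN _ _ (hN _ _ hv)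
  exact N.smul_mem _ (N.add_mem (N.add_mem (h _ _) (h _ _)) (N.smul_mem _ (h _ _)))

end Hom

end

end WhittakerSl2

namespace WhittakerSl2

noncomputable section

/-! ### The module `V(λ, 0, -2, 0)` -/

section Der

variable {M : Type*} [AddCommGroup M] [Module ℂ M] (ρ : AffTilde →ₗ⁅ℂ⁆ Module.End ℂ M)

/-- The restriction of a representation of the affine algebra with derivation. -/
abbrev hatRep : AffHat →ₗ⁅ℂ⁆ Module.End ℂ M := ρ.comp AffHat.incl

theorem der_mul_cur (x : Sl2) (n : ℤ) :
    ρ der * hatRep ρ (cur x n) = hatRep ρ (cur x n) * ρ der + (n : ℂ) • hatRep ρ (cur x n) := by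
  have h := LieHom.map_mul ρ der (cur x n)
  rwa [der_lie_cur, map_smul] at h

theorem der_mul_cen : ρ der * hatRep ρ cen = hatRep ρ cen * ρ der := by
  have h := LieHom.map_mul ρ der cen
  rwa [← lie_skew, cen_lie, neg_zero, map_zero, add_zero] at h

theorem toEnd_comp_incl (M : Type*) [AddCommGroup M] [Module ℂ M] [LieRingModule AffTilde M]
    [LieModule ℂ AffTilde M] :
    hatRep (LieModule.toEnd ℂ AffTilde M) = LieModule.toEnd ℂ AffHat M := rfl

variable {ρ} in
theorem sugawaraEnd_mul_der (C : IsCritical (hatRep ρ)) (n : ℤ) (v : M) :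
    ρ der (sugawaraEnd (hatRep ρ) n v) =
      sugawaraEnd (hatRep ρ) n (ρ der v) + (n : ℂ) • sugawaraEnd (hatRep ρ) n v :=
  LinearMap.congr_fun (C.sugawaraEnd_der (der_mul_cur ρ) n) v

end Der

/-- A module generated by a Whittaker vector at the critical level. -/
theorem isCritical_of_generated_tilde {M : Type*} [AddCommGroup M] [Module ℂ M]
    [LieRingModule AffTilde M] [LieModule ℂ AffTilde M] {lam mu : ℂ} {w : M}
    (hw : IsWhittakerVector AffHat.incl lam mu (-2) w)
    (hgen : ∀ N : Submodule ℂ M, w ∈ N → (∀ (x : AffTilde), ∀ v ∈ N, ⁅x, v⁆ ∈ N) → N = ⊤) :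
    IsCritical (LieModule.toEnd ℂ AffHat M) := by
  refine isCritical_of_generated (w := w) (restricted_of_whittaker (m := 1)
    (fun i hi => hw.e_pos i (by omega)) (fun i hi => hw.h_pos i (by omega)) fun i hi => ?_) hw.c
    fun N hwN hN hD => hgen N hwN fun x v hv => ?_
  · have := hw.f_pos (i - 1) (by omega)
    rwa [sub_add_cancel] at this
  · refine lie_mem_of_span span_affGen (forall_affGen (fun n v hv => ?_) (fun n v hv => ?_)
      (fun n v hv => ?_) (fun v hv => ?_) fun v hv => ?_) x hv
    · exact hN (cur e0 n) v hv
    · exact hN (cur h0 n) v hv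
    · exact hN (cur f0 n) v hv
    · exact hN cen v hv
    · exact hD (LieModule.toEnd ℂ AffTilde M der) (der_mul_cur _) (der_mul_cen _) v hv

theorem isCritical_hom {M M' : Type*} [AddCommGroup M] [Module ℂ M] [AddCommGroup M'] [Module ℂ M']
    {ρ : AffHat →ₗ⁅ℂ⁆ Module.End ℂ M} {ρ' : AffHat →ₗ⁅ℂ⁆ Module.End ℂ M'} (C : IsCritical ρ)
    (φ : M →ₗ[ℂ] M') (hφ : ∀ z v, φ (ρ z v) = ρ' z (φ v)) (hs : Function.Surjective φ) :
    IsCritical ρ' where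
  restricted v x := by
    obtain ⟨v, rfl⟩ := hs v
    obtain ⟨N, hN⟩ := C.restricted v x
    exact ⟨N, fun n hn => by rw [← hφ, hN n hn, map_zero]⟩
  level := by
    ext v
    obtain ⟨v, rfl⟩ := hs v
    rw [← hφ, C.level]
    simp

theorem isCritical_vTilde (lam mu : ℂ) :
    IsCritical (LieModule.toEnd ℂ AffHat (VTilde lam mu (-2))) :=
  isCritical_of_generated_tilde (w := whittakerGen AffHat.incl lam mu (-2)) isWhittakerVector_gen
    fun _ hw hN => eq_top_of_gen_mem hw hN

/-- The projection to `VZero`. -/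
def vZeroProj (lam : ℂ) : VTilde lam 0 (-2) →ₗ⁅ℂ,AffTilde⁆ VZero lam := LieSubmodule.Quotient.mk' _

theorem vZeroProj_surjective (lam : ℂ) : Function.Surjective (vZeroProj lam) :=
  LieSubmodule.Quotient.surjective_mk' _

theorem vZeroProj_lie (lam : ℂ) (z : AffHat) (v : VTilde lam 0 (-2)) :
    (vZeroProj lam : VTilde lam 0 (-2) →ₗ[ℂ] VZero lam)
      (LieModule.toEnd ℂ AffHat (VTilde lam 0 (-2)) z v) =
    LieModule.toEnd ℂ AffHat (VZero lam) z
      ((vZeroProj lam : VTilde lam 0 (-2) →ₗ[ℂ] VZero lam) v) :=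
  LieModuleHom.map_lie (vZeroProj lam) (z : AffTilde) v

/-- The generator of `VZero`. -/
def wZero (lam : ℂ) : VZero lam := vZeroProj lam (wTilde lam 0 (-2))

theorem isCritical_vZero (lam : ℂ) : IsCritical (LieModule.toEnd ℂ AffHat (VZero lam)) :=
  isCritical_hom (isCritical_vTilde lam 0) (vZeroProj lam : VTilde lam 0 (-2) →ₗ[ℂ] VZero lam)
    (vZeroProj_lie lam) (vZeroProj_surjective lam)

theorem isWhittakerVector_wZero (lam : ℂ) :
    IsWhittakerVector AffHat.incl lam 0 (-2) (wZero lam) :=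
  (isWhittakerVector_gen (j := AffHat.incl)).map (vZeroProj lam)

theorem wZero_mem_whit (lam : ℂ) : wZero lam ∈ whit (LieModule.toEnd ℂ AffHat (VZero lam)) lam :=
  ⟨(isWhittakerVector_wZero lam).e_zero, fun i hi =>
    ⟨(isWhittakerVector_wZero lam).e_pos i hi, (isWhittakerVector_wZero lam).h_pos i hi⟩⟩

theorem der_wZero (lam : ℂ) : ⁅der, wZero lam⁆ = 0 := by
  rw [wZero, ← LieModuleHom.map_lie]
  exact (LieSubmodule.Quotient.mk_eq_zero _).mpr (LieSubmodule.subset_lieSpan (Or.inl rfl))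

theorem sugawara_wZero (lam : ℂ) (n : ℤ) :
    sugawaraEnd (LieModule.toEnd ℂ AffHat (VZero lam)) n (wZero lam) = 0 := by
  rw [← (isCritical_vZero lam).restricted.sugawara_eq, wZero]
  refine ((isCritical_vTilde lam 0).restricted.map_sugawara
    (vZeroProj_lie lam) n _).symm.trans ?_
  exact (LieSubmodule.Quotient.mk_eq_zero _).mpr (LieSubmodule.subset_lieSpan (Or.inr ⟨n, rfl⟩))

theorem vZero_eq_top {lam : ℂ} {N : Submodule ℂ (VZero lam)} (hw : wZero lam ∈ N)
    (hN : ∀ (x : AffTilde), ∀ v ∈ N, ⁅x, v⁆ ∈ N) : N = ⊤ := by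
  have h : N.comap (vZeroProj lam : VTilde lam 0 (-2) →ₗ[ℂ] VZero lam) = ⊤ :=
    eq_top_of_gen_mem (j := AffHat.incl) hw fun x v hv => by
      rw [Submodule.mem_comap]
      exact (LieModuleHom.map_lie (vZeroProj lam) x v).symm ▸ hN x _ hv
  refine eq_top_iff.mpr fun v _ => ?_
  obtain ⟨u, rfl⟩ := vZeroProj_surjective lam v
  exact (h ▸ Submodule.mem_top : u ∈ N.comap _)

/-- The submodule generated by a space of Whittaker vectors that is stable under the Sugawara
operators and the derivation. -/
theorem bspan_stable {M : Type*} [AddCommGroup M] [Module ℂ M]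
    {ρ : AffTilde →ₗ⁅ℂ⁆ Module.End ℂ M} (C : IsCritical (hatRep ρ)) {lam : ℂ} (hlam : lam ≠ 0)
    {X : Submodule ℂ M} (hX : X ≤ whit (hatRep ρ) lam)
    (hT : ∀ n, ∀ x ∈ X, sugawaraEnd (hatRep ρ) n x ∈ X) (hD : ∀ x ∈ X, ρ der x ∈ X)
    (z : AffTilde) {v : M} (hv : v ∈ bspan (hatRep ρ) X) : ρ z v ∈ bspan (hatRep ρ) X := by
  refine lie_mem_of_span (M := RepSpace ρ) span_affGen (forall_affGen (fun n v hv => ?_)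
    (fun n v hv => ?_) (fun n v hv => ?_) (fun v hv => ?_) fun v hv => ?_) z hv
  · exact borelSpan_stable_e n v hv
  · exact borelSpan_stable_h n v hv
  · exact C.f_mem_bspan (fun x hx n => C.f_mem_of_whit hlam borelSpan_stable_e borelSpan_stable_h
      (hX hx) (le_borelSpan hx) (fun n => le_borelSpan (hT n x hx)) n) n v hv
  · have : ρ cen v = (-2 : ℂ) • v := LinearMap.congr_fun C.level v
    change ρ cen v ∈ _
    rw [this]
    exact Submodule.smul_mem _ _ hv
  · exact IsCritical.der_mem_bspan (der_mul_cur ρ) (fun x hx => le_borelSpan (hD x hx)) v hv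

/-- The line through the generator is stable under d and all T(n), which kill it. So the words in e
and h on it already form a submodule for the whole affine algebra. -/
theorem bspan_wZero {lam : ℂ} (hlam : lam ≠ 0) :
    bspan (LieModule.toEnd ℂ AffHat (VZero lam)) (Submodule.span ℂ {wZero lam}) = ⊤ := by
  refine vZero_eq_top (le_borelSpan (Submodule.mem_span_singleton_self _)) fun z v hv =>
    bspan_stable (ρ := LieModule.toEnd ℂ AffTilde (VZero lam)) (isCritical_vZero lam) hlam
      ?_ (fun n x hx => ?_) (fun x hx => ?_) z hv
  · rw [Submodule.span_singleton_le_iff_mem]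
    exact wZero_mem_whit lam
  · obtain ⟨t, rfl⟩ := Submodule.mem_span_singleton.mp hx
    rw [map_smul, toEnd_comp_incl, sugawara_wZero, smul_zero]
    exact Submodule.zero_mem _
  · obtain ⟨t, rfl⟩ := Submodule.mem_span_singleton.mp hx
    rw [map_smul, LieModule.toEnd_apply_apply, der_wZero, smul_zero]
    exact Submodule.zero_mem _

/-- A Whittaker vector killed by the `T(n)`, `n > 0`, is the image of the generator of a universal
Whittaker module. -/
theorem isWhittakerVector_of_whit {M : Type*} [AddCommGroup M] [Module ℂ M]
    {ρ : AffTilde →ₗ⁅ℂ⁆ Module.End ℂ M} (C : IsCritical (hatRep ρ)) {lam : ℂ} (hlam : lam ≠ 0)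
    {x : M} (hx : x ∈ whit (hatRep ρ) lam) (hT : ∀ n > 0, sugawaraEnd (hatRep ρ) n x = 0) :
    IsWhittakerVector AffHat.incl lam 0 (-2) (show RepSpace ρ from x) where
  e_zero := hx.1
  f_one := by
    rw [zero_smul]
    exact C.f_eq_zero_of_whit hlam hx hT one_pos
  c := LinearMap.congr_fun C.level x
  e_pos i hi := (hx.2 i hi).1
  h_pos i hi := (hx.2 i hi).2
  f_pos i hi := C.f_eq_zero_of_whit hlam hx hT (by omega : 0 < i + 1)

/-- Generators and relations do not show that the module is nonzero. The free field model on X = ℂ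
with d = 0 and T = 0 contains a nonzero vector satisfying all relations. -/
theorem wZero_ne_zero {lam : ℂ} (hlam : lam ≠ 0) : wZero lam ≠ 0 := by
  obtain ⟨ρ, C, hw, -, hd, hT⟩ := exists_model (X := ℂ) hlam (d := 0) (τ := 0) (t := 0)
    (by simp) (by simp) (by simp) (by simp)
  set x : Fock ℂ := Finsupp.single 0 1 with hx
  have hT' : ∀ n, sugawaraEnd (hatRep ρ) n x = 0 := fun n => by
    rw [hx, hT]; simp
  obtain ⟨φ, hφ⟩ := exists_hom (isWhittakerVector_of_whit C hlam (hw ⟨1, rfl⟩) fun n _ => hT' n)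
  intro h
  have h1 : wTilde lam 0 (-2) ∈ LieSubmodule.lieSpan ℂ AffTilde
      ({⁅der, wTilde lam 0 (-2)⁆} ∪ {v : VTilde lam 0 (-2) | ∃ n : ℤ,
        v = sugawara (LieModule.toEnd ℂ AffHat (VTilde lam 0 (-2))) n (wTilde lam 0 (-2))}) :=
    (LieSubmodule.Quotient.mk_eq_zero _).mp h
  have h2 : LieSubmodule.lieSpan ℂ AffTilde
      ({⁅der, wTilde lam 0 (-2)⁆} ∪ {v : VTilde lam 0 (-2) | ∃ n : ℤ,
        v = sugawara (LieModule.toEnd ℂ AffHat (VTilde lam 0 (-2))) n (wTilde lam 0 (-2))}) ≤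
      φ.ker := by
    refine LieSubmodule.lieSpan_le.mpr ?_
    rintro _ (rfl | ⟨n, rfl⟩)
    · change φ ⁅der, wTilde lam 0 (-2)⁆ = 0
      rw [LieModuleHom.map_lie]
      refine (congrArg (fun v : RepSpace ρ => ⁅der, v⁆) hφ).trans ?_
      change ρ der x = 0
      rw [hx, hd]; simp
    · change φ _ = 0
      refine ((isCritical_vTilde lam 0).restricted.map_sugawara
        (φ := (φ : VTilde lam 0 (-2) →ₗ[ℂ] RepSpace ρ)) (ρ' := hatRep ρ)
        (fun z v => LieModuleHom.map_lie φ z v) n _).trans ?_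
      rw [C.restricted.sugawara_eq]
      exact (congrArg (sugawaraEnd (hatRep ρ) n) hφ).trans (hT' n)
  have h3 : x = 0 := hφ.symm.trans (h2 h1)
  rw [hx] at h3
  exact one_ne_zero (Finsupp.single_eq_zero.mp h3)

end

end WhittakerSl2

namespace WhittakerSl2

noncomputable section

/-! ### Tensor products with `V(λ, 0, -2, 0)` -/

section RTensor

variable {V : Type*} [AddCommGroup V] [Module ℂ V] {e h : ℤ → Module.End ℂ V}

theorem loc_rTensor {A : ℤ → Module.End ℂ V} (hA : ∀ v, ∃ N : ℤ, ∀ n ≥ N, A n v = 0)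
    (X : Type*) [AddCommGroup X] [Module ℂ X] (v : V ⊗[ℂ] X) :
    ∃ N : ℤ, ∀ n ≥ N, (A n).rTensor X v = 0 := by
  induction v using TensorProduct.induction_on with
  | zero => exact ⟨0, fun n _ => map_zero _⟩
  | tmul v x =>
    obtain ⟨N, hN⟩ := hA v
    exact ⟨N, fun n hn => by rw [LinearMap.rTensor_tmul, hN n hn, TensorProduct.zero_tmul]⟩
  | add v w hv hw =>
    obtain ⟨N, hN⟩ := hv
    obtain ⟨N', hN'⟩ := hw
    refine ⟨max N N', fun n hn => ?_⟩
    rw [map_add, hN n (le_trans (le_max_left _ _) hn), hN' n (le_trans (le_max_right _ _) hn),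
      add_zero]

theorem BorelCurrents.rTensor (B : BorelCurrents e h) (X : Type*) [AddCommGroup X] [Module ℂ X] :
    BorelCurrents (fun n => (e n).rTensor X) (fun n => (h n).rTensor X) where
  ee m n := by rw [← LinearMap.rTensor_mul, ← LinearMap.rTensor_mul, B.ee]
  he m n := by
    rw [← LinearMap.rTensor_mul, ← LinearMap.rTensor_mul, B.he, LinearMap.rTensor_add,
      LinearMap.rTensor_smul]
  hh m n := by
    rw [← LinearMap.rTensor_mul, ← LinearMap.rTensor_mul, B.hh, LinearMap.rTensor_add,
      LinearMap.rTensor_smul]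
    congr 2
    exact LinearMap.rTensor_id X V
  loc_e := loc_rTensor B.loc_e X
  loc_h := loc_rTensor B.loc_h X

theorem borelSpan_rTensor {w : V} (htop : borelSpan e h (Submodule.span ℂ {w}) = ⊤)
    (X : Type*) [AddCommGroup X] [Module ℂ X] :
    borelSpan (fun n => (e n).rTensor X) (fun n => (h n).rTensor X)
      (LinearMap.range (TensorProduct.mk ℂ V X w)) = ⊤ := by
  set S := borelSpan (fun n => (e n).rTensor X) (fun n => (h n).rTensor X)
    (LinearMap.range (TensorProduct.mk ℂ V X w)) with hS
  have H : ∀ x : X, S.comap ((TensorProduct.mk ℂ V X).flip x) = ⊤ := fun x => by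
    refine eq_top_iff.mpr (htop ▸ borelSpan_le ?_ (fun n v hv => ?_) fun n v hv => ?_)
    · rw [Submodule.span_singleton_le_iff_mem]
      exact le_borelSpan ⟨x, rfl⟩
    · exact borelSpan_stable_e (e := fun n => (e n).rTensor X) n _ hv
    · exact borelSpan_stable_h (h := fun n => (h n).rTensor X) n _ hv
  refine eq_top_iff.mpr fun v _ => ?_
  induction v using TensorProduct.induction_on with
  | zero => exact S.zero_mem
  | tmul v x => exact (H x ▸ Submodule.mem_top : v ∈ S.comap ((TensorProduct.mk ℂ V X).flip x))
  | add v w hv hw => exact S.add_mem (hv trivial) (hw trivial)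

theorem mk_injective {w : V} (hw : w ≠ 0) (X : Type*) [AddCommGroup X] [Module ℂ X] :
    Function.Injective (TensorProduct.mk ℂ V X w) := by
  obtain ⟨f, hf⟩ : ∃ f : Module.Dual ℂ V, f w ≠ 0 := by
    by_contra! h
    exact hw ((Module.forall_dual_apply_eq_zero_iff ℂ w).mp h)
  intro x y hxy
  have := congrArg (TensorProduct.lid ℂ X ∘ f.rTensor X) hxy
  simpa [hf] using this

/-- Used to compare d or T(n) with the expected tensor formula: both have the same commutator with E
⊗ 1, a multiple of E ⊗ 1 itself. -/
theorem comm_rTensor_add_lTensor {X : Type*} [AddCommGroup X] [Module ℂ X] {A E : Module.End ℂ V}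
    {A' : Module.End ℂ (V ⊗[ℂ] X)} {c : ℂ}
    (h' : A' * E.rTensor X = E.rTensor X * A' + c • E.rTensor X) (h : A * E = E * A + c • E)
    (B : Module.End ℂ X) : (A' - (A.rTensor X + B.lTensor V)) * E.rTensor X =
      E.rTensor X * (A' - (A.rTensor X + B.lTensor V)) := by
  have h2 := congrArg (LinearMap.rTensor X) h
  rw [LinearMap.rTensor_add, LinearMap.rTensor_mul, LinearMap.rTensor_mul,
    LinearMap.rTensor_smul] at h2
  have h3 : B.lTensor V * E.rTensor X = E.rTensor X * B.lTensor V :=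
    (LinearMap.lTensor_comp_rTensor _ _ _).trans (LinearMap.rTensor_comp_lTensor _ _ _).symm
  rw [sub_mul, mul_sub, add_mul, mul_add, h', h2, h3]
  abel

/-- Over e(n) and h(n), both V ⊗ X, through the vectors w ⊗ x, and M, through i, are generated by
Whittaker vectors forming a copy of X. So they are isomorphic, and the affine action of M is carried
over to V ⊗ X. This provides operators f(n) there without any formula for them. -/
theorem exists_tensor_model {lam : ℂ} (hlam : lam ≠ 0) {κ : AffTilde →ₗ⁅ℂ⁆ Module.End ℂ V}
    (C₀ : IsCritical (hatRep κ)) {w : V} (hw : w ∈ whit (hatRep κ) lam) (hw0 : w ≠ 0)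
    (htop₀ : bspan (hatRep κ) (Submodule.span ℂ {w}) = ⊤) (hd₀ : κ der w = 0)
    (hT₀ : ∀ n, sugawaraEnd (hatRep κ) n w = 0)
    {X M : Type*} [AddCommGroup X] [Module ℂ X] [AddCommGroup M] [Module ℂ M]
    {ρ : AffTilde →ₗ⁅ℂ⁆ Module.End ℂ M} {i : X →ₗ[ℂ] M} (C : IsCritical (hatRep ρ))
    (hi : Function.Injective i) (hX : LinearMap.range i ≤ whit (hatRep ρ) lam)
    (htop : bspan (hatRep ρ) (LinearMap.range i) = ⊤) {d : Module.End ℂ X}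
    {τ : ℤ → Module.End ℂ X} (hd : ∀ x, ρ der (i x) = i (d x))
    (hT : ∀ n x, sugawaraEnd (hatRep ρ) n (i x) = i (τ n x)) :
    ∃ (ρ' : AffTilde →ₗ⁅ℂ⁆ Module.End ℂ (V ⊗[ℂ] X)) (Ξ : M ≃ₗ[ℂ] V ⊗[ℂ] X),
      (∀ z v, Ξ (ρ z v) = ρ' z (Ξ v)) ∧ IsCritical (hatRep ρ') ∧
      (∀ n, hatRep ρ' (cur e0 n) = (hatRep κ (cur e0 n)).rTensor X) ∧
      (∀ n, hatRep ρ' (cur h0 n) = (hatRep κ (cur h0 n)).rTensor X) ∧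
      ρ' der = (κ der).rTensor X + d.lTensor V ∧
      ∀ n, sugawaraEnd (hatRep ρ') n = (sugawaraEnd (hatRep κ) n).rTensor X + (τ n).lTensor V := by
  have hrange : LinearMap.range (TensorProduct.mk ℂ V X w) ≤
      whittakerVectors (fun n => (hatRep κ (cur e0 n)).rTensor X)
        (fun n => (hatRep κ (cur h0 n)).rTensor X) lam := by
    rintro _ ⟨x, rfl⟩
    refine ⟨?_, fun n hn => ⟨?_, ?_⟩⟩
    · rw [TensorProduct.mk_apply, LinearMap.rTensor_tmul, hw.1, TensorProduct.smul_tmul']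
    · rw [TensorProduct.mk_apply, LinearMap.rTensor_tmul, (hw.2 n hn).1, TensorProduct.zero_tmul]
    · rw [TensorProduct.mk_apply, LinearMap.rTensor_tmul, (hw.2 n hn).2, TensorProduct.zero_tmul]
  have htopV := borelSpan_rTensor htop₀ X
  obtain ⟨Θ, hΘ, hΘe, hΘh⟩ := exists_equiv_of_borelSpan_eq_top (C₀.borelCurrents.rTensor X)
    C.borelCurrents hlam (TensorProduct.mk ℂ V X w) i (mk_injective hw0 X) hi hrange hX htopV htop
  let ρ' : AffTilde →ₗ⁅ℂ⁆ Module.End ℂ (V ⊗[ℂ] X) :=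
    (Θ.symm.lieConj : Module.End ℂ M →ₗ⁅ℂ⁆ Module.End ℂ (V ⊗[ℂ] X)).comp ρ
  have hρ' : ∀ z v, ρ' z v = Θ.symm (ρ z (Θ v)) := fun z v => rfl
  clear_value ρ'
  have hΞ : ∀ z v, Θ.symm (ρ z v) = ρ' z (Θ.symm v) := fun z v => by
    rw [hρ', LinearEquiv.apply_symm_apply]
  have C' : IsCritical (hatRep ρ') := isCritical_hom C (Θ.symm : M →ₗ[ℂ] V ⊗[ℂ] X)
    (fun z v => hΞ z v) Θ.symm.surjective
  have he : ∀ n, hatRep ρ' (cur e0 n) = (hatRep κ (cur e0 n)).rTensor X := fun n =>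
    LinearMap.ext fun v => (hρ' _ v).trans ((Θ.symm_apply_eq).mpr (hΘe n v).symm)
  have hh : ∀ n, hatRep ρ' (cur h0 n) = (hatRep κ (cur h0 n)).rTensor X := fun n =>
    LinearMap.ext fun v => (hρ' _ v).trans ((Θ.symm_apply_eq).mpr (hΘh n v).symm)
  have htop' : bspan (hatRep ρ') (LinearMap.range (TensorProduct.mk ℂ V X w)) = ⊤ := by
    unfold bspan
    rw [funext he, funext hh]
    exact htopV
  refine ⟨ρ', Θ.symm, hΞ, C', he, hh, ?_, fun n => ?_⟩
  -- The two operators have the same commutators with e(n) and h(n), so it suffices to compare them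
  -- on the generating vectors w ⊗ x.
  · refine IsCritical.eq_of_comm htop' (fun n => ?_) (fun n => ?_) ?_
    · have h1 := der_mul_cur ρ' e0 n
      rw [he] at h1 ⊢
      exact comm_rTensor_add_lTensor h1 (der_mul_cur κ e0 n) _
    · have h1 := der_mul_cur ρ' h0 n
      rw [hh] at h1 ⊢
      exact comm_rTensor_add_lTensor h1 (der_mul_cur κ h0 n) _
    · rintro _ ⟨x, rfl⟩
      rw [hρ', hΘ, hd, ← hΘ, LinearEquiv.symm_apply_apply, LinearMap.add_apply,
        TensorProduct.mk_apply, TensorProduct.mk_apply, LinearMap.rTensor_tmul,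
        LinearMap.lTensor_tmul, hd₀, TensorProduct.zero_tmul, zero_add]
  · refine IsCritical.eq_of_comm htop' (fun k => ?_) (fun k => ?_) ?_
    · have h1 := C'.sugawaraEnd_comm n (cur e0 k)
      rw [he] at h1 ⊢
      exact comm_rTensor_add_lTensor (c := 0) (by rw [← h1, zero_smul, add_zero])
        (by rw [← C₀.sugawaraEnd_comm, zero_smul, add_zero]) _
    · have h1 := C'.sugawaraEnd_comm n (cur h0 k)
      rw [hh] at h1 ⊢
      exact comm_rTensor_add_lTensor (c := 0) (by rw [← h1, zero_smul, add_zero])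
        (by rw [← C₀.sugawaraEnd_comm, zero_smul, add_zero]) _
    · rintro _ ⟨x, rfl⟩
      have h1 : Θ.symm (sugawaraEnd (hatRep ρ) n (i x)) =
          sugawaraEnd (hatRep ρ') n (Θ.symm (i x)) := by
        rw [← C'.restricted.sugawara_eq, ← C.restricted.sugawara_eq]
        exact C.restricted.map_sugawara (φ := (Θ.symm : M →ₗ[ℂ] V ⊗[ℂ] X))
          (ρ' := hatRep ρ') (fun z v => hΞ z v) n _
      rw [hT, ← hΘ, ← hΘ, LinearEquiv.symm_apply_apply, LinearEquiv.symm_apply_apply] at h1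
      rw [← h1, LinearMap.add_apply, TensorProduct.mk_apply, TensorProduct.mk_apply,
        LinearMap.rTensor_tmul, LinearMap.lTensor_tmul, hT₀, TensorProduct.zero_tmul, zero_add]

end RTensor

section Tensor

variable {X : Type*} [AddCommGroup X] [Module ℂ X] [LieRingModule TNeg X]
  {M : Type*} [AddCommGroup M] [Module ℂ M]

/-- A module generated by Whittaker vectors that form the `TNeg`-module `X`. -/
structure WhittakerData (lam : ℂ) (ρ : AffTilde →ₗ⁅ℂ⁆ Module.End ℂ M) (i : X →ₗ[ℂ] M) : Prop where
  critical : IsCritical (hatRep ρ)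
  inj : Function.Injective i
  range_le : LinearMap.range i ≤ whit (hatRep ρ) lam
  top : bspan (hatRep ρ) (LinearMap.range i) = ⊤
  map_der : ∀ x, ρ der (i x) = i ⁅tder, x⁆
  map_T : ∀ n x, sugawaraEnd (hatRep ρ) n (i x) = i ⁅tT n, x⁆

variable {lam : ℂ} (hlam : lam ≠ 0)
include hlam

/-- The vectors `w ⊗ x` in a module with a tensor product action. -/
theorem IsTensorAction.whittakerData {ρ : AffTilde →ₗ⁅ℂ⁆ Module.End ℂ (VZero lam ⊗[ℂ] X)}
    (h : IsTensorAction lam ρ) :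
    WhittakerData lam ρ (TensorProduct.mk ℂ (VZero lam) X (wZero lam)) := by
  have hw := wZero_mem_whit lam
  have he : ∀ n, hatRep ρ (cur e0 n) =
      (LieModule.toEnd ℂ AffHat (VZero lam) (cur e0 n)).rTensor X := fun n =>
    TensorProduct.ext' fun v x => h.act_e n v x
  have hh : ∀ n, hatRep ρ (cur h0 n) =
      (LieModule.toEnd ℂ AffHat (VZero lam) (cur h0 n)).rTensor X := fun n =>
    TensorProduct.ext' fun v x => h.act_h n v x
  refine ⟨⟨h.restricted, ?_⟩, mk_injective (wZero_ne_zero hlam) X, ?_, ?_, fun x => ?_,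
    fun n x => ?_⟩
  · refine TensorProduct.ext' fun v x => (h.act_c v x).trans ?_
    have : ⁅cen, v⁆ = (-2 : ℂ) • v := LinearMap.congr_fun (isCritical_vZero lam).level v
    rw [this, ← TensorProduct.smul_tmul']
    rfl
  · rintro _ ⟨x, rfl⟩
    refine ⟨?_, fun n hn => ⟨?_, ?_⟩⟩
    · change hatRep ρ (cur e0 0) (wZero lam ⊗ₜ x) = lam • wZero lam ⊗ₜ x
      rw [he, LinearMap.rTensor_tmul, hw.1, TensorProduct.smul_tmul']
    · change hatRep ρ (cur e0 n) (wZero lam ⊗ₜ x) = 0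
      rw [he, LinearMap.rTensor_tmul, (hw.2 n hn).1, TensorProduct.zero_tmul]
    · change hatRep ρ (cur h0 n) (wZero lam ⊗ₜ x) = 0
      rw [hh, LinearMap.rTensor_tmul, (hw.2 n hn).2, TensorProduct.zero_tmul]
  · unfold bspan
    rw [funext he, funext hh]
    exact borelSpan_rTensor (bspan_wZero hlam) X
  · refine (h.act_d _ x).trans ?_
    rw [der_wZero, TensorProduct.zero_tmul, zero_add]
    rfl
  · rw [← IsRestricted.sugawara_eq h.restricted]
    refine (h.act_T n _ x).trans ?_
    rw [(isCritical_vZero lam).restricted.sugawara_eq, sugawara_wZero, TensorProduct.zero_tmul,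
      zero_add]
    rfl

/-- A tensor product action is unique. -/
theorem IsTensorAction.unique {ρ ρ' : AffTilde →ₗ⁅ℂ⁆ Module.End ℂ (VZero lam ⊗[ℂ] X)}
    (h : IsTensorAction lam ρ) (h' : IsTensorAction lam ρ') : ρ = ρ' := by
  have W := h.whittakerData hlam
  have W' := h'.whittakerData hlam
  have hE : ∀ n, hatRep ρ (cur e0 n) = hatRep ρ' (cur e0 n) := fun n =>
    TensorProduct.ext' fun v x => (h.act_e n v x).trans (h'.act_e n v x).symm
  have hH : ∀ n, hatRep ρ (cur h0 n) = hatRep ρ' (cur h0 n) := fun n =>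
    TensorProduct.ext' fun v x => (h.act_h n v x).trans (h'.act_h n v x).symm
  have hF := W.critical.f_eq hlam W'.critical W.top W.range_le hE hH (by
    rintro _ ⟨x, rfl⟩ n
    rw [W.map_T, W'.map_T])
  ext1 z
  have hz : z ∈ LinearMap.ker ((ρ : AffTilde →ₗ[ℂ] Module.End ℂ (VZero lam ⊗[ℂ] X)) -
      (ρ' : AffTilde →ₗ[ℂ] Module.End ℂ (VZero lam ⊗[ℂ] X))) := by
    refine affTilde_mem _ (fun n => sub_eq_zero.mpr (hE n)) (fun n => sub_eq_zero.mpr (hH n))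
      (fun n => sub_eq_zero.mpr (hF n)) (sub_eq_zero.mpr ?_) (sub_eq_zero.mpr ?_) z
    · exact TensorProduct.ext' fun v x => (h.act_c v x).trans (h'.act_c v x).symm
    · exact TensorProduct.ext' fun v x => (h.act_d v x).trans (h'.act_d v x).symm
  exact sub_eq_zero.mp hz

/-- A module generated by a space `X` of Whittaker vectors is a tensor product. -/
theorem WhittakerData.exists_isTensorAction [LieModule ℂ TNeg X]
    {ρ : AffTilde →ₗ⁅ℂ⁆ Module.End ℂ M} {i : X →ₗ[ℂ] M}
    (W : WhittakerData lam ρ i) : ∃ ρ' : AffTilde →ₗ⁅ℂ⁆ Module.End ℂ (VZero lam ⊗[ℂ] X),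
      IsTensorAction lam ρ' ∧ Nonempty (RepSpace ρ ≃ₗ⁅ℂ,AffTilde⁆ RepSpace ρ') := by
  obtain ⟨ρ', Θ, hΘ, C', he, hh, hd, hT⟩ := exists_tensor_model hlam
    (κ := LieModule.toEnd ℂ AffTilde (VZero lam)) (isCritical_vZero lam) (wZero_mem_whit lam)
    (wZero_ne_zero hlam) (bspan_wZero hlam) (der_wZero lam) (sugawara_wZero lam) W.critical W.inj
    W.range_le W.top (d := LieModule.toEnd ℂ TNeg X tder)
    (τ := fun n => LieModule.toEnd ℂ TNeg X (tT n)) W.map_der W.map_T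
  refine ⟨ρ', ⟨C'.restricted, fun n v x => LinearMap.congr_fun (he n) (v ⊗ₜ x),
    fun n v x => LinearMap.congr_fun (hh n) (v ⊗ₜ x), fun v x => ?_, fun v x => ?_,
    fun n v x => ?_⟩, ⟨lieEquivOfSpan (M := RepSpace ρ) (M' := RepSpace ρ') (G := Set.univ)
      (by simp) Θ fun z _ v => hΘ z v⟩⟩
  · refine (LinearMap.congr_fun C'.level (v ⊗ₜ x)).trans ?_
    have : ⁅cen, v⁆ = (-2 : ℂ) • v := LinearMap.congr_fun (isCritical_vZero lam).level v
    rw [this, ← TensorProduct.smul_tmul']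
    rfl
  · exact LinearMap.congr_fun hd (v ⊗ₜ x)
  · rw [C'.restricted.sugawara_eq, (isCritical_vZero lam).restricted.sugawara_eq]
    exact LinearMap.congr_fun (hT n) (v ⊗ₜ x)

end Tensor

end

end WhittakerSl2

namespace WhittakerSl2

noncomputable section

/-! ### Simple quotients of `V(λ, 0, -2)` -/

section Simple

variable {X : Type*} [AddCommGroup X] [Module ℂ X] [LieRingModule TNeg X] [LieModule ℂ TNeg X]
  {M : Type*} [AddCommGroup M] [Module ℂ M] {lam : ℂ} (hlam : lam ≠ 0)

/-- T(0) is central, its degree being 0, so Schur's lemma applies. This supplies the scalar needed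
to start the Riccati equation. -/
theorem exists_tT_zero_eq (hX : LieModule.IsIrreducible ℂ TNeg X) :
    ∃ t : ℂ, LieModule.toEnd ℂ TNeg X (tT 0) = t • 1 := by
  refine eq_smul_one_of_comm span_tGen countable_tGen hX fun g hg m => ?_
  have h : ⁅tT 0, g⁆ = 0 := by
    rcases hg with rfl | ⟨n, rfl⟩
    · rw [← lie_skew, tder_lie]; simp
    · exact tT_lie 0 n
  change ⁅tT 0, ⁅g, m⁆⁆ = ⁅g, ⁅tT 0, m⁆⁆
  rw [leibniz_lie, h, zero_lie, zero_add]

include hlam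

theorem exists_isTensorAction (hX : LieModule.IsIrreducible ℂ TNeg X) :
    ∃ ρ : AffTilde →ₗ⁅ℂ⁆ Module.End ℂ (VZero lam ⊗[ℂ] X), IsTensorAction lam ρ := by
  obtain ⟨t, ht⟩ := exists_tT_zero_eq hX
  obtain ⟨ρ, C, h1, h2, h3, h4⟩ := exists_model hlam (d := LieModule.toEnd ℂ TNeg X tder)
    (τ := fun n => LieModule.toEnd ℂ TNeg X (tT n))
    (fun m n => by rw [← LieHom.map_lie, tT_lie, map_zero])
    (fun n => by rw [← LieHom.map_lie, tder_lie, map_smul])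
    (fun n hn => by rw [tT_of_pos hn, map_zero]) ht
  have W : WhittakerData lam ρ (Finsupp.lsingle (R := ℂ) 0 : X →ₗ[ℂ] Fock X) :=
    ⟨C, Finsupp.single_injective 0, h1, h2, h3, h4⟩
  obtain ⟨ρ', h, -⟩ := W.exists_isTensorAction hlam
  exact ⟨ρ', h⟩

omit hlam [LieModule ℂ TNeg X] in
theorem WhittakerData.mem_borelSpan {ρ : AffTilde →ₗ⁅ℂ⁆ Module.End ℂ M} {i : X →ₗ[ℂ] M}
    (W : WhittakerData lam ρ i) (v : M) :
    v ∈ borelSpan (fun n => hatRep ρ (cur e0 n)) (fun n => hatRep ρ (cur h0 n))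
      (LinearMap.range i) :=
  (ge_of_eq W.top) Submodule.mem_top

/-- A nonzero submodule meets i(X) by rigidity. Its preimage in X is stable under d and the T(n),
hence is X, and X generates M. -/
theorem WhittakerData.eq_bot_or_eq_top {ρ : AffTilde →ₗ⁅ℂ⁆ Module.End ℂ M} {i : X →ₗ[ℂ] M}
    (W : WhittakerData lam ρ i) (hX : LieModule.IsIrreducible ℂ TNeg X) (N : Submodule ℂ M)
    (hN : ∀ z, ∀ v ∈ N, ρ z v ∈ N) : N = ⊥ ∨ N = ⊤ := by
  obtain ⟨-, hirr⟩ := (isIrreducible_iff_of_span span_tGen).mp hX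
  by_cases h0 : N = ⊥
  · exact Or.inl h0
  right
  obtain ⟨u, huN, hu0⟩ := Submodule.exists_mem_ne_zero_of_ne_bot h0
  obtain ⟨_, ⟨x, rfl⟩, hxN, hx0⟩ := W.critical.borelCurrents.exists_mem_of_mem_borelSpan hlam
    W.range_le (N := N) (fun n v hv => hN _ v hv) (fun n v hv => hN _ v hv)
    (u := u) (W.mem_borelSpan u) huN hu0
  have hN' : ∀ z, ∀ v ∈ N, hatRep ρ z v ∈ N := fun z v hv => hN z v hv
  have h1 : Submodule.comap i N = ⊤ := by
    refine (hirr _ ?_).resolve_left fun h => hx0 ?_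
    · rintro _ (rfl | ⟨n, rfl⟩) y hy
      · rw [Submodule.mem_comap, ← W.map_der]
        exact hN _ _ hy
      · rw [Submodule.mem_comap, ← W.map_T]
        exact sugawaraEnd_mem W.critical.restricted hN' n hy
    · have : x ∈ Submodule.comap i N := hxN
      rw [h, Submodule.mem_bot] at this
      exact (congrArg i this).trans (map_zero i)
  refine eq_top_iff.mpr (le_trans (ge_of_eq W.top) (borelSpan_le ?_ (fun n => hN' _) fun n => hN' _))
  rintro _ ⟨y, rfl⟩
  exact (h1 ▸ Submodule.mem_top : y ∈ Submodule.comap i N)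

/-- The T(n) with n > 0 kill every vector of i(X), so a nonzero one satisfies the relations of the
universal module with μ = 0. By simplicity the resulting homomorphism is onto. -/
theorem WhittakerData.isSimpleQuotient {ρ : AffTilde →ₗ⁅ℂ⁆ Module.End ℂ M} {i : X →ₗ[ℂ] M}
    (W : WhittakerData lam ρ i) (hX : LieModule.IsIrreducible ℂ TNeg X) :
    IsSimpleQuotient AffTilde (VTilde lam 0 (-2)) (RepSpace ρ) := by
  obtain ⟨hnt, -⟩ := (isIrreducible_iff_of_span span_tGen).mp hX
  obtain ⟨x₀, hx₀⟩ := exists_ne (0 : X)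
  have hix₀ : i x₀ ≠ 0 := fun h => hx₀ (W.inj (h.trans (map_zero i).symm))
  have hM : LieModule.IsIrreducible ℂ AffTilde (RepSpace ρ) := by
    refine (isIrreducible_iff_of_span (G := Set.univ) (by simp)).mpr
      ⟨⟨⟨i x₀, 0, hix₀⟩⟩, fun N hN => ?_⟩
    exact W.eq_bot_or_eq_top hlam hX N fun z v hv => hN z trivial v hv
  refine ⟨hM, ?_⟩
  have hT : ∀ n > 0, sugawaraEnd (hatRep ρ) n (i x₀) = 0 := fun n hn => by
    rw [W.map_T, tT_of_pos hn, zero_lie, map_zero]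
  obtain ⟨φ, hφ⟩ := exists_hom
    (isWhittakerVector_of_whit W.critical hlam (W.range_le ⟨x₀, rfl⟩) hT)
  refine ⟨φ, LieModuleHom.range_eq_top φ |>.mp ((hM.eq_bot_or_eq_top _).resolve_left fun h => ?_)⟩
  have : i x₀ ∈ φ.range := ⟨_, hφ⟩
  rw [h] at this
  exact hix₀ this

omit [LieModule ℂ TNeg X] in
theorem WhittakerData.range_eq {ρ : AffTilde →ₗ⁅ℂ⁆ Module.End ℂ M} {i : X →ₗ[ℂ] M}
    (W : WhittakerData lam ρ i) : LinearMap.range i = whit (hatRep ρ) lam :=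
  le_antisymm W.range_le fun _ hv => W.critical.borelCurrents.mem_of_mem_borelSpan hlam W.range_le
    (W.mem_borelSpan _) hv

/-- By `range_eq` the space X is intrinsic: it consists of all Whittaker vectors. So an isomorphism
of affine modules restricts to it, compatibly with d and the T(n). -/
theorem WhittakerData.equiv_of_equiv {X' M' : Type*} [AddCommGroup X'] [Module ℂ X']
    [LieRingModule TNeg X'] [LieModule ℂ TNeg X'] [AddCommGroup M'] [Module ℂ M']
    {ρ : AffTilde →ₗ⁅ℂ⁆ Module.End ℂ M} {i : X →ₗ[ℂ] M} (W : WhittakerData lam ρ i)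
    {ρ' : AffTilde →ₗ⁅ℂ⁆ Module.End ℂ M'} {i' : X' →ₗ[ℂ] M'} (W' : WhittakerData lam ρ' i')
    (Φ : RepSpace ρ ≃ₗ⁅ℂ,AffTilde⁆ RepSpace ρ') : Nonempty (X ≃ₗ⁅ℂ,TNeg⁆ X') := by
  let F : M →ₗ[ℂ] M' := (Φ : RepSpace ρ →ₗ[ℂ] RepSpace ρ')
  have hF : ∀ z v, F (ρ z v) = ρ' z (F v) := fun z v => LieModuleHom.map_lie Φ.toLieModuleHom z v
  have hFT : ∀ n v, F (sugawaraEnd (hatRep ρ) n v) = sugawaraEnd (hatRep ρ') n (F v) := fun n v => by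
    rw [← W.critical.restricted.sugawara_eq, ← W'.critical.restricted.sugawara_eq]
    exact W.critical.restricted.map_sugawara (ρ' := hatRep ρ') (fun z v => hF z v) n v
  have hFinj : Function.Injective F := Φ.toLinearEquiv.injective
  have hFsurj : Function.Surjective F := Φ.toLinearEquiv.surjective
  have hex : ∀ x, ∃ x', i' x' = F (i x) := fun x => by
    have hx : i x ∈ whit (hatRep ρ) lam := W.range_le ⟨x, rfl⟩
    have : F (i x) ∈ LinearMap.range i' := by
      rw [W'.range_eq hlam]
      refine ⟨(hF _ _).symm.trans ?_, fun n hn => ⟨(hF _ _).symm.trans ?_, (hF _ _).symm.trans ?_⟩⟩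
      · exact (congrArg F hx.1).trans (map_smul _ _ _)
      · exact (congrArg F (hx.2 n hn).1).trans (map_zero _)
      · exact (congrArg F (hx.2 n hn).2).trans (map_zero _)
    exact this
  choose g hg using hex
  let G : X →ₗ[ℂ] X' :=
    { toFun := g
      map_add' := fun x y => W'.inj (by rw [map_add, hg, hg, hg, map_add, map_add])
      map_smul' := fun t x => W'.inj (by rw [map_smul, hg, hg, map_smul, map_smul]; rfl) }
  have hG : ∀ x, i' (G x) = F (i x) := hg
  have hGinj : Function.Injective G := fun x y hxy =>
    W.inj (hFinj (by rw [← hG, ← hG, hxy]))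
  have hGsurj : Function.Surjective G := fun x' => by
    obtain ⟨v, hv⟩ := hFsurj (i' x')
    have hx' : i' x' ∈ whit (hatRep ρ') lam := W'.range_le ⟨x', rfl⟩
    have : v ∈ LinearMap.range i := by
      rw [W.range_eq hlam]
      refine ⟨hFinj ?_, fun n hn => ⟨hFinj ?_, hFinj ?_⟩⟩
      · refine (hF _ _).trans ?_
        rw [hv]
        exact hx'.1.trans ((congrArg _ hv.symm).trans (map_smul F _ _).symm)
      · refine (hF _ _).trans ?_
        rw [hv, map_zero]
        exact (hx'.2 n hn).1
      · refine (hF _ _).trans ?_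
        rw [hv, map_zero]
        exact (hx'.2 n hn).2
    obtain ⟨x, rfl⟩ := this
    exact ⟨x, W'.inj (by rw [hG, hv])⟩
  have hbij : Function.Bijective G := ⟨hGinj, hGsurj⟩
  refine ⟨lieEquivOfSpan span_tGen (LinearEquiv.ofBijective G hbij) ?_⟩
  rintro _ (rfl | ⟨n, rfl⟩) x
  · refine W'.inj ?_
    change i' (G _) = i' ⁅_, G x⁆
    rw [hG, ← W.map_der, ← W'.map_der, hG, hF]
  · refine W'.inj ?_
    change i' (G _) = i' ⁅_, G x⁆
    rw [hG, ← W.map_T, ← W'.map_T, hG, hFT]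

/-- For the converse, an isomorphism X ≅ X' lets the second module be generated by Whittaker vectors
forming X. It is then isomorphic to some tensor product action on V(λ, 0, -2, 0) ⊗ X, which is the
given one by uniqueness. -/
theorem IsTensorAction.equiv_iff {X' : Type*} [AddCommGroup X'] [Module ℂ X']
    [LieRingModule TNeg X'] [LieModule ℂ TNeg X']
    {ρ : AffTilde →ₗ⁅ℂ⁆ Module.End ℂ (VZero lam ⊗[ℂ] X)}
    {ρ' : AffTilde →ₗ⁅ℂ⁆ Module.End ℂ (VZero lam ⊗[ℂ] X')} (h : IsTensorAction lam ρ)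
    (h' : IsTensorAction lam ρ') :
    Nonempty (RepSpace ρ ≃ₗ⁅ℂ,AffTilde⁆ RepSpace ρ') ↔ Nonempty (X ≃ₗ⁅ℂ,TNeg⁆ X') := by
  have W := h.whittakerData hlam
  have W' := h'.whittakerData hlam
  refine ⟨fun ⟨Φ⟩ => W.equiv_of_equiv hlam W' Φ, fun ⟨g⟩ => ?_⟩
  let g' : X →ₗ[ℂ] X' := (g : X →ₗ[ℂ] X')
  have hg' : ∀ z x, g' ⁅z, x⁆ = ⁅z, g' x⁆ := fun z x => LieModuleHom.map_lie g.toLieModuleHom z x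
  have hr : LinearMap.range (TensorProduct.mk ℂ (VZero lam) X' (wZero lam) ∘ₗ g') =
      LinearMap.range (TensorProduct.mk ℂ (VZero lam) X' (wZero lam)) :=
    LinearMap.range_comp_of_range_eq_top _ (LinearMap.range_eq_top.mpr g.toLinearEquiv.surjective)
  have W'' : WhittakerData lam ρ' (TensorProduct.mk ℂ (VZero lam) X' (wZero lam) ∘ₗ g') :=
    { critical := W'.critical
      inj := W'.inj.comp g.toLinearEquiv.injective
      range_le := hr ▸ W'.range_le
      top := hr ▸ W'.top
      map_der := fun x => by
        rw [LinearMap.comp_apply, LinearMap.comp_apply, hg', W'.map_der]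
      map_T := fun n x => by
        rw [LinearMap.comp_apply, LinearMap.comp_apply, hg', W'.map_T] }
  obtain ⟨ρ'', h'', ⟨Ψ⟩⟩ := W''.exists_isTensorAction hlam
  rw [h''.unique hlam h] at Ψ
  exact ⟨Ψ.symm⟩

end Simple

/-! ### The Whittaker vectors of a simple module as a simple module over d and the T(n) -/

section Critical

variable {W : Type u} [AddCommGroup W] [Module ℂ W] {ρ : AffTilde →ₗ⁅ℂ⁆ Module.End ℂ W} {lam : ℂ}

theorem IsCritical.sugawaraEnd_mem_whit (C : IsCritical (hatRep ρ)) (n : ℤ) {v : W}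
    (hv : v ∈ whit (hatRep ρ) lam) : sugawaraEnd (hatRep ρ) n v ∈ whit (hatRep ρ) lam := by
  have hc : ∀ z, hatRep ρ z (sugawaraEnd (hatRep ρ) n v) =
      sugawaraEnd (hatRep ρ) n (hatRep ρ z v) := fun z =>
    LinearMap.congr_fun (C.sugawaraEnd_comm n z) v
  refine ⟨?_, fun i hi => ⟨?_, ?_⟩⟩
  · exact (hc _).trans ((congrArg _ hv.1).trans (map_smul _ _ _))
  · exact (hc _).trans ((congrArg _ (hv.2 i hi).1).trans (map_zero _))
  · exact (hc _).trans ((congrArg _ (hv.2 i hi).2).trans (map_zero _))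

theorem der_mem_whit {v : W} (hv : v ∈ whit (hatRep ρ) lam) : ρ der v ∈ whit (hatRep ρ) lam := by
  have hc : ∀ x n, hatRep ρ (cur x n) (ρ der v) =
      ρ der (hatRep ρ (cur x n) v) - (n : ℂ) • hatRep ρ (cur x n) v := fun x n => by
    have := LinearMap.congr_fun (der_mul_cur ρ x n) v
    rw [LinearMap.add_apply, Module.End.mul_apply, Module.End.mul_apply, LinearMap.smul_apply] at this
    rw [this, add_sub_cancel_right]
  refine ⟨(hc _ _).trans ?_, fun i hi => ⟨(hc _ _).trans ?_, (hc _ _).trans ?_⟩⟩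
  · rw [show hatRep ρ (cur e0 0) v = lam • v from hv.1, Int.cast_zero, zero_smul, sub_zero, map_smul]
  · rw [show hatRep ρ (cur e0 i) v = 0 from (hv.2 i hi).1, map_zero, smul_zero, sub_zero]
  · rw [show hatRep ρ (cur h0 i) v = 0 from (hv.2 i hi).2, map_zero, smul_zero, sub_zero]

/-- The kernel of a Sugawara operator is a submodule. -/
theorem IsCritical.ker_sugawaraEnd_stable (C : IsCritical (hatRep ρ)) (n : ℤ) :
    ∀ g ∈ affGen, ∀ v ∈ LinearMap.ker (sugawaraEnd (hatRep ρ) n),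
      ρ g v ∈ LinearMap.ker (sugawaraEnd (hatRep ρ) n) := by
  have h : ∀ (z : AffHat), ∀ v ∈ LinearMap.ker (sugawaraEnd (hatRep ρ) n),
      hatRep ρ z v ∈ LinearMap.ker (sugawaraEnd (hatRep ρ) n) := fun z v hv => by
    refine LinearMap.mem_ker.mpr ((LinearMap.congr_fun (C.sugawaraEnd_comm n z) v).symm.trans ?_)
    rw [Module.End.mul_apply, LinearMap.mem_ker.mp hv, map_zero]
  have hd : ∀ v ∈ LinearMap.ker (sugawaraEnd (hatRep ρ) n),
      ρ der v ∈ LinearMap.ker (sugawaraEnd (hatRep ρ) n) := fun v hv => by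
    have := sugawaraEnd_mul_der C n v
    rw [LinearMap.mem_ker.mp hv, map_zero, smul_zero, add_zero] at this
    exact LinearMap.mem_ker.mpr this.symm
  intro g hg v hv
  exact forall_affGen (P := fun g => ∀ v ∈ LinearMap.ker (sugawaraEnd (hatRep ρ) n),
    ρ g v ∈ LinearMap.ker (sugawaraEnd (hatRep ρ) n)) (fun k => h (cur e0 k))
    (fun k => h (cur h0 k)) (fun k => h (cur f0 k)) (h cen) hd g hg v hv

theorem whittakerData_of_rep {X M : Type*} [AddCommGroup X] [Module ℂ X] [AddCommGroup M] [Module ℂ M]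
    {ρ : AffTilde →ₗ⁅ℂ⁆ Module.End ℂ M} {σ : TNeg →ₗ⁅ℂ⁆ Module.End ℂ X} {i : X →ₗ[ℂ] M}
    (C : IsCritical (hatRep ρ)) (inj : Function.Injective i)
    (range_le : LinearMap.range i ≤ whit (hatRep ρ) lam)
    (top : bspan (hatRep ρ) (LinearMap.range i) = ⊤) (map_der : ∀ x, ρ der (i x) = i (σ tder x))
    (map_T : ∀ n x, sugawaraEnd (hatRep ρ) n (i x) = i (σ (tT n) x)) :
    WhittakerData lam ρ (show RepSpace σ →ₗ[ℂ] M from i) :=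
  ⟨C, inj, range_le, top, map_der, map_T⟩

theorem isIrreducible_repSpace {X : Type*} [AddCommGroup X] [Module ℂ X]
    {σ : TNeg →ₗ⁅ℂ⁆ Module.End ℂ X} (hX : Nontrivial X)
    (h : ∀ N : Submodule ℂ X, (∀ n, ∀ x ∈ N, σ (tT n) x ∈ N) → (∀ x ∈ N, σ tder x ∈ N) →
      N = ⊥ ∨ N = ⊤) : LieModule.IsIrreducible ℂ TNeg (RepSpace σ) :=
  (isIrreducible_iff_of_span span_tGen).mpr ⟨hX, fun N hN =>
    h N (fun n x hx => hN _ (Or.inr ⟨n, rfl⟩) x hx) fun x hx => hN _ (Or.inl rfl) x hx⟩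

/-- X is the space of all Whittaker vectors. A nonzero subspace Z stable under d and the T(n)
generates W, since the words in e and h on Z are stable under the whole algebra. By rigidity all
Whittaker vectors then lie in Z, so X is simple. -/
theorem IsCritical.exists_whittakerData (C : IsCritical (hatRep ρ)) (hlam : lam ≠ 0)
    (hirr : ∀ N : Submodule ℂ W, (∀ g ∈ affGen, ∀ v ∈ N, ρ g v ∈ N) → N = ⊥ ∨ N = ⊤)
    (hTpos : ∀ n > 0, sugawaraEnd (hatRep ρ) n = 0) {w : W} (hw0 : w ≠ 0)
    (hww : w ∈ whit (hatRep ρ) lam) :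
    ∃ (X : Type u) (_ : AddCommGroup X) (_ : Module ℂ X) (_ : LieRingModule TNeg X)
      (_ : LieModule ℂ TNeg X) (i : X →ₗ[ℂ] W),
      LieModule.IsIrreducible ℂ TNeg X ∧ WhittakerData lam ρ i := by
  obtain ⟨Y, hY⟩ : ∃ Y, Y = whit (hatRep ρ) lam := ⟨_, rfl⟩
  rw [← hY] at hww
  have hTY : ∀ n, ∀ x ∈ Y, sugawaraEnd (hatRep ρ) n x ∈ Y := fun n x hx =>
    hY ▸ C.sugawaraEnd_mem_whit n (hY ▸ hx)
  have hDY : ∀ x ∈ Y, ρ der x ∈ Y := fun x hx => hY ▸ der_mem_whit (hY ▸ hx)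
  have htop : ∀ Z ≤ Y, Z ≠ ⊥ → (∀ n, ∀ x ∈ Z, sugawaraEnd (hatRep ρ) n x ∈ Z) →
      (∀ x ∈ Z, ρ der x ∈ Z) → bspan (hatRep ρ) Z = ⊤ := fun Z hZ hne hT hD => by
    refine (hirr _ fun g _ v hv => bspan_stable C hlam (hY ▸ hZ) hT hD g hv).resolve_left fun h => hne ?_
    exact eq_bot_iff.mpr (le_borelSpan.trans (le_of_eq h))
  let τ : ℤ → Module.End ℂ Y := fun n => (sugawaraEnd (hatRep ρ) n).restrict (hTY n)
  let d : Module.End ℂ Y := (ρ der).restrict hDY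
  have hτ : ∀ m n, ⁅τ m, τ n⁆ = 0 := fun m n => by
    rw [LieRing.of_associative_ring_bracket, sub_eq_zero]
    refine LinearMap.ext fun x => Subtype.ext ?_
    change sugawaraEnd (hatRep ρ) m (sugawaraEnd (hatRep ρ) n x) =
      sugawaraEnd (hatRep ρ) n (sugawaraEnd (hatRep ρ) m x)
    rw [← C.restricted.sugawara_eq n, ← C.restricted.sugawara_eq n]
    exact C.restricted.map_sugawara (φ := sugawaraEnd (hatRep ρ) m) (fun z v => (LinearMap.congr_fun (C.sugawaraEnd_comm m z) v).symm)
      n x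
  have hd : ∀ n, ⁅d, τ n⁆ = (n : ℂ) • τ n := fun n => by
    rw [LieRing.of_associative_ring_bracket, sub_eq_iff_eq_add]
    refine LinearMap.ext fun x => Subtype.ext ?_
    exact (sugawaraEnd_mul_der C n x).trans (add_comm _ _)
  let σ := tRep d τ hτ hd
  have hσT : ∀ n, σ (tT n) = τ n := fun n => by
    rcases le_or_gt n 0 with hn | hn
    · exact tRep_tT hn
    · rw [tT_of_pos hn, map_zero]
      exact LinearMap.ext fun x => Subtype.ext (LinearMap.congr_fun (hTpos n hn) x).symm
  have hσd : σ tder = d := tRep_tder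
  have hYne : Y ≠ ⊥ := fun h => hw0 (by rwa [h, Submodule.mem_bot] at hww)
  have D : WhittakerData lam ρ (show RepSpace σ →ₗ[ℂ] W from Y.subtype) := by
    refine whittakerData_of_rep C Y.injective_subtype ?_ ?_ (fun x => ?_) fun n x => ?_
    · rw [Submodule.range_subtype, hY]
    · rw [Submodule.range_subtype]
      exact htop Y le_rfl hYne hTY hDY
    · rw [hσd]; rfl
    · rw [hσT]; rfl
  refine ⟨RepSpace σ, inferInstance, inferInstance, inferInstance, inferInstance, _, ?_, D⟩
  refine isIrreducible_repSpace ⟨⟨⟨w, hww⟩, 0, fun h => hw0 (congrArg Subtype.val h)⟩⟩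
    fun N hNT hND => ?_
  by_cases h0 : N = ⊥
  · exact Or.inl h0
  right
  have hZ : Submodule.map Y.subtype N ≤ Y := Submodule.map_subtype_le Y N
  have hZtop : bspan (hatRep ρ) (Submodule.map Y.subtype N) = ⊤ := by
    refine htop _ hZ (fun h => h0 ?_) ?_ ?_
    · exact Submodule.map_injective_of_injective Y.injective_subtype (h.trans (Submodule.map_bot _).symm)
    · rintro n _ ⟨x, hx, rfl⟩
      refine ⟨σ (tT n) x, hNT n x hx, ?_⟩
      rw [hσT]; rfl
    · rintro _ ⟨x, hx, rfl⟩
      refine ⟨σ tder x, hND x hx, ?_⟩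
      rw [hσd]; rfl
  refine eq_top_iff.mpr fun x _ => ?_
  obtain ⟨y, hy, hyx⟩ := C.borelCurrents.mem_of_mem_borelSpan hlam (hY ▸ hZ)
    ((ge_of_eq hZtop) Submodule.mem_top) (show (x : W) ∈ whit (hatRep ρ) lam from hY ▸ x.2)
  exact (Subtype.ext hyx : y = x) ▸ hy

end Critical

theorem IsSimpleQuotient.exists_whittaker {lam mu : ℂ} {W : Type u} [AddCommGroup W]
    [Module ℂ W] [LieRingModule AffTilde W] [LieModule ℂ AffTilde W]
    (hW : IsSimpleQuotient AffTilde (VTilde lam mu (-2)) W) :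
    IsCritical (hatRep (LieModule.toEnd ℂ AffTilde W)) ∧
      ∃ w : W, w ≠ 0 ∧ IsWhittakerVector AffHat.incl lam mu (-2) w := by
  obtain ⟨hirr, π, hπ⟩ := hW
  obtain ⟨hnt, -⟩ := (isIrreducible_iff_of_span span_affGen).mp hirr
  refine ⟨isCritical_hom (isCritical_vTilde lam mu) (π : VTilde lam mu (-2) →ₗ[ℂ] W)
    (fun z v => LieModuleHom.map_lie π (z : AffTilde) v) hπ, π (wTilde lam mu (-2)), fun h => ?_,
    (isWhittakerVector_gen (j := AffHat.incl)).map π⟩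
  have h1 : LinearMap.ker (π : VTilde lam mu (-2) →ₗ[ℂ] W) = ⊤ :=
    eq_top_of_gen_mem (j := AffHat.incl) h fun x v hv => by
      rw [LinearMap.mem_ker] at hv ⊢
      exact (LieModuleHom.map_lie π x v).trans (by
        rw [show π v = 0 from hv, lie_zero])
  obtain ⟨y, hy⟩ := exists_ne (0 : W)
  obtain ⟨v, rfl⟩ := hπ y
  exact hy (h1 ▸ Submodule.mem_top : v ∈ LinearMap.ker (π : VTilde lam mu (-2) →ₗ[ℂ] W))

section

variable {W : Type u} [AddCommGroup W] [Module ℂ W] [LieRingModule AffTilde W]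
  [LieModule ℂ AffTilde W] {lam mu : ℂ} {w : W}

theorem IsWhittakerVector.mem_whit (hw : IsWhittakerVector AffHat.incl lam mu (-2) w) :
    w ∈ whit (hatRep (LieModule.toEnd ℂ AffTilde W)) lam :=
  ⟨hw.e_zero, fun i hi => ⟨hw.e_pos i hi, hw.h_pos i hi⟩⟩

theorem IsWhittakerVector.f_eq_zero (hw : IsWhittakerVector AffHat.incl lam mu (-2) w) {n : ℤ}
    (hn : 1 < n) : hatRep (LieModule.toEnd ℂ AffTilde W) (cur f0 n) w = 0 := by
  have := hw.f_pos (n - 1) (by omega)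
  rwa [sub_add_cancel] at this

end

/-- For μ = 0 all f(n) with n > 0 kill the generator, hence so do the T(n) with n > 0. The kernel of
T(n) is a submodule, so these T(n) vanish on W. -/
theorem exists_tensor_of_isSimpleQuotient {lam : ℂ} (hlam : lam ≠ 0) (W : Type u) [AddCommGroup W]
    [Module ℂ W] [LieRingModule AffTilde W] [LieModule ℂ AffTilde W]
    (hW : IsSimpleQuotient AffTilde (VTilde lam 0 (-2)) W) :
    ∃ (X : Type u) (_ : AddCommGroup X) (_ : Module ℂ X) (_ : LieRingModule TNeg X)
      (_ : LieModule ℂ TNeg X) (ρ : AffTilde →ₗ⁅ℂ⁆ Module.End ℂ (VZero lam ⊗[ℂ] X)),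
      LieModule.IsIrreducible ℂ TNeg X ∧ IsTensorAction lam ρ ∧
        Nonempty (W ≃ₗ⁅ℂ,AffTilde⁆ RepSpace ρ) := by
  obtain ⟨C, w, hw0, hwW⟩ := hW.exists_whittaker
  obtain ⟨-, hirr⟩ := (isIrreducible_iff_of_span span_affGen).mp hW.1
  have hf : ∀ n > 0, hatRep (LieModule.toEnd ℂ AffTilde W) (cur f0 n) w = 0 := fun n hn => by
    rcases (show n = 1 ∨ 1 < n by omega) with rfl | h
    · exact hwW.f_one.trans (zero_smul _ _)
    · exact hwW.f_eq_zero h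
  have hTpos : ∀ n > 0, sugawaraEnd (hatRep (LieModule.toEnd ℂ AffTilde W)) n = 0 := fun n hn => by
    refine LinearMap.ker_eq_top.mp ((hirr _ (C.ker_sugawaraEnd_stable n)).resolve_left fun h =>
      hw0 ?_)
    have : w ∈ LinearMap.ker (sugawaraEnd (hatRep (LieModule.toEnd ℂ AffTilde W)) n) := by
      rw [LinearMap.mem_ker, C.sugawaraEnd_whit_of_f hwW.mem_whit hn fun m hm => hf m (by omega),
        hf n hn, smul_zero]
    rwa [h, Submodule.mem_bot] at this
  obtain ⟨X, _, _, _, _, i, hX, D⟩ := C.exists_whittakerData hlam hirr hTpos hw0 hwW.mem_whit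
  obtain ⟨ρ', h', ⟨Ψ⟩⟩ := D.exists_isTensorAction hlam
  refine ⟨X, inferInstance, inferInstance, inferInstance, inferInstance, ρ', hX, h', ⟨?_⟩⟩
  exact lieEquivOfSpan (G := Set.univ) (M' := RepSpace ρ') (by simp)
    (Ψ.toLinearEquiv : W ≃ₗ[ℂ] RepSpace ρ') fun z _ v => LieModuleHom.map_lie Ψ.toLieModuleHom z v

end

end WhittakerSl2

namespace WhittakerSl2

noncomputable section

/-! ### Simple modules over `TNeg` -/

section Irreducible

variable {L : Type*} [LieRing L] [LieAlgebra ℂ L] {G : Set L} {X : Type*} [AddCommGroup X]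
  [Module ℂ X] [LieRingModule L X] [LieModule ℂ L X]

theorem finrank_eq_one_of_scalar (hG : Submodule.span ℂ G = ⊤)
    (hX : LieModule.IsIrreducible ℂ L X) (h : ∀ g ∈ G, ∃ t : ℂ, ∀ x : X, ⁅g, x⁆ = t • x) :
    Module.finrank ℂ X = 1 := by
  obtain ⟨hnt, hirr⟩ := (isIrreducible_iff_of_span hG).mp hX
  obtain ⟨x, hx⟩ := exists_ne (0 : X)
  have h1 : Submodule.span ℂ {x} = ⊤ := by
    refine (hirr _ fun g hg m hm => ?_).resolve_left fun h0 => hx ?_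
    · obtain ⟨t, ht⟩ := h g hg
      rw [ht]
      exact Submodule.smul_mem _ _ hm
    · exact Submodule.span_singleton_eq_bot.mp h0
  exact (finrank_eq_one_iff_of_nonzero x hx).mpr h1

theorem isIrreducible_of_finrank_eq_one (h : Module.finrank ℂ X = 1) :
    LieModule.IsIrreducible ℂ L X := by
  have := isSimpleModule_iff_finrank_eq_one.mpr h
  exact (isIrreducible_iff_of_span (G := Set.univ) (by simp)).mpr
    ⟨IsSimpleModule.nontrivial ℂ X, fun N _ => eq_bot_or_eq_top N⟩

theorem isIrreducible_congr {Y : Type*} [AddCommGroup Y] [Module ℂ Y] [LieRingModule L Y]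
    [LieModule ℂ L Y] (f : X ≃ₗ⁅ℂ,L⁆ Y) (hY : LieModule.IsIrreducible ℂ L Y) :
    LieModule.IsIrreducible ℂ L X := by
  obtain ⟨hnt, hirr⟩ := (isIrreducible_iff_of_span (G := Set.univ) (by simp)).mp hY
  refine (isIrreducible_iff_of_span (G := Set.univ) (by simp)).mpr
    ⟨f.toLinearEquiv.toEquiv.nontrivial, fun N hN => ?_⟩
  have hf : ∀ (z : L) x, f.toLinearEquiv ⁅z, x⁆ = ⁅z, f.toLinearEquiv x⁆ := fun z x =>
    LieModuleHom.map_lie f.toLieModuleHom z x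
  rcases hirr (N.map (f.toLinearEquiv : X →ₗ[ℂ] Y)) (by
    rintro g - _ ⟨x, hx, rfl⟩
    exact ⟨⁅g, x⁆, hN g trivial x hx, hf g x⟩) with h | h
  · exact Or.inl ((Submodule.map_eq_bot_iff (e := f.toLinearEquiv)).mp h)
  · refine Or.inr (eq_top_iff.mpr fun x _ => ?_)
    obtain ⟨y, hy, hyx⟩ := (ge_of_eq h) (Submodule.mem_top (x := f.toLinearEquiv x))
    exact f.toLinearEquiv.injective hyx ▸ hy

/-- A Schur lemma for operators that commute with a generating set up to a scalar. -/
theorem eq_zero_or_isUnit (hG : Submodule.span ℂ G = ⊤) (hX : LieModule.IsIrreducible ℂ L X)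
    {A : Module.End ℂ X} (hA : ∀ g ∈ G, ∃ k : ℂ, ∀ x, ⁅g, A x⁆ = A ⁅g, x⁆ + k • A x) :
    A = 0 ∨ IsUnit A := by
  obtain ⟨hnt, hirr⟩ := (isIrreducible_iff_of_span hG).mp hX
  rcases hirr (LinearMap.ker A) (fun g hg x hx => by
    obtain ⟨k, hk⟩ := hA g hg
    have := hk x
    rw [LinearMap.mem_ker.mp hx, lie_zero, smul_zero, add_zero] at this
    exact LinearMap.mem_ker.mpr this.symm) with h | h
  · rcases hirr (LinearMap.range A) (by
      rintro g hg _ ⟨x, rfl⟩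
      obtain ⟨k, hk⟩ := hA g hg
      exact ⟨⁅g, x⁆ + k • x, by rw [hk, map_add, map_smul]⟩) with h' | h'
    · exact Or.inl (LinearMap.range_eq_bot.mp h')
    · exact Or.inr ((Module.End.isUnit_iff A).mpr
        ⟨LinearMap.ker_eq_bot.mp h, LinearMap.range_eq_top.mp h'⟩)
  · exact Or.inl (LinearMap.ker_eq_top.mp h)

end Irreducible

/-! ### Representations of the Borel subalgebra by two operators -/

section Borel

theorem span_borel : Submodule.span ℂ ({bh, be} : Set Borel) = ⊤ := by
  refine eq_top_iff.mpr fun x _ => ?_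
  obtain ⟨a, b, hab⟩ := Submodule.mem_span_pair.mp (show (x : Sl2) ∈ Submodule.span ℂ {h0, e0} from x.2)
  exact Submodule.mem_span_pair.mpr ⟨a, b, Subtype.ext hab⟩

theorem bh_lie_be : ⁅bh, be⁆ = (2 : ℂ) • be := Subtype.ext h0_lie_e0

/-- The coordinates of an element of the Borel subalgebra. -/
def borelCoord (i j : Fin 2) : Borel →ₗ[ℂ] ℂ where
  toFun x := x.val.val i j
  map_add' _ _ := rfl
  map_smul' _ _ := rfl

theorem borelCoord_bh : borelCoord 0 0 bh = 1 ∧ borelCoord 0 1 bh = 0 := by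
  have h (i j : Fin 2) : borelCoord i j bh = (Matrix.single (0 : Fin 2) (0 : Fin 2) (1 : ℂ) -
    Matrix.single 1 1 1 : Matrix (Fin 2) (Fin 2) ℂ) i j := rfl
  constructor <;> rw [h] <;> simp

theorem borelCoord_be : borelCoord 0 0 be = 0 ∧ borelCoord 0 1 be = 1 := by
  have h (i j : Fin 2) : borelCoord i j be =
    (Matrix.single (0 : Fin 2) (1 : Fin 2) (1 : ℂ) : Matrix (Fin 2) (Fin 2) ℂ) i j := rfl
  constructor <;> rw [h] <;> simp

theorem borel_ext (x : Borel) : x = borelCoord 0 0 x • bh + borelCoord 0 1 x • be := by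
  obtain ⟨a, b, hab⟩ := Submodule.mem_span_pair.mp
    (span_borel ▸ Submodule.mem_top : x ∈ Submodule.span ℂ ({bh, be} : Set Borel))
  rw [← hab]
  simp [borelCoord_bh, borelCoord_be]

variable {X : Type*} [AddCommGroup X] [Module ℂ X] {H E : Module.End ℂ X}

/-- The representation of the Borel subalgebra given by two operators with `[H, E] = 2 E`. -/
def borelRep (hHE : ⁅H, E⁆ = (2 : ℂ) • E) : Borel →ₗ⁅ℂ⁆ Module.End ℂ X where
  toLinearMap := (borelCoord 0 0).smulRight H + (borelCoord 0 1).smulRight E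
  map_lie' {x y} := by
    have hbe : (borelCoord 0 0).smulRight H be + (borelCoord 0 1).smulRight E be = E := by
      simp [borelCoord_be]
    have hxy : ⁅x, y⁆ = (2 * (borelCoord 0 0 x * borelCoord 0 1 y -
        borelCoord 0 1 x * borelCoord 0 0 y)) • be := by
      nth_rewrite 1 [borel_ext x, borel_ext y]
      simp only [add_lie, lie_add, smul_lie, lie_smul, lie_self, ← lie_skew be bh, bh_lie_be]
      module
    have hEH : ⁅E, H⁆ = -((2 : ℂ) • E) := by rw [← lie_skew, hHE]
    change ((borelCoord 0 0).smulRight H + (borelCoord 0 1).smulRight E) ⁅x, y⁆ =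
      ⁅borelCoord 0 0 x • H + borelCoord 0 1 x • E, borelCoord 0 0 y • H + borelCoord 0 1 y • E⁆
    rw [hxy, map_smul, LinearMap.add_apply, hbe]
    simp only [add_lie, lie_add, smul_lie, lie_smul, lie_self, hHE, hEH]
    module

theorem borelRep_bh (hHE : ⁅H, E⁆ = (2 : ℂ) • E) : borelRep hHE bh = H := by
  change borelCoord 0 0 bh • H + borelCoord 0 1 bh • E = H
  simp [borelCoord_bh]

theorem borelRep_be (hHE : ⁅H, E⁆ = (2 : ℂ) • E) : borelRep hHE be = E := by
  change borelCoord 0 0 be • H + borelCoord 0 1 be • E = E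
  simp [borelCoord_be]

/-- Two operators with `[H, E] = 2 E` and `E` invertible do not exist in finite dimension. -/
theorem not_finiteDimensional [Nontrivial X] (hHE : ⁅H, E⁆ = (2 : ℂ) • E) (hE : IsUnit E) :
    ¬ FiniteDimensional ℂ X := fun hfin => by
  obtain ⟨u, rfl⟩ := hE
  -- For invertible u the relation [H, u] = 2u says H - u H u⁻¹ = 2. The left side has trace zero,
  -- but the right side does not.
  have h1 : ⁅H, (u : Module.End ℂ X)⁆ * ((u⁻¹ : (Module.End ℂ X)ˣ) : Module.End ℂ X) =
      H - u * (H * ((u⁻¹ : (Module.End ℂ X)ˣ) : Module.End ℂ X)) := by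
    rw [LieRing.of_associative_ring_bracket, sub_mul, mul_assoc, Units.mul_inv, mul_one, mul_assoc]
  rw [hHE, smul_mul_assoc, Units.mul_inv] at h1
  have h2 := congrArg (LinearMap.trace ℂ X) h1
  rw [map_sub, LinearMap.trace_mul_comm, mul_assoc, Units.inv_mul, mul_one, sub_self, map_smul,
    LinearMap.trace_one, smul_eq_mul, mul_eq_zero] at h2
  have := Module.finrank_pos (R := ℂ) (M := X)
  rcases h2 with h2 | h2
  · norm_num at h2
  · exact this.ne' (by exact_mod_cast h2)

end Borel

section Numerical

/-- A numerical semigroup contains all large integers. -/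
theorem exists_forall_mem_of_closure {s : Set ℤ} {r : ℕ} (hr : 0 < r)
    (hs : AddSubgroup.closure s = AddSubgroup.zmultiples (r : ℤ)) {K : AddSubmonoid ℕ}
    (hK : ∀ i ∈ s, ∃ k ∈ K, i = -((r : ℤ) * k)) : ∃ k₀, ∀ k ≥ k₀, k ∈ K := by
  let G : AddSubgroup ℤ :=
    { carrier := {z | ∃ a ∈ K, ∃ b ∈ K, z = (r : ℤ) * ((a : ℤ) - b)}
      zero_mem' := ⟨0, K.zero_mem, 0, K.zero_mem, by simp⟩
      add_mem' := by
        rintro _ _ ⟨a, ha, b, hb, rfl⟩ ⟨a', ha', b', hb', rfl⟩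
        exact ⟨a + a', K.add_mem ha ha', b + b', K.add_mem hb hb', by push_cast; ring⟩
      neg_mem' := by
        rintro _ ⟨a, ha, b, hb, rfl⟩
        exact ⟨b, hb, a, ha, by ring⟩ }
  have hsG : AddSubgroup.closure s ≤ G := (AddSubgroup.closure_le G).mpr fun i hi => by
    obtain ⟨k, hk, rfl⟩ := hK i hi
    exact ⟨0, K.zero_mem, k, hk, by push_cast; ring⟩
  have hrG : (r : ℤ) ∈ G := hsG (hs ▸ AddSubgroup.mem_zmultiples _)
  obtain ⟨a, ha, b, hb, hab⟩ := hrG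
  have hr' : (r : ℤ) ≠ 0 := by exact_mod_cast hr.ne'
  have hab' : (a : ℤ) - b = 1 := mul_left_cancel₀ hr' (by rw [← hab, mul_one])
  obtain rfl : a = b + 1 := by omega
  -- Since b and b + 1 lie in K, write n = qb + r with r < b as (q - r) b + r (b + 1). The
  -- coefficient q - r is nonnegative because q ≥ b for n ≥ b².
  refine ⟨b * b, fun n hn => ?_⟩
  rcases Nat.eq_zero_or_pos b with rfl | hb0
  · have := K.nsmul_mem ha n
    simpa using this
  have h1 : n % b < b := Nat.mod_lt _ hb0
  have h2 : b ≤ n / b := (Nat.le_div_iff_mul_le hb0).mpr hn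
  have h3 := K.add_mem (K.nsmul_mem hb (n / b - n % b)) (K.nsmul_mem ha (n % b))
  have h4 : (n / b - n % b) • b + (n % b) • (b + 1) = n := by
    have h5 := Nat.div_add_mod n b
    obtain ⟨q, hq⟩ : ∃ q, n / b = n % b + q := ⟨n / b - n % b, by omega⟩
    rw [smul_eq_mul, smul_eq_mul, hq, Nat.add_sub_cancel_left]
    rw [hq] at h5
    linarith
  rwa [h4] at h3

end Numerical

end

end WhittakerSl2

namespace WhittakerSl2

noncomputable section

/-! ### Classification of the simple `TNeg`-modules -/

section Twist

variable (D : TwistDatum) (M : Type*) [AddCommGroup M] [Module ℂ M] [LieRingModule Borel M]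
  [LieModule ℂ Borel M]

/-- The representation on the twist of a module over the Borel subalgebra. -/
abbrev twistRep : TNeg →ₗ⁅ℂ⁆ Module.End ℂ M :=
  (UniversalEnvelopingAlgebra.lift ℂ (LieModule.toEnd ℂ Borel M)).toLieHom.comp D.φ

theorem twistRep_apply (z : TNeg) : twistRep D M z =
    UniversalEnvelopingAlgebra.lift ℂ (LieModule.toEnd ℂ Borel M) (D.φ z) := rfl

theorem twistRep_tder :
    twistRep D M tder = (-(D.r : ℂ) / 2) • LieModule.toEnd ℂ Borel M bh := by
  have h : D.φ tder = D.onD := by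
    change D.onTSpace 0 + (1 : ℂ) • D.onD = D.onD
    rw [map_zero, one_smul, zero_add]
  rw [twistRep_apply, h, TwistDatum.onD, map_smul, UniversalEnvelopingAlgebra.lift_ι_apply]

theorem twistRep_tT_of_nonpos {n : ℤ} (hn : n ≤ 0) : twistRep D M (tT n) =
    UniversalEnvelopingAlgebra.lift ℂ (LieModule.toEnd ℂ Borel M) (D.onT n) := by
  have h : D.φ (tT n) = D.onT n := by
    rw [tT_of_nonpos hn]
    change D.onTSpace (Finsupp.single ⟨n, hn⟩ 1) + (0 : ℂ) • D.onD = D.onT n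
    rw [D.onTSpace_single, one_smul, zero_smul, add_zero]
  rw [twistRep_apply, h]

theorem TwistDatum.nonpos_of_mem {n : ℤ} (hn : n ∈ D.s ∪ {0}) : n ≤ 0 := by
  rcases hn with hn | hn
  · exact (D.neg n hn).le
  · exact le_of_eq hn

theorem twistRep_tT {n : ℤ} (hn : n ∈ D.s ∪ {0}) : twistRep D M (tT n) =
    D.χ n • (LieModule.toEnd ℂ Borel M be) ^ (-n / (D.r : ℤ)).toNat := by
  rw [twistRep_tT_of_nonpos D M (D.nonpos_of_mem hn), TwistDatum.onT, if_pos hn, map_smul, map_pow,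
    UniversalEnvelopingAlgebra.lift_ι_apply]

theorem twistRep_tT_of_notMem {n : ℤ} (hn : n ∉ D.s ∪ {0}) : twistRep D M (tT n) = 0 := by
  rcases le_or_gt n 0 with h | h
  · rw [twistRep_tT_of_nonpos D M h, TwistDatum.onT, if_neg hn, map_zero]
  · rw [tT_of_pos h, map_zero]

end Twist

/-! ### Twists of infinite-dimensional simple modules over the Borel subalgebra are simple -/

section BorelModules

variable {M : Type*} [AddCommGroup M] [Module ℂ M] [LieRingModule Borel M] [LieModule ℂ Borel M]

theorem bh_lie_be_lie (m : M) : ⁅bh, ⁅be, m⁆⁆ = ⁅be, ⁅bh, m⁆⁆ + (2 : ℂ) • ⁅be, m⁆ := by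
  rw [leibniz_lie, bh_lie_be, smul_lie, add_comm]

theorem bh_lie_be_pow (k : ℕ) (m : M) : ⁅bh, (LieModule.toEnd ℂ Borel M be ^ k) m⁆ =
    (LieModule.toEnd ℂ Borel M be ^ k) ⁅bh, m⁆ +
      (2 * k : ℂ) • (LieModule.toEnd ℂ Borel M be ^ k) m := by
  induction k generalizing m with
  | zero => simp
  | succ k ih =>
    rw [pow_succ, Module.End.mul_apply, Module.End.mul_apply, ih, LieModule.toEnd_apply_apply,
      LieModule.toEnd_apply_apply, bh_lie_be_lie, map_add, map_smul]
    push_cast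
    module

/-- On an infinite-dimensional simple module over the Borel subalgebra `e` is invertible. -/
theorem isUnit_be (hM : LieModule.IsIrreducible ℂ Borel M) (hinf : ¬ FiniteDimensional ℂ M) :
    IsUnit (LieModule.toEnd ℂ Borel M be) := by
  refine (eq_zero_or_isUnit span_borel hM ?_).resolve_left fun h0 => hinf ?_
  · rintro g (rfl | rfl)
    · exact ⟨2, bh_lie_be_lie⟩
    · exact ⟨0, fun x => by rw [zero_smul, add_zero]; rfl⟩
  have hbe : ∀ m : M, ⁅be, m⁆ = 0 := fun m => LinearMap.congr_fun h0 m
  -- If e acts by zero then h is central in the action, so it is a scalar and the module has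
  -- dimension one.
  obtain ⟨t, ht⟩ := eq_smul_one_of_comm span_borel (Set.to_countable _) hM
    (A := LieModule.toEnd ℂ Borel M bh) (by
      rintro g (rfl | rfl) m
      · rfl
      · rw [hbe, hbe, map_zero])
  refine FiniteDimensional.of_finrank_pos ?_
  rw [finrank_eq_one_of_scalar span_borel hM]
  · exact one_pos
  rintro g (rfl | rfl)
  · exact ⟨t, fun m => LinearMap.congr_fun ht m⟩
  · exact ⟨0, fun m => by rw [hbe, zero_smul]⟩

/-- A submodule N of the twist is stable under h and under e^k for the k in a numerical semigroup,
in particular for all k ≥ k₀. The vectors that all these e^k map into N form a module over the Borel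
subalgebra containing N, hence all of M when N ≠ 0. As e^(k₀) is onto, N = M. -/
theorem isIrreducible_twist (D : TwistDatum) (hM : LieModule.IsIrreducible ℂ Borel M)
    (hinf : ¬ FiniteDimensional ℂ M) : LieModule.IsIrreducible ℂ TNeg (Twist D M) := by
  obtain ⟨hnt, hirr⟩ := (isIrreducible_iff_of_span span_borel).mp hM
  refine isIrreducible_repSpace hnt fun N hNT hND => ?_
  by_cases hN : N = ⊥
  · exact Or.inl hN
  right
  set E := LieModule.toEnd ℂ Borel M be with hE
  have hunit := isUnit_be hM hinf
  have hr0 : (D.r : ℂ) ≠ 0 := Nat.cast_ne_zero.mpr D.r_pos.ne'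
  have hNh : ∀ x ∈ N, ⁅bh, x⁆ ∈ N := fun x hx => by
    have := N.smul_mem (-(2 : ℂ) / D.r) (hND x hx)
    change (-(2 : ℂ) / D.r) • (twistRep D M tder) x ∈ N at this
    rw [twistRep_tder, LinearMap.smul_apply, smul_smul,
      show -(2 : ℂ) / D.r * (-(D.r : ℂ) / 2) = 1 by field_simp, one_smul] at this
    exact this
  let K : AddSubmonoid ℕ :=
    { carrier := {k | ∀ x ∈ N, (E ^ k) x ∈ N}
      zero_mem' := fun x hx => by simpa using hx
      add_mem' := fun {a b} ha hb x hx => by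
        rw [pow_add, Module.End.mul_apply]
        exact ha _ (hb x hx) }
  have hK : ∀ i ∈ D.s, ∃ k ∈ K, i = -((D.r : ℤ) * k) := fun i hi => by
    have hr : (0 : ℤ) < D.r := by exact_mod_cast D.r_pos
    have hdvd : (D.r : ℤ) ∣ i := by
      have := AddSubgroup.subset_closure hi
      rw [D.closure_eq] at this
      exact Int.mem_zmultiples_iff.mp this
    refine ⟨(-i / (D.r : ℤ)).toNat, fun x hx => ?_, ?_⟩
    · have := N.smul_mem (D.χ i)⁻¹ (hNT i x hx)
      change (D.χ i)⁻¹ • (twistRep D M (tT i)) x ∈ N at this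
      rw [twistRep_tT D M (Or.inl hi), LinearMap.smul_apply, smul_smul,
        inv_mul_cancel₀ (D.χ_ne i hi), one_smul] at this
      exact this
    · have h0 : 0 ≤ -i / (D.r : ℤ) := Int.ediv_nonneg (by have := D.neg i hi; omega) hr.le
      rw [Int.toNat_of_nonneg h0, Int.mul_ediv_cancel' ((dvd_neg).mpr hdvd), neg_neg]
  obtain ⟨k₀, hk₀⟩ := exists_forall_mem_of_closure D.r_pos D.closure_eq hK
  let P : Submodule ℂ M :=
    { carrier := {x | ∀ k ≥ k₀, (E ^ k) x ∈ N}
      zero_mem' := fun k _ => by rw [map_zero]; exact N.zero_mem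
      add_mem' := fun {x y} hx hy k hk => by
        rw [map_add]; exact N.add_mem (hx k hk) (hy k hk)
      smul_mem' := fun t x hx k hk => by
        rw [map_smul]; exact N.smul_mem t (hx k hk) }
  have hP : P = ⊤ := by
    have hNP : N ≤ P := fun x hx k hk => hk₀ k hk x hx
    refine (hirr P ?_).resolve_left fun h => hN (eq_bot_iff.mpr (hNP.trans (le_of_eq h)))
    · rintro g (rfl | rfl) x hx k hk
      · have := N.sub_mem (hNh _ (hx k hk)) (N.smul_mem (2 * k : ℂ) (hx k hk))
        rwa [bh_lie_be_pow, add_sub_cancel_right] at this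
      · have := hx (k + 1) (by omega)
        rwa [pow_succ, Module.End.mul_apply] at this
  refine eq_top_iff.mpr fun x _ => ?_
  obtain ⟨y, rfl⟩ := ((Module.End.isUnit_iff _).mp (hunit.pow k₀)).2 x
  exact (ge_of_eq hP) (Submodule.mem_top (x := y)) k₀ le_rfl

end BorelModules

/-! ### Every simple module over d and the T(n) is one-dimensional or a twist -/

section Classification

variable {X : Type u} [AddCommGroup X] [Module ℂ X] [LieRingModule TNeg X] [LieModule ℂ TNeg X]

theorem toEnd_tT_comm (m n : ℤ) : LieModule.toEnd ℂ TNeg X (tT m) * LieModule.toEnd ℂ TNeg X (tT n) =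
    LieModule.toEnd ℂ TNeg X (tT n) * LieModule.toEnd ℂ TNeg X (tT m) := by
  have : ⁅LieModule.toEnd ℂ TNeg X (tT m), LieModule.toEnd ℂ TNeg X (tT n)⁆ = 0 := by
    rw [← LieHom.map_lie, tT_lie, map_zero]
  rwa [LieRing.of_associative_ring_bracket, sub_eq_zero] at this

theorem toEnd_tder_mul_tT (n : ℤ) :
    LieModule.toEnd ℂ TNeg X tder * LieModule.toEnd ℂ TNeg X (tT n) =
      LieModule.toEnd ℂ TNeg X (tT n) * LieModule.toEnd ℂ TNeg X tder +
        (n : ℂ) • LieModule.toEnd ℂ TNeg X (tT n) := by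
  have : ⁅LieModule.toEnd ℂ TNeg X tder, LieModule.toEnd ℂ TNeg X (tT n)⁆ =
      (n : ℂ) • LieModule.toEnd ℂ TNeg X (tT n) := by
    rw [← LieHom.map_lie, tder_lie, map_smul]
  rwa [LieRing.of_associative_ring_bracket, sub_eq_iff_eq_add'] at this

/-- The operators of degree `k` that commute with all `T(n)`. -/
def IsDegree (A : Module.End ℂ X) (k : ℤ) : Prop :=
  (∀ n, LieModule.toEnd ℂ TNeg X (tT n) * A = A * LieModule.toEnd ℂ TNeg X (tT n)) ∧
    LieModule.toEnd ℂ TNeg X tder * A = A * LieModule.toEnd ℂ TNeg X tder + (k : ℂ) • A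

theorem isDegree_tT (n : ℤ) : IsDegree (LieModule.toEnd ℂ TNeg X (tT n)) n :=
  ⟨fun m => toEnd_tT_comm m n, toEnd_tder_mul_tT n⟩

theorem isDegree_one : IsDegree (1 : Module.End ℂ X) 0 := ⟨fun n => by simp, by simp⟩

theorem IsDegree.mul {A B : Module.End ℂ X} {k l : ℤ} (hA : IsDegree A k) (hB : IsDegree B l) :
    IsDegree (A * B) (k + l) := by
  refine ⟨fun n => ?_, ?_⟩
  · rw [← mul_assoc, hA.1, mul_assoc, hB.1, mul_assoc]
  · rw [← mul_assoc, hA.2, add_mul, mul_assoc, hB.2, mul_add, ← mul_assoc, smul_mul_assoc,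
      mul_smul_comm]
    push_cast
    module

theorem IsDegree.pow {A : Module.End ℂ X} {k : ℤ} (hA : IsDegree A k) (m : ℕ) :
    IsDegree (A ^ m) (m * k) := by
  induction m with
  | zero => simpa using isDegree_one
  | succ m ih =>
    have := ih.mul hA
    rw [pow_succ]
    convert this using 1
    push_cast; ring

theorem IsDegree.inv {u : (Module.End ℂ X)ˣ} {k : ℤ} (hA : IsDegree (u : Module.End ℂ X) k) :
    IsDegree ((u⁻¹ : (Module.End ℂ X)ˣ) : Module.End ℂ X) (-k) := by
  have hconj : ∀ B : Module.End ℂ X, ((u⁻¹ : (Module.End ℂ X)ˣ) : Module.End ℂ X) * (B * u) *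
      ((u⁻¹ : (Module.End ℂ X)ˣ) : Module.End ℂ X) =
      ((u⁻¹ : (Module.End ℂ X)ˣ) : Module.End ℂ X) * B := fun B => by
    rw [mul_assoc, mul_assoc B, Units.mul_inv, mul_one]
  have hconj' : ∀ B : Module.End ℂ X, ((u⁻¹ : (Module.End ℂ X)ˣ) : Module.End ℂ X) * (u * B) *
      ((u⁻¹ : (Module.End ℂ X)ˣ) : Module.End ℂ X) =
      B * ((u⁻¹ : (Module.End ℂ X)ˣ) : Module.End ℂ X) := fun B => by
    rw [← mul_assoc ((u⁻¹ : (Module.End ℂ X)ˣ) : Module.End ℂ X), Units.inv_mul, one_mul]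
  refine ⟨fun n => ?_, ?_⟩
  · rw [← hconj, ← hconj', hA.1]
  · rw [← hconj (LieModule.toEnd ℂ TNeg X tder), ← hconj' (LieModule.toEnd ℂ TNeg X tder), hA.2,
      mul_add, add_mul, mul_smul_comm, smul_mul_assoc, Units.inv_mul, one_mul]
    push_cast
    module

theorem IsDegree.eq_zero_or_isUnit (hX : LieModule.IsIrreducible ℂ TNeg X) {A : Module.End ℂ X}
    {k : ℤ} (hA : IsDegree A k) : A = 0 ∨ IsUnit A := by
  refine WhittakerSl2.eq_zero_or_isUnit span_tGen hX ?_
  rintro _ (rfl | ⟨n, rfl⟩)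
  · exact ⟨k, fun x => LinearMap.congr_fun hA.2 x⟩
  · exact ⟨0, fun x => by rw [zero_smul, add_zero]; exact LinearMap.congr_fun (hA.1 n) x⟩

theorem IsDegree.eq_smul_one (hX : LieModule.IsIrreducible ℂ TNeg X) {A : Module.End ℂ X}
    (hA : IsDegree A 0) : ∃ t : ℂ, A = t • (1 : Module.End ℂ X) := by
  refine eq_smul_one_of_comm span_tGen countable_tGen hX ?_
  rintro _ (rfl | ⟨n, rfl⟩) x
  · have := LinearMap.congr_fun hA.2 x
    rw [Int.cast_zero, zero_smul, add_zero] at this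
    exact this.symm
  · exact (LinearMap.congr_fun (hA.1 n) x).symm

theorem isIrreducible_borelRep {X : Type*} [AddCommGroup X] [Module ℂ X] {H E : Module.End ℂ X}
    {hHE : ⁅H, E⁆ = (2 : ℂ) • E} (hX : Nontrivial X)
    (h : ∀ N : Submodule ℂ X, (∀ x ∈ N, H x ∈ N) → (∀ x ∈ N, E x ∈ N) → N = ⊥ ∨ N = ⊤) :
    LieModule.IsIrreducible ℂ Borel (RepSpace (borelRep hHE)) := by
  refine (isIrreducible_iff_of_span span_borel).mpr ⟨hX, fun N hN => h N (fun x hx => ?_)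
    fun x hx => ?_⟩
  · exact (LinearMap.congr_fun (borelRep_bh hHE) x) ▸ hN bh (Or.inl rfl) x hx
  · exact (LinearMap.congr_fun (borelRep_be hHE) x) ▸ hN be (Or.inr rfl) x hx

/-- Nonzero homogeneous operators commuting with the T(n) are invertible, and the degrees of
invertible ones form a subgroup of ℤ. It contains s, hence -r, which provides u. Dividing T(n) by
the power of u of the same degree leaves an operator of degree 0, a scalar by Schur's lemma; so e =
u and h = -(2/r) d determine the module. -/
theorem exists_twist (hX : LieModule.IsIrreducible ℂ TNeg X)
    (hs : ∃ n < 0, LieModule.toEnd ℂ TNeg X (tT n) ≠ 0) :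
    ∃ (D : TwistDatum) (M : Type u) (_ : AddCommGroup M) (_ : Module ℂ M)
      (_ : LieRingModule Borel M) (_ : LieModule ℂ Borel M),
      LieModule.IsIrreducible ℂ Borel M ∧ ¬ FiniteDimensional ℂ M ∧
        Nonempty (X ≃ₗ⁅ℂ,TNeg⁆ Twist D M) := by
  obtain ⟨hnt, hirr⟩ := (isIrreducible_iff_of_span span_tGen).mp hX
  let s : Set ℤ := {n | n < 0 ∧ LieModule.toEnd ℂ TNeg X (tT n) ≠ 0}
  obtain ⟨n₀, hn₀, hTn₀⟩ := hs
  obtain ⟨a, ha⟩ := Int.subgroup_cyclic (AddSubgroup.closure s)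
  rw [← AddSubgroup.zmultiples_eq_closure, ← Int.zmultiples_natAbs] at ha
  obtain ⟨r, hr⟩ : ∃ r : ℕ, r = a.natAbs := ⟨_, rfl⟩
  rw [← hr] at ha
  have hdvd : ∀ n ∈ s, (r : ℤ) ∣ n := fun n hn => by
    have := AddSubgroup.subset_closure hn
    rw [ha] at this
    exact Int.mem_zmultiples_iff.mp this
  have hr0 : 0 < r := Nat.pos_of_ne_zero fun h => by
    have := hdvd n₀ ⟨hn₀, hTn₀⟩
    rw [h, Nat.cast_zero, zero_dvd_iff] at this
    omega
  have hrC : (r : ℂ) ≠ 0 := Nat.cast_ne_zero.mpr hr0.ne'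
  let H : AddSubgroup ℤ :=
    { carrier := {k | ∃ u : (Module.End ℂ X)ˣ, IsDegree (u : Module.End ℂ X) k}
      zero_mem' := ⟨1, isDegree_one⟩
      add_mem' := by
        rintro k l ⟨u, hu⟩ ⟨v, hv⟩
        exact ⟨u * v, hu.mul hv⟩
      neg_mem' := by
        rintro k ⟨u, hu⟩
        exact ⟨u⁻¹, hu.inv⟩ }
  have hsH : AddSubgroup.closure s ≤ H := (AddSubgroup.closure_le H).mpr fun n hn => by
    obtain ⟨u, hu⟩ := ((isDegree_tT n).eq_zero_or_isUnit hX).resolve_left hn.2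
    exact ⟨u, hu ▸ isDegree_tT n⟩
  obtain ⟨u, hu⟩ : -(r : ℤ) ∈ H := H.neg_mem (hsH (ha ▸ AddSubgroup.mem_zmultiples _))
  have hT : ∀ n ∈ s ∪ {0}, ∃ t : ℂ, LieModule.toEnd ℂ TNeg X (tT n) =
      t • (u : Module.End ℂ X) ^ (-n / (r : ℤ)).toNat := fun n hn => by
    have hdvd' : (r : ℤ) ∣ n := by
      rcases hn with hn | hn
      · exact hdvd n hn
      · rw [show n = 0 from hn]; exact dvd_zero _
    have hle : n ≤ 0 := by
      rcases hn with hn | hn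
      · exact hn.1.le
      · exact le_of_eq hn
    -- As u has degree -r and n = -mr, the power u^m has the same degree as T(n).
    obtain ⟨m, hm⟩ : ∃ m : ℕ, m = (-n / (r : ℤ)).toNat := ⟨_, rfl⟩
    have hm' : (m : ℤ) * r = -n := by
      rw [hm, Int.toNat_of_nonneg (Int.ediv_nonneg (by omega) (by omega)),
        Int.ediv_mul_cancel (dvd_neg.mpr hdvd')]
    have h1 : IsDegree (((u ^ m : (Module.End ℂ X)ˣ)⁻¹ : (Module.End ℂ X)ˣ) : Module.End ℂ X) (-n) := by
      refine IsDegree.inv ?_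
      rw [Units.val_pow_eq_pow_val]
      convert hu.pow m using 1
      rw [mul_neg, hm', neg_neg]
    have h2 := (isDegree_tT (X := X) n).mul h1
    rw [add_neg_cancel] at h2
    obtain ⟨t, ht⟩ := h2.eq_smul_one hX
    refine ⟨t, ?_⟩
    have h3 := congrArg (fun B => B * ((u ^ m : (Module.End ℂ X)ˣ) : Module.End ℂ X)) ht
    simp only [mul_assoc, Units.inv_mul, mul_one, smul_mul_assoc, one_mul] at h3
    rw [h3, ← hm, Units.val_pow_eq_pow_val]
  classical
  choose! χ hχ using hT
  let D : TwistDatum :=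
    { s := s
      nonempty := ⟨n₀, hn₀, hTn₀⟩
      neg := fun i hi => hi.1
      r := r
      r_pos := hr0
      closure_eq := ha
      χ := χ
      χ_ne := fun i hi h => hi.2 (by rw [hχ i (Or.inl hi), h, zero_smul]) }
  obtain ⟨h, hh⟩ : ∃ h : Module.End ℂ X, h = (-(2 : ℂ) / r) • LieModule.toEnd ℂ TNeg X tder :=
    ⟨_, rfl⟩
  have hhd : LieModule.toEnd ℂ TNeg X tder = (-(r : ℂ) / 2) • h := by
    rw [hh, smul_smul, show -(r : ℂ) / 2 * (-(2 : ℂ) / r) = 1 by field_simp, one_smul]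
  have hHE : ⁅h, (u : Module.End ℂ X)⁆ = (2 : ℂ) • (u : Module.End ℂ X) := by
    rw [LieRing.of_associative_ring_bracket, hh, smul_mul_assoc, mul_smul_comm, ← smul_sub, hu.2,
      add_sub_cancel_left, smul_smul]
    congr 1
    push_cast
    field_simp
  let M := RepSpace (borelRep hHE)
  have hbh : LieModule.toEnd ℂ Borel M bh = h := borelRep_bh hHE
  have hbe : LieModule.toEnd ℂ Borel M be = (u : Module.End ℂ X) := borelRep_be hHE
  have hgen : ∀ g ∈ tGen, LieModule.toEnd ℂ TNeg X g = twistRep D M g := by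
    rintro _ (rfl | ⟨n, rfl⟩)
    · exact hhd.trans (by rw [twistRep_tder, hbh]; rfl)
    · by_cases hn : n ∈ s ∪ {0}
      · exact (hχ n hn).trans (by rw [twistRep_tT D M hn, hbe]; rfl)
      · refine Eq.trans ?_ (twistRep_tT_of_notMem D M hn).symm
        rcases le_or_gt n 0 with h0 | h0
        · by_contra h1
          rcases h0.lt_or_eq with h2 | h2
          · exact hn (Or.inl ⟨h2, h1⟩)
          · exact hn (Or.inr h2)
        · rw [tT_of_pos h0, map_zero]; rfl
  refine ⟨D, M, inferInstance, inferInstance, inferInstance, inferInstance, ?_,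
    not_finiteDimensional (X := X) hHE u.isUnit, ⟨?_⟩⟩
  · refine isIrreducible_borelRep hnt fun N hNh hNu' => hirr N fun g hg m hm => ?_
    have hNu : ∀ k : ℕ, ∀ x ∈ N, ((u : Module.End ℂ X) ^ k) x ∈ N := fun k => by
      induction k with
      | zero => exact fun x hx => by simpa using hx
      | succ k ih =>
        intro x hx
        rw [pow_succ, Module.End.mul_apply]
        exact ih _ (hNu' x hx)
    change LieModule.toEnd ℂ TNeg X g m ∈ N
    rcases hg with rfl | ⟨n, rfl⟩
    · rw [hhd]
      exact N.smul_mem _ (hNh m hm)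
    · by_cases hn : n ∈ s ∪ {0}
      · rw [hχ n hn]
        exact N.smul_mem _ (hNu _ m hm)
      · have : LieModule.toEnd ℂ TNeg X (tT n) = 0 :=
          (hgen _ (Or.inr ⟨n, rfl⟩)).trans (twistRep_tT_of_notMem D M hn)
        rw [this]
        exact N.zero_mem
  · exact lieEquivOfSpan span_tGen (show X ≃ₗ[ℂ] Twist D M from LinearEquiv.refl ℂ X) fun g hg m =>
      LinearMap.congr_fun (hgen g hg) m

/-- The simple modules over `TNeg`. -/
theorem isIrreducible_tNeg_iff : LieModule.IsIrreducible ℂ TNeg X ↔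
    (Module.finrank ℂ X = 1 ∨
      ∃ (D : TwistDatum) (M : Type u) (_ : AddCommGroup M) (_ : Module ℂ M)
        (_ : LieRingModule Borel M) (_ : LieModule ℂ Borel M),
        LieModule.IsIrreducible ℂ Borel M ∧ ¬ FiniteDimensional ℂ M ∧
          Nonempty (X ≃ₗ⁅ℂ,TNeg⁆ Twist D M)) := by
  constructor
  · intro hX
    by_cases hs : ∃ n < 0, LieModule.toEnd ℂ TNeg X (tT n) ≠ 0
    · exact Or.inr (exists_twist hX hs)
    left
    push Not at hs
    obtain ⟨t₀, ht₀⟩ := exists_tT_zero_eq hX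
    have hT : ∀ n, ∃ t : ℂ, LieModule.toEnd ℂ TNeg X (tT n) = t • (1 : Module.End ℂ X) := fun n => by
      rcases lt_trichotomy n 0 with h | rfl | h
      · exact ⟨0, by rw [hs n h, zero_smul]⟩
      · exact ⟨t₀, ht₀⟩
      · exact ⟨0, by rw [tT_of_pos h, map_zero, zero_smul]⟩
    -- All T(n) act by scalars, so d commutes with everything and is a scalar too.
    have hd : IsDegree (LieModule.toEnd ℂ TNeg X tder) 0 := by
      refine ⟨fun n => ?_, by simp⟩
      obtain ⟨t, ht⟩ := hT n
      rw [ht, smul_mul_assoc, one_mul, mul_smul_comm, mul_one]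
    refine finrank_eq_one_of_scalar span_tGen hX ?_
    rintro _ (rfl | ⟨n, rfl⟩)
    · obtain ⟨t, ht⟩ := hd.eq_smul_one hX
      exact ⟨t, fun x => LinearMap.congr_fun ht x⟩
    · obtain ⟨t, ht⟩ := hT n
      exact ⟨t, fun x => LinearMap.congr_fun ht x⟩
  · rintro (h | ⟨D, M, _, _, _, _, hM, hinf, ⟨f⟩⟩)
    · exact isIrreducible_of_finrank_eq_one h
    · exact isIrreducible_congr f (isIrreducible_twist D hM hinf)

end Classification

end

end WhittakerSl2

namespace WhittakerSl2

noncomputable section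

/-! ### Induced modules -/

section Induced

variable {K L : Type*} [LieRing K] [LieAlgebra ℂ K] [LieRing L] [LieAlgebra ℂ L]
  {j : K →ₗ⁅ℂ⁆ L} {M : Type*} [AddCommGroup M] [Module ℂ M] [LieRingModule K M]

/-- The quotient map to the induced module. -/
def inducedMk (j : K →ₗ⁅ℂ⁆ L) (M : Type*) [AddCommGroup M] [Module ℂ M] [LieRingModule K M] :
    UniversalEnvelopingAlgebra ℂ L ⊗[ℂ] M →ₗ[ℂ] Induced j M :=
  ((inducedRelations j M).mkQ).restrictScalars ℂ

theorem inducedMk_surjective : Function.Surjective (inducedMk j M) :=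
  Submodule.Quotient.mk_surjective (inducedRelations j M)

theorem lie_inducedMk (x : L) (z : UniversalEnvelopingAlgebra ℂ L ⊗[ℂ] M) :
    ⁅x, inducedMk j M z⁆ = inducedMk j M (UniversalEnvelopingAlgebra.ι ℂ x • z) := rfl

/-- The canonical map to the induced module. -/
def inducedOne (j : K →ₗ⁅ℂ⁆ L) (M : Type*) [AddCommGroup M] [Module ℂ M] [LieRingModule K M] :
    M →ₗ[ℂ] Induced j M :=
  inducedMk j M ∘ₗ TensorProduct.mk ℂ (UniversalEnvelopingAlgebra ℂ L) M 1

theorem inducedOne_apply (m : M) : inducedOne j M m = inducedMk j M (1 ⊗ₜ[ℂ] m) := rfl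

theorem lie_inducedOne (x : K) (m : M) : ⁅j x, inducedOne j M m⁆ = inducedOne j M ⁅x, m⁆ := by
  rw [inducedOne_apply, lie_inducedMk, inducedOne_apply, TensorProduct.smul_tmul', smul_eq_mul,
    mul_one]
  refine (Submodule.Quotient.eq (inducedRelations j M)).mpr (Submodule.subset_span ⟨1, x, m, ?_⟩)
  rw [one_mul]

theorem induced_eq_top {N : Submodule ℂ (Induced j M)} (h1 : ∀ m, inducedOne j M m ∈ N)
    (hN : ∀ (x : L), ∀ v ∈ N, ⁅x, v⁆ ∈ N) : N = ⊤ := by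
  refine eq_top_iff.mpr fun v _ => ?_
  obtain ⟨z, rfl⟩ := inducedMk_surjective v
  have h : ∀ (u : UniversalEnvelopingAlgebra ℂ L), ∀ z ∈ N.comap (inducedMk j M),
      u • z ∈ N.comap (inducedMk j M) :=
    env_smul_mem fun x z hz => hN x _ hz
  induction z using TensorProduct.induction_on with
  | zero => rw [map_zero]; exact N.zero_mem
  | tmul u m =>
    have := h u (1 ⊗ₜ[ℂ] m) (h1 m)
    rwa [TensorProduct.smul_tmul', smul_eq_mul, mul_one] at this
  | add z z' hz hz' => rw [map_add]; exact N.add_mem (hz trivial) (hz' trivial)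

/-- Frobenius reciprocity: u ⊗ m ↦ u · ψ(m) respects the balancing relations because ψ is
equivariant. -/
theorem exists_induced_hom {W : Type*} [AddCommGroup W] [Module ℂ W] [LieRingModule L W]
    [LieModule ℂ L W] (ψ : M →ₗ[ℂ] W) (hψ : ∀ x m, ψ ⁅x, m⁆ = ⁅j x, ψ m⁆) :
    ∃ Φ : Induced j M →ₗ⁅ℂ,L⁆ W, ∀ m, Φ (inducedOne j M m) = ψ m := by
  let F := UniversalEnvelopingAlgebra.lift ℂ (LieModule.toEnd ℂ L W)
  have hF : ∀ x v, F (UniversalEnvelopingAlgebra.ι ℂ x) v = ⁅x, v⁆ := fun x v => by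
    rw [UniversalEnvelopingAlgebra.lift_ι_apply]; rfl
  let G : UniversalEnvelopingAlgebra ℂ L ⊗[ℂ] M →ₗ[ℂ] W :=
    TensorProduct.lift ((LinearMap.lcomp ℂ W ψ).comp F.toLinearMap)
  have hG : ∀ u m, G (u ⊗ₜ[ℂ] m) = F u (ψ m) := fun u m => rfl
  have hGs : ∀ u z, G (u • z) = F u (G z) := fun u z => by
    induction z using TensorProduct.induction_on with
    | zero => rw [smul_zero, map_zero, map_zero]
    | tmul u' m => rw [TensorProduct.smul_tmul', smul_eq_mul, hG, hG, map_mul, Module.End.mul_apply]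
    | add z z' hz hz' => rw [smul_add, map_add, map_add, map_add, hz, hz']
  let R : Submodule (UniversalEnvelopingAlgebra ℂ L) (UniversalEnvelopingAlgebra ℂ L ⊗[ℂ] M) :=
    { carrier := {z | G z = 0}
      zero_mem' := map_zero G
      add_mem' := fun {z z'} hz hz' => by
        change G (z + z') = 0
        rw [map_add, show G z = 0 from hz, show G z' = 0 from hz', add_zero]
      smul_mem' := fun u z hz => by
        change G (u • z) = 0
        rw [hGs, show G z = 0 from hz, map_zero] }
  have hR : inducedRelations j M ≤ R := by
    refine Submodule.span_le.mpr ?_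
    rintro _ ⟨u, x, m, rfl⟩
    change G _ = 0
    rw [map_sub, hG, hG, map_mul, Module.End.mul_apply, hF, hψ, sub_self]
  let φ : ((UniversalEnvelopingAlgebra ℂ L ⊗[ℂ] M) ⧸ inducedRelations j M) →ₗ[ℂ] W :=
    ((inducedRelations j M).restrictScalars ℂ).liftQ G (fun u hu => hR hu) ∘ₗ
      (Submodule.Quotient.restrictScalarsEquiv ℂ (inducedRelations j M)).symm
  let φ' : Induced j M →ₗ[ℂ] W := φ
  have hφ : ∀ z, φ' (inducedMk j M z) = G z := fun z => rfl
  refine ⟨{ φ' with map_lie' := fun {x v} => ?_ }, fun m => ?_⟩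
  · obtain ⟨z, rfl⟩ := inducedMk_surjective v
    change φ' ⁅x, inducedMk j M z⁆ = ⁅x, φ' (inducedMk j M z)⁆
    rw [lie_inducedMk, hφ, hφ, hGs, hF]
  · change φ' (inducedMk j M (1 ⊗ₜ[ℂ] m)) = ψ m
    rw [hφ, hG, map_one, Module.End.one_apply]

end Induced

end

end WhittakerSl2

namespace WhittakerSl2

noncomputable section

/-! ### Simple quotients of `V(λ, μ, -2)` for `μ ≠ 0` -/

/-! ### The span of the powers of d applied to a vector -/

section DerSpan

open Polynomial

variable {M : Type*} [AddCommGroup M] [Module ℂ M]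

/-- The map `q ↦ q(d) w`. -/
def polyMap (d : Module.End ℂ M) (w : M) : ℂ[X] →ₗ[ℂ] M :=
  (LinearMap.applyₗ w).comp (aeval d).toLinearMap

theorem polyMap_apply (d : Module.End ℂ M) (w : M) (q : ℂ[X]) : polyMap d w q = aeval d q w := rfl

theorem mem_range_polyMap (d : Module.End ℂ M) (w : M) : w ∈ LinearMap.range (polyMap d w) :=
  ⟨1, by rw [polyMap_apply, map_one, Module.End.one_apply]⟩

theorem range_polyMap_stable (d : Module.End ℂ M) (w : M) :
    ∀ x ∈ LinearMap.range (polyMap d w), d x ∈ LinearMap.range (polyMap d w) := by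
  rintro _ ⟨q, rfl⟩
  exact ⟨X * q, by rw [polyMap_apply, map_mul, aeval_X, Module.End.mul_apply, polyMap_apply]⟩

theorem range_polyMap_le {d : Module.End ℂ M} {w : M} {N : Submodule ℂ M} (hw : w ∈ N)
    (hd : ∀ x ∈ N, d x ∈ N) : LinearMap.range (polyMap d w) ≤ N := by
  rintro _ ⟨q, rfl⟩
  exact aeval_apply_smul_mem_of_le_comap hw q d hd

theorem polyMap_map {M' : Type*} [AddCommGroup M'] [Module ℂ M'] {d : Module.End ℂ M}
    {d' : Module.End ℂ M'} (F : M →ₗ[ℂ] M') (hF : ∀ v, F (d v) = d' (F v)) (w : M) (q : ℂ[X]) :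
    F (polyMap d w q) = polyMap d' (F w) q := by
  induction q using Polynomial.induction_on' with
  | add p q hp hq => rw [map_add, map_add, map_add, hp, hq]
  | monomial n a =>
    have h : ∀ n : ℕ, F ((d ^ n) w) = (d' ^ n) (F w) := fun n => by
      induction n with
      | zero => simp
      | succ n ih => rw [pow_succ', pow_succ', Module.End.mul_apply, Module.End.mul_apply, hF, ih]
    simp [polyMap_apply, aeval_monomial, h]

theorem finiteDimensional_range_polyMap {d : Module.End ℂ M} {w : M} {p : ℂ[X]} (hp : p ≠ 0)
    (hpw : polyMap d w p = 0) : FiniteDimensional ℂ (LinearMap.range (polyMap d w)) := by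
  have h : LinearMap.range (polyMap d w) ≤ (degreeLT ℂ p.natDegree).map (polyMap d w) := by
    rintro _ ⟨q, rfl⟩
    refine ⟨q % p, mem_degreeLT.mpr ?_, ?_⟩
    · rw [← degree_eq_natDegree hp]
      exact degree_mod_lt q hp
    · conv_rhs => rw [← EuclideanDomain.div_add_mod q p]
      rw [map_add, mul_comm p, polyMap_apply, polyMap_apply, map_mul,
        Module.End.mul_apply, show aeval d p w = 0 from hpw, map_zero, zero_add]
  have : FiniteDimensional ℂ (degreeLT ℂ p.natDegree) :=
    LinearEquiv.finiteDimensional (degreeLTEquiv ℂ p.natDegree).symm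
  exact Submodule.finiteDimensional_of_le h

/-- If `[d, T] = T` and `T` is injective, then `w, d w, d² w, …` are linearly independent for
every eigenvector `w` of `T`. -/
theorem polyMap_injective {d T : Module.End ℂ M} (hdT : ∀ v, d (T v) = T (d v) + T v)
    (hT : Function.Injective T) {w : M} (hw : w ≠ 0) {t : ℂ} (htw : T w = t • w) :
    Function.Injective (polyMap d w) := by
  refine (injective_iff_map_eq_zero _).mpr fun p hp => ?_
  by_contra hp0
  -- If p(d)w = 0 with p ≠ 0, then ℂ[d]w is finite-dimensional. It is stable under T because w is an
  -- eigenvector and Td = dT - T, and an injective T is invertible on it.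
  obtain ⟨Z, hZ⟩ : ∃ Z, Z = LinearMap.range (polyMap d w) := ⟨_, rfl⟩
  have hfin : FiniteDimensional ℂ Z := hZ ▸ finiteDimensional_range_polyMap hp0 hp
  have hwZ : w ∈ Z := hZ ▸ mem_range_polyMap d w
  have hdZ : ∀ x ∈ Z, d x ∈ Z := hZ ▸ range_polyMap_stable d w
  have hTZ : ∀ x ∈ Z, T x ∈ Z := by
    have : Z ≤ Z ⊓ Z.comap T := by
      conv_lhs => rw [hZ]
      refine range_polyMap_le ⟨hwZ, ?_⟩ fun x hx => ⟨hdZ x hx.1, ?_⟩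
      · change T w ∈ Z
        rw [htw]
        exact Z.smul_mem t hwZ
      · have h1 : T (d x) = d (T x) - T x := eq_sub_of_add_eq (hdT x).symm
        change T (d x) ∈ Z
        rw [h1]
        exact Z.sub_mem (hdZ _ hx.2) hx.2
    exact fun x hx => (this hx).2
  have hnt : Nontrivial Z := ⟨⟨⟨w, hwZ⟩, 0, fun h => hw (congrArg Subtype.val h)⟩⟩
  have hinj : Function.Injective (T.restrict hTZ) := fun x y hxy =>
    Subtype.ext (hT (congrArg Subtype.val hxy))
  -- Doubling d turns [d, T] = T into the relation [H, E] = 2E, which no finite-dimensional space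
  -- with invertible E admits.
  refine not_finiteDimensional (H := (2 : ℂ) • d.restrict hdZ) (E := T.restrict hTZ) ?_
    ((Module.End.isUnit_iff _).mpr ⟨hinj, LinearMap.injective_iff_surjective.mp hinj⟩) hfin
  rw [LieRing.of_associative_ring_bracket]
  refine LinearMap.ext fun x => Subtype.ext ?_
  change (2 : ℂ) • d (T x) - T ((2 : ℂ) • d x) = (2 : ℂ) • T x
  rw [map_smul, hdT]
  module

variable {ρ : AffTilde →ₗ⁅ℂ⁆ Module.End ℂ M} {lam : ℂ}

/-- A module generated by a Whittaker vector that is an eigenvector of the Sugawara operators. -/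
theorem bspan_range_polyMap (C : IsCritical (hatRep ρ)) (hlam : lam ≠ 0) {w : M}
    (hw : w ∈ whit (hatRep ρ) lam) (hT : ∀ n, ∃ t : ℂ, sugawaraEnd (hatRep ρ) n w = t • w)
    (hgen : ∀ N : Submodule ℂ M, w ∈ N → (∀ z, ∀ v ∈ N, ρ z v ∈ N) → N = ⊤) :
    bspan (hatRep ρ) (LinearMap.range (polyMap (ρ der) w)) = ⊤ := by
  have hd := range_polyMap_stable (ρ der) w
  refine hgen _ (le_borelSpan (mem_range_polyMap _ w)) fun z v hv =>
    bspan_stable C hlam (range_polyMap_le hw fun x hx => der_mem_whit hx) (fun n => ?_) hd z hv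
  suffices H : LinearMap.range (polyMap (ρ der) w) ≤ LinearMap.range (polyMap (ρ der) w) ⊓
      (LinearMap.range (polyMap (ρ der) w)).comap (sugawaraEnd (hatRep ρ) n) from
    fun x hx => (H hx).2
  refine range_polyMap_le ⟨mem_range_polyMap _ w, ?_⟩ fun x hx => ⟨hd x hx.1, ?_⟩
  · obtain ⟨t, ht⟩ := hT n
    change sugawaraEnd (hatRep ρ) n w ∈ LinearMap.range (polyMap (ρ der) w)
    rw [ht]
    exact Submodule.smul_mem _ t (mem_range_polyMap _ w)
  · change sugawaraEnd (hatRep ρ) n (ρ der x) ∈ LinearMap.range (polyMap (ρ der) w)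
    rw [eq_sub_of_add_eq (sugawaraEnd_mul_der C n x).symm]
    exact Submodule.sub_mem _ (hd _ hx.2) (Submodule.smul_mem _ _ hx.2)

end DerSpan

/-! ### The universal module with prescribed Sugawara eigenvalues -/

section HatC

variable (lam mu : ℂ) (c : ℤ → ℂ)

theorem isCritical_vHat : IsCritical (LieModule.toEnd ℂ AffHat (VHat lam mu (-2))) := by
  have hw : IsWhittakerVector LieHom.id lam mu (-2) (whittakerGen LieHom.id lam mu (-2)) :=
    isWhittakerVector_gen
  refine isCritical_of_generated (w := whittakerGen LieHom.id lam mu (-2))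
    (restricted_of_whittaker (m := 1) (fun i hi => hw.e_pos i (by omega))
      (fun i hi => hw.h_pos i (by omega)) fun i hi => ?_) hw.c
    fun N hwN hN _ => eq_top_of_gen_mem (j := LieHom.id) hwN hN
  have := hw.f_pos (i - 1) (by omega)
  rwa [sub_add_cancel] at this

/-- The projection to `VHatC`. -/
def vHatProj : VHat lam mu (-2) →ₗ⁅ℂ,AffHat⁆ VHatC lam mu c := LieSubmodule.Quotient.mk' _

theorem vHatProj_surjective : Function.Surjective (vHatProj lam mu c) :=
  LieSubmodule.Quotient.surjective_mk' _

theorem vHatProj_lie (z : AffHat) (v : VHat lam mu (-2)) :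
    (vHatProj lam mu c : VHat lam mu (-2) →ₗ[ℂ] VHatC lam mu c)
      (LieModule.toEnd ℂ AffHat (VHat lam mu (-2)) z v) =
    LieModule.toEnd ℂ AffHat (VHatC lam mu c) z
      ((vHatProj lam mu c : VHat lam mu (-2) →ₗ[ℂ] VHatC lam mu c) v) :=
  LieModuleHom.map_lie (vHatProj lam mu c) z v

/-- The generator of `VHatC`. -/
def wHatC : VHatC lam mu c := vHatProj lam mu c (wHat lam mu (-2))

theorem isCritical_vHatC : IsCritical (LieModule.toEnd ℂ AffHat (VHatC lam mu c)) :=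
  isCritical_hom (isCritical_vHat lam mu) (vHatProj lam mu c : VHat lam mu (-2) →ₗ[ℂ] VHatC lam mu c)
    (vHatProj_lie lam mu c) (vHatProj_surjective lam mu c)

theorem isWhittakerVector_wHatC : IsWhittakerVector LieHom.id lam mu (-2) (wHatC lam mu c) :=
  (isWhittakerVector_gen (j := LieHom.id)).map (vHatProj lam mu c)

theorem sugawara_wHatC {n : ℤ} (hn : n ≤ 0) :
    sugawara (LieModule.toEnd ℂ AffHat (VHatC lam mu c)) n (wHatC lam mu c) =
      c n • wHatC lam mu c := by
  rw [wHatC]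
  refine ((isCritical_vHat lam mu).restricted.map_sugawara (vHatProj_lie lam mu c) n _).symm.trans ?_
  refine sub_eq_zero.mp ?_
  refine Eq.trans ?_ ((LieSubmodule.Quotient.mk_eq_zero _).mpr
    (LieSubmodule.subset_lieSpan ⟨n, hn, rfl⟩))
  exact ((congrArg₂ _ rfl (map_smul (vHatProj lam mu c) _ _).symm).trans
    (map_sub (vHatProj lam mu c) _ _).symm)

theorem vHatC_eq_top {N : Submodule ℂ (VHatC lam mu c)} (hw : wHatC lam mu c ∈ N)
    (hN : ∀ (x : AffHat), ∀ v ∈ N, ⁅x, v⁆ ∈ N) : N = ⊤ := by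
  have h : N.comap (vHatProj lam mu c : VHat lam mu (-2) →ₗ[ℂ] VHatC lam mu c) = ⊤ :=
    eq_top_of_gen_mem (j := LieHom.id) hw fun x v hv => by
      rw [Submodule.mem_comap]
      exact (LieModuleHom.map_lie (vHatProj lam mu c) x v).symm ▸ hN x _ hv
  refine eq_top_iff.mpr fun v _ => ?_
  obtain ⟨u, rfl⟩ := vHatProj_surjective lam mu c v
  exact (h ▸ Submodule.mem_top : u ∈ N.comap _)

variable {lam mu c}

theorem exists_vHatC_hom {W : Type*} [AddCommGroup W] [Module ℂ W] [LieRingModule AffHat W]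
    [LieModule ℂ AffHat W] {w : W} (hw : IsWhittakerVector LieHom.id lam mu (-2) w)
    (hT : ∀ n ≤ 0, sugawara (LieModule.toEnd ℂ AffHat W) n w = c n • w) :
    ∃ ψ : VHatC lam mu c →ₗ[ℂ] W, (∀ (x : AffHat) v, ψ ⁅x, v⁆ = ⁅x, ψ v⁆) ∧
      ψ (wHatC lam mu c) = w := by
  obtain ⟨φ, hφ⟩ := exists_hom hw
  have hker : LieSubmodule.lieSpan ℂ AffHat
      {v : VHat lam mu (-2) | ∃ n ≤ 0,
        v = sugawara (LieModule.toEnd ℂ AffHat (VHat lam mu (-2))) n (wHat lam mu (-2)) -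
          c n • wHat lam mu (-2)} ≤ φ.ker := by
    refine LieSubmodule.lieSpan_le.mpr ?_
    rintro _ ⟨n, hn, rfl⟩
    change φ _ = 0
    rw [map_sub, map_smul, sub_eq_zero]
    refine ((isCritical_vHat lam mu).restricted.map_sugawara
      (φ := (φ : VHat lam mu (-2) →ₗ[ℂ] W)) (ρ' := LieModule.toEnd ℂ AffHat W)
      (fun z v => LieModuleHom.map_lie φ z v) n _).trans ?_
    have h : (φ : VHat lam mu (-2) →ₗ[ℂ] W) (wHat lam mu (-2)) = w := hφ
    rw [h, hT n hn]
    exact congrArg _ hφ.symm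
  let ψ : VHatC lam mu c →ₗ[ℂ] W :=
    Submodule.liftQ _ (φ : VHat lam mu (-2) →ₗ[ℂ] W) fun v hv => hker hv
  refine ⟨ψ, fun x v => ?_, hφ⟩
  obtain ⟨v, rfl⟩ := vHatProj_surjective lam mu c v
  exact LieModuleHom.map_lie φ x v

end HatC

end

end WhittakerSl2

namespace WhittakerSl2

noncomputable section

/-! ### Sugawara eigenvalues on the Whittaker vector for μ ≠ 0 -/

section NonzeroMu

variable {W : Type u} [AddCommGroup W] [Module ℂ W] [LieRingModule AffTilde W]
  [LieModule ℂ AffTilde W] {lam mu : ℂ} {w : W}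

theorem IsWhittakerVector.sugawara_one (C : IsCritical (hatRep (LieModule.toEnd ℂ AffTilde W)))
    (hw : IsWhittakerVector AffHat.incl lam mu (-2) w) :
    sugawaraEnd (hatRep (LieModule.toEnd ℂ AffTilde W)) 1 w = (lam * mu) • w := by
  rw [C.sugawaraEnd_whit_of_f hw.mem_whit one_pos fun m hm => hw.f_eq_zero hm, mul_smul]
  exact congrArg _ hw.f_one

theorem IsWhittakerVector.sugawara_of_gt (C : IsCritical (hatRep (LieModule.toEnd ℂ AffTilde W)))
    (hw : IsWhittakerVector AffHat.incl lam mu (-2) w) {n : ℤ} (hn : 1 < n) :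
    sugawaraEnd (hatRep (LieModule.toEnd ℂ AffTilde W)) n w = 0 := by
  rw [C.sugawaraEnd_whit_of_f hw.mem_whit (by omega) fun m hm => hw.f_eq_zero (by omega),
    hw.f_eq_zero hn, smul_zero]

/-- T(n) does not commute with d, but T(n) T(1)^m with m = -n has degree 0 and does. So it is a
scalar by Schur's lemma. Evaluate at w, where T(1)^m has the nonzero eigenvalue (λμ)^m. -/
theorem exists_sugawara_eigenvalue (hirr : LieModule.IsIrreducible ℂ AffTilde W)
    (C : IsCritical (hatRep (LieModule.toEnd ℂ AffTilde W))) (hlm : lam * mu ≠ 0)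
    (hw : IsWhittakerVector AffHat.incl lam mu (-2) w) {n : ℤ} (hn : n ≤ 0) :
    ∃ t : ℂ, sugawaraEnd (hatRep (LieModule.toEnd ℂ AffTilde W)) n w = t • w := by
  set T := sugawaraEnd (hatRep (LieModule.toEnd ℂ AffTilde W)) with hT
  obtain ⟨m, hm⟩ : ∃ m : ℕ, n + m = 0 := ⟨(-n).toNat, by omega⟩
  have hTz : ∀ k (z : AffHat) (v : W), T k ⁅(z : AffTilde), v⁆ = ⁅(z : AffTilde), T k v⁆ :=
    fun k z v => (LinearMap.congr_fun (C.sugawaraEnd_comm k z) v).symm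
  have hTd : ∀ k (v : W), T k ⁅der, v⁆ = ⁅der, T k v⁆ - (k : ℂ) • T k v := fun k v =>
    eq_sub_of_add_eq (sugawaraEnd_mul_der C k v).symm
  have hpow : ∀ (k : ℕ) (z : AffHat) (v : W),
      (T 1 ^ k) ⁅(z : AffTilde), v⁆ = ⁅(z : AffTilde), (T 1 ^ k) v⁆ := fun k z v => by
    induction k with
    | zero => simp
    | succ k ih => rw [pow_succ', Module.End.mul_apply, Module.End.mul_apply, ih, hTz]
  have hpowd : ∀ (k : ℕ) (v : W),
      (T 1 ^ k) ⁅der, v⁆ = ⁅der, (T 1 ^ k) v⁆ - (k : ℂ) • (T 1 ^ k) v := fun k v => by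
    induction k with
    | zero => simp
    | succ k ih =>
      rw [pow_succ', Module.End.mul_apply, Module.End.mul_apply, ih, map_sub, hTd, map_smul]
      push_cast
      module
  have hpoww : ∀ k : ℕ, (T 1 ^ k) w = (lam * mu) ^ k • w := fun k => by
    induction k with
    | zero => simp
    | succ k ih =>
      rw [pow_succ', Module.End.mul_apply, ih, map_smul, hw.sugawara_one C, smul_smul, ← pow_succ]
  have hmn : (n : ℂ) + m = 0 := by exact_mod_cast congrArg (Int.cast : ℤ → ℂ) hm
  have hA : ∀ (z : AffHat) (v : W),
      (T n * T 1 ^ m) ⁅(z : AffTilde), v⁆ = ⁅(z : AffTilde), (T n * T 1 ^ m) v⁆ := fun z v => by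
    rw [Module.End.mul_apply, Module.End.mul_apply, hpow, hTz]
  obtain ⟨t, ht⟩ := eq_smul_one_of_comm span_affGen countable_affGen hirr (A := T n * T 1 ^ m)
    (forall_affGen (P := fun g => ∀ v : W, (T n * T 1 ^ m) ⁅g, v⁆ = ⁅g, (T n * T 1 ^ m) v⁆)
      (fun k => hA (cur e0 k)) (fun k => hA (cur h0 k)) (fun k => hA (cur f0 k)) (hA cen)
      fun v => by
        rw [Module.End.mul_apply, Module.End.mul_apply, hpowd, map_sub, hTd, map_smul, sub_sub,
          ← add_smul, hmn, zero_smul, sub_zero])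
  refine ⟨t / (lam * mu) ^ m, ?_⟩
  have h1 := LinearMap.congr_fun ht w
  rw [Module.End.mul_apply, hpoww, map_smul, LinearMap.smul_apply, Module.End.one_apply] at h1
  rw [div_eq_inv_mul, mul_smul, ← h1, smul_smul, inv_mul_cancel₀ (pow_ne_zero m hlm), one_smul]

end NonzeroMu

/-! ### Comparison of a simple quotient with the induced module -/

section InducedHat

variable {lam mu : ℂ} {M : Type*} [AddCommGroup M] [Module ℂ M] [LieRingModule AffHat M]
  [LieModule ℂ AffHat M] {y : M}

omit [LieModule ℂ AffHat M] in
theorem IsWhittakerVector.inducedOne (h : IsWhittakerVector LieHom.id lam mu (-2) y) :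
    IsWhittakerVector AffHat.incl lam mu (-2) (inducedOne AffHat.incl M y) := by
  have key : ∀ (z : AffHat) (t : ℂ), ⁅z, y⁆ = t • y →
      ⁅AffHat.incl z, WhittakerSl2.inducedOne AffHat.incl M y⁆ =
        t • WhittakerSl2.inducedOne AffHat.incl M y := fun z t hz => by
    rw [lie_inducedOne, hz, map_smul]
  have key' : ∀ z : AffHat, ⁅z, y⁆ = 0 →
      ⁅AffHat.incl z, WhittakerSl2.inducedOne AffHat.incl M y⁆ = 0 :=
    fun z hz => by rw [lie_inducedOne, hz, map_zero]
  exact ⟨key _ _ h.e_zero, key _ _ h.f_one, key _ _ h.c, fun i hi => key' _ (h.e_pos i hi),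
    fun i hi => key' _ (h.h_pos i hi), fun i hi => key' _ (h.f_pos i hi)⟩

omit [LieModule ℂ AffHat M] in
theorem inducedOne_generates
    (hgen : ∀ N : Submodule ℂ M, y ∈ N → (∀ (x : AffHat), ∀ v ∈ N, ⁅x, v⁆ ∈ N) → N = ⊤)
    {N : Submodule ℂ (Induced AffHat.incl M)} (hw : inducedOne AffHat.incl M y ∈ N)
    (hN : ∀ (x : AffTilde), ∀ v ∈ N, ⁅x, v⁆ ∈ N) : N = ⊤ := by
  have h : N.comap (inducedOne AffHat.incl M) = ⊤ := hgen _ hw fun x v hv => by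
    rw [Submodule.mem_comap, ← lie_inducedOne]
    exact hN _ _ hv
  exact induced_eq_top (fun m => (h ▸ Submodule.mem_top :
    m ∈ N.comap (inducedOne AffHat.incl M))) hN

theorem sugawara_inducedOne (C : IsCritical (LieModule.toEnd ℂ AffHat M))
    (CI : IsCritical (hatRep (LieModule.toEnd ℂ AffTilde (Induced AffHat.incl M))))
    (h : IsWhittakerVector LieHom.id lam mu (-2) y)
    (hT : ∀ n ≤ 0, ∃ t : ℂ, sugawara (LieModule.toEnd ℂ AffHat M) n y = t • y) (n : ℤ) :
    ∃ t : ℂ, sugawaraEnd (hatRep (LieModule.toEnd ℂ AffTilde (Induced AffHat.incl M))) n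
      (inducedOne AffHat.incl M y) = t • inducedOne AffHat.incl M y := by
  have hw := h.inducedOne
  rcases lt_trichotomy n 1 with hn | rfl | hn
  · obtain ⟨t, ht⟩ := hT n (by omega)
    refine ⟨t, ?_⟩
    rw [← CI.restricted.sugawara_eq]
    refine (C.restricted.map_sugawara
      (φ := inducedOne AffHat.incl M) (fun z v => (lie_inducedOne z v).symm)
      n _).symm.trans ?_
    rw [ht, map_smul]
  · exact ⟨_, hw.sugawara_one CI⟩
  · exact ⟨0, by rw [hw.sugawara_of_gt CI hn, zero_smul]⟩

/-- A homomorphism from the module induced from a module generated by a Whittaker vector that is an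
eigenvector of the Sugawara operators, `μ ≠ 0`. -/
theorem injective_of_induced (hlam : lam ≠ 0)
    (C : IsCritical (LieModule.toEnd ℂ AffHat M))
    (h : IsWhittakerVector LieHom.id lam mu (-2) y)
    (hgen : ∀ N : Submodule ℂ M, y ∈ N → (∀ (x : AffHat), ∀ v ∈ N, ⁅x, v⁆ ∈ N) → N = ⊤)
    (hT : ∀ n ≤ 0, ∃ t : ℂ, sugawara (LieModule.toEnd ℂ AffHat M) n y = t • y)
    {W : Type*} [AddCommGroup W] [Module ℂ W] [LieRingModule AffTilde W] [LieModule ℂ AffTilde W]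
    (CW : IsCritical (hatRep (LieModule.toEnd ℂ AffTilde W)))
    (hT1 : Function.Injective (sugawaraEnd (hatRep (LieModule.toEnd ℂ AffTilde W)) 1))
    (Φ : Induced AffHat.incl M →ₗ[ℂ] W) (hΦ : ∀ (z : AffTilde) v, Φ ⁅z, v⁆ = ⁅z, Φ v⁆)
    (hy : Φ (inducedOne AffHat.incl M y) ≠ 0) : Function.Injective Φ := by
  have hw := h.inducedOne
  have CI : IsCritical (hatRep (LieModule.toEnd ℂ AffTilde (Induced AffHat.incl M))) :=
    isCritical_of_generated_tilde hw fun _ hw hN => inducedOne_generates hgen hw hN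
  have hwI := hw.mem_whit
  refine (injective_iff_map_eq_zero _).mpr fun v hv => ?_
  by_contra hv0
  have htop := bspan_range_polyMap CI hlam hwI (sugawara_inducedOne C CI h hT) fun N hN hN' =>
    inducedOne_generates hgen hN hN'
  have hker : ∀ (z : AffTilde), ∀ v ∈ LinearMap.ker Φ, ⁅z, v⁆ ∈ LinearMap.ker Φ := fun z v hv =>
    LinearMap.mem_ker.mpr ((hΦ z v).trans (by rw [LinearMap.mem_ker.mp hv, lie_zero]))
  -- By rigidity a nonzero kernel contains a nonzero vector q(d)y. Its image q(d)Φ(y) would be zero,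
  -- but the powers of d on Φ(y) are independent, since T(1) is injective on W and has Φ(y) as an
  -- eigenvector.
  obtain ⟨_, ⟨q, rfl⟩, hqN, hq0⟩ := CI.borelCurrents.exists_mem_of_mem_borelSpan hlam
    (range_polyMap_le hwI fun x hx => der_mem_whit hx) (N := LinearMap.ker Φ)
    (fun n v hv => hker (cur e0 n) v hv) (fun n v hv => hker (cur h0 n) v hv)
    ((ge_of_eq htop) Submodule.mem_top) (LinearMap.mem_ker.mpr hv) hv0
  rw [LinearMap.mem_ker, polyMap_map (d := LieModule.toEnd ℂ AffTilde (Induced AffHat.incl M) der)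
    (d' := LieModule.toEnd ℂ AffTilde W der) Φ (hΦ der)] at hqN
  have hΦ1 : sugawaraEnd (hatRep (LieModule.toEnd ℂ AffTilde W)) 1
      (Φ (inducedOne AffHat.incl M y)) = (lam * mu) • Φ (inducedOne AffHat.incl M y) := by
    rw [← CW.restricted.sugawara_eq]
    refine (CI.restricted.map_sugawara (ρ' := hatRep (LieModule.toEnd ℂ AffTilde W)) (φ := Φ)
      (fun z v => hΦ z v) 1 _).symm.trans ?_
    rw [CI.restricted.sugawara_eq, hw.sugawara_one CI, map_smul]
  have hpoly := polyMap_injective (d := LieModule.toEnd ℂ AffTilde W der) (fun v => by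
    rw [sugawaraEnd_mul_der CW, Int.cast_one, one_smul]) hT1 hy hΦ1
  exact hq0 (by rw [hpoly (hqN.trans (map_zero _).symm), map_zero])

theorem exists_equiv_induced (hlam : lam ≠ 0)
    (C : IsCritical (LieModule.toEnd ℂ AffHat M))
    (h : IsWhittakerVector LieHom.id lam mu (-2) y)
    (hgen : ∀ N : Submodule ℂ M, y ∈ N → (∀ (x : AffHat), ∀ v ∈ N, ⁅x, v⁆ ∈ N) → N = ⊤)
    (hT : ∀ n ≤ 0, ∃ t : ℂ, sugawara (LieModule.toEnd ℂ AffHat M) n y = t • y)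
    {W : Type*} [AddCommGroup W] [Module ℂ W] [LieRingModule AffTilde W] [LieModule ℂ AffTilde W]
    (CW : IsCritical (hatRep (LieModule.toEnd ℂ AffTilde W)))
    (hW : LieModule.IsIrreducible ℂ AffTilde W)
    (hT1 : Function.Injective (sugawaraEnd (hatRep (LieModule.toEnd ℂ AffTilde W)) 1))
    (ψ : M →ₗ[ℂ] W) (hψ : ∀ (x : AffHat) v, ψ ⁅x, v⁆ = ⁅x, ψ v⁆) (hy : ψ y ≠ 0) :
    Nonempty (W ≃ₗ⁅ℂ,AffTilde⁆ Induced AffHat.incl M) := by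
  obtain ⟨-, hirr⟩ := (isIrreducible_iff_of_span span_affGen).mp hW
  obtain ⟨Φ', hΦ'⟩ := exists_induced_hom (j := AffHat.incl) ψ hψ
  obtain ⟨Φ, hΦ, hΦy⟩ : ∃ Φ : Induced AffHat.incl M →ₗ[ℂ] W,
      (∀ (z : AffTilde) v, Φ ⁅z, v⁆ = ⁅z, Φ v⁆) ∧ Φ (inducedOne AffHat.incl M y) = ψ y :=
    ⟨Φ', fun z v => LieModuleHom.map_lie Φ' z v, hΦ' _⟩
  have hsurj : Function.Surjective Φ := by
    refine LinearMap.range_eq_top.mp ((hirr _ ?_).resolve_left fun h => hy ?_)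
    · rintro g - _ ⟨v, rfl⟩
      exact ⟨⁅g, v⁆, hΦ g v⟩
    · have h1 : ψ y ∈ LinearMap.range Φ := ⟨_, hΦy⟩
      rwa [h, Submodule.mem_bot] at h1
  have hinj : Function.Injective Φ :=
    injective_of_induced hlam C h hgen hT CW hT1 Φ hΦ (hΦy.symm ▸ hy)
  exact ⟨(lieEquivOfSpan (G := Set.univ) (by simp) (LinearEquiv.ofBijective Φ ⟨hinj, hsurj⟩)
    fun g _ v => hΦ g v).symm⟩

end InducedHat

theorem exists_induced_of_isSimpleQuotient {lam mu : ℂ} (hlam : lam ≠ 0) (hmu : mu ≠ 0)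
    (W : Type u) [AddCommGroup W] [Module ℂ W] [LieRingModule AffTilde W] [LieModule ℂ AffTilde W]
    (hW : IsSimpleQuotient AffTilde (VTilde lam mu (-2)) W) :
    ∃ c : ℤ → ℂ, Nonempty (W ≃ₗ⁅ℂ,AffTilde⁆ Induced AffHat.incl (VHatC lam mu c)) := by
  obtain ⟨C, w, hw0, hw⟩ := hW.exists_whittaker
  have hlm : lam * mu ≠ 0 := mul_ne_zero hlam hmu
  have hI : LieModule.IsIrreducible ℂ AffTilde W := hW.1
  have hirr := ((isIrreducible_iff_of_span span_affGen).mp hI).2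
  choose! c hc using fun n (hn : n ≤ 0) => exists_sugawara_eigenvalue hI C hlm hw hn
  refine ⟨c, ?_⟩
  -- The kernel of T(1) is a submodule, and w is not in it because its eigenvalue λμ is nonzero. By
  -- simplicity the kernel is zero.
  have hT1 : Function.Injective (sugawaraEnd (hatRep (LieModule.toEnd ℂ AffTilde W)) 1) := by
    refine LinearMap.ker_eq_bot.mp ((hirr _ (C.ker_sugawaraEnd_stable 1)).resolve_right fun h => ?_)
    have h1 : w ∈ LinearMap.ker (sugawaraEnd (hatRep (LieModule.toEnd ℂ AffTilde W)) 1) :=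
      (ge_of_eq h) Submodule.mem_top
    rw [LinearMap.mem_ker, hw.sugawara_one C] at h1
    exact (smul_ne_zero hlm hw0) h1
  have hwhat : IsWhittakerVector LieHom.id lam mu (-2) w :=
    ⟨hw.e_zero, hw.f_one, hw.c, hw.e_pos, hw.h_pos, hw.f_pos⟩
  have hT : ∀ n ≤ 0, sugawara (LieModule.toEnd ℂ AffHat W) n w = c n • w := fun n hn => by
    rw [← toEnd_comp_incl, C.restricted.sugawara_eq, hc n hn]
  exact (exists_vHatC_hom (c := c) hwhat hT).elim fun ψ hψ =>
    exists_equiv_induced hlam (isCritical_vHatC lam mu c)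
      (isWhittakerVector_wHatC lam mu c) (fun _ h h' => vHatC_eq_top lam mu c h h')
      (fun n hn => ⟨c n, sugawara_wHatC lam mu c hn⟩) C hI hT1 ψ hψ.1 (by rw [hψ.2]; exact hw0)

end

end WhittakerSl2

/-- The critical level, `λ ≠ 0`. (1) For each simple `TNeg`-module `X` there is exactly one
restricted action of the affine algebra on `V(λ, 0, -2, 0) ⊗ X` that extends the tensor product
action of `e(n)`, `h(n)`, `c`, `d`, `T(n)`; (2) with it, this is a simple quotient of
`V(λ, 0, -2)`; (3) every simple quotient is of this form; (4) two of them are isomorphic exactly if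
the modules `X` are; (5) the modules `X` are those of dimension one and the twists of
infinite-dimensional simple modules over the Borel subalgebra; (6) the case `μ ≠ 0`. -/
theorem theorem4p7 (lam : ℂ) (hlam : lam ≠ 0) :
    (∀ (X : Type u) [AddCommGroup X] [Module ℂ X] [LieRingModule TNeg X] [LieModule ℂ TNeg X],
      LieModule.IsIrreducible ℂ TNeg X →
        ∃! ρ : AffTilde →ₗ⁅ℂ⁆ Module.End ℂ (VZero lam ⊗[ℂ] X), IsTensorAction lam ρ) ∧
    (∀ (X : Type u) [AddCommGroup X] [Module ℂ X] [LieRingModule TNeg X] [LieModule ℂ TNeg X]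
      (ρ : AffTilde →ₗ⁅ℂ⁆ Module.End ℂ (VZero lam ⊗[ℂ] X)),
      LieModule.IsIrreducible ℂ TNeg X → IsTensorAction lam ρ →
        IsSimpleQuotient AffTilde (VTilde lam 0 (-2)) (RepSpace ρ)) ∧
    (∀ (W : Type u) [AddCommGroup W] [Module ℂ W] [LieRingModule AffTilde W]
      [LieModule ℂ AffTilde W],
      IsSimpleQuotient AffTilde (VTilde lam 0 (-2)) W →
        ∃ (X : Type u) (_ : AddCommGroup X) (_ : Module ℂ X) (_ : LieRingModule TNeg X)
          (_ : LieModule ℂ TNeg X) (ρ : AffTilde →ₗ⁅ℂ⁆ Module.End ℂ (VZero lam ⊗[ℂ] X)),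
          LieModule.IsIrreducible ℂ TNeg X ∧ IsTensorAction lam ρ ∧
            Nonempty (W ≃ₗ⁅ℂ,AffTilde⁆ RepSpace ρ)) ∧
    (∀ (X X' : Type u) [AddCommGroup X] [Module ℂ X] [LieRingModule TNeg X] [LieModule ℂ TNeg X]
      [AddCommGroup X'] [Module ℂ X'] [LieRingModule TNeg X'] [LieModule ℂ TNeg X']
      (ρ : AffTilde →ₗ⁅ℂ⁆ Module.End ℂ (VZero lam ⊗[ℂ] X))
      (ρ' : AffTilde →ₗ⁅ℂ⁆ Module.End ℂ (VZero lam ⊗[ℂ] X')),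
      LieModule.IsIrreducible ℂ TNeg X → LieModule.IsIrreducible ℂ TNeg X' →
        IsTensorAction lam ρ → IsTensorAction lam ρ' →
        (Nonempty (RepSpace ρ ≃ₗ⁅ℂ,AffTilde⁆ RepSpace ρ') ↔ Nonempty (X ≃ₗ⁅ℂ,TNeg⁆ X'))) ∧
    (∀ (X : Type u) [AddCommGroup X] [Module ℂ X] [LieRingModule TNeg X] [LieModule ℂ TNeg X],
      LieModule.IsIrreducible ℂ TNeg X ↔
        (Module.finrank ℂ X = 1 ∨
          ∃ (D : TwistDatum) (M : Type u) (_ : AddCommGroup M) (_ : Module ℂ M)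
            (_ : LieRingModule Borel M) (_ : LieModule ℂ Borel M),
            LieModule.IsIrreducible ℂ Borel M ∧ ¬ FiniteDimensional ℂ M ∧
              Nonempty (X ≃ₗ⁅ℂ,TNeg⁆ Twist D M))) ∧
    (∀ mu : ℂ, mu ≠ 0 → ∀ (W : Type u) [AddCommGroup W] [Module ℂ W] [LieRingModule AffTilde W]
      [LieModule ℂ AffTilde W],
      IsSimpleQuotient AffTilde (VTilde lam mu (-2)) W →
        ∃ c : ℤ → ℂ, Nonempty (W ≃ₗ⁅ℂ,AffTilde⁆ Induced AffHat.incl (VHatC lam mu c))) := by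
  refine ⟨fun X _ _ _ _ hX => ?_, fun X _ _ _ _ ρ hX h => (h.whittakerData hlam).isSimpleQuotient
    hlam hX, fun W _ _ _ _ hW => exists_tensor_of_isSimpleQuotient hlam W hW,
    fun X X' _ _ _ _ _ _ _ _ ρ ρ' _ _ h h' => h.equiv_iff hlam h',
    fun X _ _ _ _ => isIrreducible_tNeg_iff, fun mu hmu W _ _ _ _ hW =>
      exists_induced_of_isSimpleQuotient hlam hmu W hW⟩
  obtain ⟨ρ, h⟩ := exists_isTensorAction hlam hX
  exact ⟨ρ, h, fun ρ' h' => h'.unique hlam h⟩
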